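/- Let $h$ be a formal parameter, $K=\mathbb C[[h]]$. All algebras below are $h$-adically complete (separated), all tensor products are $h$-adically completed $\mathbb Z/2$-graded tensor products over $K$ (so $(a\otimes b)(c\otimes d)=(-1)^{|b||c|}ac\otimes bd$ and $\tau(a\otimes b)=(-1)^{|a||b|}b\otimes a$), and $A_{21}=\tau(A)$, $\Delta^{op}=\tau\circ\Delta$. **The classical algebra.** $U(osp(1|2))$ is the complex superalgebra generated by even $h_0,b_+,b_-$ and odd $e,f$ with $[h_0,e]=e$, $[h_0,f]=-f$, $\{e,f\}=-h_0$, $[h_0,b_\pm]=\pm2b_\pm$, $[b_+,b_-]=h_0$, $[b_+,f]=e$, $[b_-,e]=f$, $b_+=e^2$, $b_-=-f^2$. **The Jordanian algebra.** $U_h(osp(1|2))$ is the quotient of the $h$-adic completion of the free $K$-algebra on even $H,X,Y$ and odd $E,F$ by the closed two-sided ideal generated by the following relations, in which $T^{s}=\exp(shX)$ for $s\in\mathbb C$ (so $X=h^{-1}\log T$) and $\frac{T-T^{-1}}{2h}$ denotes the series $h^{-1}\sinh(hX)=\sum_{k\ge0}\frac{h^{2k}X^{2k+1}}{(2k+1)!}$: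 - $[H,E]=\frac12(T+T^{-1})E$; - $[H,F]=-\frac14(T+T^{-1})F-\frac14F(T+T^{-1})-\frac h8\big((T-T^{-1})H+H(T-T^{-1})\big)E-\frac h8E\big((T-T^{-1})H+H(T-T^{-1})\big)$; - $\{E,F\}=-\frac14(T+T^{-1})H-\frac14H(T+T^{-1})$; - $[H,T^{\pm1}]=T^{\pm2}-1$; - $[H,Y]=-\frac12(T+T^{-1})Y-\frac12Y(T+T^{-1})$; - $[T^{\pm1},Y]=\pm\frac h2(T^{\pm1}H+HT^{\pm1})$; - $E^2=\frac{T-T^{-1}}{2h}$, $\quad[Y,E]=F$, $\quad[T^{\pm1},F]=\pm\frac h2(T^{\pm2}+1)E$; - $F^2=-Y+\frac h8(T-T^{-1})H^2+\frac h4(T-T^{-1})EF+\frac{3h}{16}(T^2-T^{-2})H+\frac h4(T-T^{-1})+\frac{9h}{128}(T-T^{-1})^3$; - $[F,Y]=\frac h4(T-T^{-1})F+\frac h2(T-T^{-1})EY-\frac{h^2}4EH^2-\frac{3h^2}8(T+T^{-1})EH-\frac{h^2}2E-\frac{15h^2}{64}(T-T^{-1})^2E$. **Ohn's algebra.** $U_h(sl(2))$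 is topologically generated over $K$ by $H,X,Y$ (all even) with $[H,X]=\frac{2\sinh hX}{h}$, $[H,Y]=-Y\cosh hX-\cosh hX\,Y$, $[X,Y]=H$; with $T^{s}=\exp(shX)$ its Hopf structure is $\Delta X=X\otimes1+1\otimes X$, $\Delta H=H\otimes T+T^{-1}\otimes H$, $\Delta Y=Y\otimes T+T^{-1}\otimes Y$, $\varepsilon(X)=\varepsilon(H)=\varepsilon(Y)=0$, $S(X)=-X$, $S(H)=-THT^{-1}$, $S(Y)=-TYT^{-1}$. **Theorem.** 1. $U_h(osp(1|2))$ is $h$-torsion free, and $E\mapsto e$, $F\mapsto f$, $H\mapsto h_0$, $X\mapsto b_+$, $Y\mapsto b_-$ induces an algebra isomorphism $U_h(osp(1|2))/hU_h(osp(1|2))\cong U(osp(1|2))$. 2. $U_h(osp(1|2))$ is a Hopf superalgebra over $K$ with - $\Delta(X)=X\otimes1+1\otimes X$, $\quad\Delta(T^{\pm1})=T^{\pm1}\otimes T^{\pm1}$, - $\Delta(H)=H\otimes T+T^{-1}\otimes H$, $\quad\Delta(Y)=Y\otimes T+T^{-1}\otimes Y$, - $\Delta(E)=E\otimes T^{-1/2}+T^{1/2}\otimes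 E$, - $\Delta(F)=F\otimes T^{1/2}+T^{-1/2}\otimes F+\frac h4T^{-1}E\otimes(T^{-1/2}H+HT^{-1/2})-\frac h4(T^{1/2}H+HT^{1/2})\otimes TE$, - $\varepsilon(X)=\varepsilon(H)=\varepsilon(E)=\varepsilon(F)=\varepsilon(Y)=0$, $\quad\varepsilon(T^{\pm1})=1$, - $S(X)=-X$, $S(T^{\pm1})=T^{\mp1}$, $S(H)=-H+2hE^2$, $S(E)=-E$, $S(F)=-F-\frac h2(T+T^{-1})E$, $S(Y)=-Y-hH+h^2E^2$. 3. It quantizes $r_1=h_0\wedge b_+=h_0\otimes b_+-b_+\otimes h_0$: put $\tilde r=H\otimes X-X\otimes H$. For each generator $a\in\{H,E,F,X,Y\}$ one has $\Delta(a)\equiv a\otimes1+1\otimes a\pmod h$, and for every $a\in U_h(osp(1|2))$ one has $\Delta(a)-\Delta^{op}(a)\equiv h[\Delta(a),\tilde r]\pmod{h^2}$. 4. $U_h(sl(2))$ is a Hopf algebra with the structure maps above, and $H\mapsto H$, $X\mapsto X$, $Y\mapsto Y$ defines an injective Hopf (super)algebra homomorphism $j:U_h(sl(2))\to U_h(osp(1|2))$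 for which the $h$-adic topology of $U_h(sl(2))$ is the one induced from $U_h(osp(1|2))$. Thus $U_h(osp(1|2))$ contains Ohn's $U_h(sl(2))$ as a Hopf subalgebra. 5. Let $G=\exp(h\,TH\otimes X)$. Then $G_{21}$ is invertible, and $R=G_{21}^{-1}G$ is a universal R-matrix of $U_h(osp(1|2))$: $R$ is even and invertible, $R\,\Delta(a)=\Delta^{op}(a)\,R$ for all $a$, $(\Delta\otimes\mathrm{id})R=R_{13}R_{23}$, $(\mathrm{id}\otimes\Delta)R=R_{13}R_{12}$. It is triangular, $R_{21}R=1$, it satisfies $R\equiv1+h\,\tilde r\pmod{h^2}$, and it is the image under $j\otimes j$ of the element $\exp(-hX\otimes TH)\exp(hTH\otimes X)$ of Ohn's algebra. -/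

import Mathlib

open scoped TensorProduct

namespace Jordanian

/-! ### The `I`-adic completion of an algebra -/

/-- The `I`-adic completion of an `R`-module: the inverse limit of the modules `M / IⁿM`. -/
def Compl {R : Type*} [CommRing R] (I : Ideal R) (M : Type*) [AddCommGroup M] [Module R M] :
    Type _ :=
  AdicCompletion I M

namespace Compl

section Linear

variable {R : Type*} [CommRing R] (I : Ideal R)
variable {M N : Type*} [AddCommGroup M] [Module R M] [AddCommGroup N] [Module R N]

noncomputable instance : AddCommGroup (Compl I M) :=
  inferInstanceAs (AddCommGroup (AdicCompletion I M))

noncomputable instance : Module R (Compl I M) :=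
  inferInstanceAs (Module R (AdicCompletion I M))

/-- The quotient `M / IⁿM`. -/
abbrev Level (M : Type*) [AddCommGroup M] [Module R M] (n : ℕ) : Type _ :=
  M ⧸ (I ^ n • ⊤ : Submodule R M)

/-- The projection of `M` onto `M / IⁿM`. -/
noncomputable def toLevel (M : Type*) [AddCommGroup M] [Module R M] (n : ℕ) :
    M →ₗ[R] Level I M n :=
  (I ^ n • ⊤ : Submodule R M).mkQ

theorem toLevel_surjective (n : ℕ) : Function.Surjective (toLevel I M n) :=
  Submodule.mkQ_surjective _

theorem toLevel_eq_zero {n : ℕ} {x : M} (h : x ∈ (I ^ n • ⊤ : Submodule R M)) :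
    toLevel I M n x = 0 :=
  (Submodule.Quotient.mk_eq_zero _).mpr h

/-- The projection of the completion of `M` onto `M / IⁿM`. -/
noncomputable def eval (M : Type*) [AddCommGroup M] [Module R M] (n : ℕ) :
    Compl I M →ₗ[R] Level I M n :=
  AdicCompletion.eval I M n

/-- The canonical map from `M` to its completion. -/
noncomputable def of (M : Type*) [AddCommGroup M] [Module R M] : M →ₗ[R] Compl I M :=
  AdicCompletion.of I M

variable {I}

theorem transition_toLevel {m n : ℕ} (hmn : m ≤ n) (x : M) :
    AdicCompletion.transitionMap I M hmn (toLevel I M n x) = toLevel I M m x := rfl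

theorem transition_eval {m n : ℕ} (hmn : m ≤ n) (y : Compl I M) :
    AdicCompletion.transitionMap I M hmn (eval I M n y) = eval I M m y :=
  AdicCompletion.transitionMap_comp_eval_apply I M hmn y

theorem eval_of (n : ℕ) (x : M) : eval I M n (of I M x) = toLevel I M n x := rfl

theorem ext {x y : Compl I M} (h : ∀ n, eval I M n x = eval I M n y) : x = y :=
  AdicCompletion.ext h

theorem exists_rep (n : ℕ) (y : Compl I M) : ∃ x : M, eval I M n y = toLevel I M n x := by
  obtain ⟨x, hx⟩ := toLevel_surjective I n (eval I M n y)
  exact ⟨x, hx.symm⟩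

theorem eval_of_le {m n : ℕ} (hmn : m ≤ n) {x : M} {y : Compl I M}
    (h : eval I M n y = toLevel I M n x) : eval I M m y = toLevel I M m x := by
  rw [← transition_eval hmn, h, transition_toLevel]

/-- An element of the completion given by a compatible family of elements of the levels. -/
noncomputable def mk (f : ∀ n, Level I M n)
    (hf : ∀ {m n : ℕ} (hmn : m ≤ n), AdicCompletion.transitionMap I M hmn (f n) = f m) :
    Compl I M :=
  ⟨f, hf⟩

theorem eval_mk (f : ∀ n, Level I M n)
    (hf : ∀ {m n : ℕ} (hmn : m ≤ n), AdicCompletion.transitionMap I M hmn (f n) = f m) (n : ℕ) :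
    eval I M n (mk f hf) = f n := rfl

theorem pow_smul_top_le_ker (f : M →ₗ[R] Compl I N) (n : ℕ) :
    (I ^ n • ⊤ : Submodule R M) ≤ LinearMap.ker ((eval I N n).comp f) := by
  rw [Submodule.smul_le]
  intro r hr x _
  rw [LinearMap.mem_ker, map_smul, LinearMap.comp_apply]
  obtain ⟨z, hz⟩ := toLevel_surjective I n (eval I N n (f x))
  rw [← hz, ← map_smul]
  exact toLevel_eq_zero I (Submodule.smul_mem_smul hr Submodule.mem_top)

/-- The unique extension of a linear map from `M` to a completion `Compl I N`, to the completion
of `M`. -/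
noncomputable def extend (f : M →ₗ[R] Compl I N) : Compl I M →ₗ[R] Compl I N :=
  AdicCompletion.lift I (M := Compl I M)
    (fun n => (Submodule.liftQ (I ^ n • ⊤ : Submodule R M) ((eval I N n).comp f)
      (pow_smul_top_le_ker f n)).comp (eval I M n))
    (fun {m n} hmn => by
      refine LinearMap.ext fun y => ?_
      obtain ⟨x, hx⟩ := exists_rep n y
      rw [LinearMap.comp_apply, LinearMap.comp_apply, LinearMap.comp_apply, hx, eval_of_le hmn hx]
      exact transition_eval hmn (f x))

theorem eval_extend (f : M →ₗ[R] Compl I N) {n : ℕ} {x : M} {y : Compl I M}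
    (h : eval I M n y = toLevel I M n x) : eval I N n (extend f y) = eval I N n (f x) := by
  change (Submodule.liftQ _ ((eval I N n).comp f) (pow_smul_top_le_ker f n)) (eval I M n y) = _
  rw [h]
  exact Submodule.liftQ_apply _ _ _

theorem extend_of (f : M →ₗ[R] Compl I N) (x : M) : extend f (of I M x) = f x :=
  ext fun n => eval_extend f (eval_of n x)

variable (I) in
/-- The linear map induced on completions by a linear map. -/
noncomputable def map (f : M →ₗ[R] N) : Compl I M →ₗ[R] Compl I N :=
  extend ((of I N).comp f)

theorem eval_map (f : M →ₗ[R] N) {n : ℕ} {x : M} {y : Compl I M}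
    (h : eval I M n y = toLevel I M n x) : eval I N n (map I f y) = toLevel I N n (f x) :=
  eval_extend _ h

theorem map_of (f : M →ₗ[R] N) (x : M) : map I f (of I M x) = of I N (f x) :=
  extend_of _ x

theorem map_add_left (f g : M →ₗ[R] N) (y : Compl I M) :
    map I (f + g) y = map I f y + map I g y := by
  refine ext fun n => ?_
  obtain ⟨x, hx⟩ := exists_rep n y
  rw [map_add, eval_map _ hx, eval_map _ hx, eval_map _ hx, LinearMap.add_apply, map_add]

theorem map_smul_left (c : R) (f : M →ₗ[R] N) (y : Compl I M) :
    map I (c • f) y = c • map I f y := by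
  refine ext fun n => ?_
  obtain ⟨x, hx⟩ := exists_rep n y
  rw [map_smul, eval_map _ hx, eval_map _ hx, LinearMap.smul_apply, map_smul]

end Linear

section Algebra

variable {R : Type*} [CommRing R] {I : Ideal R} {A : Type*} [Ring A] [Algebra R A]

theorem mul_mem_left {n : ℕ} (a : A) {b : A} (hb : b ∈ (I ^ n • ⊤ : Submodule R A)) :
    a * b ∈ (I ^ n • ⊤ : Submodule R A) :=
  Submodule.smul_top_le_comap_smul_top (I ^ n) (LinearMap.mulLeft R a) hb

theorem mul_mem_right {n : ℕ} {a : A} (b : A) (ha : a ∈ (I ^ n • ⊤ : Submodule R A)) :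
    a * b ∈ (I ^ n • ⊤ : Submodule R A) :=
  Submodule.smul_top_le_comap_smul_top (I ^ n) (LinearMap.mulRight R b) ha

theorem toLevel_mul_congr {n : ℕ} {a a' b b' : A} (ha : toLevel I A n a = toLevel I A n a')
    (hb : toLevel I A n b = toLevel I A n b') :
    toLevel I A n (a * b) = toLevel I A n (a' * b') := by
  have ha' : a - a' ∈ (I ^ n • ⊤ : Submodule R A) := (Submodule.Quotient.eq _).mp ha
  have hb' : b - b' ∈ (I ^ n • ⊤ : Submodule R A) := (Submodule.Quotient.eq _).mp hb
  refine (Submodule.Quotient.eq _).mpr ?_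
  have h : a * b - a' * b' = (a - a') * b + a' * (b - b') := by noncomm_ring
  change a * b - a' * b' ∈ _
  rw [h]
  exact Submodule.add_mem _ (mul_mem_right b ha') (mul_mem_left a' hb')

/-- A representative in `A` of the class modulo `IⁿA` of an element of the completion. -/
noncomputable def rep (n : ℕ) (x : Compl I A) : A := (exists_rep n x).choose

theorem eval_eq_rep (n : ℕ) (x : Compl I A) : eval I A n x = toLevel I A n (rep n x) :=
  (exists_rep n x).choose_spec

theorem transition_mul_rep (x y : Compl I A) {m n : ℕ} (hmn : m ≤ n) :
    AdicCompletion.transitionMap I A hmn (toLevel I A n (rep n x * rep n y)) =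
      toLevel I A m (rep m x * rep m y) := by
  rw [transition_toLevel]
  refine toLevel_mul_congr ?_ ?_
  · rw [← eval_eq_rep m x, eval_of_le hmn (eval_eq_rep n x)]
  · rw [← eval_eq_rep m y, eval_of_le hmn (eval_eq_rep n y)]

/-- The product of two elements of the completion: its class modulo `Iⁿ` is the class of the
product of any representatives modulo `Iⁿ` of the two factors (see `eval_mul`). -/
noncomputable instance : Mul (Compl I A) where
  mul x y := mk (fun n => toLevel I A n (rep n x * rep n y)) (transition_mul_rep x y)

noncomputable instance : One (Compl I A) where
  one := of I A 1

theorem eval_mul {n : ℕ} {x y : Compl I A} {a b : A} (hx : eval I A n x = toLevel I A n a)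
    (hy : eval I A n y = toLevel I A n b) : eval I A n (x * y) = toLevel I A n (a * b) := by
  refine (eval_mk _ (transition_mul_rep x y) n).trans (toLevel_mul_congr ?_ ?_)
  · rw [← eval_eq_rep n x, hx]
  · rw [← eval_eq_rep n y, hy]

theorem eval_one (n : ℕ) : eval I A n (1 : Compl I A) = toLevel I A n 1 := eval_of n 1

theorem eval_add {n : ℕ} {x y : Compl I A} {a b : A} (hx : eval I A n x = toLevel I A n a)
    (hy : eval I A n y = toLevel I A n b) : eval I A n (x + y) = toLevel I A n (a + b) := by
  rw [map_add, map_add, hx, hy]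

theorem eval_smul {n : ℕ} (c : R) {x : Compl I A} {a : A} (hx : eval I A n x = toLevel I A n a) :
    eval I A n (c • x) = toLevel I A n (c • a) := by
  rw [map_smul, map_smul, hx]

theorem eval_zero (n : ℕ) : eval I A n (0 : Compl I A) = toLevel I A n 0 := by
  rw [map_zero, map_zero]

theorem of_mul (a b : A) : of I A (a * b) = of I A a * of I A b :=
  ext fun n => (eval_mul (eval_of n a) (eval_of n b)).symm

noncomputable instance : Ring (Compl I A) :=
  { (inferInstance : AddCommGroup (Compl I A)) with
    mul := (· * ·)
    one := 1
    left_distrib := fun x y z => ext fun n => by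
      obtain ⟨a, ha⟩ := exists_rep n x
      obtain ⟨b, hb⟩ := exists_rep n y
      obtain ⟨c, hc⟩ := exists_rep n z
      rw [eval_mul ha (eval_add hb hc), eval_add (eval_mul ha hb) (eval_mul ha hc), mul_add]
    right_distrib := fun x y z => ext fun n => by
      obtain ⟨a, ha⟩ := exists_rep n x
      obtain ⟨b, hb⟩ := exists_rep n y
      obtain ⟨c, hc⟩ := exists_rep n z
      rw [eval_mul (eval_add ha hb) hc, eval_add (eval_mul ha hc) (eval_mul hb hc), add_mul]
    zero_mul := fun x => ext fun n => by
      obtain ⟨a, ha⟩ := exists_rep n x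
      rw [eval_mul (eval_zero n) ha, zero_mul, eval_zero]
    mul_zero := fun x => ext fun n => by
      obtain ⟨a, ha⟩ := exists_rep n x
      rw [eval_mul ha (eval_zero n), mul_zero, eval_zero]
    mul_assoc := fun x y z => ext fun n => by
      obtain ⟨a, ha⟩ := exists_rep n x
      obtain ⟨b, hb⟩ := exists_rep n y
      obtain ⟨c, hc⟩ := exists_rep n z
      rw [eval_mul (eval_mul ha hb) hc, eval_mul ha (eval_mul hb hc), mul_assoc]
    one_mul := fun x => ext fun n => by
      obtain ⟨a, ha⟩ := exists_rep n x
      rw [eval_mul (eval_one n) ha, one_mul, ha]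
    mul_one := fun x => ext fun n => by
      obtain ⟨a, ha⟩ := exists_rep n x
      rw [eval_mul ha (eval_one n), mul_one, ha] }

noncomputable instance : Algebra R (Compl I A) :=
  Algebra.ofModule
    (fun c x y => ext fun n => by
      obtain ⟨a, ha⟩ := exists_rep n x
      obtain ⟨b, hb⟩ := exists_rep n y
      rw [eval_mul (eval_smul c ha) hb, eval_smul c (eval_mul ha hb), smul_mul_assoc])
    (fun c x y => ext fun n => by
      obtain ⟨a, ha⟩ := exists_rep n x
      obtain ⟨b, hb⟩ := exists_rep n y
      rw [eval_mul ha (eval_smul c hb), eval_smul c (eval_mul ha hb), mul_smul_comm])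

end Algebra

end Compl

/-! ### Superalgebras and their tensor products -/

/-- A superalgebra over a ring in which `2` is invertible, given by the involutive automorphism
acting as `1` on the even part and as `-1` on the odd part. -/
class Superalgebra (R A : Type*) [CommRing R] [Ring A] [Algebra R A] where
  /-- The parity automorphism. -/
  parity : A →ₐ[R] A
  /-- The parity automorphism is an involution. -/
  parity_parity : ∀ a, parity (parity a) = a

section Super

open Superalgebra

variable (R A B : Type*) [CommRing R] [Ring A] [Algebra R A] [Superalgebra R A] [Ring B]
  [Algebra R B] [Superalgebra R B]

/-- The even part (`i = 0`) and the odd part (`i = 1`) of a superalgebra. -/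
def evenOdd (i : ZMod 2) : Submodule R A :=
  LinearMap.eqLocus (parity (R := R) (A := A)).toLinearMap
    (((-1 : R) ^ i.val) • (LinearMap.id : A →ₗ[R] A))

variable {R A} in
theorem mem_evenOdd {i : ZMod 2} {a : A} :
    a ∈ evenOdd R A i ↔ parity (R := R) a = ((-1 : R) ^ i.val) • a := Iff.rfl

variable {R A} in
theorem parity_of_mem_zero {a : A} (ha : a ∈ evenOdd R A 0) : parity (R := R) a = a := by
  rw [mem_evenOdd.mp ha, ZMod.val_zero, pow_zero, one_smul]

variable {R A} in
theorem parity_of_mem_one {a : A} (ha : a ∈ evenOdd R A 1) : parity (R := R) a = -a := by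
  rw [mem_evenOdd.mp ha, ZMod.val_one, pow_one, neg_one_smul]

variable {R A} in
theorem parity_mem {i : ZMod 2} {a : A} (ha : a ∈ evenOdd R A i) :
    parity (R := R) a ∈ evenOdd R A i := by
  rw [mem_evenOdd] at *
  rw [ha, map_smul, ha]

variable [Invertible (2 : R)]

/-- The even component of an element of a superalgebra. -/
noncomputable def evenPart : A →ₗ[R] evenOdd R A 0 :=
  LinearMap.codRestrict _ (⅟(2 : R) • (LinearMap.id + (parity (R := R) (A := A)).toLinearMap))
    (fun a => by
      change ⅟(2 : R) • (a + parity (R := R) a) ∈ _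
      rw [mem_evenOdd, map_smul, map_add, parity_parity, add_comm, ZMod.val_zero, pow_zero,
        one_smul])

/-- The odd component of an element of a superalgebra. -/
noncomputable def oddPart : A →ₗ[R] evenOdd R A 1 :=
  LinearMap.codRestrict _ (⅟(2 : R) • (LinearMap.id - (parity (R := R) (A := A)).toLinearMap))
    (fun a => by
      change ⅟(2 : R) • (a - parity (R := R) a) ∈ _
      rw [mem_evenOdd, map_smul, map_sub, parity_parity, ZMod.val_one, pow_one, neg_one_smul,
        ← smul_neg, neg_sub])

theorem coe_evenPart (a : A) : (evenPart R A a : A) = ⅟(2 : R) • (a + parity (R := R) a) := rfl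

theorem coe_oddPart (a : A) : (oddPart R A a : A) = ⅟(2 : R) • (a - parity (R := R) a) := rfl

/-- The decomposition of an element of a superalgebra into its even and odd components. -/
noncomputable def decomposeHom : A →ₗ[R] DirectSum (ZMod 2) fun i => evenOdd R A i :=
  (DirectSum.lof R (ZMod 2) (fun i => evenOdd R A i) 0).comp (evenPart R A) +
    (DirectSum.lof R (ZMod 2) (fun i => evenOdd R A i) 1).comp (oddPart R A)

theorem decomposeHom_of_mem_zero (y : evenOdd R A 0) :
    decomposeHom R A y = DirectSum.lof R (ZMod 2) (fun i => evenOdd R A i) 0 y := by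
  have h0 : evenPart R A y = y := by
    ext
    rw [coe_evenPart, parity_of_mem_zero y.2, ← two_smul R (y : A), smul_smul, invOf_mul_self,
      one_smul]
  have h1 : oddPart R A y = 0 := by
    ext
    rw [coe_oddPart, parity_of_mem_zero y.2, sub_self, smul_zero, Submodule.coe_zero]
  rw [decomposeHom, LinearMap.add_apply, LinearMap.comp_apply, LinearMap.comp_apply, h0, h1,
    map_zero, add_zero]

theorem decomposeHom_of_mem_one (y : evenOdd R A 1) :
    decomposeHom R A y = DirectSum.lof R (ZMod 2) (fun i => evenOdd R A i) 1 y := by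
  have h0 : evenPart R A y = 0 := by
    ext
    rw [coe_evenPart, parity_of_mem_one y.2, add_neg_cancel, smul_zero, Submodule.coe_zero]
  have h1 : oddPart R A y = y := by
    ext
    rw [coe_oddPart, parity_of_mem_one y.2, sub_neg_eq_add, ← two_smul R (y : A), smul_smul,
      invOf_mul_self, one_smul]
  rw [decomposeHom, LinearMap.add_apply, LinearMap.comp_apply, LinearMap.comp_apply, h0, h1,
    map_zero, zero_add]

theorem coeLinearMap_decomposeHom (a : A) :
    DirectSum.coeLinearMap (evenOdd R A) (decomposeHom R A a) = a := by
  rw [decomposeHom, LinearMap.add_apply, LinearMap.comp_apply, LinearMap.comp_apply, map_add,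
    DirectSum.coeLinearMap_lof, DirectSum.coeLinearMap_lof, coe_evenPart, coe_oddPart, ← smul_add,
    add_add_sub_cancel, ← two_smul R a, smul_smul, invOf_mul_self, one_smul]

theorem decomposeHom_coeLinearMap (x : DirectSum (ZMod 2) fun i => evenOdd R A i) :
    decomposeHom R A (DirectSum.coeLinearMap (evenOdd R A) x) = x := by
  induction x using DirectSum.induction_on with
  | zero => rw [map_zero, map_zero]
  | add x y hx hy => rw [map_add, map_add, hx, hy]
  | of i y =>
    change decomposeHom R A (DirectSum.coeLinearMap (evenOdd R A)
      (DirectSum.lof R (ZMod 2) (fun i => evenOdd R A i) i y)) = _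
    rw [DirectSum.coeLinearMap_lof]
    fin_cases i
    · exact decomposeHom_of_mem_zero R A y
    · exact decomposeHom_of_mem_one R A y

noncomputable instance : GradedAlgebra (evenOdd R A) where
  one_mem := by
    rw [mem_evenOdd, map_one, ZMod.val_zero, pow_zero, one_smul]
  mul_mem := by
    intro i j a b ha hb
    rw [mem_evenOdd] at *
    rw [map_mul, ha, hb, smul_mul_smul_comm, ← pow_add]
    congr 1
    rw [ZMod.val_add, ← neg_one_pow_eq_pow_mod_two]
  decompose' := decomposeHom R A
  left_inv := coeLinearMap_decomposeHom R A
  right_inv := decomposeHom_coeLinearMap R A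

/-- The tensor product of two superalgebras, with the multiplication
`(a ⊗ b) (c ⊗ d) = (-1) ^ (|b| |c|) (a c ⊗ b d)`. -/
abbrev STensor : Type _ := evenOdd R A ᵍ⊗[R] evenOdd R B

variable {R A B}

/-- The element `a ⊗ b` of the tensor product of two superalgebras. -/
noncomputable def stmul (a : A) (b : B) : STensor R A B := a ᵍ⊗ₜ[R] b

variable (R A B)

/-- The parity automorphism of the tensor product: `a ⊗ b` is mapped to the tensor product of the
images of `a` and `b`. -/
noncomputable def tensorParity : STensor R A B →ₐ[R] STensor R A B :=
  GradedTensorProduct.lift (evenOdd R A) (evenOdd R B)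
    ((GradedTensorProduct.includeLeft (evenOdd R A) (evenOdd R B)).comp parity)
    ((GradedTensorProduct.includeRight (evenOdd R A) (evenOdd R B)).comp parity)
    (by
      intro i j a b
      have h := GradedTensorProduct.tmul_coe_mul_coe_tmul (R := R) (𝒜 := evenOdd R A)
        (ℬ := evenOdd R B) 1 ⟨_, parity_mem b.2⟩ ⟨_, parity_mem a.2⟩ 1
      rw [one_mul, mul_one] at h
      change (parity (R := R) (a : A) ᵍ⊗ₜ[R] (1 : B)) * ((1 : A) ᵍ⊗ₜ[R] parity (R := R) (b : B)) =
        (-1 : ℤˣ) ^ (j * i) •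
          (((1 : A) ᵍ⊗ₜ[R] parity (R := R) (b : B)) * (parity (R := R) (a : A) ᵍ⊗ₜ[R] (1 : B)))
      rw [h, GradedTensorProduct.tmul_one_mul_one_tmul, smul_smul, Int.units_mul_self, one_smul])

theorem tensorParity_stmul (a : A) (b : B) :
    tensorParity R A B (stmul a b) = stmul (parity (R := R) a) (parity (R := R) b) :=
  (GradedTensorProduct.lift_tmul _ _ _ _ _ a b).trans
    (GradedTensorProduct.tmul_one_mul_one_tmul _ _ _ _)

noncomputable instance : Superalgebra R (STensor R A B) where
  parity := tensorParity R A B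
  parity_parity x := by
    have h : (tensorParity R A B).toLinearMap ∘ₗ (tensorParity R A B).toLinearMap =
        LinearMap.id := by
      refine GradedTensorProduct.hom_ext _ _ (TensorProduct.ext' fun a b => ?_)
      change tensorParity R A B (tensorParity R A B (stmul a b)) = stmul a b
      rw [tensorParity_stmul, tensorParity_stmul, parity_parity, parity_parity]
    exact LinearMap.congr_fun h x

end Super

/-! ### Topological Hopf superalgebras and universal R-matrices -/

section Hopf

open Superalgebra

variable {R : Type*} [CommRing R] [Invertible (2 : R)] (I : Ideal R)
variable (A : Type*) [Ring A] [Algebra R A] [Superalgebra R A]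
variable {B C D : Type*} [Ring B] [Algebra R B] [Superalgebra R B] [Ring C] [Algebra R C]
  [Superalgebra R C] [Ring D] [Algebra R D] [Superalgebra R D]

/-- The completed tensor square of a superalgebra. -/
abbrev Tensor2 : Type _ := Compl I (STensor R A A)

/-- The completed tensor cube of a superalgebra. -/
abbrev Tensor3 : Type _ := Compl I (STensor R (STensor R A A) A)

/-- The map `a ⊗ b ↦ f a ⊗ g b`, for parity preserving linear maps `f` and `g`. -/
noncomputable def tensorMap (f : A →ₗ[R] B) (g : C →ₗ[R] D) : STensor R A C →ₗ[R] STensor R B D :=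
  (GradedTensorProduct.of R (evenOdd R B) (evenOdd R D)).toLinearMap ∘ₗ TensorProduct.map f g ∘ₗ
    (GradedTensorProduct.of R (evenOdd R A) (evenOdd R C)).symm.toLinearMap

theorem tensorMap_stmul (f : A →ₗ[R] B) (g : C →ₗ[R] D) (a : A) (c : C) :
    tensorMap A f g (stmul a c) = stmul (f a) (g c) := rfl

/-- The multiplication map `a ⊗ b ↦ a b`. -/
noncomputable def mulMap : STensor R A A →ₗ[R] A :=
  LinearMap.mul' R A ∘ₗ (GradedTensorProduct.of R (evenOdd R A) (evenOdd R A)).symm.toLinearMap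

theorem mulMap_stmul (a b : A) : mulMap A (stmul (R := R) a b) = a * b :=
  LinearMap.mul'_apply

variable {A} in
/-- The map `a ⊗ b ↦ ε(a) b`. -/
noncomputable def counitLeft (ε : A →ₗ[R] R) : STensor R A A →ₗ[R] A :=
  (TensorProduct.lid R A).toLinearMap ∘ₗ TensorProduct.map ε LinearMap.id ∘ₗ
    (GradedTensorProduct.of R (evenOdd R A) (evenOdd R A)).symm.toLinearMap

variable {A} in
/-- The map `a ⊗ b ↦ ε(b) a`. -/
noncomputable def counitRight (ε : A →ₗ[R] R) : STensor R A A →ₗ[R] A :=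
  (TensorProduct.rid R A).toLinearMap ∘ₗ TensorProduct.map LinearMap.id ε ∘ₗ
    (GradedTensorProduct.of R (evenOdd R A) (evenOdd R A)).symm.toLinearMap

theorem counitLeft_stmul (ε : A →ₗ[R] R) (a b : A) : counitLeft ε (stmul a b) = ε a • b :=
  TensorProduct.lid_tmul _ _

theorem counitRight_stmul (ε : A →ₗ[R] R) (a b : A) : counitRight ε (stmul a b) = ε b • a :=
  TensorProduct.rid_tmul _ _

/-- The map `(x, b) ↦ x ⊗ b`, where `x` is in the tensor square. -/
noncomputable def appendRight : STensor R A A →ₗ[R] A →ₗ[R] STensor R (STensor R A A) A :=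
  (TensorProduct.mk R (STensor R A A) A).compr₂
    (GradedTensorProduct.of R (evenOdd R (STensor R A A)) (evenOdd R A)).toLinearMap

theorem appendRight_apply (x : STensor R A A) (b : A) : appendRight A x b = stmul x b := rfl

/-- The map `(a, x) ↦ a ⊗ x`, where `x` is in the tensor square, which sends `(a, b ⊗ c)` to
`(a ⊗ b) ⊗ c`. -/
noncomputable def appendLeft : A →ₗ[R] STensor R A A →ₗ[R] STensor R (STensor R A A) A :=
  ((TensorProduct.mk R A (A ⊗[R] A)).compr₂
    ((GradedTensorProduct.of R (evenOdd R (STensor R A A)) (evenOdd R A)).toLinearMap ∘ₗ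
      TensorProduct.map (GradedTensorProduct.of R (evenOdd R A) (evenOdd R A)).toLinearMap
        LinearMap.id ∘ₗ (TensorProduct.assoc R A A A).symm.toLinearMap)).compl₂
    (GradedTensorProduct.of R (evenOdd R A) (evenOdd R A)).symm.toLinearMap

theorem appendLeft_stmul (a b c : A) :
    appendLeft A a (stmul (R := R) b c) = stmul (stmul a b) c := rfl

variable {I A} in
/-- The map `Δ ⊗ id`, from the completed tensor square to the completed tensor cube. -/
noncomputable def comulTensorId (Δ : A →ₗ[R] Tensor2 I A) : Tensor2 I A →ₗ[R] Tensor3 I A :=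
  Compl.extend
    (TensorProduct.lift
      (LinearMap.mk₂ R (fun a b => Compl.map I ((appendRight A).flip b) (Δ a))
        (fun a a' b => by rw [map_add, map_add])
        (fun c a b => by rw [map_smul, map_smul])
        (fun a b b' => by rw [map_add, Compl.map_add_left])
        (fun c a b => by rw [map_smul, Compl.map_smul_left])) ∘ₗ
      (GradedTensorProduct.of R (evenOdd R A) (evenOdd R A)).symm.toLinearMap)

theorem comulTensorId_of (Δ : A →ₗ[R] Tensor2 I A) (a b : A) :
    comulTensorId Δ (Compl.of I _ (stmul a b)) =
      Compl.map I ((appendRight A).flip b) (Δ a) :=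
  Compl.extend_of _ _

variable {I A} in
/-- The map `id ⊗ Δ`, from the completed tensor square to the completed tensor cube. -/
noncomputable def idTensorComul (Δ : A →ₗ[R] Tensor2 I A) : Tensor2 I A →ₗ[R] Tensor3 I A :=
  Compl.extend
    (TensorProduct.lift
      (LinearMap.mk₂ R (fun a b => Compl.map I (appendLeft A a) (Δ b))
        (fun a a' b => by rw [map_add, Compl.map_add_left])
        (fun c a b => by rw [map_smul, Compl.map_smul_left])
        (fun a b b' => by rw [map_add, map_add])
        (fun c a b => by rw [map_smul, map_smul])) ∘ₗ
      (GradedTensorProduct.of R (evenOdd R A) (evenOdd R A)).symm.toLinearMap)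

theorem idTensorComul_of (Δ : A →ₗ[R] Tensor2 I A) (a b : A) :
    idTensorComul Δ (Compl.of I _ (stmul a b)) = Compl.map I (appendLeft A a) (Δ b) :=
  Compl.extend_of _ _

/-- The structure of an `I`-adic Hopf superalgebra on a superalgebra `A`: `A` is `I`-adically
separated and complete, the coproduct takes its values in the completed tensor square, and all
structure maps preserve the parity. -/
structure HopfSuperalgebra where
  /-- The underlying module is separated and complete. -/
  complete : IsAdicComplete I A
  /-- The coproduct, an algebra homomorphism. -/
  comul : A →ₐ[R] Tensor2 I A
  /-- The counit, an algebra homomorphism. -/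
  counit : A →ₐ[R] R
  /-- The antipode. -/
  antipode : A →ₗ[R] A
  /-- The coproduct preserves the parity. -/
  comul_parity : ∀ a, comul (parity (R := R) a) =
    Compl.map I (parity (R := R) (A := STensor R A A)).toLinearMap (comul a)
  /-- The counit preserves the parity. -/
  counit_parity : ∀ a, counit (parity (R := R) a) = counit a
  /-- The antipode preserves the parity. -/
  antipode_parity : ∀ a, antipode (parity (R := R) a) = parity (R := R) (antipode a)
  /-- The coproduct is coassociative. -/
  coassoc : ∀ a, comulTensorId comul.toLinearMap (comul a) =
    idTensorComul comul.toLinearMap (comul a)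
  /-- `(ε ⊗ id) ∘ Δ = id`. -/
  counit_comul : ∀ a, Compl.map I (counitLeft counit.toLinearMap) (comul a) = Compl.of I A a
  /-- `(id ⊗ ε) ∘ Δ = id`. -/
  comul_counit : ∀ a, Compl.map I (counitRight counit.toLinearMap) (comul a) = Compl.of I A a
  /-- `m ∘ (S ⊗ id) ∘ Δ = ε`. -/
  antipode_comul : ∀ a, Compl.map I (mulMap A ∘ₗ tensorMap A antipode LinearMap.id) (comul a) =
    Compl.of I A (algebraMap R A (counit a))
  /-- `m ∘ (id ⊗ S) ∘ Δ = ε`. -/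
  comul_antipode : ∀ a, Compl.map I (mulMap A ∘ₗ tensorMap A LinearMap.id antipode) (comul a) =
    Compl.of I A (algebraMap R A (counit a))

/-- The flip `a ⊗ b ↦ (-1) ^ (|a| |b|) b ⊗ a` of the completed tensor square. -/
noncomputable def flip21 : Tensor2 I A →ₗ[R] Tensor2 I A :=
  Compl.map I (GradedTensorProduct.comm (evenOdd R A) (evenOdd R A)).toLinearMap

/-- The embedding `a ⊗ b ↦ a ⊗ b ⊗ 1`. -/
noncomputable def leg12 : Tensor2 I A →ₗ[R] Tensor3 I A :=
  Compl.map I ((appendRight A).flip 1)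

/-- The embedding `a ⊗ b ↦ a ⊗ 1 ⊗ b`. -/
noncomputable def leg13 : Tensor2 I A →ₗ[R] Tensor3 I A :=
  Compl.map I (tensorMap A
    (GradedTensorProduct.includeLeft (evenOdd R A) (evenOdd R A)).toLinearMap LinearMap.id)

/-- The embedding `a ⊗ b ↦ 1 ⊗ a ⊗ b`. -/
noncomputable def leg23 : Tensor2 I A →ₗ[R] Tensor3 I A :=
  Compl.map I (tensorMap A
    (GradedTensorProduct.includeRight (evenOdd R A) (evenOdd R A)).toLinearMap LinearMap.id)

variable {I A} in
/-- `𝓡` is a triangular universal R-matrix of the Hopf superalgebra `H`. -/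
structure IsTriangularRMatrix (H : HopfSuperalgebra I A) (𝓡 : Tensor2 I A) : Prop where
  isUnit : IsUnit 𝓡
  even : Compl.map I (parity (R := R) (A := STensor R A A)).toLinearMap 𝓡 = 𝓡
  intertwines : ∀ a, 𝓡 * H.comul a = flip21 I A (H.comul a) * 𝓡
  comul_left : comulTensorId H.comul.toLinearMap 𝓡 = leg13 I A 𝓡 * leg23 I A 𝓡
  comul_right : idTensorComul H.comul.toLinearMap 𝓡 = leg13 I A 𝓡 * leg12 I A 𝓡
  triangular : flip21 I A 𝓡 * 𝓡 = 1

end Hopf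

/-! ### Formal power series in the deformation parameter -/

/-- The base ring `ℂ⟦h⟧`. -/
abbrev K : Type := PowerSeries ℂ

/-- The deformation parameter `h`, as an element of `ℂ⟦h⟧`. -/
noncomputable def hbar : K := PowerSeries.X

/-- A complex number as a constant of `ℂ⟦h⟧`. -/
noncomputable def cst (z : ℂ) : K := PowerSeries.C z

/-- The ideal `(h)` of `ℂ⟦h⟧`. -/
noncomputable def hIdeal : Ideal K := Ideal.span {hbar}

/-- The exponential `exp (h z) = ∑ hᵏ zᵏ / k!`, as an element of the `h`-adic completion. -/
noncomputable def expH {A : Type*} [Ring A] [Algebra K A] (z : A) : Compl hIdeal A :=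
  Compl.mk
    (fun n => Compl.toLevel hIdeal A n
      (∑ k ∈ Finset.range n, (cst (1 / (k.factorial : ℂ)) * hbar ^ k) • z ^ k))
    (fun {m n} hmn => by
      rw [Compl.transition_toLevel, ← sub_eq_zero, ← map_sub]
      refine Compl.toLevel_eq_zero _ ?_
      rw [← Finset.sum_sdiff (Finset.range_mono hmn), add_sub_cancel_right]
      refine Submodule.sum_mem _ fun k hk => Submodule.smul_mem_smul ?_ Submodule.mem_top
      have hk' : m ≤ k := by
        simp only [Finset.mem_sdiff, Finset.mem_range, not_lt] at hk
        exact hk.2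
      refine Ideal.mul_mem_left _ _ (Ideal.pow_le_pow_right hk' ?_)
      exact Ideal.pow_mem_pow (Ideal.mem_span_singleton_self _) k)

noncomputable instance : Invertible (2 : K) :=
  ⟨PowerSeries.C (1 / 2 : ℂ), by
    rw [show (2 : K) = PowerSeries.C (2 : ℂ) from (map_ofNat _ 2).symm, ← map_mul]
    norm_num, by
    rw [show (2 : K) = PowerSeries.C (2 : ℂ) from (map_ofNat _ 2).symm, ← map_mul]
    norm_num⟩

/-! ### Topologically presented superalgebras over `ℂ⟦h⟧` -/

section Presentation

/-- The topologically free `ℂ⟦h⟧`-algebra on a set `G` of generators, consisting of the formal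
power series in `h` with coefficients in the free algebra `ℂ⟨G⟩`. -/
abbrev FreeSeries (G : Type) : Type := PowerSeries (FreeAlgebra ℂ G)

noncomputable instance (G : Type) : Algebra K (FreeSeries G) :=
  RingHom.toAlgebra' (PowerSeries.map (algebraMap ℂ (FreeAlgebra ℂ G))) (by
    intro c x
    ext n
    rw [PowerSeries.coeff_mul, PowerSeries.coeff_mul, ← Finset.Nat.sum_antidiagonal_swap]
    refine Finset.sum_congr rfl fun p _ => ?_
    rw [Prod.fst_swap, Prod.snd_swap, PowerSeries.coeff_map]
    exact Algebra.commutes _ _)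

/-- The generator `g`, as a constant power series. -/
noncomputable def gen {G : Type} (g : G) : FreeSeries G := PowerSeries.C (FreeAlgebra.ι ℂ g)

/-- The series `exp (s h g) = ∑ (s h)ⁿ gⁿ / n!`, for a generator `g` and a number `s`. -/
noncomputable def expSeries {G : Type} (g : G) (s : ℂ) : FreeSeries G :=
  PowerSeries.mk fun n => (s ^ n / (n.factorial : ℂ)) • FreeAlgebra.ι ℂ g ^ n

/-- The series `sinh (h g) / h = ∑ h²ᵏ g²ᵏ⁺¹ / (2k+1)!`, for a generator `g`. -/
noncomputable def sinhSeries {G : Type} (g : G) : FreeSeries G :=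
  PowerSeries.mk fun n =>
    if Even n then (1 / ((n + 1).factorial : ℂ)) • FreeAlgebra.ι ℂ g ^ (n + 1) else 0

/-- The automorphism of the free algebra that changes the sign of the odd generators. -/
noncomputable def freeParity {G : Type} (odd : G → Bool) : FreeAlgebra ℂ G →ₐ[ℂ] FreeAlgebra ℂ G :=
  FreeAlgebra.lift ℂ fun g => if odd g then -FreeAlgebra.ι ℂ g else FreeAlgebra.ι ℂ g

/-- The automorphism of the topologically free algebra that changes the sign of the odd
generators. -/
noncomputable def seriesParity {G : Type} (odd : G → Bool) : FreeSeries G →ₐ[K] FreeSeries G :=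
  { PowerSeries.map (freeParity odd).toRingHom with
    commutes' := fun c => by
      ext n
      exact (freeParity odd).commutes _ }

theorem freeParity_freeParity {G : Type} (odd : G → Bool) (x : FreeAlgebra ℂ G) :
    freeParity odd (freeParity odd x) = x := by
  have h : (freeParity odd).comp (freeParity odd) = AlgHom.id ℂ _ := by
    ext g
    simp only [freeParity, AlgHom.comp_apply, Function.comp_apply, FreeAlgebra.lift_ι_apply,
      AlgHom.id_apply]
    split_ifs with hg
    · rw [map_neg, FreeAlgebra.lift_ι_apply, if_pos hg, neg_neg]
    · rw [FreeAlgebra.lift_ι_apply, if_neg hg]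
  exact DFunLike.congr_fun h x

theorem coeff_seriesParity {G : Type} (odd : G → Bool) (x : FreeSeries G) (n : ℕ) :
    PowerSeries.coeff n (seriesParity odd x) = freeParity odd (PowerSeries.coeff n x) :=
  PowerSeries.coeff_map _ _ _

theorem seriesParity_seriesParity {G : Type} (odd : G → Bool) (x : FreeSeries G) :
    seriesParity odd (seriesParity odd x) = x := by
  ext n
  rw [coeff_seriesParity, coeff_seriesParity, freeParity_freeParity]

theorem freeParity_ι {G : Type} (odd : G → Bool) (g : G) :
    freeParity odd (FreeAlgebra.ι ℂ g) =
      if odd g then -FreeAlgebra.ι ℂ g else FreeAlgebra.ι ℂ g :=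
  FreeAlgebra.lift_ι_apply _ _

theorem seriesParity_gen_even {G : Type} (odd : G → Bool) {g : G} (hg : odd g = false) :
    seriesParity odd (gen g) = gen g := by
  refine (PowerSeries.map_C _ _).trans ?_
  change PowerSeries.C (freeParity odd _) = _
  rw [freeParity_ι, hg]
  rfl

theorem seriesParity_gen_odd {G : Type} (odd : G → Bool) {g : G} (hg : odd g = true) :
    seriesParity odd (gen g) = -gen g := by
  refine (PowerSeries.map_C _ _).trans ?_
  change PowerSeries.C (freeParity odd _) = _
  rw [freeParity_ι, hg]
  exact map_neg _ _

theorem seriesParity_expSeries {G : Type} (odd : G → Bool) {g : G} (hg : odd g = false) (s : ℂ) :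
    seriesParity odd (expSeries g s) = expSeries g s := by
  ext n
  rw [coeff_seriesParity, expSeries, PowerSeries.coeff_mk, map_smul, map_pow, freeParity_ι, hg]
  rfl

theorem seriesParity_sinhSeries {G : Type} (odd : G → Bool) {g : G} (hg : odd g = false) :
    seriesParity odd (sinhSeries g) = sinhSeries g := by
  ext n
  rw [coeff_seriesParity, sinhSeries, PowerSeries.coeff_mk]
  split_ifs
  · rw [map_smul, map_pow, freeParity_ι, hg]
    rfl
  · rw [map_zero]

/-- A presentation of a topological superalgebra by generators, their parities, and homogeneous
relations `r = 0`. -/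
structure Presentation where
  /-- The set of generators. -/
  Gen : Type
  /-- The parities of the generators. -/
  odd : Gen → Bool
  /-- The set of relators. -/
  rel : Set (FreeSeries Gen)
  /-- Every relator is even or odd. -/
  homogeneous : ∀ r ∈ rel, seriesParity odd r = r ∨ seriesParity odd r = -r

namespace Presentation

variable (P : Presentation)

/-- The `h`-adic closure of the two-sided ideal generated by the relators: the intersection over
all `n` of the two-sided ideals generated by the relators and `hⁿ`. -/
noncomputable def closedIdeal : TwoSidedIdeal (FreeSeries P.Gen) :=
  ⨅ n : ℕ, TwoSidedIdeal.span (P.rel ∪ {PowerSeries.X ^ n})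

/-- The topological `ℂ⟦h⟧`-algebra with the given generators and relations. -/
abbrev Alg : Type := FreeSeries P.Gen ⧸ P.closedIdeal.asIdeal

/-- The projection of the topologically free algebra onto the presented algebra. -/
noncomputable def proj : FreeSeries P.Gen →ₐ[K] P.Alg := Ideal.Quotient.mkₐ K _

theorem seriesParity_mem {x : FreeSeries P.Gen} (hx : x ∈ P.closedIdeal) :
    seriesParity P.odd x ∈ P.closedIdeal := by
  rw [closedIdeal, TwoSidedIdeal.mem_iInf] at hx ⊢
  intro n
  have h : TwoSidedIdeal.span (P.rel ∪ {PowerSeries.X ^ n}) ≤ TwoSidedIdeal.comap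
      (seriesParity P.odd) (TwoSidedIdeal.span (P.rel ∪ {PowerSeries.X ^ n})) := by
    rw [TwoSidedIdeal.span_le]
    rintro r (hr | hr)
    · rw [SetLike.mem_coe, TwoSidedIdeal.mem_comap]
      have hr' := TwoSidedIdeal.subset_span (Set.mem_union_left {PowerSeries.X ^ n} hr)
      rcases P.homogeneous r hr with h | h <;> rw [h]
      · exact hr'
      · exact neg_mem hr'
    · rw [SetLike.mem_coe, TwoSidedIdeal.mem_comap]
      have hr' := TwoSidedIdeal.subset_span (Set.mem_union_right P.rel hr)
      rw [Set.mem_singleton_iff] at hr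
      have hX : seriesParity P.odd r = r := by
        rw [hr, map_pow]
        congr 1
        exact PowerSeries.map_X _
      rw [hX]
      exact hr'
  exact (TwoSidedIdeal.mem_comap (seriesParity P.odd)).mp (h (hx n))

noncomputable instance : Superalgebra K P.Alg where
  parity := Ideal.Quotient.liftₐ _ (P.proj.comp (seriesParity P.odd))
    (fun _ ha => Ideal.Quotient.eq_zero_iff_mem.mpr (P.seriesParity_mem ha))
  parity_parity a := by
    obtain ⟨x, rfl⟩ := Ideal.Quotient.mk_surjective a
    change P.proj (seriesParity P.odd (seriesParity P.odd x)) = _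
    rw [seriesParity_seriesParity]
    rfl

end Presentation

end Presentation

/-! ### The Jordanian algebras -/

/-- The names of the generators of the Jordanian deformation of `osp(1|2)`. -/
inductive OspGen : Type
  | H | E | F | X | Y

namespace OspGen

/-- The generators `E` and `F` are odd, the others are even. -/
def odd : OspGen → Bool
  | E => true
  | F => true
  | _ => false

end OspGen

namespace Osp

open OspGen

/-- The relators of the Jordanian algebra `U_h(osp(1|2))`, where `T s = exp (s h X)`. -/
inductive Rel : FreeSeries OspGen → Prop
  | HE : Rel (gen H * gen E - gen E * gen H -
      cst (1 / 2) • ((expSeries X 1 + expSeries X (-1)) * gen E))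
  | HF : Rel (gen H * gen F - gen F * gen H +
      cst (1 / 4) • ((expSeries X 1 + expSeries X (-1)) * gen F) +
      cst (1 / 4) • (gen F * (expSeries X 1 + expSeries X (-1))) +
      (cst (1 / 8) * hbar) • (((expSeries X 1 - expSeries X (-1)) * gen H +
        gen H * (expSeries X 1 - expSeries X (-1))) * gen E) +
      (cst (1 / 8) * hbar) • (gen E * ((expSeries X 1 - expSeries X (-1)) * gen H +
        gen H * (expSeries X 1 - expSeries X (-1)))))
  | EF : Rel (gen E * gen F + gen F * gen E +
      cst (1 / 4) • ((expSeries X 1 + expSeries X (-1)) * gen H) +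
      cst (1 / 4) • (gen H * (expSeries X 1 + expSeries X (-1))))
  | HT : Rel (gen H * expSeries X 1 - expSeries X 1 * gen H - (expSeries X 1 ^ 2 - 1))
  | HTinv : Rel (gen H * expSeries X (-1) - expSeries X (-1) * gen H - (expSeries X (-1) ^ 2 - 1))
  | HY : Rel (gen H * gen Y - gen Y * gen H +
      cst (1 / 2) • ((expSeries X 1 + expSeries X (-1)) * gen Y) +
      cst (1 / 2) • (gen Y * (expSeries X 1 + expSeries X (-1))))
  | TY : Rel (expSeries X 1 * gen Y - gen Y * expSeries X 1 -
      (cst (1 / 2) * hbar) • (expSeries X 1 * gen H + gen H * expSeries X 1))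
  | TinvY : Rel (expSeries X (-1) * gen Y - gen Y * expSeries X (-1) +
      (cst (1 / 2) * hbar) • (expSeries X (-1) * gen H + gen H * expSeries X (-1)))
  | EE : Rel (gen E ^ 2 - sinhSeries X)
  | YE : Rel (gen Y * gen E - gen E * gen Y - gen F)
  | TF : Rel (expSeries X 1 * gen F - gen F * expSeries X 1 -
      (cst (1 / 2) * hbar) • ((expSeries X 1 ^ 2 + 1) * gen E))
  | TinvF : Rel (expSeries X (-1) * gen F - gen F * expSeries X (-1) +
      (cst (1 / 2) * hbar) • ((expSeries X (-1) ^ 2 + 1) * gen E))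
  | FF : Rel (gen F ^ 2 + gen Y -
      (cst (1 / 8) * hbar) • ((expSeries X 1 - expSeries X (-1)) * gen H ^ 2) -
      (cst (1 / 4) * hbar) • ((expSeries X 1 - expSeries X (-1)) * gen E * gen F) -
      (cst (3 / 16) * hbar) • ((expSeries X 1 ^ 2 - expSeries X (-1) ^ 2) * gen H) -
      (cst (1 / 4) * hbar) • (expSeries X 1 - expSeries X (-1)) -
      (cst (9 / 128) * hbar) • (expSeries X 1 - expSeries X (-1)) ^ 3)
  | FY : Rel (gen F * gen Y - gen Y * gen F -
      (cst (1 / 4) * hbar) • ((expSeries X 1 - expSeries X (-1)) * gen F) -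
      (cst (1 / 2) * hbar) • ((expSeries X 1 - expSeries X (-1)) * gen E * gen Y) +
      (cst (1 / 4) * hbar ^ 2) • (gen E * gen H ^ 2) +
      (cst (3 / 8) * hbar ^ 2) • ((expSeries X 1 + expSeries X (-1)) * gen E * gen H) +
      (cst (1 / 2) * hbar ^ 2) • gen E +
      (cst (15 / 64) * hbar ^ 2) • ((expSeries X 1 - expSeries X (-1)) ^ 2 * gen E))

/-- The presentation of the Jordanian algebra `U_h(osp(1|2))`. -/
noncomputable def presentation : Presentation where
  Gen := OspGen
  odd := OspGen.odd
  rel := {r | Rel r}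
  homogeneous := by
    have hH : seriesParity OspGen.odd (gen H) = gen H := seriesParity_gen_even _ rfl
    have hY : seriesParity OspGen.odd (gen Y) = gen Y := seriesParity_gen_even _ rfl
    have hE : seriesParity OspGen.odd (gen E) = -gen E := seriesParity_gen_odd _ rfl
    have hF : seriesParity OspGen.odd (gen F) = -gen F := seriesParity_gen_odd _ rfl
    have hT : ∀ s, seriesParity OspGen.odd (expSeries X s) = expSeries X s :=
      seriesParity_expSeries _ rfl
    have hS : seriesParity OspGen.odd (sinhSeries X) = sinhSeries X :=
      seriesParity_sinhSeries _ rfl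
    rintro r (_ | _)
    case HE | HF | YE | TF | TinvF | FY =>
      right
      simp only [map_sub, map_add, map_mul, map_smul, map_pow, map_one, hH, hY, hE, hF, hT,
        mul_neg, neg_mul, smul_neg]
      abel
    all_goals
      left
      simp only [map_sub, map_add, map_mul, map_smul, map_pow, map_one, hH, hY, hE, hF, hT, hS,
        mul_neg, neg_mul, neg_neg, neg_sq]

/-- The Jordanian algebra `U_h(osp(1|2))`. -/
abbrev U : Type := presentation.Alg

/-- The generators of `U_h(osp(1|2))`. -/
noncomputable def x (g : OspGen) : U := presentation.proj (gen g)

/-- The element `T ^ s = exp (s h X)` of `U_h(osp(1|2))`. -/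
noncomputable def T (s : ℂ) : U := presentation.proj (expSeries X s)

/-- The element `a ⊗ b` of the completed tensor square of `U_h(osp(1|2))`. -/
noncomputable def tens (a b : U) : Tensor2 hIdeal U := Compl.of hIdeal _ (stmul a b)

/-- The coproduct, the counit and the antipode take the prescribed values on the generators. -/
structure HasStructureMaps (𝓗 : HopfSuperalgebra hIdeal U) : Prop where
  comul_X : 𝓗.comul (x X) = tens (x X) 1 + tens 1 (x X)
  comul_T : 𝓗.comul (T 1) = tens (T 1) (T 1)
  comul_Tinv : 𝓗.comul (T (-1)) = tens (T (-1)) (T (-1))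
  comul_H : 𝓗.comul (x H) = tens (x H) (T 1) + tens (T (-1)) (x H)
  comul_E : 𝓗.comul (x E) = tens (x E) (T (-1 / 2)) + tens (T (1 / 2)) (x E)
  comul_F : 𝓗.comul (x F) = tens (x F) (T (1 / 2)) + tens (T (-1 / 2)) (x F) +
    (cst (1 / 4) * hbar) • tens (T (-1) * x E) (T (-1 / 2) * x H + x H * T (-1 / 2)) -
    (cst (1 / 4) * hbar) • tens (T (1 / 2) * x H + x H * T (1 / 2)) (T 1 * x E)
  comul_Y : 𝓗.comul (x Y) = tens (x Y) (T 1) + tens (T (-1)) (x Y)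
  counit_X : 𝓗.counit (x X) = 0
  counit_T : 𝓗.counit (T 1) = 1
  counit_Tinv : 𝓗.counit (T (-1)) = 1
  counit_H : 𝓗.counit (x H) = 0
  counit_E : 𝓗.counit (x E) = 0
  counit_F : 𝓗.counit (x F) = 0
  counit_Y : 𝓗.counit (x Y) = 0
  antipode_X : 𝓗.antipode (x X) = -x X
  antipode_T : 𝓗.antipode (T 1) = T (-1)
  antipode_Tinv : 𝓗.antipode (T (-1)) = T 1
  antipode_H : 𝓗.antipode (x H) = -x H + (cst 2 * hbar) • x E ^ 2
  antipode_E : 𝓗.antipode (x E) = -x E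
  antipode_F : 𝓗.antipode (x F) = -x F - (cst (1 / 2) * hbar) • ((T 1 + T (-1)) * x E)
  antipode_Y : 𝓗.antipode (x Y) = -x Y - hbar • x H + hbar ^ 2 • x E ^ 2

/-- The classical r-matrix `h ∧ b₊ = h ⊗ b₊ - b₊ ⊗ h`, lifted to `U_h(osp(1|2))`. -/
noncomputable def rMatrix : Tensor2 hIdeal U := tens (x H) (x X) - tens (x X) (x H)

/-- The twist element `G = exp (h T H ⊗ X)`. -/
noncomputable def G : Tensor2 hIdeal U := expH (stmul (T 1 * x H) (x X))

/-- The element `G₂₁⁻¹ G`. -/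
noncomputable def R : Tensor2 hIdeal U := Ring.inverse (flip21 hIdeal U G) * G

end Osp

/-! ### The classical enveloping superalgebra -/

namespace Classical

open OspGen

/-- A generator of the free algebra on `h, e, f, b₊, b₋`, which carry here the names of their
deformations `H, E, F, X, Y`. -/
noncomputable def g (i : OspGen) : FreeAlgebra ℂ OspGen := FreeAlgebra.ι ℂ i

/-- The relators of the enveloping superalgebra of `osp(1|2)`. -/
inductive Rel : FreeAlgebra ℂ OspGen → Prop
  | he : Rel (g H * g E - g E * g H - g E)
  | hf : Rel (g H * g F - g F * g H + g F)
  | ef : Rel (g E * g F + g F * g E + g H)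
  | hb_plus : Rel (g H * g X - g X * g H - 2 * g X)
  | hb_minus : Rel (g H * g Y - g Y * g H + 2 * g Y)
  | bb : Rel (g X * g Y - g Y * g X - g H)
  | b_plus_f : Rel (g X * g F - g F * g X - g E)
  | b_minus_e : Rel (g Y * g E - g E * g Y - g F)
  | b_plus : Rel (g X - g E ^ 2)
  | b_minus : Rel (g Y + g F ^ 2)

/-- The enveloping superalgebra `U(osp(1|2))`. -/
abbrev U : Type := FreeAlgebra ℂ OspGen ⧸ (TwoSidedIdeal.span {r | Rel r}).asIdeal

/-- The generators of `U(osp(1|2))`. -/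
noncomputable def x (i : OspGen) : U := Ideal.Quotient.mk _ (g i)

end Classical

/-! ### Ohn's algebra -/

/-- The names of the generators of Ohn's algebra. -/
inductive SlGen : Type
  | H | X | Y

namespace Sl

open SlGen

/-- The relators of Ohn's algebra `U_h(sl(2))`, where
`cosh (h X) = (exp (h X) + exp (- h X)) / 2`. -/
inductive Rel : FreeSeries SlGen → Prop
  | HX : Rel (gen H * gen X - gen X * gen H - cst 2 • sinhSeries X)
  | HY : Rel (gen H * gen Y - gen Y * gen H +
      gen Y * (cst (1 / 2) • (expSeries X 1 + expSeries X (-1))) +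
      (cst (1 / 2) • (expSeries X 1 + expSeries X (-1))) * gen Y)
  | XY : Rel (gen X * gen Y - gen Y * gen X - gen H)

/-- The presentation of Ohn's algebra `U_h(sl(2))`. All its elements are even. -/
noncomputable def presentation : Presentation where
  Gen := SlGen
  odd := fun _ => false
  rel := {r | Rel r}
  homogeneous := by
    have hg : ∀ i, seriesParity (fun _ : SlGen => false) (gen i) = gen i := fun i =>
      seriesParity_gen_even _ rfl
    have hT : ∀ s, seriesParity (fun _ : SlGen => false) (expSeries X s) = expSeries X s :=
      seriesParity_expSeries _ rfl
    have hS : seriesParity (fun _ : SlGen => false) (sinhSeries X) = sinhSeries X :=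
      seriesParity_sinhSeries _ rfl
    rintro r (_ | _)
    all_goals
      left
      simp only [map_sub, map_add, map_mul, map_smul, hg, hT, hS]

/-- Ohn's algebra `U_h(sl(2))`. -/
abbrev U : Type := presentation.Alg

/-- The generators of `U_h(sl(2))`. -/
noncomputable def x (g : SlGen) : U := presentation.proj (gen g)

/-- The element `T ^ s = exp (s h X)` of `U_h(sl(2))`. -/
noncomputable def T (s : ℂ) : U := presentation.proj (expSeries X s)

/-- The element `a ⊗ b` of the completed tensor square of `U_h(sl(2))`. -/
noncomputable def tens (a b : U) : Tensor2 hIdeal U := Compl.of hIdeal _ (stmul a b)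

/-- The coproduct, the counit and the antipode are those of Ohn's Hopf algebra. -/
structure HasStructureMaps (𝓗 : HopfSuperalgebra hIdeal U) : Prop where
  comul_X : 𝓗.comul (x X) = tens (x X) 1 + tens 1 (x X)
  comul_H : 𝓗.comul (x H) = tens (x H) (T 1) + tens (T (-1)) (x H)
  comul_Y : 𝓗.comul (x Y) = tens (x Y) (T 1) + tens (T (-1)) (x Y)
  counit_X : 𝓗.counit (x X) = 0
  counit_H : 𝓗.counit (x H) = 0
  counit_Y : 𝓗.counit (x Y) = 0
  antipode_X : 𝓗.antipode (x X) = -x X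
  antipode_H : 𝓗.antipode (x H) = -(T 1 * x H * T (-1))
  antipode_Y : 𝓗.antipode (x Y) = -(T 1 * x Y * T (-1))

/-- The universal R-matrix `exp (-h X ⊗ T H) exp (h T H ⊗ X)` attached to Ohn's algebra. -/
noncomputable def R : Tensor2 hIdeal U :=
  expH (-stmul (x X) (T 1 * x H)) * expH (stmul (T 1 * x H) (x X))

/-- The inclusion of the set of generators of Ohn's algebra. -/
def toOsp : SlGen → OspGen
  | H => OspGen.H
  | X => OspGen.X
  | Y => OspGen.Y

end Sl

/-- `j` is an embedding of Ohn's algebra as a Hopf subalgebra of `U_h(osp(1|2))`: an injective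
homomorphism of `h`-adic Hopf superalgebras mapping generators to generators, for which the
`h`-adic topology of Ohn's algebra is induced by that of `U_h(osp(1|2))`. -/
structure IsHopfEmbedding (𝓞 : HopfSuperalgebra hIdeal Sl.U) (𝓗 : HopfSuperalgebra hIdeal Osp.U)
    (j : Sl.U →ₐ[K] Osp.U) : Prop where
  generators : ∀ i, j (Sl.x i) = Osp.x (Sl.toOsp i)
  parity : ∀ a, Superalgebra.parity (R := K) (j a) = j (Superalgebra.parity (R := K) a)
  injective : Function.Injective j
  saturated : ∀ a b, j a = hbar • b → ∃ a', a = hbar • a'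
  comul : ∀ a, 𝓗.comul (j a) =
    Compl.map hIdeal (tensorMap Sl.U j.toLinearMap j.toLinearMap) (𝓞.comul a)
  counit : ∀ a, 𝓗.counit (j a) = 𝓞.counit a
  antipode : ∀ a, 𝓗.antipode (j a) = j (𝓞.antipode a)

end Jordanian

open Jordanian

open scoped TensorProduct

set_option linter.unusedSimpArgs false
set_option linter.style.haveILetI false
-- As an algebra the Jordanian deformation is trivial, and everything rests on the change of
-- generators that shows this. Put e = T^(-1/2) E, b = T H and f = T^(1/2) F - (h/2) e b + (h/8)(T²
-- - 1) e. These elements satisfy the classical relations f e = -e f - b, b e = e b + e, f b = b f +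
-- f, and T^(-2) = 1 - 2h e², so that X = -log(1 - 2h e²)/(2h), and E, H, F, Y are recovered from e,
-- f, b. Read backwards, these formulas define elements of U(osp(1|2))⟦h⟧. The Jordanian relators
-- vanish on them by rewriting words in e, f, b, q = T^(1/2) and p = T^(-1/2) into normal form
-- (`OspLetters.rules`), which gives the homomorphism `Osp.toModel`. Modulo h the Jordanian relators
-- imply the classical ones, so the kernel of the reduction is hU_h, and repeated division by h
-- shows that `Osp.toModel` is injective. Torsion-freeness and the classical relations between e, f,
-- b follow, and so does the universal property `Osp.exists_algHom`: a triple satisfying the three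
-- classical relations in a complete algebra defines a homomorphism from U_h, which is determined by
-- its values at e and f.
--
-- The coproduct is Δ(e) = e ⊗ T^(-1) + 1 ⊗ e, Δ(b) = b ⊗ T² + 1 ⊗ b, Δ(f) = f ⊗ T + 1 ⊗ f - h b ⊗
-- T² e. It is built for any two supercommuting homomorphisms in place of a ↦ a ⊗ 1 and a ↦ 1 ⊗ a
-- (`Osp.conv`), so that coassociativity and the counit axioms become equalities of homomorphisms,
-- checked on e and f. The value Δ(X) = X ⊗ 1 + 1 ⊗ X is found by comparing exponentials; logarithms
-- may be taken because the tensor square is torsion-free, U_h being flat over ℂ⟦h⟧. The antipode is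
-- a super-antihomomorphism; multiplying its odd part by the imaginary unit turns it into a
-- homomorphism to the opposite algebra, to which the universal property applies.
--
-- The R-matrix comes from a twist: G = exp(h b ⊗ X) satisfies G Δ(a) = (a ⊗ 1 + 1 ⊗ a) G for a = e,
-- f, b. The right-hand coproduct is symmetric, so R = G₂₁⁻¹ G intertwines Δ and its opposite and is
-- triangular. The hexagon identities are formal consequences of (Δ ⊗ id) G = G₁₂⁻¹ G₁₃ G₂₃ G₁₂, of
-- X being primitive and of R commuting with Δ(X).
--
-- In Ohn's algebra the elements b, b₊ and b₋, mapped to b, e² and -f², satisfy the relations of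
-- sl(2). Since U(osp(1|2)) is free over U(sl(2)) on 1, e, f, e f, representations of sl(2) can be
-- induced; the resulting 4 × 4 matrices show that the map from Ohn's algebra is injective modulo h,
-- then injective, and finally split. Its Hopf structure is the restriction of that of U_h.
namespace Jordanian

/-! ### Congruences modulo powers of `h` -/

section HMod

variable {M N : Type*} [AddCommGroup M] [Module K M] [AddCommGroup N] [Module K N]

/-- Congruence modulo `hⁿ`. -/
def HMod (n : ℕ) (x y : M) : Prop := ∃ z : M, x - y = hbar ^ n • z

theorem mem_hIdeal_pow_smul_top {n : ℕ} {x : M} :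
    x ∈ (hIdeal ^ n • ⊤ : Submodule K M) ↔ ∃ z, x = hbar ^ n • z := by
  rw [hIdeal, Ideal.span_singleton_pow, Submodule.ideal_span_singleton_smul,
    Submodule.mem_smul_pointwise_iff_exists]
  exact ⟨fun ⟨z, _, hz⟩ => ⟨z, hz.symm⟩, fun ⟨z, hz⟩ => ⟨z, trivial, hz.symm⟩⟩

theorem smodEq_iff_hMod {n : ℕ} {x y : M} :
    x ≡ y [SMOD (hIdeal ^ n • ⊤ : Submodule K M)] ↔ HMod n x y := by
  rw [SModEq.sub_mem, mem_hIdeal_pow_smul_top, HMod]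

namespace HMod

@[refl] theorem refl (n : ℕ) (x : M) : HMod n x x := ⟨0, by simp⟩

theorem of_eq {n : ℕ} {x y : M} (h : x = y) : HMod n x y := h ▸ refl n x

theorem symm {n : ℕ} {x y : M} (h : HMod n x y) : HMod n y x := by
  obtain ⟨z, hz⟩ := h
  exact ⟨-z, by rw [smul_neg, ← hz, neg_sub]⟩

theorem trans {n : ℕ} {x y w : M} (h : HMod n x y) (h' : HMod n y w) : HMod n x w := by
  obtain ⟨z, hz⟩ := h
  obtain ⟨z', hz'⟩ := h'
  exact ⟨z + z', by rw [smul_add, ← hz, ← hz', sub_add_sub_cancel]⟩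

theorem add {n : ℕ} {x y x' y' : M} (h : HMod n x y) (h' : HMod n x' y') :
    HMod n (x + x') (y + y') := by
  obtain ⟨z, hz⟩ := h
  obtain ⟨z', hz'⟩ := h'
  exact ⟨z + z', by rw [smul_add, ← hz, ← hz', add_sub_add_comm]⟩

theorem neg {n : ℕ} {x y : M} (h : HMod n x y) : HMod n (-x) (-y) := by
  obtain ⟨z, hz⟩ := h
  exact ⟨-z, by rw [smul_neg, ← hz]; abel⟩

theorem sub {n : ℕ} {x y x' y' : M} (h : HMod n x y) (h' : HMod n x' y') :
    HMod n (x - x') (y - y') := by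
  rw [sub_eq_add_neg, sub_eq_add_neg]
  exact h.add h'.neg

theorem zero (x y : M) : HMod 0 x y := ⟨x - y, by simp⟩

theorem map (f : M →ₗ[K] N) {n : ℕ} {x y : M} (h : HMod n x y) : HMod n (f x) (f y) := by
  obtain ⟨z, hz⟩ := h
  exact ⟨f z, by rw [← map_sub, hz, map_smul]⟩

theorem smul (c : K) {n : ℕ} {x y : M} (h : HMod n x y) : HMod n (c • x) (c • y) :=
  h.map (LinearMap.lsmul K M c)

theorem hbar_smul {n : ℕ} {x y : M} (h : HMod n x y) :
    HMod (n + 1) (hbar • x) (hbar • y) := by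
  obtain ⟨z, hz⟩ := h
  exact ⟨z, by rw [← smul_sub, hz, smul_smul, ← pow_succ']⟩

theorem mono {m n : ℕ} (hmn : m ≤ n) {x y : M} (h : HMod n x y) : HMod m x y := by
  obtain ⟨z, hz⟩ := h
  exact ⟨hbar ^ (n - m) • z, by rw [hz, smul_smul, ← pow_add, Nat.add_sub_cancel' hmn]⟩

theorem eq [IsHausdorff hIdeal M] {x y : M} (h : ∀ n, HMod n x y) : x = y :=
  (IsHausdorff.eq_iff_smodEq (I := hIdeal)).mpr fun n => smodEq_iff_hMod.mpr (h n)

end HMod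

theorem isHausdorff_of_hMod (h : ∀ x : M, (∀ n, HMod n x 0) → x = 0) : IsHausdorff hIdeal M :=
  ⟨fun x hx => h x fun n => smodEq_iff_hMod.mp (hx n)⟩

theorem exists_hMod_limit [IsPrecomplete hIdeal M] (u : ℕ → M)
    (hu : ∀ n, HMod n (u (n + 1)) (u n)) : ∃ L, ∀ n, HMod n (u n) L := by
  have hu' : ∀ m k, HMod m (u m) (u (m + k)) := fun m k => by
    induction k with
    | zero => exact HMod.refl _ _
    | succ k ih => exact ih.trans ((hu (m + k)).mono (Nat.le_add_right m k)).symm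
  obtain ⟨L, hL⟩ := IsPrecomplete.prec (I := hIdeal) ‹_› (f := u) (fun {m n} hmn => by
    rw [smodEq_iff_hMod]
    obtain ⟨k, rfl⟩ := Nat.exists_eq_add_of_le hmn
    exact hu' m k)
  exact ⟨L, fun n => smodEq_iff_hMod.mp (hL n)⟩

theorem isPrecomplete_of_hMod
    (h : ∀ u : ℕ → M, (∀ n, HMod n (u (n + 1)) (u n)) → ∃ L, ∀ n, HMod n (u n) L) :
    IsPrecomplete hIdeal M :=
  ⟨fun u hu => by
    obtain ⟨L, hL⟩ := h u fun n => (smodEq_iff_hMod.mp (hu (Nat.le_succ n))).symm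
    exact ⟨L, fun n => smodEq_iff_hMod.mpr (hL n)⟩⟩

theorem isAdicComplete_of_linearEquiv (e : M ≃ₗ[K] N) [IsAdicComplete hIdeal M] :
    IsAdicComplete hIdeal N where
  toIsHausdorff := isHausdorff_of_hMod fun x hx => by
    rw [← e.symm.map_eq_zero_iff]
    refine HMod.eq fun n => ?_
    have h := (hx n).map e.symm.toLinearMap
    rwa [map_zero] at h
  toIsPrecomplete := isPrecomplete_of_hMod fun u hu => by
    obtain ⟨L, hL⟩ := exists_hMod_limit (fun n => e.symm (u n))
      fun n => (hu n).map e.symm.toLinearMap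
    refine ⟨e L, fun n => ?_⟩
    have h := (hL n).map e.toLinearMap
    simpa using h

theorem isAdicComplete_pi {ι : Type*} {M : ι → Type*} [∀ i, AddCommGroup (M i)]
    [∀ i, Module K (M i)] [∀ i, IsAdicComplete hIdeal (M i)] :
    IsAdicComplete hIdeal (∀ i, M i) where
  toIsHausdorff := isHausdorff_of_hMod fun x hx => funext fun i =>
    HMod.eq fun n => (hx n).map (LinearMap.proj i)
  toIsPrecomplete := isPrecomplete_of_hMod fun u hu => by
    have h := fun i => exists_hMod_limit (fun n => u n i) fun n => (hu n).map (LinearMap.proj i)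
    choose L hL using h
    refine ⟨L, fun n => ?_⟩
    choose z hz using fun i => hL i n
    exact ⟨z, funext hz⟩

instance isAdicComplete_compl : IsAdicComplete hIdeal (Compl hIdeal M) :=
  AdicCompletion.isAdicComplete (I := hIdeal) (M := M) ⟨{hbar}, by simp [hIdeal]⟩

/-- As (h) is finitely generated, the kernel of the projection of the completion to level n is hⁿ
times the completion. -/
theorem hMod_of_eval_eq {n : ℕ} {x y : Compl hIdeal M}
    (h : Compl.eval hIdeal M n x = Compl.eval hIdeal M n y) : HMod n x y := by
  have hfg : hIdeal.FG := ⟨{hbar}, by simp [hIdeal]⟩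
  have h1 : x - y ∈ LinearMap.ker (Compl.eval hIdeal M n) := by
    rw [LinearMap.mem_ker, map_sub, h, sub_self]
  rw [← smodEq_iff_hMod, SModEq.sub_mem]
  exact (AdicCompletion.pow_smul_top_eq_ker_eval (M := M) (n := n) hfg).ge h1

/-- Every element of the completion is a limit of elements of the module. -/
theorem exists_hMod_of (n : ℕ) (x : Compl hIdeal M) :
    ∃ m : M, HMod n x (Compl.of hIdeal M m) := by
  obtain ⟨m, hm⟩ := Compl.exists_rep n x
  exact ⟨m, hMod_of_eval_eq (by rw [hm, Compl.eval_of])⟩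

theorem linearMap_ext_compl [IsHausdorff hIdeal N] {f g : Compl hIdeal M →ₗ[K] N}
    (h : ∀ m, f (Compl.of hIdeal M m) = g (Compl.of hIdeal M m)) (x : Compl hIdeal M) :
    f x = g x :=
  HMod.eq fun n => by
    obtain ⟨m, hm⟩ := exists_hMod_of n x
    exact (hm.map f).trans ((HMod.of_eq (h m)).trans (hm.map g).symm)

/-- Division by h costs one level: a representative at level n + 1 which h sends into hⁿ⁺¹M lies in
hⁿM, hence vanishes at level n. -/
theorem eq_zero_of_hbar_smul_compl (hM : ∀ m : M, hbar • m = 0 → m = 0) {x : Compl hIdeal M}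
    (hx : hbar • x = 0) : x = 0 := by
  have hpow : ∀ (n : ℕ) (m : M), hbar ^ n • m = 0 → m = 0 := fun n => by
    induction n with
    | zero => intro m hm; simpa using hm
    | succ n ih => exact fun m hm => hM m (ih _ (by rwa [smul_smul, ← pow_succ]))
  refine Compl.ext fun n => ?_
  obtain ⟨m, hm⟩ := Compl.exists_rep (n + 1) x
  have h1 : Compl.toLevel hIdeal M (n + 1) (hbar • m) = 0 := by
    rw [map_smul, ← hm, ← map_smul, hx, map_zero]
  obtain ⟨z, hz⟩ := mem_hIdeal_pow_smul_top.mp ((Submodule.Quotient.mk_eq_zero _).mp h1)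
  have h2 : m = hbar ^ n • z := by
    rw [← sub_eq_zero]
    refine hM _ ?_
    rw [smul_sub, hz, smul_smul, ← pow_succ', sub_self]
  rw [Compl.eval_of_le (Nat.le_succ n) hm, map_zero]
  exact Compl.toLevel_eq_zero _ (mem_hIdeal_pow_smul_top.mpr ⟨z, h2⟩)

/-- A submodule is dense if it meets every class modulo `h`. -/
def HDense (S : Submodule K M) : Prop := ∀ m : M, ∃ s ∈ S, HMod 1 m s

/-- The error of an approximation modulo h is h times an element, which can be approximated in turn;
each round gains one order. -/
theorem HDense.exists_hMod {S : Submodule K M} (hS : HDense S) (n : ℕ) (m : M) :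
    ∃ s ∈ S, HMod n m s := by
  induction n generalizing m with
  | zero => exact ⟨0, S.zero_mem, HMod.zero _ _⟩
  | succ n ih =>
    obtain ⟨s, hs, z, hz⟩ := hS m
    obtain ⟨t, ht, hzt⟩ := ih z
    refine ⟨s + hbar • t, S.add_mem hs (S.smul_mem _ ht), ?_⟩
    have h : m = s + hbar • z := by rw [pow_one] at hz; rw [← hz]; abel
    rw [h]
    exact (HMod.refl _ s).add hzt.hbar_smul

theorem HDense.linearMap_ext [IsHausdorff hIdeal N] {S : Submodule K M} (hS : HDense S)
    {f g : M →ₗ[K] N} (h : ∀ s ∈ S, f s = g s) (m : M) : f m = g m :=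
  HMod.eq fun n => by
    obtain ⟨s, hs, hm⟩ := hS.exists_hMod n m
    exact (hm.map f).trans ((HMod.of_eq (h s hs)).trans (hm.map g).symm)

end HMod

/-! ### Congruences in algebras -/

section Ring

variable {B : Type*} [Ring B] [Algebra K B]

namespace HMod

theorem mul_left (a : B) {n : ℕ} {x y : B} (h : HMod n x y) : HMod n (a * x) (a * y) :=
  h.map (LinearMap.mulLeft K a)

theorem mul_right (a : B) {n : ℕ} {x y : B} (h : HMod n x y) : HMod n (x * a) (y * a) :=
  h.map (LinearMap.mulRight K a)

theorem mul {n : ℕ} {x y x' y' : B} (h : HMod n x y) (h' : HMod n x' y') :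
    HMod n (x * x') (y * y') :=
  (h.mul_right x').trans (h'.mul_left y)

end HMod

variable (B) in
/-- The two-sided ideal `hⁿB`. -/
noncomputable def hTwoSided (n : ℕ) : TwoSidedIdeal B :=
  TwoSidedIdeal.mk' {x | HMod n x 0} (HMod.refl n 0)
    (fun {x y} hx hy => by simpa using HMod.add hx hy)
    (fun {x} hx => by simpa using HMod.neg hx)
    (fun {x y} hy => by simpa using HMod.mul_left x hy)
    (fun {x y} hx => by simpa using HMod.mul_right y hx)

theorem mem_hTwoSided {n : ℕ} {x : B} : x ∈ hTwoSided B n ↔ HMod n x 0 :=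
  TwoSidedIdeal.mem_mk' _ _ _ _ _ _ _

end Ring

end Jordanian
namespace Jordanian

instance isAdicComplete_K : IsAdicComplete hIdeal K :=
  inferInstanceAs (IsAdicComplete (Ideal.span {PowerSeries.X}) (PowerSeries ℂ))

/-! ### Evaluation of power series in `h` -/

section SerEval

variable {A : Type*} [Ring A] {B : Type*} [Ring B] [Algebra K B]

theorem hMod_partialSum_succ (φ : A →+* B) (s : PowerSeries A) (n : ℕ) :
    HMod n (∑ k ∈ Finset.range (n + 1), hbar ^ k • φ (PowerSeries.coeff k s))
      (∑ k ∈ Finset.range n, hbar ^ k • φ (PowerSeries.coeff k s)) := by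
  rw [Finset.sum_range_succ]
  exact ⟨φ (PowerSeries.coeff n s), add_sub_cancel_left _ _⟩

variable [IsAdicComplete hIdeal B]

/-- The sum `∑ hᵏ φ(aₖ)`, where `∑ hᵏ aₖ` is a power series. -/
noncomputable def serSum (φ : A →+* B) (s : PowerSeries A) : B :=
  (exists_hMod_limit (fun n => ∑ k ∈ Finset.range n, hbar ^ k • φ (PowerSeries.coeff k s))
    (hMod_partialSum_succ φ s)).choose

theorem hMod_serSum (φ : A →+* B) (s : PowerSeries A) (n : ℕ) :
    HMod n (∑ k ∈ Finset.range n, hbar ^ k • φ (PowerSeries.coeff k s)) (serSum φ s) :=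
  (exists_hMod_limit (fun n => ∑ k ∈ Finset.range n, hbar ^ k • φ (PowerSeries.coeff k s))
    (hMod_partialSum_succ φ s)).choose_spec n

theorem eq_serSum {φ : A →+* B} {s : PowerSeries A} {y : B}
    (h : ∀ n, HMod n (∑ k ∈ Finset.range n, hbar ^ k • φ (PowerSeries.coeff k s)) y) :
    y = serSum φ s :=
  HMod.eq fun n => (h n).symm.trans (hMod_serSum φ s n)

theorem serSum_add (φ : A →+* B) (s t : PowerSeries A) :
    serSum φ (s + t) = serSum φ s + serSum φ t :=
  (eq_serSum fun n => by
    simp only [map_add, smul_add, Finset.sum_add_distrib]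
    exact (hMod_serSum φ s n).add (hMod_serSum φ t n)).symm

theorem serSum_C (φ : A →+* B) (a : A) : serSum φ (PowerSeries.C a) = φ a :=
  (eq_serSum fun n => by
    cases n with
    | zero => exact HMod.zero _ _
    | succ n =>
      refine HMod.of_eq ?_
      rw [Finset.sum_range_succ', Finset.sum_eq_zero]
      · simp
      · intro k _
        simp).symm

theorem serSum_C_mul (φ : A →+* B) (a : A) (s : PowerSeries A) :
    serSum φ (PowerSeries.C a * s) = φ a * serSum φ s :=
  (eq_serSum fun n => by
    refine HMod.trans (HMod.of_eq ?_) ((hMod_serSum φ s n).mul_left (φ a))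
    rw [Finset.mul_sum]
    exact Finset.sum_congr rfl fun k _ => by
      rw [PowerSeries.coeff_C_mul, map_mul, mul_smul_comm]).symm

theorem serSum_X_mul (φ : A →+* B) (s : PowerSeries A) :
    serSum φ (PowerSeries.X * s) = hbar • serSum φ s :=
  (eq_serSum fun n => by
    cases n with
    | zero => exact HMod.zero _ _
    | succ n =>
      refine HMod.trans (HMod.of_eq ?_) (hMod_serSum φ s n).hbar_smul
      rw [Finset.sum_range_succ', Finset.smul_sum]
      simp [PowerSeries.coeff_succ_X_mul, smul_smul, pow_succ']).symm

theorem powerSeries_eq_C_add_X_mul (s : PowerSeries A) :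
    ∃ s', s = PowerSeries.C (PowerSeries.constantCoeff s) + PowerSeries.X * s' :=
  ⟨PowerSeries.mk fun n => PowerSeries.coeff (n + 1) s, by
    ext n
    cases n with
    | zero => simp
    | succ n => simp [PowerSeries.coeff_succ_X_mul]⟩

/-- An induction principle for identities between elements of a complete module which depend on a
power series. -/
theorem powerSeries_induction {N : Type*} [AddCommGroup N] [Module K N] [IsHausdorff hIdeal N]
    {f g : PowerSeries A → N}
    (h : ∀ (n : ℕ) (a : A) (s : PowerSeries A), HMod n (f s) (g s) →
      HMod (n + 1) (f (PowerSeries.C a + PowerSeries.X * s))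
        (g (PowerSeries.C a + PowerSeries.X * s)))
    (s : PowerSeries A) : f s = g s := by
  -- Writing s = a + t s' raises the order of a congruence by one, so the induction on the order
  -- must let the series vary.
  refine HMod.eq fun n => ?_
  induction n generalizing s with
  | zero => exact HMod.zero _ _
  | succ n ih =>
    obtain ⟨s', hs⟩ := powerSeries_eq_C_add_X_mul s
    rw [hs]
    exact h n _ _ (ih s')

theorem serSum_mul (φ : A →+* B) (s t : PowerSeries A) :
    serSum φ (s * t) = serSum φ s * serSum φ t := by
  refine powerSeries_induction (f := fun s => serSum φ (s * t))
    (g := fun s => serSum φ s * serSum φ t) (fun n a s ih => ?_) s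
  rw [add_mul, mul_assoc, serSum_add, serSum_add, serSum_C, serSum_C_mul, serSum_X_mul,
    serSum_X_mul, add_mul, smul_mul_assoc]
  exact (HMod.refl _ _).add ih.hbar_smul

/-- The ring homomorphism `∑ hᵏ aₖ ↦ ∑ hᵏ φ(aₖ)` to a complete algebra. -/
noncomputable def serEval (φ : A →+* B) : PowerSeries A →+* B where
  toFun := serSum φ
  map_one' := by rw [← map_one PowerSeries.C, serSum_C, map_one]
  map_mul' := serSum_mul φ
  map_zero' := by rw [← map_zero PowerSeries.C, serSum_C, map_zero]
  map_add' := serSum_add φ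

@[simp] theorem serEval_C (φ : A →+* B) (a : A) : serEval φ (PowerSeries.C a) = φ a :=
  serSum_C φ a

theorem serEval_X_mul (φ : A →+* B) (s : PowerSeries A) :
    serEval φ (PowerSeries.X * s) = hbar • serEval φ s :=
  serSum_X_mul φ s

theorem serEval_C_add_X_mul (φ : A →+* B) (a : A) (s : PowerSeries A) :
    serEval φ (PowerSeries.C a + PowerSeries.X * s) = φ a + hbar • serEval φ s := by
  rw [map_add, serEval_C, serEval_X_mul]

theorem serEval_map_algebraMap [Algebra ℂ A] {φ : A →+* B}
    (hφ : ∀ c : ℂ, φ (algebraMap ℂ A c) = algebraMap K B (cst c)) (c : K) :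
    serEval φ (PowerSeries.map (algebraMap ℂ A) c) = algebraMap K B c := by
  refine powerSeries_induction (A := ℂ)
    (f := fun c => serEval φ (PowerSeries.map (algebraMap ℂ A) c))
    (g := fun c => algebraMap K B c) (fun n a s ih => ?_) c
  rw [map_add, map_mul, PowerSeries.map_C, PowerSeries.map_X, serEval_C_add_X_mul, hφ, map_add,
    map_mul]
  refine (HMod.refl _ _).add ?_
  change HMod (n + 1) _ (algebraMap K B hbar * _)
  rw [← Algebra.smul_def]
  exact ih.hbar_smul

end SerEval

/-! ### Evaluation of power series in one variable `t` at `t = h z` -/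

section PsEval

variable {B : Type*} [Ring B] [Algebra K B]

/-- The homomorphism from `ℂ[x]` to a `ℂ⟦h⟧`-algebra with a given value at `x`. -/
noncomputable def polyEval (z : B) : Polynomial ℂ →+* B :=
  Polynomial.eval₂RingHom' ((algebraMap K B).comp PowerSeries.C) z
    fun _ => Algebra.commutes _ _

@[simp] theorem polyEval_X (z : B) : polyEval z Polynomial.X = z :=
  Polynomial.eval₂_X _ _

@[simp] theorem polyEval_C (z : B) (c : ℂ) :
    polyEval z (Polynomial.C c) = algebraMap K B (cst c) :=
  Polynomial.eval₂_C _ _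

variable [IsAdicComplete hIdeal B]

/-- The value at `t = h z` of a power series in `t`. -/
noncomputable def psEval (z : B) : PowerSeries ℂ →+* B :=
  -- The series ∑ cₖ tᵏ becomes ∑ cₖ xᵏ tᵏ with coefficients in ℂ[x]; then x is specialised to z and
  -- t to h.
  (serEval (polyEval z)).comp
    ((PowerSeries.rescale Polynomial.X).comp (PowerSeries.map Polynomial.C))

theorem psEval_C (z : B) (c : ℂ) : psEval z (PowerSeries.C c) = algebraMap K B (cst c) := by
  have h : PowerSeries.rescale (Polynomial.X : Polynomial ℂ) (PowerSeries.C (Polynomial.C c)) =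
      PowerSeries.C (Polynomial.C c) := by
    ext1 n
    rw [PowerSeries.coeff_rescale, PowerSeries.coeff_C]
    split_ifs with hn <;> simp [hn]
  rw [psEval, RingHom.comp_apply, RingHom.comp_apply, PowerSeries.map_C, h, serEval_C, polyEval_C]

theorem psEval_X (z : B) : psEval z PowerSeries.X = hbar • z := by
  rw [psEval, RingHom.comp_apply, RingHom.comp_apply, PowerSeries.map_X, PowerSeries.rescale_X,
    mul_comm, serEval_X_mul, serEval_C, polyEval_X]

theorem psEval_C_add_X_mul (z : B) (c : ℂ) (φ : PowerSeries ℂ) :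
    psEval z (PowerSeries.C c + PowerSeries.X * φ) =
      algebraMap K B (cst c) + hbar • (z * psEval z φ) := by
  rw [map_add, map_mul, psEval_C, psEval_X, smul_mul_assoc]

theorem psEval_smul (z : B) (c : ℂ) (φ : PowerSeries ℂ) :
    psEval z (c • φ) = cst c • psEval z φ := by
  rw [PowerSeries.smul_eq_C_mul, map_mul, psEval_C, Algebra.smul_def]

/-- Approximation of the value at `h z` of a power series by its partial sums. -/
theorem hMod_psEval (z : B) (φ : PowerSeries ℂ) (n : ℕ) :
    HMod n (∑ k ∈ Finset.range n, (cst (PowerSeries.coeff k φ) * hbar ^ k) • z ^ k)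
      (psEval z φ) := by
  refine HMod.trans (HMod.of_eq ?_) (hMod_serSum _ _ n)
  refine Finset.sum_congr rfl fun k _ => ?_
  rw [RingHom.comp_apply, PowerSeries.coeff_rescale, PowerSeries.coeff_map, map_mul, map_pow,
    polyEval_X, polyEval_C,
    ← Algebra.commutes, ← Algebra.smul_def, smul_smul, mul_comm]

theorem map_psEval {B' : Type*} [Ring B'] [Algebra K B'] [IsAdicComplete hIdeal B']
    (g : B →ₐ[K] B') (z : B) (φ : PowerSeries ℂ) : g (psEval z φ) = psEval (g z) φ := by
  refine powerSeries_induction (f := fun φ => g (psEval z φ)) (g := psEval (g z))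
    (fun n a s ih => ?_) φ
  rw [psEval_C_add_X_mul, psEval_C_add_X_mul, map_add, map_smul, map_mul, AlgHom.commutes]
  exact (HMod.refl _ _).add (ih.mul_left _).hbar_smul

theorem psEval_mul_eq_mul_psEval {z w y : B} (h : z * y = y * w) (φ : PowerSeries ℂ) :
    psEval z φ * y = y * psEval w φ := by
  refine powerSeries_induction (f := fun φ => psEval z φ * y) (g := fun φ => y * psEval w φ)
    (fun n a s ih => ?_) φ
  rw [psEval_C_add_X_mul, psEval_C_add_X_mul, add_mul, mul_add, Algebra.commutes, smul_mul_assoc,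
    mul_smul_comm, mul_assoc, ← mul_assoc y w, ← h, mul_assoc z]
  exact (HMod.refl _ _).add (ih.mul_left _).hbar_smul

theorem commute_psEval_left {z y : B} (h : Commute z y) (φ : PowerSeries ℂ) :
    Commute (psEval z φ) y :=
  psEval_mul_eq_mul_psEval h φ

/-- If `[y, z] = c` commutes with `z` then `[y, φ(h z)] = h c φ'(h z)`. -/
theorem mul_psEval_of_commutator {y z c : B} (h : y * z = z * y + c) (hc : Commute z c)
    (φ : PowerSeries ℂ) :
    y * psEval z φ =
      psEval z φ * y + hbar • (c * psEval z (PowerSeries.derivative ℂ φ)) := by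
  refine powerSeries_induction (f := fun φ => y * psEval z φ) (g := fun φ => psEval z φ * y +
    hbar • (c * psEval z (PowerSeries.derivative ℂ φ))) (fun n a s ih => ?_) φ
  have hd : PowerSeries.derivative ℂ (PowerSeries.C a + PowerSeries.X * s) =
      s + PowerSeries.X * PowerSeries.derivative ℂ s := by
    rw [map_add, Derivation.leibniz, PowerSeries.derivative_C, PowerSeries.derivative_X]
    simp [add_comm]
  rw [hd, psEval_C_add_X_mul, map_add, map_mul, psEval_X, mul_add, add_mul, Algebra.commutes,
    mul_smul_comm, ← mul_assoc, h]
  have e1 : hbar • ((z * y + c) * psEval z s) =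
      hbar • (z * (y * psEval z s)) + hbar • (c * psEval z s) := by
    rw [add_mul, smul_add, mul_assoc]
  have e2 : hbar • (z * (psEval z s * y +
        hbar • (c * psEval z (PowerSeries.derivative ℂ s)))) + hbar • (c * psEval z s) =
      hbar • (z * psEval z s) * y + hbar • (c * (psEval z s +
        hbar • z * psEval z (PowerSeries.derivative ℂ s))) := by
    rw [mul_add, mul_add, smul_add, smul_add, smul_mul_assoc, smul_mul_assoc, mul_smul_comm,
      mul_smul_comm, ← mul_assoc z c, hc.eq, mul_assoc c z, mul_assoc]
    abel
  rw [e1, add_assoc, ← e2]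
  exact (HMod.refl _ _).add ((ih.mul_left z).hbar_smul.add (HMod.refl _ _))

/-- The composition of power series without constant terms. -/
theorem psEval_mul_psEval (z : B) (w φ : PowerSeries ℂ) :
    psEval (z * psEval z w) φ = psEval z (psEval (B := K) w φ) := by
  refine powerSeries_induction (f := psEval (z * psEval z w))
    (g := fun φ => psEval z (psEval (B := K) w φ)) (fun n a s ih => ?_) φ
  -- Here `K` is itself the target algebra, with h in the role of the variable t, so `psEval w φ` is
  -- the series φ(t w(t)).
  have h : psEval (B := K) w (PowerSeries.C a + PowerSeries.X * s) =
      PowerSeries.C a + PowerSeries.X * (w * psEval (B := K) w s) :=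
    psEval_C_add_X_mul (B := K) w a s
  rw [h, psEval_C_add_X_mul, psEval_C_add_X_mul, map_mul, ← mul_assoc]
  exact (HMod.refl _ _).add (ih.mul_left _).hbar_smul

end PsEval

end Jordanian
namespace Jordanian

/-! ### The exponential of `h z` -/

section Hexp

variable {B : Type*} [Ring B] [Algebra K B] [IsAdicComplete hIdeal B]

/-- The exponential `exp (h z)` in a complete algebra. -/
noncomputable def hexp (z : B) : B := psEval z (PowerSeries.exp ℂ)

theorem serEval_rescale_exp {A : Type*} [CommRing A] [Algebra ℚ A] (φ : A →+* B) (a : A) :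
    serEval φ (PowerSeries.rescale a (PowerSeries.exp A)) = hexp (φ a) := by
  refine (eq_serSum fun n => HMod.trans (HMod.of_eq ?_) (hMod_psEval _ _ n)).symm
  refine Finset.sum_congr rfl fun k _ => ?_
  -- There is at most one ring homomorphism from ℚ to a given ring, so the two ways of mapping the
  -- rational coefficients to `B` agree.
  have h : φ (algebraMap ℚ A (1 / (k.factorial : ℚ))) =
      algebraMap K B (cst (algebraMap ℚ ℂ (1 / (k.factorial : ℚ)))) :=
    RingHom.congr_fun (RingHom.ext_rat (φ.comp (algebraMap ℚ A))
      (((algebraMap K B).comp PowerSeries.C).comp (algebraMap ℚ ℂ))) _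
  rw [PowerSeries.coeff_rescale, PowerSeries.coeff_exp, PowerSeries.coeff_exp, map_mul, map_pow,
    h, ← Algebra.commutes, ← Algebra.smul_def, smul_smul, mul_comm]

/-- The identity exp(x t) exp(y t) = exp((x + y) t) over ℂ[x][y] is pushed forward along x ↦ z, y ↦
w; the commutation of z and w is what makes this substitution a homomorphism. -/
theorem hexp_add {z w : B} (h : Commute z w) : hexp (z + w) = hexp z * hexp w := by
  let φ : Polynomial (Polynomial ℂ) →+* B :=
    Polynomial.eval₂RingHom' (polyEval z) w fun p => by
      induction p using Polynomial.induction_on' with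
      | add p q hp hq => rw [map_add]; exact hp.add_left hq
      | monomial n a =>
        rw [← Polynomial.C_mul_X_pow_eq_monomial, map_mul, map_pow, polyEval_C, polyEval_X]
        exact Commute.mul_left (Algebra.commutes _ _) (h.pow_left n)
  have h1 : φ (Polynomial.C Polynomial.X) = z :=
    (Polynomial.eval₂_C _ _).trans (polyEval_X z)
  have h2 : φ Polynomial.X = w := Polynomial.eval₂_X _ _
  have h3 := congrArg (serEval φ) (PowerSeries.exp_mul_exp_eq_exp_add
    (Polynomial.C Polynomial.X : Polynomial (Polynomial ℂ)) Polynomial.X)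
  rw [map_mul, serEval_rescale_exp, serEval_rescale_exp, serEval_rescale_exp, map_add, h1, h2] at h3
  exact h3.symm

@[simp] theorem hexp_zero : hexp (0 : B) = 1 := by
  rw [hexp]
  have h := (hMod_psEval (0 : B) (PowerSeries.exp ℂ))
  refine HMod.eq fun n => (h n).symm.trans ?_
  cases n with
  | zero => exact HMod.zero _ _
  | succ n =>
    refine HMod.of_eq ?_
    rw [Finset.sum_range_succ']
    simp [cst]

theorem hexp_mul_hexp_neg (z : B) : hexp z * hexp (-z) = 1 := by
  rw [← hexp_add (Commute.refl z).neg_right, add_neg_cancel, hexp_zero]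

theorem hexp_neg_mul_hexp (z : B) : hexp (-z) * hexp z = 1 := by
  rw [← hexp_add (Commute.refl z).neg_left, neg_add_cancel, hexp_zero]

theorem isUnit_hexp (z : B) : IsUnit (hexp z) :=
  ⟨⟨hexp z, hexp (-z), hexp_mul_hexp_neg z, hexp_neg_mul_hexp z⟩, rfl⟩

theorem map_hexp {B' : Type*} [Ring B'] [Algebra K B'] [IsAdicComplete hIdeal B']
    (g : B →ₐ[K] B') (z : B) : g (hexp z) = hexp (g z) :=
  map_psEval g z _

theorem hexp_mul_eq_mul_hexp {z w y : B} (h : z * y = y * w) : hexp z * y = y * hexp w :=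
  psEval_mul_eq_mul_psEval h _

theorem commute_hexp_left {z y : B} (h : Commute z y) : Commute (hexp z) y :=
  commute_psEval_left h _

theorem commute_hexp_hexp {z y : B} (h : Commute z y) : Commute (hexp z) (hexp y) :=
  (commute_hexp_left (commute_hexp_left h.symm).symm)

theorem mul_hexp_of_commutator {y z c : B} (h : y * z = z * y + c) (hc : Commute z c) :
    y * hexp z = hexp z * y + hbar • (c * hexp z) := by
  rw [hexp, mul_psEval_of_commutator h hc, PowerSeries.derivative_exp]

theorem psEval_rescale (z : B) (s : ℂ) (φ : PowerSeries ℂ) :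
    psEval z (PowerSeries.rescale s φ) = psEval (cst s • z) φ := by
  refine powerSeries_induction (f := fun φ => psEval z (PowerSeries.rescale s φ))
    (g := psEval (cst s • z)) (fun n a t ih => ?_) φ
  have h : PowerSeries.rescale s (PowerSeries.C a + PowerSeries.X * t) =
      PowerSeries.C a + PowerSeries.X * (s • PowerSeries.rescale s t) := by
    rw [map_add, map_mul, PowerSeries.rescale_X, PowerSeries.smul_eq_C_mul]
    congr 1
    · ext n
      rw [PowerSeries.coeff_rescale, PowerSeries.coeff_C]
      split_ifs with hn <;> simp [hn]
    · ring
  rw [h, psEval_C_add_X_mul, psEval_C_add_X_mul, psEval_smul, mul_smul_comm _ z, smul_mul_assoc]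
  exact (HMod.refl _ _).add ((ih.mul_left z).smul (cst s)).hbar_smul

theorem hMod_one_psEval (z : B) (φ : PowerSeries ℂ) :
    HMod 1 (psEval z φ) (algebraMap K B (cst (PowerSeries.constantCoeff φ))) := by
  obtain ⟨φ', hφ⟩ := powerSeries_eq_C_add_X_mul φ
  nth_rewrite 1 [hφ]
  rw [psEval_C_add_X_mul]
  exact ⟨z * psEval z φ', by rw [pow_one, add_sub_cancel_left]⟩

theorem hMod_one_hexp (z : B) : HMod 1 (hexp z) 1 := by
  have h := hMod_one_psEval z (PowerSeries.exp ℂ)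
  rwa [PowerSeries.constantCoeff_exp, cst, map_one, map_one] at h

theorem hMod_two_hexp (z : B) : HMod 2 (hexp z) (1 + hbar • z) := by
  have h := (hMod_psEval z (PowerSeries.exp ℂ) 2).symm
  rw [← hexp] at h
  simpa [Finset.sum_range_succ, cst] using h

/-- Commuting elements of a torsion-free algebra with the same exponential are equal. -/
theorem eq_of_hexp_eq (htf : ∀ x : B, hbar • x = 0 → x = 0) {z w : B} (hzw : Commute z w)
    (h : hexp z = hexp w) : z = w := by
  have h1 : hexp (z - w) = 1 := by
    rw [sub_eq_add_neg, hexp_add hzw.neg_right, h, hexp_mul_hexp_neg]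
  -- Write exp t = 1 + t g(t) with g(0) = 1. Then g(h(z - w)) is invertible, and exp(h(z - w)) = 1
  -- leaves h(z - w) = 0.
  obtain ⟨g, hg⟩ := powerSeries_eq_C_add_X_mul (PowerSeries.exp ℂ)
  have hu : IsUnit (PowerSeries.constantCoeff g) := by
    have := congrArg (PowerSeries.coeff 1) hg
    rw [map_add, PowerSeries.coeff_exp, ← zero_add 1, PowerSeries.coeff_succ_X_mul] at this
    rw [← PowerSeries.coeff_zero_eq_constantCoeff_apply]
    simp at this
    simp [← this]
  have hu' : IsUnit (psEval (z - w) g) := (PowerSeries.isUnit_iff_constantCoeff.mpr hu).map _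
  have h2 : hbar • ((z - w) * psEval (z - w) g) = 0 := by
    rw [hexp, hg, psEval_C_add_X_mul, PowerSeries.constantCoeff_exp, cst, map_one, map_one] at h1
    exact add_eq_left.mp h1
  have h3 := htf _ h2
  rwa [hu'.mul_left_eq_zero, sub_eq_zero] at h3

end Hexp

/-! ### The logarithm of `1 - 2 h z` -/

section Hlog

/-- The power series `- log (1 - 2 t) / (2 t)`. -/
noncomputable def logSeries : PowerSeries ℂ := PowerSeries.mk fun n => 2 ^ n / (n + 1)

/-- The series t · `logSeries` is -log(1 - 2t)/2, and its derivative is the geometric series of 2t.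
-/
theorem derivative_X_mul_logSeries :
    PowerSeries.derivative ℂ (PowerSeries.X * logSeries) * (1 - PowerSeries.C 2 * PowerSeries.X) =
      1 := by
  have h : PowerSeries.derivative ℂ (PowerSeries.X * logSeries) =
      PowerSeries.mk fun n => (2 : ℂ) ^ n := by
    ext n
    rw [PowerSeries.coeff_derivative, PowerSeries.coeff_succ_X_mul, logSeries,
      PowerSeries.coeff_mk, PowerSeries.coeff_mk]
    exact div_mul_cancel₀ _ (Nat.cast_add_one_ne_zero n)
  rw [h, mul_sub, mul_one, mul_comm (PowerSeries.C 2), ← mul_assoc]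
  ext n
  cases n with
  | zero => simp
  | succ n => simp [PowerSeries.coeff_one, pow_succ]

/-- The chain rule for φ(t w(t)). -/
theorem derivative_psEval (w φ : PowerSeries ℂ) :
    PowerSeries.derivative ℂ (psEval (B := K) w φ) =
      PowerSeries.derivative ℂ (PowerSeries.X * w) *
        psEval (B := K) w (PowerSeries.derivative ℂ φ) := by
  refine powerSeries_induction (N := K)
    (f := fun φ => PowerSeries.derivative ℂ (psEval (B := K) w φ))
    (g := fun φ => PowerSeries.derivative ℂ (PowerSeries.X * w) *
        psEval (B := K) w (PowerSeries.derivative ℂ φ)) (fun n a s ih => ?_) φ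
  have h : psEval (B := K) w (PowerSeries.C a + PowerSeries.X * s) =
      PowerSeries.C a + (PowerSeries.X * w) * psEval (B := K) w s := by
    rw [mul_assoc]
    exact psEval_C_add_X_mul (B := K) w a s
  have hX : psEval (B := K) w PowerSeries.X = PowerSeries.X * w := psEval_X (B := K) w
  have hC : ∀ y : PowerSeries ℂ, PowerSeries.derivative ℂ (PowerSeries.C a + y) =
      PowerSeries.derivative ℂ y := fun y => by
    rw [map_add, PowerSeries.derivative_C, zero_add]
  have e1 : PowerSeries.derivative ℂ (PowerSeries.X * w * psEval (B := K) w s) =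
      PowerSeries.X * (w * PowerSeries.derivative ℂ (psEval (B := K) w s)) +
        psEval (B := K) w s * PowerSeries.derivative ℂ (PowerSeries.X * w) := by
    rw [Derivation.leibniz, smul_eq_mul, smul_eq_mul, mul_assoc]
  have e2 : psEval (B := K) w (PowerSeries.derivative ℂ (PowerSeries.X * s)) =
      PowerSeries.X * w * psEval (B := K) w (PowerSeries.derivative ℂ s) +
        psEval (B := K) w s := by
    rw [Derivation.leibniz, PowerSeries.derivative_X, smul_eq_mul, smul_eq_mul, mul_one, map_add,
      map_mul, hX]
  have e3 : PowerSeries.derivative ℂ (PowerSeries.X * w) * (PowerSeries.X * w *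
      psEval (B := K) w (PowerSeries.derivative ℂ s) + psEval (B := K) w s) =
      PowerSeries.X * (w * (PowerSeries.derivative ℂ (PowerSeries.X * w) *
        psEval (B := K) w (PowerSeries.derivative ℂ s))) +
        psEval (B := K) w s * PowerSeries.derivative ℂ (PowerSeries.X * w) := by
    ring
  rw [h, hC, hC, e1, e2, e3]
  exact ((ih.mul_left w).hbar_smul).add (HMod.refl _ _)

/-- This is exp(log(1 - 2t)) = 1 - 2t. The left side θ solves θ'(1 - 2t) = -2θ with θ(0) = 1; the
recursion (n + 1) θₙ₊₁ = 2(n - 1) θₙ yields θ₁ = -2 and stops at n = 1. -/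
theorem psEval_logSeries_exp :
    psEval (B := K) logSeries (PowerSeries.rescale (-2) (PowerSeries.exp ℂ)) =
      1 - PowerSeries.C 2 * PowerSeries.X := by
  set θ := psEval (B := K) logSeries (PowerSeries.rescale (-2) (PowerSeries.exp ℂ)) with hθ
  have hd : PowerSeries.derivative ℂ (PowerSeries.rescale (-2) (PowerSeries.exp ℂ)) =
      PowerSeries.C (-2) * PowerSeries.rescale (-2) (PowerSeries.exp ℂ) := by
    ext n
    have h := congrArg (PowerSeries.coeff n) (PowerSeries.derivative_exp ℂ)
    rw [PowerSeries.coeff_derivative] at h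
    rw [PowerSeries.coeff_derivative, PowerSeries.coeff_rescale, PowerSeries.coeff_C_mul,
      PowerSeries.coeff_rescale, mul_assoc, h, pow_succ]
    ring
  have h1 : PowerSeries.derivative ℂ θ * (1 - PowerSeries.C 2 * PowerSeries.X) =
      PowerSeries.C (-2) * θ := by
    have hC : psEval (B := K) logSeries (PowerSeries.C (-2)) = PowerSeries.C (-2) :=
      psEval_C (B := K) _ _
    rw [hθ, derivative_psEval, hd, RingHom.map_mul, hC, mul_right_comm,
      derivative_X_mul_logSeries, one_mul]
  have h0 : PowerSeries.coeff 0 θ = 1 := by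
    obtain ⟨z, hz⟩ := hMod_one_psEval (B := K) logSeries
      (PowerSeries.rescale (-2) (PowerSeries.exp ℂ))
    have hz' : θ = PowerSeries.C (PowerSeries.constantCoeff
        (PowerSeries.rescale (-2) (PowerSeries.exp ℂ))) + PowerSeries.X * z := by
      rw [pow_one] at hz
      exact sub_eq_iff_eq_add'.mp hz
    rw [hz', ← PowerSeries.coeff_zero_eq_constantCoeff_apply, PowerSeries.coeff_rescale]
    simp
  have hrec : ∀ n : ℕ, PowerSeries.coeff (n + 1) θ * (n + 1) =
      2 * (n - 1) * PowerSeries.coeff n θ := fun n => by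
    have h2 := congrArg (PowerSeries.coeff n) h1
    rw [mul_sub, mul_one, mul_left_comm, map_sub, PowerSeries.coeff_C_mul, PowerSeries.coeff_C_mul,
      PowerSeries.coeff_derivative] at h2
    cases n with
    | zero => simp at h2 ⊢; exact h2
    | succ n =>
      rw [mul_comm _ PowerSeries.X, PowerSeries.coeff_succ_X_mul,
          PowerSeries.coeff_derivative] at h2
      push_cast at h2 ⊢
      linear_combination h2
  have h2 : PowerSeries.coeff 1 θ = -2 := by
    have := hrec 0
    rw [h0] at this
    simpa using this
  have h3 : ∀ n : ℕ, PowerSeries.coeff (n + 2) θ = 0 := fun n => by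
    induction n with
    | zero => simpa using hrec 1
    | succ n ih =>
      have := hrec (n + 2)
      rw [ih, mul_zero] at this
      exact (mul_eq_zero.mp this).resolve_right (Nat.cast_add_one_ne_zero _)
  ext n
  rw [map_sub, PowerSeries.coeff_C_mul]
  rcases n with _ | _ | n
  · simpa using h0
  · simpa [PowerSeries.coeff_one] using h2
  · simpa [PowerSeries.coeff_one, PowerSeries.coeff_X] using h3 n

variable {B : Type*} [Ring B] [Algebra K B] [IsAdicComplete hIdeal B]

/-- The element `- log (1 - 2 h z) / (2 h)`. -/
noncomputable def hlog (z : B) : B := z * psEval z logSeries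

theorem hexp_hlog (z : B) : hexp (cst (-2) • hlog z) = 1 - (cst 2 * hbar) • z := by
  rw [hexp, ← psEval_rescale, hlog, psEval_mul_psEval, psEval_logSeries_exp, map_sub, map_one,
    map_mul, psEval_C, psEval_X, ← Algebra.smul_def, smul_smul]

theorem hbar_smul_hlog (z : B) : hbar • hlog z = psEval z (PowerSeries.X * logSeries) := by
  rw [map_mul, psEval_X, hlog, smul_mul_assoc]

theorem map_hlog {B' : Type*} [Ring B'] [Algebra K B'] [IsAdicComplete hIdeal B']
    (g : B →ₐ[K] B') (z : B) : g (hlog z) = hlog (g z) := by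
  rw [hlog, map_mul, map_psEval, hlog]

theorem commute_hlog_left {z y : B} (h : Commute z y) : Commute (hlog z) y :=
  h.mul_left (commute_psEval_left h _)

theorem hMod_one_hlog (z : B) : HMod 1 (hlog z) z := by
  have h := (hMod_one_psEval z logSeries).mul_left z
  have h0 : PowerSeries.constantCoeff logSeries = 1 := by simp [logSeries]
  rwa [h0, cst, map_one, map_one, mul_one] at h

/-- If `[y, z] = c` commutes with `z` then `[y, log (1 - 2 h z)] (1 - 2 h z) = - 2 h c`. -/
theorem hbar_smul_commutator_hlog {y z c : B} (h : y * z = z * y + c) (hc : Commute z c) :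
    hbar • ((y * hlog z - hlog z * y) * (1 - (cst 2 * hbar) • z)) = hbar • c := by
  have h1 := mul_psEval_of_commutator h hc (PowerSeries.X * logSeries)
  have h2 : psEval z (1 - PowerSeries.C 2 * PowerSeries.X) = 1 - (cst 2 * hbar) • z := by
    rw [map_sub, map_one, map_mul, psEval_C, psEval_X, ← Algebra.smul_def, smul_smul]
  rw [← smul_mul_assoc, smul_sub, ← mul_smul_comm, ← smul_mul_assoc, hbar_smul_hlog, h1,
    add_sub_cancel_left, smul_mul_assoc, mul_assoc, ← h2, ← map_mul, derivative_X_mul_logSeries,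
    map_one, mul_one]

end Hlog

end Jordanian
namespace Jordanian

/-! ### Homomorphisms from presented algebras -/

theorem freeAlgebra_ringHom_ext {G : Type} {B : Type*} [Ring B] {f g : FreeAlgebra ℂ G →+* B}
    (hc : ∀ c : ℂ, f (algebraMap ℂ _ c) = g (algebraMap ℂ _ c))
    (h : ∀ i, f (FreeAlgebra.ι ℂ i) = g (FreeAlgebra.ι ℂ i)) : f = g := by
  ext x
  induction x using FreeAlgebra.induction with
  | grade0 c => exact hc c
  | grade1 i => exact h i
  | mul a b ha hb => rw [map_mul, map_mul, ha, hb]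
  | add a b ha hb => rw [map_add, map_add, ha, hb]

section Series

variable {A : Type*} [Ring A] [Algebra K (PowerSeries A)]

theorem hbar_pow_smul_series (hX : algebraMap K (PowerSeries A) hbar = PowerSeries.X) (n : ℕ)
    (s : PowerSeries A) : hbar ^ n • s = PowerSeries.X ^ n * s := by
  rw [Algebra.smul_def, map_pow, hX]

/-- A congruence modulo hᵐ fixes the coefficients below m, so the n-th coefficient is stationary
from index n + 1 on, and the limit is read off from these stationary values. -/
theorem exists_series_limit (hX : algebraMap K (PowerSeries A) hbar = PowerSeries.X)
    (u : ℕ → PowerSeries A) (hu : ∀ n, HMod n (u (n + 1)) (u n)) :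
    ∃ L, ∀ n, HMod n (u n) L := by
  have hc : ∀ n k, PowerSeries.coeff n (u (n + 1 + k)) = PowerSeries.coeff n (u (n + 1)) :=
    fun n k => by
      induction k with
      | zero => rfl
      | succ k ih =>
        obtain ⟨z, hz⟩ := hu (n + 1 + k)
        rw [hbar_pow_smul_series hX] at hz
        have h := congrArg (PowerSeries.coeff n) hz
        rw [PowerSeries.coeff_X_pow_mul', if_neg (by omega), map_sub, sub_eq_zero] at h
        exact h.trans ih
  refine ⟨PowerSeries.mk fun n => PowerSeries.coeff n (u (n + 1)), fun n => ?_⟩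
  refine ⟨PowerSeries.mk fun k => PowerSeries.coeff (n + k) (u n) -
    PowerSeries.coeff (n + k) (u (n + k + 1)), ?_⟩
  rw [hbar_pow_smul_series hX]
  ext k
  rw [PowerSeries.coeff_X_pow_mul', map_sub, PowerSeries.coeff_mk]
  split_ifs with h
  · rw [PowerSeries.coeff_mk, Nat.add_sub_cancel' h]
  · obtain ⟨d, hd⟩ := Nat.exists_eq_add_of_le (Nat.not_le.mp h)
    rw [hd, show k.succ + d = k + 1 + d from rfl, hc, sub_self]

theorem isAdicComplete_powerSeries (hX : algebraMap K (PowerSeries A) hbar = PowerSeries.X) :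
    IsAdicComplete hIdeal (PowerSeries A) where
  toIsHausdorff := isHausdorff_of_hMod fun x hx => by
    ext n
    obtain ⟨z, hz⟩ := hx (n + 1)
    rw [sub_zero, hbar_pow_smul_series hX] at hz
    rw [hz, PowerSeries.coeff_X_pow_mul', if_neg (by omega), map_zero]
  toIsPrecomplete := isPrecomplete_of_hMod (exists_series_limit hX)

theorem powerSeries_hbar_torsionFree (hX : algebraMap K (PowerSeries A) hbar = PowerSeries.X)
    {x : PowerSeries A} (hx : hbar • x = 0) : x = 0 := by
  rw [← pow_one hbar, hbar_pow_smul_series hX, pow_one] at hx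
  ext n
  rw [← PowerSeries.coeff_succ_X_mul, hx, map_zero, map_zero]

theorem algebraMap_hbar_freeSeries {G : Type} :
    algebraMap K (FreeSeries G) hbar = PowerSeries.X := PowerSeries.map_X _

end Series

section FreeLift

variable {G : Type} {B : Type*} [Ring B] [Algebra K B]

/-- The homomorphism from a free complex algebra to a `ℂ⟦h⟧`-algebra with given values on the
generators. -/
noncomputable def freeLift (b : G → B) : FreeAlgebra ℂ G →+* B :=
  letI := Algebra.compHom B (PowerSeries.C : ℂ →+* K)
  (FreeAlgebra.lift ℂ b).toRingHom

@[simp] theorem freeLift_ι (b : G → B) (g : G) : freeLift b (FreeAlgebra.ι ℂ g) = b g :=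
  letI := Algebra.compHom B (PowerSeries.C : ℂ →+* K)
  FreeAlgebra.lift_ι_apply b g

theorem freeLift_algebraMap (b : G → B) (c : ℂ) :
    freeLift b (algebraMap ℂ _ c) = algebraMap K B (cst c) :=
  letI := Algebra.compHom B (PowerSeries.C : ℂ →+* K)
  (FreeAlgebra.lift ℂ b).commutes c

theorem freeLift_smul (b : G → B) (c : ℂ) (x : FreeAlgebra ℂ G) :
    freeLift b (c • x) = cst c • freeLift b x := by
  rw [Algebra.smul_def, map_mul, freeLift_algebraMap, Algebra.smul_def]

variable [IsAdicComplete hIdeal B]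

/-- The homomorphism from the topologically free algebra to a complete algebra with given values on
the generators. -/
noncomputable def seriesLift (b : G → B) : FreeSeries G →ₐ[K] B where
  __ := serEval (freeLift b)
  commutes' := serEval_map_algebraMap (freeLift_algebraMap b)

theorem seriesLift_apply (b : G → B) (s : FreeSeries G) :
    seriesLift b s = serEval (freeLift b) s := rfl

@[simp] theorem seriesLift_gen (b : G → B) (g : G) : seriesLift b (gen g) = b g := by
  rw [seriesLift_apply, gen, serEval_C, freeLift_ι]

theorem seriesLift_rescale (b : G → B) (g : G) (s : FreeSeries G) (φ : PowerSeries ℂ)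
    (hs : ∀ n, PowerSeries.coeff n s = PowerSeries.coeff n φ • FreeAlgebra.ι ℂ g ^ n) :
    seriesLift b s = psEval (b g) φ := by
  refine (eq_serSum fun n => HMod.trans (HMod.of_eq ?_) (hMod_psEval (b g) φ n)).symm
  refine Finset.sum_congr rfl fun k _ => ?_
  rw [hs, freeLift_smul, map_pow, freeLift_ι, smul_smul, mul_comm]

@[simp] theorem seriesLift_expSeries (b : G → B) (g : G) (s : ℂ) :
    seriesLift b (expSeries g s) = hexp (cst s • b g) := by
  rw [hexp, ← psEval_rescale]
  refine seriesLift_rescale b g _ _ fun n => ?_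
  rw [expSeries, PowerSeries.coeff_mk, PowerSeries.coeff_rescale, PowerSeries.coeff_exp]
  simp [div_eq_mul_inv]

/-- In a torsion-free target this determines the image of `sinhSeries`, so the relation for E² needs
to be checked only after multiplication by 2h. -/
theorem hbar_smul_sinhSeries {G : Type} (g : G) :
    (cst 2 * hbar) • sinhSeries g = expSeries g 1 - expSeries g (-1) := by
  have h : ∀ x : FreeSeries G, (cst 2 * hbar) • x = PowerSeries.C (algebraMap ℂ _ 2) *
      (PowerSeries.X * x) := fun x => by
    rw [Algebra.smul_def, map_mul, algebraMap_hbar_freeSeries, mul_assoc]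
    congr 1
    exact PowerSeries.map_C _ _
  rw [h]
  ext n
  rw [PowerSeries.coeff_C_mul, map_sub, ← Algebra.smul_def, expSeries, expSeries,
    PowerSeries.coeff_mk, PowerSeries.coeff_mk]
  cases n with
  | zero => simp
  | succ n =>
    rw [PowerSeries.coeff_succ_X_mul, sinhSeries, PowerSeries.coeff_mk, ← sub_smul]
    rcases Nat.even_or_odd n with hn | hn
    · rw [if_pos hn, smul_smul, hn.add_one.neg_one_pow]
      congr 1
      ring
    · rw [if_neg (Nat.not_even_iff_odd.mpr hn), hn.add_one.neg_one_pow]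
      simp

theorem series_hdense :
    HDense (Subalgebra.toSubmodule (Algebra.adjoin K (Set.range (gen (G := G))))) := fun m => by
  obtain ⟨s, hs⟩ := powerSeries_eq_C_add_X_mul m
  refine ⟨PowerSeries.C (PowerSeries.constantCoeff m), ?_, s, ?_⟩
  · generalize PowerSeries.constantCoeff m = a
    rw [Subalgebra.mem_toSubmodule]
    induction a using FreeAlgebra.induction with
    | grade0 c =>
      have h : PowerSeries.C (algebraMap ℂ (FreeAlgebra ℂ G) c) =
          algebraMap K (FreeSeries G) (cst c) := (PowerSeries.map_C _ _).symm
      rw [h]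
      exact Subalgebra.algebraMap_mem _ _
    | grade1 i => exact Algebra.subset_adjoin ⟨i, rfl⟩
    | mul a b ha hb => rw [map_mul]; exact mul_mem ha hb
    | add a b ha hb => rw [map_add]; exact add_mem ha hb
  · rw [hbar_pow_smul_series algebraMap_hbar_freeSeries, pow_one]
    nth_rewrite 1 [hs]
    exact add_sub_cancel_left _ _

end FreeLift

namespace Presentation

variable (P : Presentation) {B : Type*} [Ring B] [Algebra K B]

/-- The generators of the presented algebra. -/
noncomputable def var (g : P.Gen) : P.Alg := P.proj (gen g)

theorem proj_surjective : Function.Surjective P.proj := Ideal.Quotient.mk_surjective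

theorem proj_eq_zero_iff {s : FreeSeries P.Gen} : P.proj s = 0 ↔ s ∈ P.closedIdeal := by
  rw [← TwoSidedIdeal.mem_asIdeal]
  exact Ideal.Quotient.eq_zero_iff_mem

theorem proj_rel {r : FreeSeries P.Gen} (hr : r ∈ P.rel) : P.proj r = 0 := by
  rw [proj_eq_zero_iff, closedIdeal, TwoSidedIdeal.mem_iInf]
  exact fun n => TwoSidedIdeal.subset_span (Or.inl hr)

/-- Separatedness is the closedness of the ideal, an intersection of the ideals generated by the
relators and hⁿ. For completeness the successive differences of a sequence are lifted and summed in
the free algebra. -/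
instance isAdicComplete_alg : IsAdicComplete hIdeal P.Alg where
  toIsHausdorff := isHausdorff_of_hMod fun x hx => by
    obtain ⟨s, rfl⟩ := P.proj_surjective x
    rw [proj_eq_zero_iff, closedIdeal, TwoSidedIdeal.mem_iInf]
    intro n
    obtain ⟨z, hz⟩ := hx n
    obtain ⟨t, rfl⟩ := P.proj_surjective z
    rw [sub_zero, ← map_smul, ← sub_eq_zero, ← map_sub, proj_eq_zero_iff, closedIdeal,
      TwoSidedIdeal.mem_iInf] at hz
    have h1 : hbar ^ n • t ∈ TwoSidedIdeal.span (P.rel ∪ {PowerSeries.X ^ n}) := by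
      rw [hbar_pow_smul_series algebraMap_hbar_freeSeries]
      exact TwoSidedIdeal.mul_mem_right _ _ _ (TwoSidedIdeal.subset_span (Or.inr rfl))
    simpa using TwoSidedIdeal.add_mem _ (hz n) h1
  toIsPrecomplete := isPrecomplete_of_hMod fun u hu => by
    choose z hz using hu
    choose t ht using fun n => P.proj_surjective (z n)
    obtain ⟨s0, hs0⟩ := P.proj_surjective (u 0)
    let v : ℕ → FreeSeries P.Gen := fun n => s0 + ∑ k ∈ Finset.range n, hbar ^ k • t k
    have hv : ∀ n, P.proj (v n) = u n := fun n => by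
      induction n with
      | zero => simpa [v] using hs0
      | succ n ih =>
        have h : v (n + 1) = v n + hbar ^ n • t n := by
          simp only [v, Finset.sum_range_succ, add_assoc]
        rw [h, map_add, ih, map_smul, ht, ← hz, add_sub_cancel]
    obtain ⟨L, hL⟩ := exists_series_limit algebraMap_hbar_freeSeries v fun n => ⟨t n, by
      simp only [v, Finset.sum_range_succ]; abel⟩
    exact ⟨P.proj L, fun n => hv n ▸ (hL n).map P.proj.toLinearMap⟩

theorem hdense_adjoin :
    HDense (Subalgebra.toSubmodule (Algebra.adjoin K (Set.range P.var))) := fun m => by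
  obtain ⟨s, rfl⟩ := P.proj_surjective m
  obtain ⟨t, ht, hst⟩ := series_hdense s
  refine ⟨P.proj t, ?_, hst.map P.proj.toLinearMap⟩
  have h : (Algebra.adjoin K (Set.range (gen (G := P.Gen)))).map P.proj =
      Algebra.adjoin K (Set.range P.var) := by
    rw [AlgHom.map_adjoin, ← Set.range_comp]
    rfl
  rw [← h]
  exact ⟨t, ht, rfl⟩

theorem algHom_ext [IsHausdorff hIdeal B] {f g : P.Alg →ₐ[K] B}
    (h : ∀ i, f (P.var i) = g (P.var i)) :
    f = g := by
  have h1 : Algebra.adjoin K (Set.range P.var) ≤ AlgHom.equalizer f g := by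
    rw [Algebra.adjoin_le_iff]
    rintro _ ⟨i, rfl⟩
    exact h i
  exact AlgHom.ext fun a => P.hdense_adjoin.linearMap_ext (f := f.toLinearMap)
    (g := g.toLinearMap) (fun s hs => h1 hs) a

section Lift

variable [IsAdicComplete hIdeal B]

/-- The ideal generated by the relators and hⁿ is mapped into hⁿB for every n, and B is separated.
-/
theorem map_closedIdeal {f : FreeSeries P.Gen →ₐ[K] B} (hf : ∀ r ∈ P.rel, f r = 0)
    {s : FreeSeries P.Gen} (hs : s ∈ P.closedIdeal) : f s = 0 := by
  refine HMod.eq fun n => ?_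
  rw [closedIdeal, TwoSidedIdeal.mem_iInf] at hs
  have h : TwoSidedIdeal.span (P.rel ∪ {PowerSeries.X ^ n}) ≤
      (hTwoSided B n).comap (f : FreeSeries P.Gen →+* B) := by
    rw [TwoSidedIdeal.span_le]
    rintro r (hr | hr)
    · rw [SetLike.mem_coe, TwoSidedIdeal.mem_comap, mem_hTwoSided]
      exact HMod.of_eq (hf r hr)
    · rw [SetLike.mem_coe, TwoSidedIdeal.mem_comap, mem_hTwoSided]
      refine ⟨1, ?_⟩
      rw [Set.mem_singleton_iff.mp hr, ← algebraMap_hbar_freeSeries, ← map_pow]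
      change f _ - 0 = _
      rw [AlgHom.commutes, sub_zero, Algebra.algebraMap_eq_smul_one]
  exact mem_hTwoSided.mp ((TwoSidedIdeal.mem_comap _).mp (h (hs n)))

/-- The homomorphism from the presented algebra to a complete algebra with given values on the
generators. -/
noncomputable def lift (b : P.Gen → B) (hb : ∀ r ∈ P.rel, seriesLift b r = 0) : P.Alg →ₐ[K] B :=
  Ideal.Quotient.liftₐ _ (seriesLift b) fun _ hs => P.map_closedIdeal hb hs

@[simp] theorem lift_var (b : P.Gen → B) (hb : ∀ r ∈ P.rel, seriesLift b r = 0) (g : P.Gen) :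
    P.lift b hb (P.var g) = b g :=
  seriesLift_gen b g

theorem proj_eq_seriesLift (s : FreeSeries P.Gen) : P.proj s = seriesLift P.var s := by
  have h : ∀ s ∈ Subalgebra.toSubmodule (Algebra.adjoin K (Set.range (gen (G := P.Gen)))),
      P.proj.toLinearMap s = (seriesLift P.var).toLinearMap s := fun s hs => by
    have h1 : Algebra.adjoin K (Set.range (gen (G := P.Gen))) ≤
        AlgHom.equalizer P.proj (seriesLift P.var) := by
      rw [Algebra.adjoin_le_iff]
      rintro _ ⟨i, rfl⟩
      exact (seriesLift_gen P.var i).symm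
    exact h1 hs
  exact series_hdense.linearMap_ext h s

theorem proj_expSeries (g : P.Gen) (s : ℂ) :
    P.proj (expSeries g s) = hexp (cst s • P.var g) := by
  rw [proj_eq_seriesLift, seriesLift_expSeries]

/-- A homomorphism from a presented algebra factors through an injective homomorphism if its values
on the generators do. -/
theorem exists_lift_of_injective {B' : Type*} [Ring B'] [Algebra K B'] [IsAdicComplete hIdeal B']
    {ι : B →ₐ[K] B'} (hι : Function.Injective ι) (φ : P.Alg →ₐ[K] B') (b : P.Gen → B)
    (hb : ∀ g, ι (b g) = φ (P.var g)) : ∃ ψ : P.Alg →ₐ[K] B, ι.comp ψ = φ ∧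
      ∀ g, ψ (P.var g) = b g := by
  have h : ∀ s, ι (seriesLift b s) = φ (P.proj s) := fun s => by
    refine series_hdense.linearMap_ext (f := (ι.comp (seriesLift b)).toLinearMap)
      (g := (φ.comp P.proj).toLinearMap) (fun s hs => ?_) s
    have h1 : Algebra.adjoin K (Set.range (gen (G := P.Gen))) ≤
        AlgHom.equalizer (ι.comp (seriesLift b)) (φ.comp P.proj) := by
      rw [Algebra.adjoin_le_iff]
      rintro _ ⟨i, rfl⟩
      exact (congrArg ι (seriesLift_gen b i)).trans (hb i)
    exact h1 hs
  have hb' : ∀ r ∈ P.rel, seriesLift b r = 0 := fun r hr => hι (by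
    rw [h, P.proj_rel hr, map_zero, map_zero])
  exact ⟨P.lift b hb', P.algHom_ext fun g => by
    rw [AlgHom.comp_apply, lift_var, hb], P.lift_var b hb'⟩

end Lift

theorem parity_var (g : P.Gen) :
    Superalgebra.parity (R := K) (P.var g) = if P.odd g then -P.var g else P.var g := by
  change P.proj (seriesParity P.odd (gen g)) = _
  split_ifs with h
  · rw [seriesParity_gen_odd _ h, map_neg, var]
  · rw [seriesParity_gen_even _ (by simpa using h), var]

end Presentation

end Jordanian
namespace Jordanian

/-! ### The commutation relations between `e`, `f`, `b` and `q = exp (h X / 2)` -/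

/-- Elements `e`, `f`, `b` of a complex algebra satisfying the relations of `osp(1|2)`, together
with a central element `h` and a fourth root `q` of `(1 - 2 h e²)⁻¹`, with inverse `p`. -/
structure OspLetters (A : Type*) [Ring A] [Algebra ℂ A] where
  (h q p e f b : A)
  qh : h * q = q * h
  ph : h * p = p * h
  eh : e * h = h * e
  fh : f * h = h * f
  bh : b * h = h * b
  qp : q * p = 1
  pq : p * q = 1
  eq : e * q = q * e
  ep : e * p = p * e
  fe : f * e = -(e * f) - b
  be : b * e = e * b + e
  fb : f * b = b * f + f
  -- The four rules from here on describe the derivations [b, ·] and [f, ·], which send e² to 2e²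
  -- and -e, applied to q = (1 - 2h e²)^(-1/4) and to its inverse; in the rules for b, h e² has been
  -- replaced by (1 - p⁴)/2.
  bq : b * q = q * b + (1 / 2 : ℂ) • (q * (q * (q * (q * q))) - q)
  bp : b * p = p * b - (1 / 2 : ℂ) • (q * (q * q) - p)
  fq : f * q = q * f - (1 / 2 : ℂ) • (q * (q * (q * (q * (q * (h * e))))))
  fp : f * p = p * f + (1 / 2 : ℂ) • (q * (q * (q * (h * e))))
  hee : h * (e * e) = (1 / 2 : ℂ) • (1 - p * (p * (p * p)))

/-- Words are kept right-associated, so every rule x y = r needs a second form that acts at the head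
of a longer word. -/
theorem mul_mul_of_mul_eq {A : Type*} [Ring A] {x y r : A} (h : x * y = r) (w : A) :
    x * (y * w) = r * w := by
  rw [← mul_assoc, h]

theorem mul_mul_mul_of_mul_eq {A : Type*} [Ring A] {x y z r : A} (h : x * (y * z) = r) (w : A) :
    x * (y * (z * w)) = r * w := by
  rw [← mul_assoc y, ← mul_assoc, h]

/-- The distributive laws and the collection of scalars, bundled into one simp argument which
accompanies the rewriting rules. -/
theorem smul_expand (A : Type*) [Ring A] [Algebra ℂ A] :
    (∀ x y z : A, x * (y + z) = x * y + x * z) ∧ (∀ x y z : A, (x + y) * z = x * z + y * z) ∧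
    (∀ x y z : A, x * (y - z) = x * y - x * z) ∧ (∀ x y z : A, (x - y) * z = x * z - y * z) ∧
    (∀ x y z : A, x * y * z = x * (y * z)) ∧ (∀ x y : A, x * -y = -(x * y)) ∧
    (∀ x y : A, -x * y = -(x * y)) ∧ (∀ x : A, x * 1 = x) ∧ (∀ x : A, 1 * x = x) ∧
    (∀ (c : ℂ) (x y : A), c • x * y = c • (x * y)) ∧
    (∀ (c : ℂ) (x y : A), x * c • y = c • (x * y)) ∧
    (∀ (c : ℂ) (x y : A), c • (x + y) = c • x + c • y) ∧
    (∀ (c : ℂ) (x y : A), c • (x - y) = c • x - c • y) ∧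
    (∀ (c : ℂ) (x : A), c • -x = -(c • x)) ∧ (∀ (c d : ℂ) (x : A), c • d • x = (c * d) • x) ∧
    (∀ x : A, x ^ 2 = x * x) ∧ (∀ x : A, x ^ 3 = x * (x * x)) :=
  ⟨mul_add, add_mul, mul_sub, sub_mul, mul_assoc, mul_neg, neg_mul, mul_one, one_mul,
    smul_mul_assoc, fun c x y => mul_smul_comm c x y, smul_add, smul_sub, smul_neg,
    fun c d x => smul_smul c d x, pow_two, fun x => by rw [pow_succ', pow_two]⟩

namespace OspLetters

variable {A : Type*} [Ring A] [Algebra ℂ A] (L : OspLetters A)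

/-- The rewriting rules which bring a word into the order `q`, `p`, `h`, `e`, `b`, `f`. -/
theorem rules :
    (L.h * L.q = L.q * L.h) ∧
    (∀ w, L.h * (L.q * w) = (L.q * L.h) * w) ∧
    (L.h * L.p = L.p * L.h) ∧
    (∀ w, L.h * (L.p * w) = (L.p * L.h) * w) ∧
    (L.e * L.h = L.h * L.e) ∧
    (∀ w, L.e * (L.h * w) = (L.h * L.e) * w) ∧
    (L.f * L.h = L.h * L.f) ∧
    (∀ w, L.f * (L.h * w) = (L.h * L.f) * w) ∧
    (L.b * L.h = L.h * L.b) ∧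
    (∀ w, L.b * (L.h * w) = (L.h * L.b) * w) ∧
    (L.q * L.p = 1) ∧
    (∀ w, L.q * (L.p * w) = (1) * w) ∧
    (L.p * L.q = 1) ∧
    (∀ w, L.p * (L.q * w) = (1) * w) ∧
    (L.e * L.q = L.q * L.e) ∧
    (∀ w, L.e * (L.q * w) = (L.q * L.e) * w) ∧
    (L.e * L.p = L.p * L.e) ∧
    (∀ w, L.e * (L.p * w) = (L.p * L.e) * w) ∧
    (L.f * L.e = -(L.e * L.f) - L.b) ∧
    (∀ w, L.f * (L.e * w) = (-(L.e * L.f) - L.b) * w) ∧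
    (L.b * L.e = L.e * L.b + L.e) ∧
    (∀ w, L.b * (L.e * w) = (L.e * L.b + L.e) * w) ∧
    (L.f * L.b = L.b * L.f + L.f) ∧
    (∀ w, L.f * (L.b * w) = (L.b * L.f + L.f) * w) ∧
    (L.b * L.q = L.q * L.b + (1 / 2 : ℂ) • (L.q * (L.q * (L.q * (L.q * L.q))) - L.q)) ∧
    (∀ w, L.b * (L.q * w) = (L.q * L.b + (1 / 2 : ℂ) • (L.q * (L.q * (L.q * (L.q * L.q))) - L.q)) *
      w) ∧
    (L.b * L.p = L.p * L.b - (1 / 2 : ℂ) • (L.q * (L.q * L.q) - L.p)) ∧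
    (∀ w, L.b * (L.p * w) = (L.p * L.b - (1 / 2 : ℂ) • (L.q * (L.q * L.q) - L.p)) * w) ∧
    (L.f * L.q = L.q * L.f - (1 / 2 : ℂ) • (L.q * (L.q * (L.q * (L.q * (L.q * (L.h * L.e))))))) ∧
    (∀ w, L.f * (L.q * w) = (L.q * L.f - (1 / 2 : ℂ) • (L.q * (L.q * (L.q * (L.q * (L.q * (L.h * L.e))))))) *
      w) ∧
    (L.f * L.p = L.p * L.f + (1 / 2 : ℂ) • (L.q * (L.q * (L.q * (L.h * L.e))))) ∧
    (∀ w, L.f * (L.p * w) = (L.p * L.f + (1 / 2 : ℂ) • (L.q * (L.q * (L.q * (L.h * L.e))))) * w) ∧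
    (L.h * (L.e * L.e) = (1 / 2 : ℂ) • (1 - L.p * (L.p * (L.p * L.p)))) ∧
    (∀ w, L.h * (L.e * (L.e * w)) = ((1 / 2 : ℂ) • (1 - L.p * (L.p * (L.p * L.p)))) * w) :=
  ⟨L.qh,
    mul_mul_of_mul_eq L.qh,
    L.ph,
    mul_mul_of_mul_eq L.ph,
    L.eh,
    mul_mul_of_mul_eq L.eh,
    L.fh,
    mul_mul_of_mul_eq L.fh,
    L.bh,
    mul_mul_of_mul_eq L.bh,
    L.qp,
    mul_mul_of_mul_eq L.qp,
    L.pq,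
    mul_mul_of_mul_eq L.pq,
    L.eq,
    mul_mul_of_mul_eq L.eq,
    L.ep,
    mul_mul_of_mul_eq L.ep,
    L.fe,
    mul_mul_of_mul_eq L.fe,
    L.be,
    mul_mul_of_mul_eq L.be,
    L.fb,
    mul_mul_of_mul_eq L.fb,
    L.bq,
    mul_mul_of_mul_eq L.bq,
    L.bp,
    mul_mul_of_mul_eq L.bp,
    L.fq,
    mul_mul_of_mul_eq L.fq,
    L.fp,
    mul_mul_of_mul_eq L.fp,
    L.hee,
    mul_mul_mul_of_mul_eq L.hee⟩

/-- The element `exp (h X)`. -/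
noncomputable def T : A := L.q * L.q

/-- The element `exp (- h X)`. -/
noncomputable def T' : A := L.p * L.p

/-- The generator `H`. -/
noncomputable def H : A := L.p * (L.p * L.b)

/-- The generator `E`. -/
noncomputable def E : A := L.q * L.e

/-- The generator `Y`. -/
noncomputable def Y : A := L.p * (L.p * (-(L.f * L.f) + (1 / 2 : ℂ) • (L.h * (L.b * L.b)) +
  (1 / 8 : ℂ) • (L.h * (L.q * (L.q * (L.q * L.q)) - 1))))

/-- The generator `F`. -/
noncomputable def F : A := L.p * L.f + (1 / 2 : ℂ) • (L.p * (L.h * (L.e * L.b))) -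
  (1 / 8 : ℂ) • (L.q * (L.q * (L.q * (L.h * L.e))) - L.p * (L.h * L.e))

/-- This relation and the thirteen after it are proved alike: the rules put all words into normal
form, and `module` compares their complex coefficients. -/
theorem rel_HE : L.H * L.E - L.E * L.H - (1 / 2 : ℂ) • ((L.T + L.T') * L.E) = 0 := by
  simp only [H, E, T, T', F, Y, L.rules, smul_expand A]
  module

theorem rel_HF : L.H * L.F - L.F * L.H + (1 / 4 : ℂ) • ((L.T + L.T') * L.F) +
      (1 / 4 : ℂ) • (L.F * (L.T + L.T')) +
      (1 / 8 : ℂ) • (L.h * (((L.T - L.T') * L.H + L.H * (L.T - L.T')) * L.E)) +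
      (1 / 8 : ℂ) • (L.h * (L.E * ((L.T - L.T') * L.H + L.H * (L.T - L.T')))) = 0 := by
  simp only [H, E, T, T', F, Y, L.rules, smul_expand A]
  module

theorem rel_EF : L.E * L.F + L.F * L.E + (1 / 4 : ℂ) • ((L.T + L.T') * L.H) +
      (1 / 4 : ℂ) • (L.H * (L.T + L.T')) = 0 := by
  simp only [H, E, T, T', F, Y, L.rules, smul_expand A]
  module

theorem rel_HT : L.H * L.T - L.T * L.H - (L.T ^ 2 - 1) = 0 := by
  simp only [H, E, T, T', F, Y, L.rules, smul_expand A]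
  module

theorem rel_HTinv : L.H * L.T' - L.T' * L.H - (L.T' ^ 2 - 1) = 0 := by
  simp only [H, E, T, T', F, Y, L.rules, smul_expand A]
  module

theorem rel_HY : L.H * L.Y - L.Y * L.H + (1 / 2 : ℂ) • ((L.T + L.T') * L.Y) +
      (1 / 2 : ℂ) • (L.Y * (L.T + L.T')) = 0 := by
  simp only [H, E, T, T', F, Y, L.rules, smul_expand A]
  module

theorem rel_TY : L.T * L.Y - L.Y * L.T - (1 / 2 : ℂ) • (L.h * (L.T * L.H + L.H * L.T)) = 0 := by
  simp only [H, E, T, T', F, Y, L.rules, smul_expand A]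
  module

theorem rel_TinvY : L.T' * L.Y - L.Y * L.T' +
      (1 / 2 : ℂ) • (L.h * (L.T' * L.H + L.H * L.T')) = 0 := by
  simp only [H, E, T, T', F, Y, L.rules, smul_expand A]
  module

/-- The relation is cleared of its denominator because sinh(hX)/h is not a word in the letters; the
factor 2h is cancelled later, in a torsion-free algebra. -/
theorem rel_EE : (2 : ℂ) • (L.h * L.E ^ 2) = L.T - L.T' := by
  simp only [H, E, T, T', F, Y, L.rules, smul_expand A]
  module

/-- This relation dictates the correction terms in `F`: they are what the commutator of Y and E
leaves in normal form. -/
theorem rel_YE : L.Y * L.E - L.E * L.Y - L.F = 0 := by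
  simp only [H, E, T, T', F, Y, L.rules, smul_expand A]
  module

theorem rel_TF : L.T * L.F - L.F * L.T - (1 / 2 : ℂ) • (L.h * ((L.T ^ 2 + 1) * L.E)) = 0 := by
  simp only [H, E, T, T', F, Y, L.rules, smul_expand A]
  module

theorem rel_TinvF : L.T' * L.F - L.F * L.T' +
      (1 / 2 : ℂ) • (L.h * ((L.T' ^ 2 + 1) * L.E)) = 0 := by
  simp only [H, E, T, T', F, Y, L.rules, smul_expand A]
  module

theorem rel_FF : L.F ^ 2 + L.Y - (1 / 8 : ℂ) • (L.h * ((L.T - L.T') * L.H ^ 2)) -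
      (1 / 4 : ℂ) • (L.h * ((L.T - L.T') * L.E * L.F)) -
      (3 / 16 : ℂ) • (L.h * ((L.T ^ 2 - L.T' ^ 2) * L.H)) -
      (1 / 4 : ℂ) • (L.h * (L.T - L.T')) - (9 / 128 : ℂ) • (L.h * (L.T - L.T') ^ 3) = 0 := by
  simp only [H, E, T, T', F, Y, L.rules, smul_expand A]
  module

theorem rel_FY : L.F * L.Y - L.Y * L.F -
      (1 / 4 : ℂ) • (L.h * ((L.T - L.T') * L.F)) -
      (1 / 2 : ℂ) • (L.h * ((L.T - L.T') * L.E * L.Y)) +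
      (1 / 4 : ℂ) • (L.h ^ 2 * (L.E * L.H ^ 2)) +
      (3 / 8 : ℂ) • (L.h ^ 2 * ((L.T + L.T') * L.E * L.H)) +
      (1 / 2 : ℂ) • (L.h ^ 2 * L.E) +
      (15 / 64 : ℂ) • (L.h ^ 2 * ((L.T - L.T') ^ 2 * L.E)) = 0 := by
  simp only [H, E, T, T', F, Y, L.rules, smul_expand A]
  module

end OspLetters

end Jordanian
namespace Jordanian

/-! ### Constructing the letters -/

/-- The complex algebra underlying a `ℂ⟦h⟧`-algebra. -/
noncomputable abbrev complexAlgebra (B : Type*) [Ring B] [Algebra K B] : Algebra ℂ B :=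
  Algebra.compHom B (PowerSeries.C : ℂ →+* K)

theorem complex_smul {B : Type*} [Ring B] [Algebra K B] (c : ℂ) (x : B) :
    letI := complexAlgebra B
    c • x = cst c • x := rfl

/-- The letters `q`, `p`, `e`, `f`, `b` in a `ℂ⟦h⟧`-algebra. -/
structure HLetters (B : Type*) [Ring B] [Algebra K B] where
  /-- The underlying letters, over the complex numbers. -/
  toLetters : @OspLetters B _ (complexAlgebra B)
  h_eq : letI := complexAlgebra B; toLetters.h = algebraMap K B hbar

namespace HLetters

variable {B : Type*} [Ring B] [Algebra K B] (L : HLetters B)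

/-- The element `exp (h X / 2)`. -/
def q : B := letI := complexAlgebra B; L.toLetters.q

/-- The element `exp (- h X / 2)`. -/
def p : B := letI := complexAlgebra B; L.toLetters.p

/-- The odd raising element. -/
def e : B := letI := complexAlgebra B; L.toLetters.e

/-- The odd lowering element. -/
def f : B := letI := complexAlgebra B; L.toLetters.f

/-- The Cartan element. -/
def b : B := letI := complexAlgebra B; L.toLetters.b

/-- The element `exp (h X)`. -/
noncomputable def T : B := letI := complexAlgebra B; L.toLetters.T

/-- The element `exp (- h X)`. -/
noncomputable def T' : B := letI := complexAlgebra B; L.toLetters.T'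

/-- The generator `H`. -/
noncomputable def H : B := letI := complexAlgebra B; L.toLetters.H

/-- The generator `E`. -/
noncomputable def E : B := letI := complexAlgebra B; L.toLetters.E

/-- The generator `Y`. -/
noncomputable def Y : B := letI := complexAlgebra B; L.toLetters.Y

/-- The generator `F`. -/
noncomputable def F : B := letI := complexAlgebra B; L.toLetters.F

theorem rel_HE : L.H * L.E - L.E * L.H - cst (1 / 2) • ((L.T + L.T') * L.E) = 0 := by
  letI := complexAlgebra B
  have h := L.toLetters.rel_HE
  -- The letter h turns into the scalar `hbar`, and complex scalars turn into constants of ℂ⟦h⟧.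
  simp only [L.h_eq, complex_smul, ← map_pow, ← Algebra.smul_def] at h
  exact h

theorem rel_HF : L.H * L.F - L.F * L.H + cst (1 / 4) • ((L.T + L.T') * L.F) +
      cst (1 / 4) • (L.F * (L.T + L.T')) +
      cst (1 / 8) • hbar • ((((L.T - L.T') * L.H + L.H * (L.T - L.T')) * L.E)) +
      cst (1 / 8) • hbar • ((L.E * ((L.T - L.T') * L.H + L.H * (L.T - L.T')))) = 0 := by
  letI := complexAlgebra B
  have h := L.toLetters.rel_HF
  simp only [L.h_eq, complex_smul, ← map_pow, ← Algebra.smul_def] at h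
  exact h

theorem rel_EF : L.E * L.F + L.F * L.E + cst (1 / 4) • ((L.T + L.T') * L.H) +
      cst (1 / 4) • (L.H * (L.T + L.T')) = 0 := by
  letI := complexAlgebra B
  have h := L.toLetters.rel_EF
  simp only [L.h_eq, complex_smul, ← map_pow, ← Algebra.smul_def] at h
  exact h

theorem rel_HT : L.H * L.T - L.T * L.H - (L.T ^ 2 - 1) = 0 := by
  letI := complexAlgebra B
  exact L.toLetters.rel_HT

theorem rel_HTinv : L.H * L.T' - L.T' * L.H - (L.T' ^ 2 - 1) = 0 := by
  letI := complexAlgebra B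
  exact L.toLetters.rel_HTinv

theorem rel_HY : L.H * L.Y - L.Y * L.H + cst (1 / 2) • ((L.T + L.T') * L.Y) +
      cst (1 / 2) • (L.Y * (L.T + L.T')) = 0 := by
  letI := complexAlgebra B
  have h := L.toLetters.rel_HY
  simp only [L.h_eq, complex_smul, ← map_pow, ← Algebra.smul_def] at h
  exact h

theorem rel_TY : L.T * L.Y - L.Y * L.T - cst (1 / 2) • hbar • ((L.T * L.H + L.H * L.T)) = 0 := by
  letI := complexAlgebra B
  have h := L.toLetters.rel_TY
  simp only [L.h_eq, complex_smul, ← map_pow, ← Algebra.smul_def] at h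
  exact h

theorem rel_TinvY : L.T' * L.Y - L.Y * L.T' +
      cst (1 / 2) • hbar • ((L.T' * L.H + L.H * L.T')) = 0 := by
  letI := complexAlgebra B
  have h := L.toLetters.rel_TinvY
  simp only [L.h_eq, complex_smul, ← map_pow, ← Algebra.smul_def] at h
  exact h

theorem rel_EE : cst 2 • hbar • (L.E ^ 2) = L.T - L.T' := by
  letI := complexAlgebra B
  have h := L.toLetters.rel_EE
  simp only [L.h_eq, complex_smul, ← map_pow, ← Algebra.smul_def] at h
  exact h

theorem rel_YE : L.Y * L.E - L.E * L.Y - L.F = 0 := by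
  letI := complexAlgebra B
  exact L.toLetters.rel_YE

theorem rel_TF : L.T * L.F - L.F * L.T - cst (1 / 2) • hbar • (((L.T ^ 2 + 1) * L.E)) = 0 := by
  letI := complexAlgebra B
  have h := L.toLetters.rel_TF
  simp only [L.h_eq, complex_smul, ← map_pow, ← Algebra.smul_def] at h
  exact h

theorem rel_TinvF : L.T' * L.F - L.F * L.T' +
      cst (1 / 2) • hbar • (((L.T' ^ 2 + 1) * L.E)) = 0 := by
  letI := complexAlgebra B
  have h := L.toLetters.rel_TinvF
  simp only [L.h_eq, complex_smul, ← map_pow, ← Algebra.smul_def] at h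
  exact h

theorem rel_FF : L.F ^ 2 + L.Y - cst (1 / 8) • hbar • (((L.T - L.T') * L.H ^ 2)) -
      cst (1 / 4) • hbar • (((L.T - L.T') * L.E * L.F)) -
      cst (3 / 16) • hbar • (((L.T ^ 2 - L.T' ^ 2) * L.H)) -
      cst (1 / 4) • hbar • ((L.T - L.T')) - cst (9 / 128) • hbar • ((L.T - L.T') ^ 3) = 0 := by
  letI := complexAlgebra B
  have h := L.toLetters.rel_FF
  simp only [L.h_eq, complex_smul, ← map_pow, ← Algebra.smul_def] at h
  exact h

theorem rel_FY : L.F * L.Y - L.Y * L.F -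
      cst (1 / 4) • hbar • (((L.T - L.T') * L.F)) -
      cst (1 / 2) • hbar • (((L.T - L.T') * L.E * L.Y)) +
      cst (1 / 4) • hbar ^ 2 • ((L.E * L.H ^ 2)) +
      cst (3 / 8) • hbar ^ 2 • (((L.T + L.T') * L.E * L.H)) +
      cst (1 / 2) • hbar ^ 2 • (L.E) +
      cst (15 / 64) • hbar ^ 2 • (((L.T - L.T') ^ 2 * L.E)) = 0 := by
  letI := complexAlgebra B
  have h := L.toLetters.rel_FY
  simp only [L.h_eq, complex_smul, ← map_pow, ← Algebra.smul_def] at h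
  exact h

end HLetters

/-! ### Letters from the classical relations in a torsion-free algebra -/

section Build

theorem cst_add (a b : ℂ) : cst (a + b) = cst a + cst b := map_add PowerSeries.C a b

theorem cst_mul (a b : ℂ) : cst (a * b) = cst a * cst b := map_mul PowerSeries.C a b

theorem cst_one : cst 1 = 1 := map_one PowerSeries.C

theorem cst_neg (a : ℂ) : cst (-a) = -cst a := map_neg PowerSeries.C a

theorem cst_two : cst 2 = 2 := map_ofNat PowerSeries.C 2

variable {B : Type*} [Ring B] [Algebra K B] [IsAdicComplete hIdeal B]

theorem hexp_cst_mul_hexp_cst (z : B) (s t : ℂ) :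
    hexp (cst s • z) * hexp (cst t • z) = hexp (cst (s + t) • z) := by
  rw [cst_add, add_smul, hexp_add]
  exact ((Commute.refl z).smul_left _).smul_right _

theorem mul_hexp_cst_of_commute {z y : B} (h : Commute y z) (s : ℂ) :
    y * hexp (cst s • z) = hexp (cst s • z) * y :=
  (commute_hexp_left (h.symm.smul_left (cst s))).symm

/-- Commutators with the logarithm of `1 - 2 h z`, in a torsion-free algebra. -/
theorem commutator_hlog (htf : ∀ x : B, hbar • x = 0 → x = 0) {y z c : B}
    (h : y * z = z * y + c) (hc : Commute z c) :
    y * hlog z = hlog z * y + c * hexp (cst 2 • hlog z) := by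
  -- Torsion-freeness cancels the factor h in `hbar_smul_commutator_hlog`. The factor 1 - 2hz is
  -- exp(-2h `hlog z`), so it can then be moved to the other side.
  have h1 : (y * hlog z - hlog z * y) * hexp (cst (-2) • hlog z) = c := by
    rw [hexp_hlog, ← sub_eq_zero]
    refine htf _ ?_
    rw [smul_sub, hbar_smul_commutator_hlog h hc, sub_self]
  rw [← sub_eq_iff_eq_add', ← h1, mul_assoc, hexp_cst_mul_hexp_cst]
  norm_num [cst]

/-- With X = `hlog z` and T = exp(hX) one has dX/dz = (1 - 2hz)⁻¹ = T², so the derivative of Tˢ with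
respect to z is s h Tˢ⁺². -/
theorem commutator_hexp_hlog (htf : ∀ x : B, hbar • x = 0 → x = 0) {y z c : B}
    (h : y * z = z * y + c) (hc : Commute z c) (s : ℂ) :
    y * hexp (cst s • hlog z) = hexp (cst s • hlog z) * y +
      cst s • (hexp (cst (s + 2) • hlog z) * (hbar • c)) := by
  have hc' : Commute (hlog z) c := commute_hlog_left hc
  have hX := commutator_hlog htf h hc
  have h1 : y * (cst s • hlog z) = (cst s • hlog z) * y +
      cst s • (c * hexp (cst 2 • hlog z)) := by
    rw [mul_smul_comm, hX, smul_add, smul_mul_assoc]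
  have h2 : Commute (cst s • hlog z) (cst s • (c * hexp (cst 2 • hlog z))) :=
    ((hc'.mul_right (commute_hexp_left ((Commute.refl (hlog z)).smul_left _)).symm).smul_left
      _).smul_right _
  rw [mul_hexp_of_commutator h1 h2, smul_mul_assoc, mul_assoc, hexp_cst_mul_hexp_cst,
    ← (commute_hexp_left (hc'.smul_left (cst (2 + s)))).eq, smul_comm, mul_smul_comm,
    add_comm (2 : ℂ) s]

/-- The letters attached to elements `e`, `f`, `b` satisfying the relations of `osp(1|2)`, in a
torsion-free algebra. -/
noncomputable def lettersOfTorsionFree (htf : ∀ x : B, hbar • x = 0 → x = 0) {e f b : B}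
    (hfe : f * e = -(e * f) - b) (hbe : b * e = e * b + e) (hfb : f * b = b * f + f) :
    HLetters B :=
  have hX : Commute e (hlog (e * e)) :=
    (commute_hlog_left ((Commute.refl e).mul_left (Commute.refl e))).symm
  -- The commutators of b and f with e² are 2e² and -e. Both commute with e², as the formulas for
  -- commutators with the logarithm require.
  have he2 : b * (e * e) = e * e * b + cst 2 • (e * e) := by
    rw [← mul_assoc, hbe, add_mul, mul_assoc, hbe, mul_add, cst_two, two_smul, ← mul_assoc,
      add_assoc]
  have hf2 : f * (e * e) = e * e * f + -e := by
    rw [← mul_assoc, hfe, sub_mul, hbe, neg_mul, mul_assoc, hfe]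
    noncomm_ring
  have hee : hbar • (e * e) = cst (1 / 2) • (1 - hexp (cst (-2) • hlog (e * e))) := by
    rw [hexp_hlog, sub_sub_cancel, smul_smul, ← mul_assoc, ← cst_mul]
    norm_num [cst_one]
  have hce : Commute (e * e) (-e) := ((Commute.refl e).mul_left (Commute.refl e)).neg_right
  have hcc : Commute (e * e) (cst 2 • (e * e)) := (Commute.refl (e * e)).smul_right _
  -- As 2h e² = 1 - T⁻², the product 2h e² Tˢ⁺² is Tˢ⁺² - Tˢ, which removes e² from the rules for b.
  have key : ∀ s : ℂ, hexp (cst (s + 2) • hlog (e * e)) * (hbar • cst 2 • (e * e)) =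
      hexp (cst (s + 2) • hlog (e * e)) - hexp (cst s • hlog (e * e)) := fun s => by
    rw [smul_comm hbar, hee, smul_smul, ← cst_mul, mul_smul_comm, mul_sub, hexp_cst_mul_hexp_cst]
    norm_num [cst_one]
  have keyf : ∀ s : ℂ, hexp (cst (s + 2) • hlog (e * e)) * (hbar • -e) =
      -(hexp (cst (s + 2) • hlog (e * e)) * (algebraMap K B hbar * e)) := fun s => by
    rw [smul_neg, mul_neg, Algebra.smul_def hbar e]
  have hn : ∀ y : B, cst (-(1 / 2)) • y = -(cst (1 / 2) • y) := fun y => by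
    rw [cst_neg, neg_smul]
  letI := complexAlgebra B
  { h_eq := rfl, toLetters := {
    h := algebraMap K B hbar
    q := hexp (cst (1 / 2) • hlog (e * e))
    p := hexp (cst (-(1 / 2)) • hlog (e * e))
    e := e
    f := f
    b := b
    qh := Algebra.commutes _ _
    ph := Algebra.commutes _ _
    eh := (Algebra.commutes _ _).symm
    fh := (Algebra.commutes _ _).symm
    bh := (Algebra.commutes _ _).symm
    qp := by rw [hexp_cst_mul_hexp_cst]; norm_num [cst]
    pq := by rw [hexp_cst_mul_hexp_cst]; norm_num [cst]
    eq := mul_hexp_cst_of_commute hX _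
    ep := mul_hexp_cst_of_commute hX _
    fe := hfe
    be := hbe
    fb := hfb
    bq := by
      simp only [complex_smul, hexp_cst_mul_hexp_cst]
      rw [commutator_hexp_hlog htf he2 hcc, key]
      norm_num
    bp := by
      simp only [complex_smul, hexp_cst_mul_hexp_cst]
      rw [commutator_hexp_hlog htf he2 hcc, key, hn (_ - _), ← sub_eq_add_neg]
      norm_num
    fq := by
      simp only [complex_smul, ← mul_assoc, hexp_cst_mul_hexp_cst]
      rw [commutator_hexp_hlog htf hf2 hce, keyf, smul_neg, ← sub_eq_add_neg, mul_assoc]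
      norm_num
    fp := by
      simp only [complex_smul, ← mul_assoc, hexp_cst_mul_hexp_cst]
      rw [commutator_hexp_hlog htf hf2 hce, keyf, smul_neg, hn (_ * _), neg_neg, mul_assoc]
      norm_num
    hee := by
      simp only [complex_smul, hexp_cst_mul_hexp_cst]
      rw [← Algebra.smul_def, hee]
      norm_num } }

end Build

end Jordanian
namespace Jordanian

/-! ### The power series model of `U_h(osp(1|2))` -/

/-- The power series in `h` with coefficients in `U(osp(1|2))`. -/
abbrev Model : Type := PowerSeries Classical.U

noncomputable instance : Algebra K Model :=
  RingHom.toAlgebra' (PowerSeries.map (algebraMap ℂ Classical.U)) (by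
    intro c x
    ext n
    rw [PowerSeries.coeff_mul, PowerSeries.coeff_mul, ← Finset.Nat.sum_antidiagonal_swap]
    refine Finset.sum_congr rfl fun p _ => ?_
    rw [Prod.fst_swap, Prod.snd_swap, PowerSeries.coeff_map]
    exact Algebra.commutes _ _)

namespace Model

open OspGen

theorem algebraMap_eq (c : K) :
    algebraMap K Model c = PowerSeries.map (algebraMap ℂ Classical.U) c := rfl

theorem algebraMap_hbar : algebraMap K Model hbar = PowerSeries.X := PowerSeries.map_X _

theorem algebraMap_cst (c : ℂ) :
    algebraMap K Model (cst c) = PowerSeries.C (algebraMap ℂ Classical.U c) :=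
  PowerSeries.map_C _ _

instance : IsAdicComplete hIdeal Model := isAdicComplete_powerSeries algebraMap_hbar

theorem torsionFree (x : Model) (hx : hbar • x = 0) : x = 0 :=
  powerSeries_hbar_torsionFree algebraMap_hbar hx

end Model

/-! ### Homomorphisms from the classical enveloping superalgebra -/

namespace Classical

open OspGen

theorem rel_eq_zero {r : FreeAlgebra ℂ OspGen} (hr : Rel r) :
    Ideal.Quotient.mk (TwoSidedIdeal.span {r | Rel r}).asIdeal r = 0 :=
  Ideal.Quotient.eq_zero_iff_mem.mpr
    (TwoSidedIdeal.mem_asIdeal.mpr (TwoSidedIdeal.subset_span hr))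

theorem fe : x F * x E = -(x E * x F) - x H := by
  have h := rel_eq_zero Rel.ef
  rw [map_add, map_add, map_mul, map_mul] at h
  rw [← sub_eq_zero, ← h]
  simp only [x]
  abel

theorem be : x H * x E = x E * x H + x E := by
  have h := rel_eq_zero Rel.he
  rw [map_sub, map_sub, map_mul, map_mul] at h
  rw [← sub_eq_zero, ← h]
  simp only [x]
  abel

theorem fb : x F * x H = x H * x F + x F := by
  have h := rel_eq_zero Rel.hf
  rw [map_add, map_sub, map_mul, map_mul] at h
  rw [← sub_eq_zero, ← neg_eq_zero, ← h]
  simp only [x]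
  abel

theorem x_X : x X = x E * x E := by
  have h := rel_eq_zero Rel.b_plus
  rw [map_sub, map_pow, sub_eq_zero, pow_two] at h
  exact h

theorem x_Y : x Y = -(x F * x F) := by
  have h := rel_eq_zero Rel.b_minus
  rw [map_add, map_pow, pow_two] at h
  exact eq_neg_of_add_eq_zero_left h

/-- The values of the generators of `U(osp(1|2))` determined by those of `e`, `f` and `h`. -/
def values {B : Type*} [Ring B] (e f b : B) : OspGen → B
  | H => b
  | E => e
  | F => f
  | X => e * e
  | Y => -(f * f)

/-- After the substitution b₊ = e², b₋ = -f², all ten classical relators reduce to zero by moving f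
to the right and e to the left with the three given relations. -/
theorem freeLift_values_eq_zero {B : Type*} [Ring B] [Algebra K B] {e f b : B}
    (hfe : f * e = -(e * f) - b) (hbe : b * e = e * b + e) (hfb : f * b = b * f + f)
    {r : FreeAlgebra ℂ OspGen} (hr : Rel r) : freeLift (values e f b) r = 0 := by
  have he : ∀ w : B, b * (e * w) = e * (b * w) + e * w := fun w => by
    rw [← mul_assoc, hbe, add_mul, mul_assoc]
  have hf : ∀ w : B, f * (b * w) = b * (f * w) + f * w := fun w => by
    rw [← mul_assoc, hfb, add_mul, mul_assoc]
  have hef : ∀ w : B, f * (e * w) = -(e * (f * w)) - b * w := fun w => by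
    rw [← mul_assoc, hfe, sub_mul, neg_mul, mul_assoc]
  rcases hr with _ | _ <;>
    simp only [g, map_sub, map_add, map_mul, freeLift_ι, values, pow_two,
      mul_assoc, hfe, hbe, hfb, he, hf, hef, mul_add, mul_sub, mul_neg, neg_mul, two_mul] <;>
    abel

/-- The homomorphism from `U(osp(1|2))` given by two elements `e`, `f` which satisfy the relations
of the odd generators. -/
theorem exists_hom {B : Type*} [Ring B] [Algebra K B] {e f b : B}
    (hfe : f * e = -(e * f) - b) (hbe : b * e = e * b + e) (hfb : f * b = b * f + f) :
    ∃ φ : U →+* B, (∀ c : ℂ, φ (algebraMap ℂ U c) = algebraMap K B (cst c)) ∧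
      φ (x E) = e ∧ φ (x F) = f ∧ φ (x H) = b := by
  let v := values e f b
  have hv : ∀ r, Rel r → freeLift v r = 0 := fun r hr => freeLift_values_eq_zero hfe hbe hfb hr
  have hle : ∀ a ∈ (TwoSidedIdeal.span {r | Rel r}).asIdeal, freeLift v a = 0 := fun a ha => by
    have h : TwoSidedIdeal.span {r | Rel r} ≤ TwoSidedIdeal.comap (freeLift v) ⊥ :=
      TwoSidedIdeal.span_le.mpr fun r hr => by
        rw [SetLike.mem_coe, TwoSidedIdeal.mem_comap, hv r hr]
        exact TwoSidedIdeal.zero_mem _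
    have h1 := (TwoSidedIdeal.mem_comap _).mp (h (TwoSidedIdeal.mem_asIdeal.mp ha))
    exact (TwoSidedIdeal.mem_bot _).mp h1
  refine ⟨Ideal.Quotient.lift _ (freeLift v) hle, fun c => ?_, ?_, ?_, ?_⟩
  · exact freeLift_algebraMap v c
  all_goals exact freeLift_ι v _

/-- `U(osp(1|2))` is generated by `e` and `f`. -/
theorem induction_on {p : U → Prop} (hc : ∀ c : ℂ, p (algebraMap ℂ U c)) (he : p (x E))
    (hf : p (x F)) (hadd : ∀ a b, p a → p b → p (a + b)) (hmul : ∀ a b, p a → p b → p (a * b))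
    (a : U) : p a := by
  have hneg : ∀ a, p a → p (-a) := fun a ha => by
    have h : -a = algebraMap ℂ U (-1) * a := by rw [map_neg, map_one, neg_one_mul]
    rw [h]
    exact hmul _ _ (hc _) ha
  obtain ⟨s, rfl⟩ := Ideal.Quotient.mk_surjective a
  induction s using FreeAlgebra.induction with
  | grade0 c => exact hc c
  | grade1 i =>
    cases i with
    | H =>
      have h : x H = -(x E * x F + x F * x E) := by rw [fe]; abel
      change p (x H)
      rw [h]
      exact hneg _ (hadd _ _ (hmul _ _ he hf) (hmul _ _ hf he))
    | E => exact he
    | F => exact hf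
    | X =>
      change p (x X)
      rw [x_X]
      exact hmul _ _ he he
    | Y =>
      change p (x Y)
      rw [x_Y]
      exact hneg _ (hmul _ _ hf hf)
  | mul a b ha hb => rw [map_mul]; exact hmul _ _ ha hb
  | add a b ha hb => rw [map_add]; exact hadd _ _ ha hb

end Classical

namespace Model

open OspGen

/-- The letters of the model. -/
noncomputable def letters : HLetters Model :=
  lettersOfTorsionFree torsionFree (e := PowerSeries.C (Classical.x E))
    (f := PowerSeries.C (Classical.x F)) (b := PowerSeries.C (Classical.x H))
    (by rw [← map_mul, Classical.fe, map_sub, map_neg, map_mul])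
    (by rw [← map_mul, Classical.be, map_add, map_mul])
    (by rw [← map_mul, Classical.fb, map_add, map_mul])

/-- The images in the model of the generators of `U_h(osp(1|2))`. -/
noncomputable def gens : OspGen → Model
  | H => letters.H
  | E => letters.E
  | F => letters.F
  | X => hlog (letters.e * letters.e)
  | Y => letters.Y

theorem hexp_gens_X : hexp (cst 1 • gens X) = letters.T := by
  change _ = hexp (cst (1 / 2) • gens X) * hexp (cst (1 / 2) • gens X)
  rw [hexp_cst_mul_hexp_cst, add_halves]

theorem hexp_neg_gens_X : hexp (cst (-1) • gens X) = letters.T' := by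
  change _ = hexp (cst (-(1 / 2)) • gens X) * hexp (cst (-(1 / 2)) • gens X)
  rw [hexp_cst_mul_hexp_cst]
  norm_num

/-- Multiplied by 2h, both sides become T - T⁻¹, and the model is torsion-free. -/
theorem seriesLift_sinhSeries : seriesLift gens (sinhSeries X) = letters.E ^ 2 := by
  have h := congrArg (seriesLift gens) (hbar_smul_sinhSeries X)
  rw [map_smul, map_sub, seriesLift_expSeries, seriesLift_expSeries, hexp_gens_X, hexp_neg_gens_X,
    ← letters.rel_EE, mul_smul, ← sub_eq_zero, ← smul_sub, ← smul_sub] at h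
  have h2 : IsUnit (cst 2) := (isUnit_iff_ne_zero.mpr two_ne_zero).map PowerSeries.C
  rw [h2.smul_eq_zero] at h
  exact sub_eq_zero.mp (torsionFree _ h)

theorem seriesLift_rel {r : FreeSeries OspGen} (hr : Osp.Rel r) : seriesLift gens r = 0 := by
  cases hr <;>
    simp only [map_sub, map_add, map_mul, map_smul, map_pow, map_one, seriesLift_gen,
      seriesLift_expSeries, hexp_gens_X, hexp_neg_gens_X, seriesLift_sinhSeries, mul_smul]
  case HE => exact letters.rel_HE
  case HF => exact letters.rel_HF
  case EF => exact letters.rel_EF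
  case HT => exact letters.rel_HT
  case HTinv => exact letters.rel_HTinv
  case HY => exact letters.rel_HY
  case TY => exact letters.rel_TY
  case TinvY => exact letters.rel_TinvY
  case EE => exact sub_self _
  case YE => exact letters.rel_YE
  case TF => exact letters.rel_TF
  case TinvF => exact letters.rel_TinvF
  case FF => exact letters.rel_FF
  case FY => exact letters.rel_FY

end Model

/-! ### The comparison map to the model -/

namespace Osp

open OspGen

/-- The homomorphism from `U_h(osp(1|2))` to its power series model. -/
noncomputable def toModel : U →ₐ[K] Model :=
  presentation.lift Model.gens fun _ hr => Model.seriesLift_rel hr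

/-- The projection of the topologically free algebra onto `U_h(osp(1|2))`. -/
noncomputable def proj : FreeSeries OspGen →ₐ[K] U := presentation.proj

theorem proj_surjective : Function.Surjective proj := presentation.proj_surjective

theorem proj_rel {r : FreeSeries OspGen} (hr : Rel r) : proj r = 0 := presentation.proj_rel hr

theorem proj_gen (i : OspGen) : proj (gen i) = x i := rfl

theorem T_eq (s : ℂ) : T s = hexp (cst s • x X) := presentation.proj_expSeries X s

theorem proj_expSeries (s : ℂ) : proj (expSeries X s) = T s := rfl

theorem toModel_x (i : OspGen) : toModel (x i) = Model.gens i := presentation.lift_var _ _ i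

end Osp

end Jordanian
namespace Jordanian

namespace Osp

open OspGen

/-! ### The reduction modulo `h` -/

/-- The reduction of `U_h(osp(1|2))` modulo `h`. -/
noncomputable def reduction : U →+* Classical.U := PowerSeries.constantCoeff.comp toModel.toRingHom

theorem constantCoeff_of_hMod {a b : Model} (h : HMod 1 a b) :
    PowerSeries.constantCoeff a = PowerSeries.constantCoeff b := by
  obtain ⟨z, hz⟩ := h
  rw [hbar_pow_smul_series Model.algebraMap_hbar, pow_one] at hz
  rw [← sub_eq_zero, ← map_sub, hz, map_mul, PowerSeries.constantCoeff_X, zero_mul]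

theorem constantCoeff_hexp (z : Model) : PowerSeries.constantCoeff (hexp z) = 1 := by
  rw [constantCoeff_of_hMod (hMod_one_hexp z), map_one]

theorem reduction_smul (c : K) (a : U) :
    reduction (c • a) = PowerSeries.constantCoeff c • reduction a := by
  change PowerSeries.constantCoeff (toModel (c • a)) = _ • PowerSeries.constantCoeff (toModel a)
  rw [map_smul, Algebra.smul_def, map_mul, Algebra.smul_def]
  congr 1

theorem reduction_x (i : OspGen) : reduction (x i) = Classical.x i := by
  change PowerSeries.constantCoeff (toModel (x i)) = _
  have hh : ∀ a : Model, PowerSeries.constantCoeff (algebraMap K Model hbar * a) = 0 := fun a => by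
    rw [Model.algebraMap_hbar, map_mul, PowerSeries.constantCoeff_X, zero_mul]
  have hc : ∀ (c : ℂ) (a : Model), PowerSeries.constantCoeff (cst c • a) =
      algebraMap ℂ _ c * PowerSeries.constantCoeff a := fun c a => by
    rw [Algebra.smul_def, map_mul, Model.algebraMap_cst, PowerSeries.constantCoeff_C]
  have hq : PowerSeries.constantCoeff Model.letters.q = 1 := constantCoeff_hexp _
  have hp : PowerSeries.constantCoeff Model.letters.p = 1 := constantCoeff_hexp _
  have he : PowerSeries.constantCoeff Model.letters.e = Classical.x E :=
    PowerSeries.constantCoeff_C _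
  have hf : PowerSeries.constantCoeff Model.letters.f = Classical.x F :=
    PowerSeries.constantCoeff_C _
  have hb : PowerSeries.constantCoeff Model.letters.b = Classical.x H :=
    PowerSeries.constantCoeff_C _
  rw [toModel_x]
  cases i with
  | H =>
    change PowerSeries.constantCoeff (Model.letters.p * (Model.letters.p * Model.letters.b)) = _
    rw [map_mul, map_mul, hp, hb, one_mul, one_mul]
  | E =>
    change PowerSeries.constantCoeff (Model.letters.q * Model.letters.e) = _
    rw [map_mul, hq, he, one_mul]
  | F =>
    change PowerSeries.constantCoeff (Model.letters.p * Model.letters.f +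
      cst (1 / 2) • (Model.letters.p * (algebraMap K Model hbar * _)) -
      cst (1 / 8) • (Model.letters.q * (Model.letters.q * (Model.letters.q *
        (algebraMap K Model hbar * _))) - Model.letters.p * (algebraMap K Model hbar * _))) = _
    simp only [map_add, map_sub, hc, map_mul, hh, hp, hf]
    simp
  | X =>
    change PowerSeries.constantCoeff (hlog (Model.letters.e * Model.letters.e)) = _
    rw [constantCoeff_of_hMod (hMod_one_hlog _), map_mul, he, Classical.x_X]
  | Y =>
    change PowerSeries.constantCoeff (Model.letters.p * (Model.letters.p *
      (-(Model.letters.f * Model.letters.f) + cst (1 / 2) • (algebraMap K Model hbar * _) +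
        cst (1 / 8) • (algebraMap K Model hbar * _)))) = _
    simp only [map_add, hc, map_mul, hh, hp, hf, map_neg]
    simp [Classical.x_Y]

theorem reduction_hbar_smul (a : U) : reduction (hbar • a) = 0 := by
  rw [reduction_smul, hbar, PowerSeries.constantCoeff_X, zero_smul]

theorem reduction_proj_C (a : FreeAlgebra ℂ OspGen) :
    reduction (proj (PowerSeries.C a)) = Ideal.Quotient.mk _ a := by
  have h : (reduction.comp (proj : FreeSeries OspGen →+* U)).comp PowerSeries.C =
      Ideal.Quotient.mk (TwoSidedIdeal.span {r | Classical.Rel r}).asIdeal := by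
    refine freeAlgebra_ringHom_ext (fun c => ?_) reduction_x
    change reduction (proj (PowerSeries.C (algebraMap ℂ _ c))) = _
    have h1 : PowerSeries.C (algebraMap ℂ (FreeAlgebra ℂ OspGen) c) =
        algebraMap K (FreeSeries OspGen) (cst c) := (PowerSeries.map_C _ _).symm
    rw [h1, AlgHom.commutes, Algebra.algebraMap_eq_smul_one, reduction_smul, map_one, cst,
      PowerSeries.constantCoeff_C, ← Algebra.algebraMap_eq_smul_one]
    rfl
  exact RingHom.congr_fun h a

theorem proj_eq_C_add (s : FreeSeries OspGen) : ∃ z, proj s =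
    proj (PowerSeries.C (PowerSeries.constantCoeff s)) + hbar • z := by
  obtain ⟨t, ht⟩ := powerSeries_eq_C_add_X_mul s
  refine ⟨proj t, ?_⟩
  nth_rewrite 1 [ht]
  have h := hbar_pow_smul_series algebraMap_hbar_freeSeries 1 t
  rw [pow_one, pow_one] at h
  rw [map_add, ← h, map_smul]

theorem cst_half_smul_add {M : Type*} [AddCommGroup M] [Module K M] (a : M) :
    cst (1 / 2) • (a + a) = a := by
  rw [← two_smul K a, smul_smul, ← cst_two, ← cst_mul]
  norm_num [cst_one]

theorem cst_quarter_smul_add {M : Type*} [AddCommGroup M] [Module K M] (a : M) :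
    cst (1 / 4) • (a + a) + cst (1 / 4) • (a + a) = a := by
  rw [← smul_add, ← two_smul K a, ← two_smul K (_ • a), smul_smul, smul_smul, ← cst_two, ← cst_mul,
    ← cst_mul]
  norm_num [cst_one]

/-- Modulo `h`, the relations of `U_h(osp(1|2))` are those of `U(osp(1|2))`. -/
theorem classical_of_hbar_smul_eq_zero {Q : Type*} [Ring Q] [Algebra K Q] (π : U →ₐ[K] Q)
    (hT : ∀ s, π (T s) = 1) (hh : ∀ a : Q, hbar • a = 0) :
    π (x F) * π (x E) = -(π (x E) * π (x F)) - π (x H) ∧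
    π (x H) * π (x E) = π (x E) * π (x H) + π (x E) ∧
    π (x F) * π (x H) = π (x H) * π (x F) + π (x F) ∧
    ((π : U →+* _).comp (proj : FreeSeries OspGen →+* U)).comp PowerSeries.C =
      freeLift (Classical.values (π (x E)) (π (x F)) (π (x H))) := by
  have hS : π (proj (sinhSeries X)) = π (x X) := by
    obtain ⟨z, hz⟩ := proj_eq_C_add (sinhSeries X)
    have h0 : PowerSeries.constantCoeff (sinhSeries X) = FreeAlgebra.ι ℂ X := by
      rw [← PowerSeries.coeff_zero_eq_constantCoeff_apply, sinhSeries, PowerSeries.coeff_mk]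
      simp
    rw [hz, h0, map_add, map_smul, hh, add_zero]
    rfl
  have hrel : ∀ {r : FreeSeries OspGen}, Rel r → π (proj r) = 0 := fun {r} hr => by
    rw [proj_rel hr, map_zero]
  have hg : ∀ i, π (proj (PowerSeries.C (FreeAlgebra.ι ℂ i))) = π (x i) := fun i => rfl
  -- With Tˢ = 1 and h = 0 the five relators `EE`, `HE`, `EF`, `HF` and `FF` suffice: they give the
  -- three relations between e, f, h and express b₊ and b₋ as squares.
  have hE2 : π (x X) = π (x E) * π (x E) := by
    have h := hrel Rel.EE
    simp only [map_sub, map_pow, hS, proj_gen] at h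
    rw [← sub_eq_zero.mp h, pow_two]
  have hHE : π (x H) * π (x E) = π (x E) * π (x H) + π (x E) := by
    have h := hrel Rel.HE
    simp only [map_sub, map_mul, map_add, map_smul, proj_gen, proj_expSeries, hT, add_mul,
      one_mul, cst_half_smul_add] at h
    rw [← sub_eq_zero, ← h]
    abel
  have hEF : π (x H) = -(π (x E) * π (x F) + π (x F) * π (x E)) := by
    have h := hrel Rel.EF
    simp only [map_mul, map_add, map_smul, proj_gen, proj_expSeries, hT, add_mul,
      one_mul, mul_add, mul_one, add_assoc, cst_quarter_smul_add] at h
    rw [← sub_eq_zero, ← h]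
    abel
  have hHF : π (x H) * π (x F) = π (x F) * π (x H) - π (x F) := by
    have h := hrel Rel.HF
    simp only [map_sub, map_mul, map_add, map_smul, proj_gen, proj_expSeries, hT, add_mul,
      one_mul, mul_add, mul_one, sub_self, zero_mul, mul_zero, smul_zero, add_zero, add_assoc,
      cst_quarter_smul_add] at h
    rw [← sub_eq_zero, ← h]
    abel
  have hFF : π (x Y) = -(π (x F) * π (x F)) := by
    have h := hrel Rel.FF
    simp only [map_sub, map_mul, map_add, map_smul, map_pow, proj_gen, proj_expSeries, hT, one_pow,
      sub_self, zero_mul, smul_zero, sub_zero, pow_succ, pow_zero, mul_zero, one_mul] at h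
    exact eq_neg_of_add_eq_zero_right h
  have hFE : π (x F) * π (x E) = -(π (x E) * π (x F)) - π (x H) := by
    rw [hEF]; abel
  have hFH : π (x F) * π (x H) = π (x H) * π (x F) + π (x F) := by
    rw [hHF, sub_add_cancel]
  refine ⟨hFE, hHE, hFH, ?_⟩
  · refine freeAlgebra_ringHom_ext (fun c => ?_) fun i => ?_
    · rw [freeLift_algebraMap]
      have h1 : PowerSeries.C (algebraMap ℂ (FreeAlgebra ℂ OspGen) c) =
          algebraMap K (FreeSeries OspGen) (cst c) := (PowerSeries.map_C _ _).symm
      change π (proj (PowerSeries.C (algebraMap ℂ _ c))) = _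
      rw [h1, AlgHom.commutes, AlgHom.commutes]
    · rw [freeLift_ι]
      cases i with
      | H => rfl
      | E => rfl
      | F => rfl
      | X => exact hE2
      | Y => exact hFF

/-- The relations of `U(osp(1|2))` hold in `U_h(osp(1|2))` modulo `h`. -/
theorem hMod_classical_rel {r : FreeAlgebra ℂ OspGen} (hr : Classical.Rel r) :
    HMod 1 (proj (PowerSeries.C r)) 0 := by
  rw [← mem_hTwoSided, ← TwoSidedIdeal.mem_asIdeal, ← Ideal.Quotient.eq_zero_iff_mem]
  let π : U →ₐ[K] U ⧸ (hTwoSided U 1).asIdeal := Ideal.Quotient.mkₐ K _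
  change π _ = 0
  have hπ : ∀ {a b : U}, HMod 1 a b → π a = π b := fun {a b} h => by
    rw [← sub_eq_zero, ← map_sub]
    refine Ideal.Quotient.eq_zero_iff_mem.mpr (TwoSidedIdeal.mem_asIdeal.mpr
      (mem_hTwoSided.mpr ?_))
    simpa using h.sub (HMod.refl 1 b)
  have hT : ∀ s, π (T s) = 1 := fun s => by
    rw [T_eq, hπ (hMod_one_hexp _), map_one]
  have hh : ∀ a : U ⧸ (hTwoSided U 1).asIdeal, hbar • a = 0 := fun a => by
    obtain ⟨b, rfl⟩ := Ideal.Quotient.mk_surjective a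
    change hbar • π b = 0
    rw [← map_smul, ← map_zero π]
    exact hπ ⟨b, by rw [pow_one, sub_zero]⟩
  obtain ⟨hFE, hHE, hFH, h⟩ := classical_of_hbar_smul_eq_zero π hT hh
  exact (RingHom.congr_fun h r).trans (Classical.freeLift_values_eq_zero hFE hHE hFH hr)

/-- If the reduction of an element vanishes, the constant term of a lift lies in the classical
ideal; the classical relators hold in U_h modulo h, so this constant term is divisible by h in U_h.
-/
theorem reduction_eq_zero_iff {a : U} : reduction a = 0 ↔ ∃ b, a = hbar • b := by
  constructor
  · intro ha
    obtain ⟨s, rfl⟩ := proj_surjective a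
    obtain ⟨z, hz⟩ := proj_eq_C_add s
    rw [hz, map_add, reduction_hbar_smul, add_zero, reduction_proj_C,
      Ideal.Quotient.eq_zero_iff_mem, TwoSidedIdeal.mem_asIdeal] at ha
    have hle : TwoSidedIdeal.span {r | Classical.Rel r} ≤ (hTwoSided U 1).comap
        ((proj : FreeSeries OspGen →+* U).comp PowerSeries.C) :=
      TwoSidedIdeal.span_le.mpr fun r hr => by
        rw [SetLike.mem_coe, TwoSidedIdeal.mem_comap, mem_hTwoSided]
        exact hMod_classical_rel hr
    obtain ⟨y, hy⟩ := mem_hTwoSided.mp ((TwoSidedIdeal.mem_comap _).mp (hle ha))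
    refine ⟨y + z, ?_⟩
    rw [pow_one, sub_zero] at hy
    rw [hz, smul_add, ← hy]
    rfl
  · rintro ⟨b, rfl⟩
    exact reduction_hbar_smul b

theorem reduction_surjective : Function.Surjective reduction := fun y => by
  obtain ⟨s, rfl⟩ := Ideal.Quotient.mk_surjective y
  exact ⟨_, reduction_proj_C s⟩

/-- An element of the kernel has zero reduction, so it is h b, and b is again in the kernel because
the model is torsion-free. Hence the kernel lies in every hⁿU_h, and U_h is separated. -/
theorem toModel_injective : Function.Injective toModel := by
  rw [injective_iff_map_eq_zero]
  have h : ∀ n, ∀ a : U, toModel a = 0 → HMod n a 0 := fun n => by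
    induction n with
    | zero => exact fun a _ => HMod.zero a 0
    | succ n ih =>
      intro a ha
      have h0 : reduction a = 0 := by
        change PowerSeries.constantCoeff (toModel a) = 0
        rw [ha, map_zero]
      obtain ⟨b, rfl⟩ := reduction_eq_zero_iff.mp h0
      rw [map_smul] at ha
      simpa using (ih b (Model.torsionFree _ ha)).hbar_smul
  exact fun a ha => HMod.eq fun n => h n a ha

theorem torsionFree (a : U) (ha : hbar • a = 0) : a = 0 :=
  toModel_injective (by
    rw [map_zero]
    exact Model.torsionFree _ (by rw [← map_smul, ha, map_zero]))

end Osp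

end Jordanian
namespace Jordanian

/-! ### The letters in terms of the Jordanian generators -/

namespace HLetters

variable {B : Type*} [Ring B] [Algebra K B] (L : HLetters B)

theorem p_mul_E : L.p * L.E = L.e := by
  letI := complexAlgebra B
  exact (mul_assoc _ _ _).symm.trans ((congrArg (· * L.toLetters.e) L.toLetters.pq).trans
    (one_mul _))

theorem T_mul_H : L.T * L.H = L.b := by
  letI := complexAlgebra B
  change L.toLetters.q * L.toLetters.q * (L.toLetters.p * (L.toLetters.p * L.toLetters.b)) =
    L.toLetters.b
  simp only [mul_assoc, mul_mul_of_mul_eq L.toLetters.qp, one_mul]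

/-- Solves the definition of F for f; the right-hand side will serve as the definition of f inside
U_h. -/
theorem f_eq : L.f = L.q * L.F - (cst (1 / 2) * hbar) • (L.e * L.b) +
    (cst (1 / 8) * hbar) • ((L.T * L.T - 1) * L.e) := by
  letI := complexAlgebra B
  simp only [mul_smul, Algebra.smul_def hbar, ← L.h_eq]
  change L.toLetters.f = L.toLetters.q * L.toLetters.F -
    (1 / 2 : ℂ) • (L.toLetters.h * (L.toLetters.e * L.toLetters.b)) +
    (1 / 8 : ℂ) • (L.toLetters.h *
      ((L.toLetters.q * L.toLetters.q * (L.toLetters.q * L.toLetters.q) - 1) * L.toLetters.e))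
  simp only [OspLetters.F, L.toLetters.rules, smul_expand B]
  module

theorem T_mul_Y : L.T * L.Y = -(L.f * L.f) + (cst (1 / 2) * hbar) • (L.b * L.b) +
    (cst (1 / 8) * hbar) • (L.T * L.T - 1) := by
  letI := complexAlgebra B
  simp only [mul_smul, Algebra.smul_def hbar, ← L.h_eq]
  change L.toLetters.q * L.toLetters.q * L.toLetters.Y = -(L.toLetters.f * L.toLetters.f) +
    (1 / 2 : ℂ) • (L.toLetters.h * (L.toLetters.b * L.toLetters.b)) +
    (1 / 8 : ℂ) • (L.toLetters.h *
      ((L.toLetters.q * L.toLetters.q * (L.toLetters.q * L.toLetters.q) - 1)))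
  rw [OspLetters.Y, mul_assoc, mul_mul_of_mul_eq L.toLetters.qp, one_mul,
    mul_mul_of_mul_eq L.toLetters.qp, one_mul]
  simp only [mul_assoc]

end HLetters

namespace Osp

open OspGen

/-! ### The letters of `U_h(osp(1|2))` -/

theorem T_add (s t : ℂ) : T (s + t) = T s * T t := by
  rw [T_eq, T_eq, T_eq, hexp_cst_mul_hexp_cst]

theorem toModel_T (s : ℂ) : toModel (T s) = hexp (cst s • Model.gens X) := by
  rw [T_eq, map_hexp, map_smul, toModel_x]

/-- The element of `U_h(osp(1|2))` which corresponds to `e` under the isomorphism with the model. -/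
noncomputable def e : U := T (-1 / 2) * x E

/-- The element of `U_h(osp(1|2))` which corresponds to `h` under the isomorphism with the model. -/
noncomputable def b : U := T 1 * x H

/-- The element of `U_h(osp(1|2))` which corresponds to `f` under the isomorphism with the model. -/
noncomputable def f : U := T (1 / 2) * x F - (cst (1 / 2) * hbar) • (e * b) +
    (cst (1 / 8) * hbar) • ((T 1 * T 1 - 1) * e)

theorem toModel_e : toModel e = PowerSeries.C (Classical.x E) := by
  have h : toModel (T (-1 / 2)) = Model.letters.p := by
    rw [toModel_T, neg_div]
    rfl
  rw [e, map_mul, h, toModel_x]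
  exact Model.letters.p_mul_E

theorem toModel_b : toModel b = PowerSeries.C (Classical.x H) := by
  rw [b, map_mul, toModel_T, Model.hexp_gens_X, toModel_x]
  exact Model.letters.T_mul_H

theorem toModel_f : toModel f = PowerSeries.C (Classical.x F) := by
  have h : toModel (T (1 / 2)) = Model.letters.q := toModel_T _
  rw [f, map_add, map_sub, map_mul, map_smul, map_smul, map_mul, map_mul, map_sub, map_mul, h,
    map_one, toModel_T, Model.hexp_gens_X, toModel_x, toModel_e, toModel_b]
  exact Model.letters.f_eq.symm

/-- The classical relations hold for e, f, b in U_h because their images in the model are constants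
satisfying them and `toModel` is injective. -/
theorem fe : f * e = -(e * f) - b := toModel_injective (by
  simp only [map_sub, map_neg, map_mul, toModel_e, toModel_f, toModel_b]
  rw [← map_mul, Classical.fe, map_sub, map_neg, map_mul])

theorem be : b * e = e * b + e := toModel_injective (by
  simp only [map_add, map_mul, toModel_e, toModel_b]
  rw [← map_mul, Classical.be, map_add, map_mul])

theorem fb : f * b = b * f + f := toModel_injective (by
  simp only [map_add, map_mul, toModel_f, toModel_b]
  rw [← map_mul, Classical.fb, map_add, map_mul])

theorem x_X : x X = hlog (e * e) := toModel_injective (by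
  rw [map_hlog, map_mul, toModel_e, toModel_x]
  rfl)

/-- Since e, f, b satisfy the classical relations exactly, and not only modulo h, the reduction U_h
→ U(osp(1|2)) has a multiplicative section. -/
theorem exists_section : ∃ σ : Classical.U →+* U,
    (∀ c : ℂ, σ (algebraMap ℂ _ c) = algebraMap K U (cst c)) ∧
      σ (Classical.x E) = e ∧ σ (Classical.x F) = f ∧ σ (Classical.x H) = b :=
  Classical.exists_hom fe be fb

theorem toModel_section {σ : Classical.U →+* U}
    (hc : ∀ c : ℂ, σ (algebraMap ℂ _ c) = algebraMap K U (cst c)) (he : σ (Classical.x E) = e)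
    (hf : σ (Classical.x F) = f) (a : Classical.U) : toModel (σ a) = PowerSeries.C a := by
  induction a using Classical.induction_on with
  | hc c => rw [hc, AlgHom.commutes, Model.algebraMap_cst]
  | he => rw [he, toModel_e]
  | hf => rw [hf, toModel_f]
  | hadd a b ha hb => rw [map_add, map_add, ha, hb, map_add]
  | hmul a b ha hb => rw [map_mul, map_mul, ha, hb, map_mul]

theorem hdense_adjoin : HDense (Subalgebra.toSubmodule (Algebra.adjoin K {e, f})) := fun a => by
  obtain ⟨σ, hc, he, hf, -⟩ := exists_section
  have hS : ∀ y, σ y ∈ Algebra.adjoin K {e, f} := fun y => by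
    induction y using Classical.induction_on with
    | hc c => rw [hc]; exact Subalgebra.algebraMap_mem _ _
    | he => rw [he]; exact Algebra.subset_adjoin (Or.inl rfl)
    | hf => rw [hf]; exact Algebra.subset_adjoin (Or.inr rfl)
    | hadd a b ha hb => rw [map_add]; exact add_mem ha hb
    | hmul a b ha hb => rw [map_mul]; exact mul_mem ha hb
  refine ⟨σ (reduction a), hS _, ?_⟩
  have h : reduction (a - σ (reduction a)) = 0 := by
    rw [map_sub, sub_eq_zero]
    change _ = PowerSeries.constantCoeff (toModel (σ (reduction a)))
    rw [toModel_section hc he hf, PowerSeries.constantCoeff_C]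
  obtain ⟨z, hz⟩ := reduction_eq_zero_iff.mp h
  exact ⟨z, by rw [hz, pow_one]⟩

/-- Two homomorphisms are equal if they agree on `e` and `f`. -/
theorem algHom_ext {B : Type*} [Ring B] [Algebra K B] [IsHausdorff hIdeal B] {φ ψ : U →ₐ[K] B}
    (he : φ e = ψ e) (hf : φ f = ψ f) : φ = ψ := by
  have h1 : Algebra.adjoin K {e, f} ≤ AlgHom.equalizer φ ψ := by
    rw [Algebra.adjoin_le_iff]
    rintro _ (rfl | rfl)
    · exact he
    · exact hf
  exact AlgHom.ext fun a => hdense_adjoin.linearMap_ext (f := φ.toLinearMap)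
    (g := ψ.toLinearMap) (fun s hs => h1 hs) a

/-- The universal property of `U_h(osp(1|2))`. -/
theorem exists_algHom {B : Type*} [Ring B] [Algebra K B] [IsAdicComplete hIdeal B] {e' f' b' : B}
    (hfe : f' * e' = -(e' * f') - b') (hbe : b' * e' = e' * b' + e')
    (hfb : f' * b' = b' * f' + f') :
    ∃ φ : U →ₐ[K] B, φ e = e' ∧ φ f = f' ∧ φ b = b' := by
  obtain ⟨σ, hc, he, hf, hb⟩ := Classical.exists_hom hfe hbe hfb
  -- The homomorphism σ from U(osp(1|2)) extends to power series in h, since the target is complete,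
  -- and it is then composed with `toModel`.
  refine ⟨AlgHom.mk' ((serEval σ).comp (toModel : U →+* Model)) ?_, ?_, ?_, ?_⟩
  · intro c a
    change serEval σ (toModel (c • a)) = c • serEval σ (toModel a)
    rw [map_smul, Algebra.smul_def, Algebra.smul_def, map_mul, Model.algebraMap_eq,
      serEval_map_algebraMap hc]
  · change serEval σ (toModel e) = _
    rw [toModel_e, serEval_C, he]
  · change serEval σ (toModel f) = _
    rw [toModel_f, serEval_C, hf]
  · change serEval σ (toModel b) = _
    rw [toModel_b, serEval_C, hb]

/-! ### Relations between the letters and the generators -/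

theorem T_mul_T_neg (s : ℂ) : T s * T (-s) = 1 := by
  rw [← T_add, add_neg_cancel, T_eq]
  simp [cst]

theorem T_neg_mul_T (s : ℂ) : T (-s) * T s = 1 := by
  rw [← T_add, neg_add_cancel, T_eq]
  simp [cst]

theorem x_E : x E = T (1 / 2) * e := by
  rw [e, ← mul_assoc, neg_div, T_mul_T_neg, one_mul]

theorem x_H : x H = T (-1) * b := by
  rw [b, ← mul_assoc, T_neg_mul_T, one_mul]

theorem x_F : x F = x Y * x E - x E * x Y := by
  have h := proj_rel Rel.YE
  rw [map_sub, map_sub, map_mul, map_mul, sub_eq_zero] at h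
  exact h.symm

theorem T_mul_Y : T 1 * x Y = -(f * f) + (cst (1 / 2) * hbar) • (b * b) +
    (cst (1 / 8) * hbar) • (T 2 - 1) := toModel_injective (by
  have h : T 2 = T 1 * T 1 := by rw [← T_add, one_add_one_eq_two]
  simp only [h, map_add, map_sub, map_neg, map_mul, map_smul, map_one, toModel_f,
    toModel_b, toModel_x, toModel_T, Model.hexp_gens_X]
  exact Model.letters.T_mul_Y)

theorem hbar_smul_e_mul_e : (cst 2 * hbar) • (e * e) = 1 - T (-2) := by
  rw [T_eq, x_X, hexp_hlog, sub_sub_cancel]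

theorem commute_e_X : Commute e (x X) := by
  rw [x_X]
  exact (commute_hlog_left ((Commute.refl e).mul_left (Commute.refl e))).symm

theorem commute_T_X (s : ℂ) : Commute (T s) (x X) := by
  rw [T_eq]
  exact commute_hexp_left ((Commute.refl _).smul_left _)

theorem commute_e_T (s : ℂ) : Commute e (T s) := by
  rw [T_eq]
  exact (commute_hexp_left (commute_e_X.symm.smul_left _)).symm

/-- As X is the logarithm `hlog (e * e)`, the derivations [b, ·] and [f, ·] act on it by their
values 2e² and -e at e², times the derivative (1 - 2h e²)⁻¹ = T². -/
theorem b_mul_X : b * x X = x X * b + cst 2 • (e * e * T 2) := by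
  have he2 : b * (e * e) = e * e * b + cst 2 • (e * e) := by
    rw [← mul_assoc, be, add_mul, mul_assoc, be, mul_add, cst_two, two_smul, ← mul_assoc,
      add_assoc]
  have hc : Commute (e * e) (cst 2 • (e * e)) := (Commute.refl (e * e)).smul_right _
  rw [x_X, commutator_hlog torsionFree he2 hc, smul_mul_assoc, T_eq, x_X]

theorem f_mul_X : f * x X = x X * f - T 2 * e := by
  have hf2 : f * (e * e) = e * e * f + -e := by
    rw [← mul_assoc, fe, sub_mul, be, neg_mul, mul_assoc, fe]
    noncomm_ring
  have hc : Commute (e * e) (-e) := ((Commute.refl e).mul_left (Commute.refl e)).neg_right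
  rw [x_X, commutator_hlog torsionFree hf2 hc, ← x_X, ← T_eq, neg_mul, (commute_e_T 2).eq,
    sub_eq_add_neg]

theorem f_mul_T (s : ℂ) : f * T s = T s * f - (cst s * hbar) • (T (s + 2) * e) := by
  have hf2 : f * (e * e) = e * e * f + -e := by
    rw [← mul_assoc, fe, sub_mul, be, neg_mul, mul_assoc, fe]
    noncomm_ring
  have hc : Commute (e * e) (-e) := ((Commute.refl e).mul_left (Commute.refl e)).neg_right
  rw [T_eq, x_X, commutator_hexp_hlog torsionFree hf2 hc, ← x_X, ← T_eq, ← T_eq, smul_neg, mul_neg,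
    smul_neg, mul_smul_comm, mul_smul, sub_eq_add_neg]

theorem b_mul_T (s : ℂ) : b * T s = T s * b + cst s • (T (s + 2) - T s) := by
  have he2 : b * (e * e) = e * e * b + cst 2 • (e * e) := by
    rw [← mul_assoc, be, add_mul, mul_assoc, be, mul_add, cst_two, two_smul, ← mul_assoc,
      add_assoc]
  have hc : Commute (e * e) (cst 2 • (e * e)) := (Commute.refl (e * e)).smul_right _
  have h : hbar • cst 2 • (e * e) = 1 - T (-2) := by
    rw [smul_smul, mul_comm, hbar_smul_e_mul_e]
  have h2 : T (s + 2) * T (-2) = T s := by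
    rw [← T_add]
    congr 1
    ring
  rw [T_eq, x_X, commutator_hexp_hlog torsionFree he2 hc, ← x_X, ← T_eq, ← T_eq, h, mul_sub, h2,
    mul_one]

end Osp

end Jordanian
namespace Jordanian

open Superalgebra

/-! ### Homomorphisms from tensor products of superalgebras -/

section SuperTensor

variable {A B C D : Type*} [Ring A] [Algebra K A] [Superalgebra K A] [Ring B] [Algebra K B]
  [Superalgebra K B] [Ring C] [Algebra K C] [Ring D] [Algebra K D]

/-- The images of `f` and `g` commute in the sense of superalgebras. -/
def SuperCommute (f : A →ₐ[K] C) (g : B →ₐ[K] C) : Prop :=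
  ∀ a b, (parity (R := K) b = b → g b * f a = f a * g b) ∧
    (parity (R := K) b = -b → g b * f a = f (parity (R := K) a) * g b)

theorem SuperCommute.comp {f : A →ₐ[K] C} {g : B →ₐ[K] C} (h : SuperCommute f g) (φ : C →ₐ[K] D) :
    SuperCommute (φ.comp f) (φ.comp g) := fun a b =>
  ⟨fun hb => by
    simp only [AlgHom.comp_apply]
    rw [← map_mul, (h a b).1 hb, map_mul], fun hb => by
    simp only [AlgHom.comp_apply]
    rw [← map_mul, (h a b).2 hb, map_mul]⟩

/-- The homomorphism `a ⊗ b ↦ f(a) g(b)`. -/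
noncomputable def superLift (f : A →ₐ[K] C) (g : B →ₐ[K] C) (h : SuperCommute f g) :
    STensor K A B →ₐ[K] C :=
  GradedTensorProduct.lift (evenOdd K A) (evenOdd K B) f g (by
    intro i j a b
    fin_cases j
    · have hb := (h a b).1 (parity_of_mem_zero b.2)
      change _ = (-1 : ℤˣ) ^ ((0 : ZMod 2) * i) • _
      rw [hb, zero_mul, uzpow_zero, one_smul]
    · have hb := (h a b).2 (parity_of_mem_one b.2)
      change _ = (-1 : ℤˣ) ^ ((1 : ZMod 2) * i) • _
      rw [hb, one_mul]
      fin_cases i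
      · change _ = (-1 : ℤˣ) ^ (0 : ZMod 2) • _
        rw [parity_of_mem_zero a.2, uzpow_zero, one_smul]
      · change _ = (-1 : ℤˣ) ^ (1 : ZMod 2) • _
        rw [parity_of_mem_one a.2, uzpow_one, map_neg, neg_mul, Units.neg_smul, one_smul, neg_neg])

@[simp] theorem superLift_stmul (f : A →ₐ[K] C) (g : B →ₐ[K] C) (h : SuperCommute f g) (a : A)
    (b : B) : superLift f g h (stmul a b) = f a * g b := rfl

/-- The embedding `a ↦ a ⊗ 1`. -/
noncomputable def inl : A →ₐ[K] STensor K A B := GradedTensorProduct.includeLeft _ _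

/-- The embedding `b ↦ 1 ⊗ b`. -/
noncomputable def inr : B →ₐ[K] STensor K A B := GradedTensorProduct.includeRight _ _

theorem inl_mul_inr (a : A) (b : B) : (inl a : STensor K A B) * inr b = stmul a b :=
  GradedTensorProduct.tmul_one_mul_one_tmul _ _ a b

theorem parity_inl (a : A) :
    parity (R := K) (inl a : STensor K A B) = inl (parity (R := K) a) := by
  change tensorParity K A B (stmul a 1) = stmul _ 1
  rw [tensorParity_stmul, map_one]

theorem parity_inr (b : B) :
    parity (R := K) (inr b : STensor K A B) = inr (parity (R := K) b) := by
  change tensorParity K A B (stmul 1 b) = stmul 1 _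
  rw [tensorParity_stmul, map_one]

theorem superLift_inl (f : A →ₐ[K] C) (g : B →ₐ[K] C) (h : SuperCommute f g) (a : A) :
    superLift f g h (inl a) = f a :=
  (superLift_stmul f g h a 1).trans (by rw [map_one, mul_one])

theorem superLift_inr (f : A →ₐ[K] C) (g : B →ₐ[K] C) (h : SuperCommute f g) (b : B) :
    superLift f g h (inr b) = g b :=
  (superLift_stmul f g h 1 b).trans (by rw [map_one, one_mul])

theorem linearMap_ext_stmul {M : Type*} [AddCommGroup M] [Module K M]
    {f g : STensor K A B →ₗ[K] M} (h : ∀ a b, f (stmul a b) = g (stmul a b))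
    (x : STensor K A B) : f x = g x :=
  LinearMap.congr_fun (GradedTensorProduct.hom_ext _ _ (TensorProduct.ext' h)) x

theorem exists_even_add_odd (a : A) : ∃ a₀ a₁, a = a₀ + a₁ ∧ parity (R := K) a₀ = a₀ ∧
    parity (R := K) a₁ = -a₁ := by
  refine ⟨evenPart K A a, oddPart K A a, ?_, parity_of_mem_zero (Subtype.property _),
    parity_of_mem_one (Subtype.property _)⟩
  rw [coe_evenPart, coe_oddPart, ← smul_add, add_add_sub_cancel, ← two_smul K, smul_smul,
    invOf_mul_self, one_smul]

theorem mem_evenOdd_zero {a : A} (ha : parity (R := K) a = a) : a ∈ evenOdd K A 0 := by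
  rw [mem_evenOdd, ha, ZMod.val_zero, pow_zero, one_smul]

theorem mem_evenOdd_one {a : A} (ha : parity (R := K) a = -a) : a ∈ evenOdd K A 1 := by
  rw [mem_evenOdd, ha, ZMod.val_one, pow_one, neg_one_smul]

/-- The definition assumes homogeneity of the second argument only, so the argument that is not
assumed homogeneous is split into its even and odd parts. -/
theorem SuperCommute.symm {f : A →ₐ[K] C} {g : B →ₐ[K] C}
    (h : SuperCommute f g) : SuperCommute g f := fun b a => by
  obtain ⟨b₀, b₁, rfl, h₀, h₁⟩ := exists_even_add_odd b
  constructor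
  · intro ha
    rw [map_add, mul_add, add_mul, (h a b₀).1 h₀, (h a b₁).2 h₁, ha]
  · intro ha
    rw [map_add, map_add, map_add, mul_add, add_mul, h₀, h₁, (h a b₀).1 h₀, map_neg, neg_mul,
      (h a b₁).2 h₁, ha, map_neg, neg_mul, neg_neg]

theorem SuperCommute.comp_left {A' : Type*} [Ring A'] [Algebra K A'] [Superalgebra K A']
    {f : A →ₐ[K] C} {g : B →ₐ[K] C} (h : SuperCommute f g) {φ : A' →ₐ[K] A}
    (hφ : ∀ a, parity (R := K) (φ a) = φ (parity (R := K) a)) : SuperCommute (f.comp φ) g :=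
  fun a b => ⟨fun hb => (h (φ a) b).1 hb, fun hb => by
    rw [AlgHom.comp_apply, (h (φ a) b).2 hb, hφ]
    rfl⟩

theorem SuperCommute.superLift_left {k : B →ₐ[K] C} {A' : Type*} [Ring A'] [Algebra K A']
    [Superalgebra K A'] {f : A →ₐ[K] C} {g : A' →ₐ[K] C} (h : SuperCommute f g)
    (hf : SuperCommute f k) (hg : SuperCommute g k) : SuperCommute (superLift f g h) k :=
  fun x b => by
  constructor
  · intro hb
    refine linearMap_ext_stmul (f := LinearMap.mulLeft K (k b) ∘ₗ (superLift f g h).toLinearMap)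
      (g := LinearMap.mulRight K (k b) ∘ₗ (superLift f g h).toLinearMap) (fun a a' => ?_) x
    change k b * (f a * g a') = f a * g a' * k b
    rw [← mul_assoc, (hf a b).1 hb, mul_assoc, (hg a' b).1 hb, mul_assoc]
  · intro hb
    refine linearMap_ext_stmul (f := LinearMap.mulLeft K (k b) ∘ₗ (superLift f g h).toLinearMap)
      (g := LinearMap.mulRight K (k b) ∘ₗ (superLift f g h).toLinearMap ∘ₗ
        (tensorParity K A A').toLinearMap) (fun a a' => ?_) x
    change k b * (f a * g a') = superLift f g h (tensorParity K A A' (stmul a a')) * k b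
    rw [tensorParity_stmul, superLift_stmul, ← mul_assoc, (hf a b).2 hb, mul_assoc,
      (hg a' b).2 hb, mul_assoc]

theorem superCommute_inl_inr : SuperCommute (inl : A →ₐ[K] STensor K A B) inr := fun a b => by
  have key : ∀ (a : A) (j : ZMod 2) (i : ZMod 2), a ∈ evenOdd K A i → b ∈ evenOdd K B j →
      (inr b : STensor K A B) * inl a = (-1 : ℤˣ) ^ (j * i) • (inl a * inr b) := by
    intro a j i ha hb
    have h := GradedTensorProduct.tmul_coe_mul_coe_tmul (R := K) (𝒜 := evenOdd K A)
      (ℬ := evenOdd K B) 1 ⟨b, hb⟩ ⟨a, ha⟩ 1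
    rw [one_mul, mul_one] at h
    rw [inl_mul_inr]
    exact h
  obtain ⟨a₀, a₁, rfl, h₀, h₁⟩ := exists_even_add_odd a
  constructor
  · intro hb
    rw [map_add, mul_add, add_mul, key a₀ 0 0 (mem_evenOdd_zero h₀) (mem_evenOdd_zero hb),
      key a₁ 0 1 (mem_evenOdd_one h₁) (mem_evenOdd_zero hb), zero_mul, zero_mul, uzpow_zero,
      one_smul, one_smul]
  · intro hb
    rw [map_add, map_add, map_add, mul_add, add_mul, h₀, h₁,
      key a₀ 1 0 (mem_evenOdd_zero h₀) (mem_evenOdd_one hb),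
      key a₁ 1 1 (mem_evenOdd_one h₁) (mem_evenOdd_one hb), mul_zero, mul_one, uzpow_zero, one_smul,
      uzpow_one, map_neg, neg_mul, Units.neg_smul, one_smul]

end SuperTensor

/-! ### Homomorphisms between completions -/

section ComplHom

variable {A B C : Type*} [Ring A] [Algebra K A] [Ring B] [Algebra K B] [Ring C] [Algebra K C]

/-- The canonical homomorphism from an algebra to its completion. -/
noncomputable def toCompl (A : Type*) [Ring A] [Algebra K A] : A →ₐ[K] Compl hIdeal A :=
  AlgHom.ofLinearMap (Compl.of hIdeal A) rfl Compl.of_mul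

theorem toCompl_apply (a : A) : toCompl A a = Compl.of hIdeal A a := rfl

/-- The extension to the completion of a homomorphism with values in a completion. -/
noncomputable def complExtend (f : A →ₐ[K] Compl hIdeal B) :
    Compl hIdeal A →ₐ[K] Compl hIdeal B :=
  AlgHom.ofLinearMap (Compl.extend f.toLinearMap)
    ((Compl.extend_of f.toLinearMap 1).trans (map_one f)) (fun x y => HMod.eq fun n => by
      obtain ⟨a, ha⟩ := exists_hMod_of n x
      obtain ⟨b, hb⟩ := exists_hMod_of n y
      refine ((ha.mul hb).map (Compl.extend f.toLinearMap)).trans (HMod.trans (HMod.of_eq ?_)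
        ((ha.map (Compl.extend f.toLinearMap)).mul (hb.map (Compl.extend f.toLinearMap))).symm)
      rw [← Compl.of_mul, Compl.extend_of, Compl.extend_of, Compl.extend_of]
      exact map_mul f a b)

@[simp] theorem complExtend_toCompl (f : A →ₐ[K] Compl hIdeal B) (a : A) :
    complExtend f (toCompl A a) = f a := Compl.extend_of f.toLinearMap a

/-- The homomorphism of completions induced by a homomorphism. -/
noncomputable def complMap (f : A →ₐ[K] B) : Compl hIdeal A →ₐ[K] Compl hIdeal B :=
  complExtend ((toCompl B).comp f)

@[simp] theorem complMap_toCompl (f : A →ₐ[K] B) (a : A) :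
    complMap f (toCompl A a) = toCompl B (f a) := complExtend_toCompl _ a

/-- The Hopf axioms are stated with completed linear maps. Recognising these as homomorphisms of
algebras allows verification on generators. -/
theorem complMap_eq (f : A →ₐ[K] B) (g : A →ₗ[K] B) (h : ∀ a, f a = g a)
    (x : Compl hIdeal A) : Compl.map hIdeal g x = complMap f x :=
  linearMap_ext_compl (f := Compl.map hIdeal g) (g := (complMap f).toLinearMap) (fun a => by
    rw [Compl.map_of, ← h]
    exact (complMap_toCompl f a).symm) x

theorem complMap_apply (f : A →ₐ[K] B) (x : Compl hIdeal A) :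
    complMap f x = Compl.map hIdeal f.toLinearMap x := (complMap_eq f _ (fun _ => rfl) x).symm

/-- A completed tensor square has to be a superalgebra in its own right, so that supercommutation
makes sense for homomorphisms defined on it or composed with a coproduct. -/
noncomputable instance [Superalgebra K A] : Superalgebra K (Compl hIdeal A) where
  parity := complMap parity
  parity_parity x := linearMap_ext_compl
    (f := ((complMap (parity (R := K) (A := A))).comp (complMap parity)).toLinearMap)
    (g := LinearMap.id) (fun a => by
      change complMap parity (complMap parity (toCompl A a)) = toCompl A a
      rw [complMap_toCompl, complMap_toCompl, parity_parity]) x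

theorem parity_toCompl [Superalgebra K A] (a : A) :
    parity (R := K) (toCompl A a) = toCompl A (parity (R := K) a) := complMap_toCompl _ a

theorem parity_compl_apply [Superalgebra K A] (x : Compl hIdeal A) :
    parity (R := K) x = Compl.map hIdeal (parity (R := K) (A := A)).toLinearMap x :=
  complMap_apply _ x

end ComplHom

end Jordanian
namespace Jordanian

open Superalgebra

/-! ### Supercommutation in completions -/

section ComplSuper

/-- The map `x ↦ a x`. -/
noncomputable def lmul {B : Type*} [Ring B] [Algebra K B] (a : B) : B →ₗ[K] B :=
  LinearMap.mulLeft K a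

/-- The map `x ↦ x a`. -/
noncomputable def rmul {B : Type*} [Ring B] [Algebra K B] (a : B) : B →ₗ[K] B :=
  LinearMap.mulRight K a

variable {A B C : Type*} [Ring A] [Algebra K A] [Superalgebra K A] [Ring B] [Algebra K B]
  [Superalgebra K B] [Ring C] [Algebra K C]

theorem SuperCommute.complMap_left {f : A →ₐ[K] C} {g : B →ₐ[K] C} (h : SuperCommute f g) :
    SuperCommute (complMap f) ((toCompl C).comp g) := fun x b => by
  constructor
  · intro hb
    refine linearMap_ext_compl
      (f := LinearMap.mulLeft K (toCompl C (g b)) ∘ₗ (complMap f).toLinearMap)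
      (g := LinearMap.mulRight K (toCompl C (g b)) ∘ₗ (complMap f).toLinearMap) (fun a => ?_) x
    change toCompl C (g b) * complMap f (toCompl A a) = complMap f (toCompl A a) * toCompl C (g b)
    rw [complMap_toCompl, ← map_mul, (h a b).1 hb, map_mul]
  · intro hb
    refine linearMap_ext_compl
      (f := LinearMap.mulLeft K (toCompl C (g b)) ∘ₗ (complMap f).toLinearMap)
      (g := LinearMap.mulRight K (toCompl C (g b)) ∘ₗ (complMap f).toLinearMap ∘ₗ
        (parity (R := K) (A := Compl hIdeal A)).toLinearMap) (fun a => ?_) x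
    change toCompl C (g b) * complMap f (toCompl A a) =
      complMap f (parity (R := K) (toCompl A a)) * toCompl C (g b)
    rw [parity_toCompl, complMap_toCompl, complMap_toCompl, ← map_mul, (h a b).2 hb, map_mul]

end ComplSuper

theorem SuperCommute.congr {A B C : Type*} [Ring A] [Algebra K A] [Superalgebra K A] [Ring B]
    [Algebra K B] [Superalgebra K B] [Ring C] [Algebra K C] {f f' : A →ₐ[K] C} {g g' : B →ₐ[K] C}
    (h : SuperCommute f g) (hf : ∀ a, f a = f' a) (hg : ∀ b, g b = g' b) : SuperCommute f' g' := by
  have h1 : f = f' := AlgHom.ext hf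
  have h2 : g = g' := AlgHom.ext hg
  rwa [← h1, ← h2]

/-! ### The completed tensor square and cube -/

section Legs

variable (A : Type*) [Ring A] [Algebra K A] [Superalgebra K A]

/-- The embedding `a ↦ a ⊗ 1` into the completed tensor square. -/
noncomputable def ι₁ : A →ₐ[K] Tensor2 hIdeal A := (toCompl _).comp inl

/-- The embedding `a ↦ 1 ⊗ a` into the completed tensor square. -/
noncomputable def ι₂ : A →ₐ[K] Tensor2 hIdeal A := (toCompl _).comp inr

/-- The embedding `a ↦ a ⊗ 1 ⊗ 1` into the completed tensor cube. -/
noncomputable def j₁ : A →ₐ[K] Tensor3 hIdeal A := (toCompl _).comp (inl.comp inl)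

/-- The embedding `a ↦ 1 ⊗ a ⊗ 1` into the completed tensor cube. -/
noncomputable def j₂ : A →ₐ[K] Tensor3 hIdeal A := (toCompl _).comp (inl.comp inr)

/-- The embedding `a ↦ 1 ⊗ 1 ⊗ a` into the completed tensor cube. -/
noncomputable def j₃ : A →ₐ[K] Tensor3 hIdeal A := (toCompl _).comp inr

variable {A}

theorem of_stmul (a b : A) : Compl.of hIdeal _ (stmul (R := K) a b) = ι₁ A a * ι₂ A b := by
  rw [ι₁, ι₂, AlgHom.comp_apply, AlgHom.comp_apply, ← map_mul, inl_mul_inr, toCompl_apply]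

theorem superCommute_ι : SuperCommute (ι₁ A) (ι₂ A) := superCommute_inl_inr.comp _

theorem superCommute_inl_inl_inr : SuperCommute
    ((inl : STensor K A A →ₐ[K] STensor K (STensor K A A) A).comp (inl : A →ₐ[K] STensor K A A))
    (inr : A →ₐ[K] STensor K (STensor K A A) A) := superCommute_inl_inr.comp_left parity_inl

theorem superCommute_inl_inr_inr : SuperCommute
    ((inl : STensor K A A →ₐ[K] STensor K (STensor K A A) A).comp (inr : A →ₐ[K] STensor K A A))
    (inr : A →ₐ[K] STensor K (STensor K A A) A) := superCommute_inl_inr.comp_left parity_inr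

theorem superCommute_inl_inl_inl_inr : SuperCommute
    ((inl : STensor K A A →ₐ[K] STensor K (STensor K A A) A).comp (inl : A →ₐ[K] STensor K A A))
    ((inl : STensor K A A →ₐ[K] STensor K (STensor K A A) A).comp inr) :=
  superCommute_inl_inr.comp _

theorem superCommute_j₁_j₂ : SuperCommute (j₁ A) (j₂ A) := superCommute_inl_inl_inl_inr.comp _

theorem superCommute_j₁_j₃ : SuperCommute (j₁ A) (j₃ A) := superCommute_inl_inl_inr.comp _

theorem superCommute_j₂_j₃ : SuperCommute (j₂ A) (j₃ A) := superCommute_inl_inr_inr.comp _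

variable (A) in
/-- The embedding `leg12` as a homomorphism of algebras. -/
noncomputable def leg12Hom : Tensor2 hIdeal A →ₐ[K] Tensor3 hIdeal A := complMap inl

variable (A) in
/-- The embedding `leg13` as a homomorphism of algebras. -/
noncomputable def leg13Hom : Tensor2 hIdeal A →ₐ[K] Tensor3 hIdeal A :=
  complMap (superLift _ _ superCommute_inl_inl_inr)

variable (A) in
/-- The embedding `leg23` as a homomorphism of algebras. -/
noncomputable def leg23Hom : Tensor2 hIdeal A →ₐ[K] Tensor3 hIdeal A :=
  complMap (superLift _ _ superCommute_inl_inr_inr)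

variable (A) in
/-- The flip as a homomorphism of algebras. -/
noncomputable def flipHom : Tensor2 hIdeal A →ₐ[K] Tensor2 hIdeal A :=
  complMap (GradedTensorProduct.comm (evenOdd K A) (evenOdd K A)).toAlgHom

theorem leg12_eq (x : Tensor2 hIdeal A) : leg12 hIdeal A x = leg12Hom A x :=
  complMap_eq _ _ (fun _ => rfl) x

theorem leg13_eq (x : Tensor2 hIdeal A) : leg13 hIdeal A x = leg13Hom A x := by
  refine complMap_eq _ _ (linearMap_ext_stmul
    (f := (superLift _ _ superCommute_inl_inl_inr).toLinearMap) fun a b => ?_) x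
  exact inl_mul_inr (inl a) b

theorem leg23_eq (x : Tensor2 hIdeal A) : leg23 hIdeal A x = leg23Hom A x := by
  refine complMap_eq _ _ (linearMap_ext_stmul
    (f := (superLift _ _ superCommute_inl_inr_inr).toLinearMap) fun a b => ?_) x
  exact inl_mul_inr (inr a) b

theorem flip21_eq (x : Tensor2 hIdeal A) : flip21 hIdeal A x = flipHom A x :=
  complMap_eq _ _ (fun _ => rfl) x

@[simp] theorem leg12Hom_ι₁ (a : A) : leg12Hom A (ι₁ A a) = j₁ A a := complMap_toCompl _ _

@[simp] theorem leg12Hom_ι₂ (a : A) : leg12Hom A (ι₂ A a) = j₂ A a := complMap_toCompl _ _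

@[simp] theorem leg13Hom_ι₁ (a : A) : leg13Hom A (ι₁ A a) = j₁ A a :=
  (complMap_toCompl _ _).trans (congrArg _ (superLift_inl _ _ _ a))

@[simp] theorem leg13Hom_ι₂ (a : A) : leg13Hom A (ι₂ A a) = j₃ A a :=
  (complMap_toCompl _ _).trans (congrArg _ (superLift_inr _ _ _ a))

@[simp] theorem leg23Hom_ι₁ (a : A) : leg23Hom A (ι₁ A a) = j₂ A a :=
  (complMap_toCompl _ _).trans (congrArg _ (superLift_inl _ _ _ a))

@[simp] theorem leg23Hom_ι₂ (a : A) : leg23Hom A (ι₂ A a) = j₃ A a :=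
  (complMap_toCompl _ _).trans (congrArg _ (superLift_inr _ _ _ a))

@[simp] theorem flipHom_ι₁ (a : A) : flipHom A (ι₁ A a) = ι₂ A a := by
  refine (complMap_toCompl _ _).trans (congrArg (toCompl _) ?_)
  -- No sign occurs, since the other tensor factor is 1, which is even.
  have key : ∀ (i : ZMod 2) (a : A), a ∈ evenOdd K A i →
      GradedTensorProduct.comm (evenOdd K A) (evenOdd K A) (inl a) = inr a := fun i a ha => by
    have h := GradedTensorProduct.comm_coe_tmul_coe (R := K) (evenOdd K A) (evenOdd K A) ⟨a, ha⟩
      (⟨1, mem_evenOdd_zero (map_one _)⟩ : evenOdd K A 0)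
    rw [zero_mul, uzpow_zero, one_smul] at h
    exact h
  obtain ⟨a₀, a₁, rfl, h₀, h₁⟩ := exists_even_add_odd a
  change GradedTensorProduct.comm (evenOdd K A) (evenOdd K A) (inl (a₀ + a₁)) = inr (a₀ + a₁)
  rw [map_add, map_add, map_add, key 0 a₀ (mem_evenOdd_zero h₀), key 1 a₁ (mem_evenOdd_one h₁)]

@[simp] theorem flipHom_ι₂ (a : A) : flipHom A (ι₂ A a) = ι₁ A a := by
  refine (complMap_toCompl _ _).trans (congrArg (toCompl _) ?_)
  have key : ∀ (i : ZMod 2) (a : A), a ∈ evenOdd K A i →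
      GradedTensorProduct.comm (evenOdd K A) (evenOdd K A) (inr a) = inl a := fun i a ha => by
    have h := GradedTensorProduct.comm_coe_tmul_coe (R := K) (evenOdd K A) (evenOdd K A)
      (⟨1, mem_evenOdd_zero (map_one _)⟩ : evenOdd K A 0) ⟨a, ha⟩
    rw [mul_zero, uzpow_zero, one_smul] at h
    exact h
  obtain ⟨a₀, a₁, rfl, h₀, h₁⟩ := exists_even_add_odd a
  change GradedTensorProduct.comm (evenOdd K A) (evenOdd K A) (inr (a₀ + a₁)) = inl (a₀ + a₁)
  rw [map_add, map_add, map_add, key 0 a₀ (mem_evenOdd_zero h₀), key 1 a₁ (mem_evenOdd_one h₁)]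

theorem parity_ι₁ (a : A) : parity (R := K) (ι₁ A a) = ι₁ A (parity (R := K) a) :=
  (parity_toCompl _).trans (congrArg (toCompl _) (parity_inl a))

theorem parity_ι₂ (a : A) : parity (R := K) (ι₂ A a) = ι₂ A (parity (R := K) a) :=
  (parity_toCompl _).trans (congrArg (toCompl _) (parity_inr a))

theorem superCommute_leg12_j₃ : SuperCommute (leg12Hom A) (j₃ A) :=
  superCommute_inl_inr.complMap_left

theorem superCommute_j₁_leg23 : SuperCommute (j₁ A) (leg23Hom A) :=
  ((superCommute_inl_inr_inr.superLift_left superCommute_inl_inl_inl_inr.symm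
    superCommute_inl_inl_inr.symm).complMap_left).symm

/-! ### The maps Δ ⊗ id and id ⊗ Δ as homomorphisms -/

section Comul

variable (Δ : A →ₐ[K] Tensor2 hIdeal A) (hΔ : ∀ a, parity (R := K) (Δ a) = Δ (parity (R := K) a))

/-- The map `Δ ⊗ id`, as a homomorphism of algebras. -/
noncomputable def comulTensorIdHom : Tensor2 hIdeal A →ₐ[K] Tensor3 hIdeal A :=
  complExtend (superLift ((leg12Hom A).comp Δ) (j₃ A) (superCommute_leg12_j₃.comp_left hΔ))

/-- The map `id ⊗ Δ`, as a homomorphism of algebras. -/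
noncomputable def idTensorComulHom : Tensor2 hIdeal A →ₐ[K] Tensor3 hIdeal A :=
  complExtend (superLift (j₁ A) ((leg23Hom A).comp Δ)
    (superCommute_j₁_leg23.symm.comp_left hΔ).symm)

@[simp] theorem comulTensorIdHom_ι₁ (a : A) :
    comulTensorIdHom Δ hΔ (ι₁ A a) = leg12Hom A (Δ a) :=
  (complExtend_toCompl _ _).trans (superLift_inl _ _ _ a)

@[simp] theorem comulTensorIdHom_ι₂ (a : A) : comulTensorIdHom Δ hΔ (ι₂ A a) = j₃ A a :=
  (complExtend_toCompl _ _).trans (superLift_inr _ _ _ a)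

@[simp] theorem idTensorComulHom_ι₁ (a : A) : idTensorComulHom Δ hΔ (ι₁ A a) = j₁ A a :=
  (complExtend_toCompl _ _).trans (superLift_inl _ _ _ a)

@[simp] theorem idTensorComulHom_ι₂ (a : A) :
    idTensorComulHom Δ hΔ (ι₂ A a) = leg23Hom A (Δ a) :=
  (complExtend_toCompl _ _).trans (superLift_inr _ _ _ a)

theorem map_appendRight (b : A) (y : Tensor2 hIdeal A) :
    Compl.map hIdeal ((appendRight A).flip b) y = leg12Hom A y * j₃ A b := by
  refine linearMap_ext_compl (g := rmul (j₃ A b) ∘ₗ (leg12Hom A).toLinearMap)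
    (fun x => ?_) y
  change _ = leg12Hom A (toCompl _ x) * toCompl _ (inr b)
  rw [Compl.map_of, leg12Hom, complMap_toCompl, ← map_mul, inl_mul_inr, toCompl_apply]
  rfl

theorem map_appendLeft (a : A) (y : Tensor2 hIdeal A) :
    Compl.map hIdeal (appendLeft A a) y = j₁ A a * leg23Hom A y := by
  refine linearMap_ext_compl (g := lmul (j₁ A a) ∘ₗ (leg23Hom A).toLinearMap)
    (fun x => ?_) y
  change _ = toCompl _ (inl (inl a)) * leg23Hom A (toCompl _ x)
  rw [Compl.map_of, leg23Hom, complMap_toCompl, ← map_mul, toCompl_apply]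
  refine congrArg _ (linearMap_ext_stmul (f := appendLeft A a)
    (g := LinearMap.mulLeft K (inl (inl a)) ∘ₗ
      (superLift _ _ superCommute_inl_inr_inr).toLinearMap) (fun b c => ?_) x)
  change stmul (stmul a b) c = inl (inl a) * (inl (inr b) * inr c)
  rw [← mul_assoc, ← map_mul, inl_mul_inr, inl_mul_inr]

theorem comulTensorId_eq (y : Tensor2 hIdeal A) :
    comulTensorId Δ.toLinearMap y = comulTensorIdHom Δ hΔ y := by
  refine linearMap_ext_compl (g := (comulTensorIdHom Δ hΔ).toLinearMap) (fun x => ?_) y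
  refine linearMap_ext_stmul (f := comulTensorId Δ.toLinearMap ∘ₗ Compl.of hIdeal _)
    (g := (comulTensorIdHom Δ hΔ).toLinearMap ∘ₗ Compl.of hIdeal _) (fun a b => ?_) x
  change comulTensorId Δ.toLinearMap (Compl.of hIdeal _ (stmul a b)) =
    comulTensorIdHom Δ hΔ (Compl.of hIdeal _ (stmul a b))
  rw [comulTensorId_of, map_appendRight, of_stmul, map_mul, comulTensorIdHom_ι₁,
    comulTensorIdHom_ι₂]
  rfl

theorem idTensorComul_eq (y : Tensor2 hIdeal A) :
    idTensorComul Δ.toLinearMap y = idTensorComulHom Δ hΔ y := by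
  refine linearMap_ext_compl (g := (idTensorComulHom Δ hΔ).toLinearMap) (fun x => ?_) y
  refine linearMap_ext_stmul (f := idTensorComul Δ.toLinearMap ∘ₗ Compl.of hIdeal _)
    (g := (idTensorComulHom Δ hΔ).toLinearMap ∘ₗ Compl.of hIdeal _) (fun a b => ?_) x
  change idTensorComul Δ.toLinearMap (Compl.of hIdeal _ (stmul a b)) =
    idTensorComulHom Δ hΔ (Compl.of hIdeal _ (stmul a b))
  rw [idTensorComul_of, map_appendLeft, of_stmul, map_mul, idTensorComulHom_ι₁,
    idTensorComulHom_ι₂]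
  rfl

end Comul

end Legs

end Jordanian
namespace Jordanian

/-! ### Two supercommuting copies of the letters -/

/-- Two copies of the letters with the same `h`, which commute in the sense of superalgebras. -/
structure OspPair (A : Type*) [Ring A] [Algebra ℂ A] where
  (L₁ L₂ : OspLetters A)
  h_eq : L₂.h = L₁.h
  qq : L₂.q * L₁.q = L₁.q * L₂.q
  qp : L₂.q * L₁.p = L₁.p * L₂.q
  qe : L₁.e * L₂.q = L₂.q * L₁.e
  qf : L₁.f * L₂.q = L₂.q * L₁.f
  qb : L₁.b * L₂.q = L₂.q * L₁.b
  pq : L₂.p * L₁.q = L₁.q * L₂.p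
  pp : L₂.p * L₁.p = L₁.p * L₂.p
  pe : L₁.e * L₂.p = L₂.p * L₁.e
  pf : L₁.f * L₂.p = L₂.p * L₁.f
  pb : L₁.b * L₂.p = L₂.p * L₁.b
  eq : L₂.e * L₁.q = L₁.q * L₂.e
  ep : L₂.e * L₁.p = L₁.p * L₂.e
  ee : L₁.e * L₂.e = -(L₂.e * L₁.e)
  ef : L₁.f * L₂.e = -(L₂.e * L₁.f)
  eb : L₁.b * L₂.e = L₂.e * L₁.b
  fq : L₂.f * L₁.q = L₁.q * L₂.f
  fp : L₂.f * L₁.p = L₁.p * L₂.f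
  fe : L₁.e * L₂.f = -(L₂.f * L₁.e)
  ff : L₁.f * L₂.f = -(L₂.f * L₁.f)
  fb : L₁.b * L₂.f = L₂.f * L₁.b
  bq : L₂.b * L₁.q = L₁.q * L₂.b
  bp : L₂.b * L₁.p = L₁.p * L₂.b
  be : L₁.e * L₂.b = L₂.b * L₁.e
  bf : L₁.f * L₂.b = L₂.b * L₁.f
  bb : L₁.b * L₂.b = L₂.b * L₁.b

namespace OspPair

variable {A : Type*} [Ring A] [Algebra ℂ A] (P : OspPair A)

/-- The rewriting rules which bring a word into normal form. -/
theorem cross_rules :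
    -- Together with the rules of the two copies this sorts words as q₁, p₁, then q₂, p₂, h, then
    -- e₂, b₂, f₂, and last e₁, b₁, f₁; signs appear only when odd letters of different copies are
    -- exchanged.
    (P.L₂.q * P.L₁.q = P.L₁.q * P.L₂.q) ∧
    (∀ w, P.L₂.q * (P.L₁.q * w) = P.L₁.q * P.L₂.q * w) ∧
    (P.L₂.q * P.L₁.p = P.L₁.p * P.L₂.q) ∧
    (∀ w, P.L₂.q * (P.L₁.p * w) = P.L₁.p * P.L₂.q * w) ∧
    (P.L₁.e * P.L₂.q = P.L₂.q * P.L₁.e) ∧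
    (∀ w, P.L₁.e * (P.L₂.q * w) = P.L₂.q * P.L₁.e * w) ∧
    (P.L₁.f * P.L₂.q = P.L₂.q * P.L₁.f) ∧
    (∀ w, P.L₁.f * (P.L₂.q * w) = P.L₂.q * P.L₁.f * w) ∧
    (P.L₁.b * P.L₂.q = P.L₂.q * P.L₁.b) ∧
    (∀ w, P.L₁.b * (P.L₂.q * w) = P.L₂.q * P.L₁.b * w) ∧
    (P.L₂.p * P.L₁.q = P.L₁.q * P.L₂.p) ∧
    (∀ w, P.L₂.p * (P.L₁.q * w) = P.L₁.q * P.L₂.p * w) ∧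
    (P.L₂.p * P.L₁.p = P.L₁.p * P.L₂.p) ∧
    (∀ w, P.L₂.p * (P.L₁.p * w) = P.L₁.p * P.L₂.p * w) ∧
    (P.L₁.e * P.L₂.p = P.L₂.p * P.L₁.e) ∧
    (∀ w, P.L₁.e * (P.L₂.p * w) = P.L₂.p * P.L₁.e * w) ∧
    (P.L₁.f * P.L₂.p = P.L₂.p * P.L₁.f) ∧
    (∀ w, P.L₁.f * (P.L₂.p * w) = P.L₂.p * P.L₁.f * w) ∧
    (P.L₁.b * P.L₂.p = P.L₂.p * P.L₁.b) ∧
    (∀ w, P.L₁.b * (P.L₂.p * w) = P.L₂.p * P.L₁.b * w) ∧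
    (P.L₂.e * P.L₁.q = P.L₁.q * P.L₂.e) ∧
    (∀ w, P.L₂.e * (P.L₁.q * w) = P.L₁.q * P.L₂.e * w) ∧
    (P.L₂.e * P.L₁.p = P.L₁.p * P.L₂.e) ∧
    (∀ w, P.L₂.e * (P.L₁.p * w) = P.L₁.p * P.L₂.e * w) ∧
    (P.L₁.e * P.L₂.e = -(P.L₂.e * P.L₁.e)) ∧
    (∀ w, P.L₁.e * (P.L₂.e * w) = -(P.L₂.e * P.L₁.e) * w) ∧
    (P.L₁.f * P.L₂.e = -(P.L₂.e * P.L₁.f)) ∧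
    (∀ w, P.L₁.f * (P.L₂.e * w) = -(P.L₂.e * P.L₁.f) * w) ∧
    (P.L₁.b * P.L₂.e = P.L₂.e * P.L₁.b) ∧
    (∀ w, P.L₁.b * (P.L₂.e * w) = P.L₂.e * P.L₁.b * w) ∧
    (P.L₂.f * P.L₁.q = P.L₁.q * P.L₂.f) ∧
    (∀ w, P.L₂.f * (P.L₁.q * w) = P.L₁.q * P.L₂.f * w) ∧
    (P.L₂.f * P.L₁.p = P.L₁.p * P.L₂.f) ∧
    (∀ w, P.L₂.f * (P.L₁.p * w) = P.L₁.p * P.L₂.f * w) ∧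
    (P.L₁.e * P.L₂.f = -(P.L₂.f * P.L₁.e)) ∧
    (∀ w, P.L₁.e * (P.L₂.f * w) = -(P.L₂.f * P.L₁.e) * w) ∧
    (P.L₁.f * P.L₂.f = -(P.L₂.f * P.L₁.f)) ∧
    (∀ w, P.L₁.f * (P.L₂.f * w) = -(P.L₂.f * P.L₁.f) * w) ∧
    (P.L₁.b * P.L₂.f = P.L₂.f * P.L₁.b) ∧
    (∀ w, P.L₁.b * (P.L₂.f * w) = P.L₂.f * P.L₁.b * w) ∧
    (P.L₂.b * P.L₁.q = P.L₁.q * P.L₂.b) ∧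
    (∀ w, P.L₂.b * (P.L₁.q * w) = P.L₁.q * P.L₂.b * w) ∧
    (P.L₂.b * P.L₁.p = P.L₁.p * P.L₂.b) ∧
    (∀ w, P.L₂.b * (P.L₁.p * w) = P.L₁.p * P.L₂.b * w) ∧
    (P.L₁.e * P.L₂.b = P.L₂.b * P.L₁.e) ∧
    (∀ w, P.L₁.e * (P.L₂.b * w) = P.L₂.b * P.L₁.e * w) ∧
    (P.L₁.f * P.L₂.b = P.L₂.b * P.L₁.f) ∧
    (∀ w, P.L₁.f * (P.L₂.b * w) = P.L₂.b * P.L₁.f * w) ∧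
    (P.L₁.b * P.L₂.b = P.L₂.b * P.L₁.b) ∧
    (∀ w, P.L₁.b * (P.L₂.b * w) = P.L₂.b * P.L₁.b * w) :=
  ⟨P.qq, mul_mul_of_mul_eq P.qq, P.qp, mul_mul_of_mul_eq P.qp, P.qe, mul_mul_of_mul_eq P.qe,
    P.qf, mul_mul_of_mul_eq P.qf, P.qb, mul_mul_of_mul_eq P.qb, P.pq, mul_mul_of_mul_eq P.pq,
    P.pp, mul_mul_of_mul_eq P.pp, P.pe, mul_mul_of_mul_eq P.pe, P.pf, mul_mul_of_mul_eq P.pf,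
    P.pb, mul_mul_of_mul_eq P.pb, P.eq, mul_mul_of_mul_eq P.eq, P.ep, mul_mul_of_mul_eq P.ep,
    P.ee, mul_mul_of_mul_eq P.ee, P.ef, mul_mul_of_mul_eq P.ef, P.eb, mul_mul_of_mul_eq P.eb,
    P.fq, mul_mul_of_mul_eq P.fq, P.fp, mul_mul_of_mul_eq P.fp, P.fe, mul_mul_of_mul_eq P.fe,
    P.ff, mul_mul_of_mul_eq P.ff, P.fb, mul_mul_of_mul_eq P.fb, P.bq, mul_mul_of_mul_eq P.bq,
    P.bp, mul_mul_of_mul_eq P.bp, P.be, mul_mul_of_mul_eq P.be, P.bf, mul_mul_of_mul_eq P.bf,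
    P.bb, mul_mul_of_mul_eq P.bb⟩

/-- The coproduct of `e`. -/
noncomputable def e : A := P.L₁.e * (P.L₂.p * P.L₂.p) + P.L₂.e

/-- The coproduct of `b`. -/
noncomputable def b : A := P.L₁.b * (P.L₂.q * (P.L₂.q * (P.L₂.q * P.L₂.q))) + P.L₂.b

/-- The coproduct of `f`. -/
noncomputable def f : A := P.L₁.f * (P.L₂.q * P.L₂.q) + P.L₂.f -
  P.L₁.h * (P.L₁.b * (P.L₂.q * (P.L₂.q * (P.L₂.q * (P.L₂.q * P.L₂.e)))))

/-- This and the next two identities are the classical relations for the proposed coproducts of e,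
b, f. By the universal property they are all that is needed for the coproduct to exist. -/
theorem comul_be : P.b * P.e = P.e * P.b + P.e := by
  have r₂ := P.L₂.rules
  -- The copies share one central h; naming it uniformly makes the two sets of rules compatible.
  rw [P.h_eq] at r₂
  simp only [e, b, P.L₁.rules, r₂, P.cross_rules, smul_expand A]
  module

theorem comul_fe : P.f * P.e = -(P.e * P.f) - P.b := by
  have r₂ := P.L₂.rules
  rw [P.h_eq] at r₂
  simp only [e, b, f, P.L₁.rules, r₂, P.cross_rules, smul_expand A]
  module

theorem comul_fb : P.f * P.b = P.b * P.f + P.f := by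
  have r₂ := P.L₂.rules
  rw [P.h_eq] at r₂
  simp only [b, f, P.L₁.rules, r₂, P.cross_rules, smul_expand A]
  module

/-- Says that w = -f² + (h/2) b² satisfies Δ(w) = w ⊗ T² + 1 ⊗ w. The remaining summand (h/8)(T² -
1) of T Y obeys the same law because T² is group-like, so it is left out here. -/
theorem comul_Y : -(P.f * P.f) + (1 / 2 : ℂ) • (P.L₁.h * (P.b * P.b)) =
    (-(P.L₁.f * P.L₁.f) + (1 / 2 : ℂ) • (P.L₁.h * (P.L₁.b * P.L₁.b))) *
      (P.L₂.q * (P.L₂.q * (P.L₂.q * P.L₂.q))) +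
    (-(P.L₂.f * P.L₂.f) + (1 / 2 : ℂ) • (P.L₁.h * (P.L₂.b * P.L₂.b))) := by
  have r₂ := P.L₂.rules
  rw [P.h_eq] at r₂
  simp only [b, f, P.L₁.rules, r₂, P.cross_rules, smul_expand A]
  module

/-- The left side is the coproduct of F = T^(-1/2)(f + (h/2) e b - (h/8)(T² - 1) e), with T
group-like; the right side is the prescribed formula. -/
theorem comul_F : P.L₁.p * P.L₂.p * (P.f + (1 / 2 : ℂ) • (P.L₁.h * (P.e * P.b)) -
      (1 / 8 : ℂ) • (P.L₁.h * ((P.L₁.T * P.L₁.T * (P.L₂.T * P.L₂.T) - 1) * P.e))) =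
    P.L₁.F * P.L₂.q + P.L₁.p * P.L₂.F +
      (1 / 4 : ℂ) • (P.L₁.h * (P.L₁.T' * P.L₁.E * (P.L₂.p * P.L₂.H + P.L₂.H * P.L₂.p))) -
      (1 / 4 : ℂ) • (P.L₁.h * ((P.L₁.q * P.L₁.H + P.L₁.H * P.L₁.q) * (P.L₂.T * P.L₂.E))) := by
  have r₂ := P.L₂.rules
  rw [P.h_eq] at r₂
  simp only [e, b, f, OspLetters.T, OspLetters.T', OspLetters.E, OspLetters.F, OspLetters.H,
    P.h_eq, P.L₁.rules, r₂, P.cross_rules, smul_expand A]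
  module

end OspPair

end Jordanian
namespace Jordanian

open Superalgebra

/-- The image of the letters under a homomorphism. -/
noncomputable def HLetters.map {B B' : Type*} [Ring B] [Algebra K B] [Ring B'] [Algebra K B']
    (L : HLetters B) (φ : B →ₐ[K] B') : HLetters B' :=
  letI := complexAlgebra B
  letI := complexAlgebra B'
  have hs : ∀ (c : ℂ) (x : B), φ (c • x) = c • φ x := fun c x => map_smul φ (cst c) x
  { h_eq := (congrArg φ L.h_eq).trans (φ.commutes _)
    toLetters := {
      h := φ L.toLetters.h
      q := φ L.toLetters.q
      p := φ L.toLetters.p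
      e := φ L.toLetters.e
      f := φ L.toLetters.f
      b := φ L.toLetters.b
      qh := by rw [← map_mul, L.toLetters.qh, map_mul]
      ph := by rw [← map_mul, L.toLetters.ph, map_mul]
      eh := by rw [← map_mul, L.toLetters.eh, map_mul]
      fh := by rw [← map_mul, L.toLetters.fh, map_mul]
      bh := by rw [← map_mul, L.toLetters.bh, map_mul]
      qp := by rw [← map_mul, L.toLetters.qp, map_one]
      pq := by rw [← map_mul, L.toLetters.pq, map_one]
      eq := by rw [← map_mul, L.toLetters.eq, map_mul]
      ep := by rw [← map_mul, L.toLetters.ep, map_mul]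
      fe := by rw [← map_mul, L.toLetters.fe, map_sub, map_neg, map_mul]
      be := by rw [← map_mul, L.toLetters.be, map_add, map_mul]
      fb := by rw [← map_mul, L.toLetters.fb, map_add, map_mul]
      bq := by simp only [← map_mul, L.toLetters.bq, map_add, map_sub, hs]
      bp := by simp only [← map_mul, L.toLetters.bp, map_sub, hs]
      fq := by simp only [← map_mul, L.toLetters.fq, map_sub, hs]
      fp := by simp only [← map_mul, L.toLetters.fp, map_add, hs]
      hee := by
        simp only [← map_mul, L.toLetters.hee, hs]
        rw [map_sub, map_one] } }

namespace Osp

open OspGen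

/-- The letters of `U_h(osp(1|2))`. -/
noncomputable def letters : HLetters U := lettersOfTorsionFree torsionFree fe be fb

theorem letters_q : letters.q = T (1 / 2) := by rw [T_eq, x_X]; rfl

theorem letters_p : letters.p = T (-1 / 2) := by rw [T_eq, x_X, neg_div]; rfl

/-! ### Parities -/

theorem parity_x_even {i : OspGen} (hi : i.odd = false) : parity (R := K) (x i) = x i :=
  (presentation.parity_var i).trans (if_neg (by
    change ¬ i.odd = true
    rw [hi]
    exact Bool.false_ne_true))

theorem parity_x_odd {i : OspGen} (hi : i.odd = true) : parity (R := K) (x i) = -x i :=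
  (presentation.parity_var i).trans (if_pos hi)

theorem parity_T (s : ℂ) : parity (R := K) (T s) = T s := by
  rw [T_eq, map_hexp, map_smul, parity_x_even rfl]

theorem parity_e : parity (R := K) e = -e := by
  rw [e, map_mul, parity_T, parity_x_odd rfl, mul_neg]

theorem parity_b : parity (R := K) b = b := by
  rw [b, map_mul, parity_T, parity_x_even rfl]

theorem parity_f : parity (R := K) f = -f := by
  rw [f, map_add, map_sub, map_mul, map_smul, map_smul, map_mul, map_mul, map_sub, map_mul,
    parity_T, parity_T, parity_e, parity_b, parity_x_odd rfl, map_one]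
  simp only [mul_neg, neg_mul, smul_neg]
  abel

/-! ### The completed tensor square -/

/-- Over the discrete valuation ring ℂ⟦h⟧ flatness is torsion-freeness, and a nonzero scalar is a
unit times a power of h. -/
instance : Module.Flat K U := by
  rw [IsDedekindDomain.flat_iff_torsion_eq_bot, eq_bot_iff]
  rintro a ⟨⟨c, hc⟩, h⟩
  change c • a = 0 at h
  have hirr : Irreducible hbar := PowerSeries.X_prime.irreducible
  obtain ⟨n, u, hu⟩ := IsDiscreteValuationRing.associated_pow_irreducible
    (nonZeroDivisors.ne_zero hc) hirr
  have h1 : hbar ^ n • a = 0 := by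
    rw [← hu, mul_comm, mul_smul, h, smul_zero]
  clear h hu hc
  induction n with
  | zero => simpa using h1
  | succ n ih =>
    rw [pow_succ', mul_smul] at h1
    exact ih (torsionFree _ h1)

/-- Multiplication by h is injective on U_h and remains so after tensoring with the flat module U_h.
-/
theorem torsionFree_stensor (z : STensor K U U) (hz : hbar • z = 0) : z = 0 := by
  have h : Function.Injective ((LinearMap.lsmul K U hbar).rTensor U) :=
    Module.Flat.rTensor_preserves_injective_linearMap _
      ((injective_iff_map_eq_zero _).mpr torsionFree)
  have h1 : ∀ y : U ⊗[K] U, (LinearMap.lsmul K U hbar).rTensor U y = hbar • y := fun y => by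
    induction y with
    | zero => simp
    | add a b ha hb => rw [map_add, ha, hb, smul_add]
    | tmul a b => rfl
  exact (injective_iff_map_eq_zero _).mp h z ((h1 z).trans hz)

theorem torsionFree_tensor (z : Tensor2 hIdeal U) (hz : hbar • z = 0) : z = 0 :=
  eq_zero_of_hbar_smul_compl torsionFree_stensor hz

theorem tens_eq (a b : U) : tens a b = ι₁ U a * ι₂ U b := of_stmul a b

theorem parity_q : parity (R := K) letters.q = letters.q := by rw [letters_q, parity_T]

theorem parity_p : parity (R := K) letters.p = letters.p := by rw [letters_p, parity_T]

theorem T_one : T 1 = letters.q * letters.q := by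
  rw [letters_q, ← T_add, add_halves]

theorem T_neg_one : T (-1) = letters.p * letters.p := by
  rw [letters_p, ← T_add]
  congr 1
  norm_num

theorem T_two : T 2 = letters.q * (letters.q * (letters.q * letters.q)) := by
  rw [letters_q, ← T_add, ← T_add, ← T_add]
  congr 1
  norm_num

/-! ### The convolution of two supercommuting homomorphisms -/

section Conv

variable {B : Type*} [Ring B] [Algebra K B] {i j : U →ₐ[K] B}

theorem _root_.Jordanian.SuperCommute.right_even (h : SuperCommute i j) {a : U}
    (ha : parity (R := K) a = a) (c : U) : j a * i c = i c * j a :=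
  (h c a).1 ha

theorem _root_.Jordanian.SuperCommute.left_even (h : SuperCommute i j) {a : U}
    (ha : parity (R := K) a = a) (c : U) : i a * j c = j c * i a :=
  (h.symm c a).1 ha

theorem _root_.Jordanian.SuperCommute.odd (h : SuperCommute i j) {a c : U}
    (ha : parity (R := K) a = -a) (hc : parity (R := K) c = -c) : i a * j c = -(j c * i a) := by
  rw [(h.symm c a).2 ha, hc, map_neg, neg_mul]

theorem commute_of_even (h : SuperCommute i j) (a : U) {c : U} (hc : parity (R := K) c = c) :
    Commute (i a) (j c) := (h.right_even hc a).symm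

/-- The two copies of the letters given by two supercommuting homomorphisms. -/
noncomputable def pair (h : SuperCommute i j) : @OspPair B _ (complexAlgebra _) :=
  letI := complexAlgebra B
  { L₁ := (letters.map i).toLetters
    L₂ := (letters.map j).toLetters
    h_eq := (letters.map j).h_eq.trans (letters.map i).h_eq.symm
    qq := h.right_even parity_q _
    qp := h.right_even parity_q _
    qe := (h.right_even parity_q _).symm
    qf := (h.right_even parity_q _).symm
    qb := (h.right_even parity_q _).symm
    pq := h.right_even parity_p _
    pp := h.right_even parity_p _
    pe := (h.right_even parity_p _).symm
    pf := (h.right_even parity_p _).symm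
    pb := (h.right_even parity_p _).symm
    eq := (h.left_even parity_q _).symm
    ep := (h.left_even parity_p _).symm
    ee := h.odd parity_e parity_e
    ef := h.odd parity_f parity_e
    eb := h.left_even parity_b _
    fq := (h.left_even parity_q _).symm
    fp := (h.left_even parity_p _).symm
    fe := h.odd parity_e parity_f
    ff := h.odd parity_f parity_f
    fb := h.left_even parity_b _
    bq := (h.left_even parity_q _).symm
    bp := (h.left_even parity_p _).symm
    be := (h.right_even parity_b _).symm
    bf := (h.right_even parity_b _).symm
    bb := (h.right_even parity_b _).symm }

theorem pair_h (h : SuperCommute i j) : letI := complexAlgebra B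
    (pair h).L₁.h = algebraMap K B hbar := (letters.map i).h_eq

theorem pair_e (h : SuperCommute i j) : letI := complexAlgebra B
    (pair h).e = i e * j (T (-1)) + j e := by
  rw [T_neg_one, map_mul]
  rfl

theorem pair_b (h : SuperCommute i j) : letI := complexAlgebra B
    (pair h).b = i b * j (T 2) + j b := by
  rw [T_two]
  simp only [map_mul]
  rfl

theorem pair_f (h : SuperCommute i j) : letI := complexAlgebra B
    (pair h).f = i f * j (T 1) + j f - hbar • (i b * j (T 2 * e)) := by
  letI := complexAlgebra B
  rw [T_one, T_two, OspPair.f, pair_h, ← Algebra.smul_def]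
  simp only [map_mul, mul_assoc]
  rfl

variable [IsAdicComplete hIdeal B]

theorem exists_conv (h : SuperCommute i j) : ∃ Δ : U →ₐ[K] B,
    Δ e = i e * j (T (-1)) + j e ∧
    Δ f = i f * j (T 1) + j f - hbar • (i b * j (T 2 * e)) ∧
    Δ b = i b * j (T 2) + j b := by
  letI := complexAlgebra B
  obtain ⟨Δ, he, hf, hb⟩ := exists_algHom (pair h).comul_fe (pair h).comul_be (pair h).comul_fb
  exact ⟨Δ, he.trans (pair_e h), hf.trans (pair_f h), hb.trans (pair_b h)⟩

/-- The convolution of two supercommuting homomorphisms, which is their tensor product composed with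
the coproduct. -/
noncomputable def conv (h : SuperCommute i j) : U →ₐ[K] B := (exists_conv h).choose

theorem conv_e (h : SuperCommute i j) : conv h e = i e * j (T (-1)) + j e :=
  (exists_conv h).choose_spec.1

theorem conv_f (h : SuperCommute i j) :
    conv h f = i f * j (T 1) + j f - hbar • (i b * j (T 2 * e)) :=
  (exists_conv h).choose_spec.2.1

theorem conv_b (h : SuperCommute i j) : conv h b = i b * j (T 2) + j b :=
  (exists_conv h).choose_spec.2.2

/-- Applying a homomorphism to a coproduct only changes the two homomorphisms being convolved. All
Hopf axioms that compare homomorphisms are reduced to statements about `conv` in this way. -/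
theorem map_conv (h : SuperCommute i j) {C : Type*} [Ring C] [Algebra K C] [IsAdicComplete hIdeal C]
    (φ : B →ₐ[K] C) (a : U) : φ (conv h a) = conv (h.comp φ) a := by
  have h1 : φ.comp (conv h) = conv (h.comp φ) := algHom_ext
    (by simp only [AlgHom.comp_apply, conv_e, map_add, map_mul])
    (by simp only [AlgHom.comp_apply, conv_f, map_add, map_sub, map_mul, map_smul])
  exact DFunLike.congr_fun h1 a

theorem conv_congr {i' j' : U →ₐ[K] B} (h : SuperCommute i j) (h' : SuperCommute i' j')
    (hi : ∀ a, i a = i' a) (hj : ∀ a, j a = j' a) : conv h = conv h' :=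
  algHom_ext (by rw [conv_e, conv_e, hi, hj, hj]) (by rw [conv_f, conv_f, hi, hi, hj, hj, hj])

theorem conv_parity (h : SuperCommute i j)
    (h' : SuperCommute (i.comp (parity (R := K))) (j.comp (parity (R := K)))) (a : U) :
    conv h' a = conv h (parity (R := K) a) := by
  have h1 : conv h' = (conv h).comp (parity (R := K)) := algHom_ext
    (by
      simp only [AlgHom.comp_apply, conv_e, parity_e, parity_T, map_neg, neg_mul, neg_add])
    (by
      simp only [AlgHom.comp_apply, conv_f, parity_e, parity_T, parity_f, parity_b, map_neg,
        neg_mul, map_mul, mul_neg, smul_neg]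
      abel)
  exact DFunLike.congr_fun h1 a

/-- The cross terms of the square cancel: e ⊗ T⁻¹ and 1 ⊗ e anticommute, as e is odd and commutes
with T. -/
theorem conv_e_mul_e (h : SuperCommute i j) :
    conv h (e * e) = i (e * e) * j (T (-2)) + j (e * e) := by
  have h2 : T (-2) = T (-1) * T (-1) := by rw [← T_add]; norm_num
  have h1 : j e * i e = -(i e * j e) := by rw [h.odd parity_e parity_e, neg_neg]
  have h3 : j (T (-1)) * i e = i e * j (T (-1)) := h.right_even (parity_T _) _
  have h4 : j e * j (T (-1)) = j (T (-1)) * j e := by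
    rw [← map_mul, (commute_e_T _).eq, map_mul]
  simp only [h2, map_mul, conv_e, mul_add, add_mul]
  simp only [mul_assoc]
  simp only [← mul_assoc, h1, neg_mul]
  simp only [mul_assoc, h4]
  rw [← mul_assoc (j (T (-1))) (i e), h3]
  simp only [mul_assoc]
  abel

theorem parity_X : parity (R := K) (x X) = x X := parity_x_even rfl

theorem commute_e_mul_e_X : Commute (e * e) (x X) := commute_e_X.mul_left commute_e_X

theorem parity_e_mul_e : parity (R := K) (e * e) = e * e := by
  rw [map_mul, parity_e, neg_mul_neg]

theorem hexp_smul_X (i : U →ₐ[K] B) (s : ℂ) : hexp (cst s • i (x X)) = i (T s) := by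
  rw [T_eq, map_hexp, map_smul]

/-- From Δ(e²) = e² ⊗ T⁻² + 1 ⊗ e² and T⁻² = 1 - 2h e² it follows that T⁻² is group-like. So both
sides, multiplied by -2, have the same exponential; they commute, and torsion-freeness allows
logarithms to be taken. -/
theorem conv_X (htf : ∀ z : B, hbar • z = 0 → z = 0) (h : SuperCommute i j) :
    conv h (x X) = i (x X) + j (x X) := by
  have hc : Commute (conv h (x X)) (i (x X) + j (x X)) := by
    rw [x_X, map_hlog, ← x_X]
    refine commute_hlog_left ?_
    rw [conv_e_mul_e]
    refine (Commute.add_left (Commute.mul_left ?_ ?_) ?_).add_right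
      (Commute.add_left (Commute.mul_left ?_ ?_) ?_)
    · exact commute_e_mul_e_X.map i
    · exact (commute_of_even h _ (parity_T _)).symm
    · exact (commute_of_even h _ parity_e_mul_e).symm
    · exact commute_of_even h _ parity_X
    · exact (commute_T_X _).map j
    · exact commute_e_mul_e_X.map j
  have h3 : cst (-2) • conv h (x X) = cst (-2) • (i (x X) + j (x X)) := by
    refine eq_of_hexp_eq htf ((hc.smul_left _).smul_right _) ?_
    rw [smul_add, hexp_add (((commute_of_even h _ parity_X).smul_left _).smul_right _),
      hexp_smul_X, hexp_smul_X, hexp_smul_X]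
    have h1 : T (-2) = 1 - (cst 2 * hbar) • (e * e) := by rw [hbar_smul_e_mul_e, sub_sub_cancel]
    have h2 : ∀ φ : U →ₐ[K] B, (cst 2 * hbar) • φ (e * e) = 1 - φ (T (-2)) := fun φ => by
      rw [← map_smul, hbar_smul_e_mul_e, map_sub, map_one]
    nth_rewrite 1 [h1]
    rw [map_sub, map_one, map_smul, conv_e_mul_e, smul_add, ← smul_mul_assoc, h2, h2, sub_mul,
      one_mul]
    abel
  have h2 : IsUnit (cst (-2)) :=
    (isUnit_iff_ne_zero.mpr (neg_ne_zero.mpr two_ne_zero)).map PowerSeries.C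
  exact h2.smul_left_cancel.mp h3

variable {h : SuperCommute i j}

/-- Primitivity of X is assumed instead of torsion-freeness of the target, so that the formula
applies in the tensor cube, where primitivity is inherited from the tensor square. -/
theorem conv_T (hX : conv h (x X) = i (x X) + j (x X)) (s : ℂ) :
    conv h (T s) = i (T s) * j (T s) := by
  rw [T_eq, map_hexp, map_smul, hX, smul_add,
    hexp_add (((commute_of_even h _ parity_X).smul_left _).smul_right _), hexp_smul_X, hexp_smul_X,
    ← T_eq]

theorem conv_H (hX : conv h (x X) = i (x X) + j (x X)) :
    conv h (x H) = i (x H) * j (T 1) + i (T (-1)) * j (x H) := by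
  have h1 : T (-1) * T 2 = T 1 := by rw [← T_add]; norm_num
  rw [x_H, map_mul, conv_T hX, conv_b, mul_add, map_mul, map_mul, ← h1, map_mul]
  simp only [mul_assoc]
  rw [← mul_assoc (j _) (i b), h.right_even (parity_T _), mul_assoc (i b)]

theorem conv_E (hX : conv h (x X) = i (x X) + j (x X)) :
    conv h (x E) = i (x E) * j (T (-1 / 2)) + i (T (1 / 2)) * j (x E) := by
  have h1 : T (1 / 2) * T (-1) = T (-1 / 2) := by rw [← T_add]; norm_num
  rw [x_E, map_mul, conv_T hX, conv_e, mul_add, map_mul, map_mul, ← h1, map_mul]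
  simp only [mul_assoc]
  rw [← mul_assoc (j _) (i e), h.right_even (parity_T _), mul_assoc (i e)]

theorem conv_T_mul_Y (hX : conv h (x X) = i (x X) + j (x X)) :
    conv h (T 1 * x Y) = i (T 1 * x Y) * j (T 2) + j (T 1 * x Y) := by
  letI := complexAlgebra B
  have h2 : conv h (-(f * f) + (cst (1 / 2) * hbar) • (b * b)) =
      i (-(f * f) + (cst (1 / 2) * hbar) • (b * b)) * j (T 2) +
        j (-(f * f) + (cst (1 / 2) * hbar) • (b * b)) := by
    have h1 := (pair h).comul_Y
    rw [pair_f, pair_b, ← conv_f h, ← conv_b h, pair_h] at h1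
    simp only [← Algebra.smul_def, complex_smul, smul_smul] at h1
    rw [T_two]
    simp only [map_add, map_neg, map_mul, map_smul]
    exact h1
  rw [T_mul_Y]
  generalize -(f * f) + (cst (1 / 2) * hbar) • (b * b) = w at h2 ⊢
  rw [map_add, h2, map_add i, map_add j, add_mul, map_smul, map_smul, map_smul,
    map_sub, map_sub, map_sub, conv_T hX, map_one, map_one, map_one, smul_mul_assoc, sub_mul,
    one_mul, smul_sub, smul_sub, smul_sub]
  abel

theorem conv_Y (hX : conv h (x X) = i (x X) + j (x X)) :
    conv h (x Y) = i (x Y) * j (T 1) + i (T (-1)) * j (x Y) := by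
  have h1 : T (-1) * T 2 = T 1 := by rw [← T_add]; norm_num
  have h3 : x Y = T (-1) * (T 1 * x Y) := by rw [← mul_assoc, T_neg_mul_T, one_mul]
  rw [h3, map_mul, conv_T hX, conv_T_mul_Y hX]
  generalize T 1 * x Y = w
  rw [mul_add, map_mul i, map_mul j _ w, ← h1, map_mul j _ (T 2)]
  simp only [mul_assoc]
  rw [← mul_assoc (j _) (i w), h.right_even (parity_T _), mul_assoc (i w)]

theorem x_F_eq : x F = T (-1 / 2) * (f + (cst (1 / 2) * hbar) • (e * b) -
    (cst (1 / 8) * hbar) • ((T 1 * T 1 - 1) * e)) := by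
  have h1 : T (-1 / 2) * T (1 / 2) = 1 := by rw [neg_div, T_neg_mul_T]
  have h2 : f + (cst (1 / 2) * hbar) • (e * b) - (cst (1 / 8) * hbar) • ((T 1 * T 1 - 1) * e) =
      T (1 / 2) * x F := by rw [f]; abel
  rw [h2, ← mul_assoc, h1, one_mul]

theorem conv_F (hX : conv h (x X) = i (x X) + j (x X)) :
    conv h (x F) = i (x F) * j (T (1 / 2)) + i (T (-1 / 2)) * j (x F) +
    (cst (1 / 4) * hbar) • (i (T (-1) * x E) * j (T (-1 / 2) * x H + x H * T (-1 / 2))) -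
    (cst (1 / 4) * hbar) • (i (T (1 / 2) * x H + x H * T (1 / 2)) * j (T 1 * x E)) := by
  letI := complexAlgebra B
  have h1 := (pair h).comul_F
  have hT : ∀ k : U →ₐ[K] B, (letters.map k).toLetters.T = k (T 1) := fun k => by
    rw [T_one, map_mul]
    rfl
  have hT' : ∀ k : U →ₐ[K] B, (letters.map k).toLetters.T' = k (T (-1)) := fun k => by
    rw [T_neg_one, map_mul]
    rfl
  have hq : ∀ k : U →ₐ[K] B, (letters.map k).toLetters.q = k (T (1 / 2)) := fun k =>
    congrArg k letters_q
  have hp : ∀ k : U →ₐ[K] B, (letters.map k).toLetters.p = k (T (-1 / 2)) := fun k =>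
    congrArg k letters_p
  have hE : ∀ k : U →ₐ[K] B, (letters.map k).toLetters.E = k (x E) := fun k => by
    rw [x_E, map_mul, OspLetters.E, hq]
    rfl
  have hH : ∀ k : U →ₐ[K] B, (letters.map k).toLetters.H = k (x H) := fun k => by
    rw [x_H, map_mul, OspLetters.H, ← mul_assoc]
    exact congrArg (· * _) (hT' k)
  have hF : ∀ k : U →ₐ[K] B, (letters.map k).toLetters.F = k (x F) := fun k => by
    have h2 := (letters.map k).f_eq
    have h3 : (letters.map k).q * (letters.map k).F = k (T (1 / 2)) * k (x F) := by
      rw [← map_mul]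
      have h4 := congrArg k (show T (1 / 2) * x F = f + (cst (1 / 2) * hbar) • (e * b) -
        (cst (1 / 8) * hbar) • ((T 1 * T 1 - 1) * e) by rw [f]; abel)
      have h5 : (letters.map k).f = k f := rfl
      have h6 : (letters.map k).e = k e := rfl
      have h7 : (letters.map k).b = k b := rfl
      have h8 : (letters.map k).T = k (T 1) := hT k
      rw [h5, h6, h7, h8] at h2
      rw [h4, map_sub, map_add, h2, map_smul, map_smul, map_mul, map_mul, map_sub, map_mul, map_one]
      abel
    have h4 : (letters.map k).q = k (T (1 / 2)) := hq k
    rw [h4] at h3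
    have h5 : k (T (-(1 / 2))) * k (T (1 / 2)) = 1 := by
      rw [← map_mul, T_neg_mul_T, map_one]
    have h6 := congrArg (k (T (-(1 / 2))) * ·) h3
    simp only [← mul_assoc, h5, one_mul] at h6
    exact h6
  -- Through `x_F_eq` and the group-likeness of T, the coproduct of F takes the shape of the left
  -- side of `OspPair.comul_F`.
  have h2 : conv h (x F) = (pair h).L₁.p * (pair h).L₂.p * ((pair h).f +
      (1 / 2 : ℂ) • ((pair h).L₁.h * ((pair h).e * (pair h).b)) - (1 / 8 : ℂ) • ((pair h).L₁.h *
        (((pair h).L₁.T * (pair h).L₁.T * ((pair h).L₂.T * (pair h).L₂.T) - 1) * (pair h).e))) := by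
    rw [x_F_eq, map_mul, conv_T hX, pair_f, pair_e, pair_b, pair_h, ← conv_e h, ← conv_b h,
      ← conv_f h]
    have h3 : (pair h).L₁.T * (pair h).L₁.T * ((pair h).L₂.T * (pair h).L₂.T) =
        conv h (T 1 * T 1) := by
      change (letters.map i).toLetters.T * (letters.map i).toLetters.T *
        ((letters.map j).toLetters.T * (letters.map j).toLetters.T) = _
      rw [hT, hT, ← map_mul, ← map_mul, ← T_add, conv_T hX]
    rw [h3]
    simp only [← Algebra.smul_def, complex_smul, smul_smul]
    simp only [map_add, map_sub, map_smul, map_mul, map_one]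
    change _ = (letters.map i).toLetters.p * (letters.map j).toLetters.p * _
    rw [hp, hp]
  rw [h2, h1]
  change (letters.map i).toLetters.F * (letters.map j).toLetters.q +
    (letters.map i).toLetters.p * (letters.map j).toLetters.F +
    cst (1 / 4) • ((pair h).L₁.h * ((letters.map i).toLetters.T' * (letters.map i).toLetters.E *
      ((letters.map j).toLetters.p * (letters.map j).toLetters.H +
        (letters.map j).toLetters.H * (letters.map j).toLetters.p))) -
    cst (1 / 4) • ((pair h).L₁.h * (((letters.map i).toLetters.q * (letters.map i).toLetters.H +
      (letters.map i).toLetters.H * (letters.map i).toLetters.q) *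
        ((letters.map j).toLetters.T * (letters.map j).toLetters.E))) = _
  rw [hF, hF, hq, hq, hp, hp, hE, hE, hH, hH, hT, hT', pair_h, ← Algebra.smul_def,
    ← Algebra.smul_def, smul_smul, smul_smul]
  simp only [map_mul, map_add]

end Conv

end Osp

end Jordanian
namespace Jordanian

open Superalgebra

/-! ### Associativity of the convolution -/

namespace Osp

open OspGen

/-- On e both bracketings agree because T is group-like. On f both give the terms -h b ⊗ T² e ⊗ T,
-h b ⊗ T² ⊗ T² e and -h 1 ⊗ b ⊗ T² e in addition to the diagonal ones. -/
theorem conv_assoc {B : Type*} [Ring B] [Algebra K B] [IsAdicComplete hIdeal B]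
    {i j k m n : U →ₐ[K] B} (hij : SuperCommute i j) (hjk : SuperCommute j k)
    (hm : ∀ a, m a = conv hij a) (hn : ∀ a, n a = conv hjk a) (hmk : SuperCommute m k)
    (hin : SuperCommute i n) (hX : conv hjk (x X) = j (x X) + k (x X)) :
    conv hmk = conv hin := by
  have hT : ∀ s, n (T s) = j (T s) * k (T s) := fun s => by rw [hn, conv_T hX]
  refine algHom_ext ?_ ?_
  · rw [conv_e, conv_e, hT, hm, hn, conv_e, conv_e, add_mul, mul_assoc, add_assoc]
  · have h1 : k (T 2) * k (T (-1)) = k (T 1) := by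
      rw [← map_mul, ← T_add]
      norm_num
    have h2 : k (T 2) * j e = j e * k (T 2) := hjk.right_even (parity_T _) _
    rw [conv_f, conv_f, map_mul n, hT, hT, hm, hm, hn, hn, conv_f, conv_f, conv_b, conv_e]
    simp only [map_mul, add_mul, sub_mul, mul_add, smul_add, mul_assoc, smul_mul_assoc]
    rw [← mul_assoc (k (T 2)) (j e), h2, mul_assoc (j e), h1]
    abel

theorem isAdicComplete : IsAdicComplete hIdeal U := presentation.isAdicComplete_alg

/-! ### The coproduct -/

/-- The coproduct of `U_h(osp(1|2))`. -/
noncomputable def comul : U →ₐ[K] Tensor2 hIdeal U := conv superCommute_ι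

theorem comul_X' : conv (superCommute_ι (A := U)) (x X) = ι₁ U (x X) + ι₂ U (x X) :=
  conv_X torsionFree_tensor superCommute_ι

theorem comul_e : comul e = ι₁ U e * ι₂ U (T (-1)) + ι₂ U e := conv_e _

theorem comul_f :
    comul f = ι₁ U f * ι₂ U (T 1) + ι₂ U f - hbar • (ι₁ U b * ι₂ U (T 2 * e)) := conv_f _

theorem comul_T (s : ℂ) : comul (T s) = ι₁ U (T s) * ι₂ U (T s) := conv_T comul_X' s

theorem comul_X : comul (x X) = tens (x X) 1 + tens 1 (x X) := by
  rw [tens_eq, tens_eq, map_one, map_one, one_mul, mul_one]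
  exact comul_X'

theorem comul_H : comul (x H) = tens (x H) (T 1) + tens (T (-1)) (x H) := by
  rw [tens_eq, tens_eq]
  exact conv_H comul_X'

theorem comul_E : comul (x E) = tens (x E) (T (-1 / 2)) + tens (T (1 / 2)) (x E) := by
  rw [tens_eq, tens_eq]
  exact conv_E comul_X'

theorem comul_Y : comul (x Y) = tens (x Y) (T 1) + tens (T (-1)) (x Y) := by
  rw [tens_eq, tens_eq]
  exact conv_Y comul_X'

theorem comul_F : comul (x F) = tens (x F) (T (1 / 2)) + tens (T (-1 / 2)) (x F) +
    (cst (1 / 4) * hbar) • tens (T (-1) * x E) (T (-1 / 2) * x H + x H * T (-1 / 2)) -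
    (cst (1 / 4) * hbar) • tens (T (1 / 2) * x H + x H * T (1 / 2)) (T 1 * x E) := by
  rw [tens_eq, tens_eq, tens_eq, tens_eq]
  exact conv_F comul_X'

/-- Twisting both embeddings by the parity changes the signs of e and f on each side of the
formulas, which is the effect of the parity on the argument. -/
theorem parity_comul (a : U) : parity (R := K) (comul a) = comul (parity (R := K) a) := by
  have h := (superCommute_ι (A := U)).comp (parity (R := K) (A := Tensor2 hIdeal U))
  have h1 : SuperCommute ((ι₁ U).comp (parity (R := K))) ((ι₂ U).comp (parity (R := K))) :=
    h.congr parity_ι₁ parity_ι₂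
  refine (map_conv superCommute_ι (parity (R := K) (A := Tensor2 hIdeal U)) a).trans ?_
  rw [conv_congr h h1 parity_ι₁ parity_ι₂]
  exact conv_parity superCommute_ι h1 a

theorem leg12Hom_comul (a : U) : leg12Hom U (comul a) = conv superCommute_j₁_j₂ a :=
  (map_conv _ _ a).trans
    (DFunLike.congr_fun (conv_congr _ _ leg12Hom_ι₁ leg12Hom_ι₂) a)

theorem leg23Hom_comul (a : U) : leg23Hom U (comul a) = conv superCommute_j₂_j₃ a :=
  (map_conv _ _ a).trans
    (DFunLike.congr_fun (conv_congr _ _ leg23Hom_ι₁ leg23Hom_ι₂) a)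

theorem conv_j₂_j₃_X : conv superCommute_j₂_j₃ (x X) = j₂ U (x X) + j₃ U (x X) := by
  rw [← leg23Hom_comul]
  refine (congrArg (leg23Hom U) comul_X').trans ?_
  rw [map_add, leg23Hom_ι₁, leg23Hom_ι₂]

/-- Both sides are threefold convolutions of the embeddings of U_h into the tensor cube, bracketed
in the two possible ways. -/
theorem coassoc (a : U) : comulTensorId comul.toLinearMap (comul a) =
    idTensorComul comul.toLinearMap (comul a) := by
  rw [comulTensorId_eq comul parity_comul, idTensorComul_eq comul parity_comul]
  refine (map_conv _ (comulTensorIdHom comul parity_comul) a).trans (Eq.trans ?_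
    (map_conv _ (idTensorComulHom comul parity_comul) a).symm)
  have h1 : SuperCommute ((comulTensorIdHom comul parity_comul).comp (ι₁ U)) (j₃ U) :=
    (superCommute_ι.comp (comulTensorIdHom comul parity_comul)).congr (fun _ => rfl)
      (comulTensorIdHom_ι₂ comul parity_comul)
  have h2 : SuperCommute (j₁ U) ((idTensorComulHom comul parity_comul).comp (ι₂ U)) :=
    (superCommute_ι.comp (idTensorComulHom comul parity_comul)).congr
      (idTensorComulHom_ι₁ comul parity_comul) (fun _ => rfl)
  rw [conv_congr (superCommute_ι.comp (comulTensorIdHom comul parity_comul)) h1 (fun _ => rfl)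
      (comulTensorIdHom_ι₂ comul parity_comul),
    conv_congr (superCommute_ι.comp (idTensorComulHom comul parity_comul)) h2
      (idTensorComulHom_ι₁ comul parity_comul) (fun _ => rfl)]
  exact DFunLike.congr_fun (conv_assoc superCommute_j₁_j₂ superCommute_j₂_j₃
    (fun a => (comulTensorIdHom_ι₁ comul parity_comul a).trans (leg12Hom_comul a))
    (fun a => (idTensorComulHom_ι₂ comul parity_comul a).trans (leg23Hom_comul a)) h1 h2
    conv_j₂_j₃_X) a

/-! ### The counit -/

theorem exists_counit : ∃ ε : U →ₐ[K] K, ε e = 0 ∧ ε f = 0 ∧ ε b = 0 :=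
  exists_algHom (by simp) (by simp) (by simp)

/-- The counit of `U_h(osp(1|2))`. -/
noncomputable def counit : U →ₐ[K] K := exists_counit.choose

theorem counit_e : counit e = 0 := exists_counit.choose_spec.1

theorem counit_f : counit f = 0 := exists_counit.choose_spec.2.1

theorem counit_b : counit b = 0 := exists_counit.choose_spec.2.2

theorem counit_X : counit (x X) = 0 := by
  rw [x_X, map_hlog, map_mul, counit_e, mul_zero, hlog, zero_mul]

theorem counit_T (s : ℂ) : counit (T s) = 1 := by
  rw [T_eq, map_hexp, map_smul, counit_X, smul_zero, hexp_zero]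

theorem counit_H : counit (x H) = 0 := by rw [x_H, map_mul, counit_b, mul_zero]

theorem counit_E : counit (x E) = 0 := by rw [x_E, map_mul, counit_e, mul_zero]

theorem counit_F : counit (x F) = 0 := by
  rw [x_F, map_sub, map_mul, map_mul, counit_E, mul_zero, zero_mul, sub_zero]

theorem counit_Y : counit (x Y) = 0 := by
  have h : counit (T 1 * x Y) = 0 := by
    rw [T_mul_Y, map_add, map_add, map_neg, map_mul, map_smul, map_smul, map_mul, map_sub, map_one,
      counit_T, counit_f, counit_b]
    simp
  rwa [map_mul, counit_T, one_mul] at h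

theorem counit_parity (a : U) : counit (parity (R := K) a) = counit a := by
  have h : counit.comp (parity (R := K)) = counit := algHom_ext
    (by rw [AlgHom.comp_apply, parity_e, map_neg, counit_e, neg_zero])
    (by rw [AlgHom.comp_apply, parity_f, map_neg, counit_f, neg_zero])
  exact DFunLike.congr_fun h a

/-- The counit axioms follow from this by `map_conv`: the map ε ⊗ id is a homomorphism which turns
the first embedding into the counit. -/
theorem conv_of_left_counit {B : Type*} [Ring B] [Algebra K B] [IsAdicComplete hIdeal B]
    {i j : U →ₐ[K] B} (h : SuperCommute i j) (hi : ∀ a, i a = algebraMap K B (counit a)) :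
    conv h = j :=
  algHom_ext
    (by rw [conv_e, hi, counit_e, map_zero, zero_mul, zero_add])
    (by rw [conv_f, hi, hi, counit_f, counit_b, map_zero, zero_mul, zero_mul, smul_zero, zero_add,
      sub_zero])

theorem conv_of_right_counit {B : Type*} [Ring B] [Algebra K B] [IsAdicComplete hIdeal B]
    {i j : U →ₐ[K] B} (h : SuperCommute i j) (hj : ∀ a, j a = algebraMap K B (counit a)) :
    conv h = i :=
  algHom_ext
    (by rw [conv_e, hj, hj, counit_e, counit_T, map_zero, map_one, mul_one, add_zero])
    (by rw [conv_f, hj, hj, hj, map_mul, counit_f, counit_e, counit_T, mul_zero, map_zero, map_one,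
      mul_one, mul_zero, smul_zero, add_zero, sub_zero])

theorem superCommute_counit_left :
    SuperCommute ((Algebra.ofId K U).comp counit) (AlgHom.id K U) := fun a c =>
  ⟨fun _ => (Algebra.commutes (counit a) c).symm, fun _ => by
    simp only [AlgHom.comp_apply, counit_parity]
    exact (Algebra.commutes (counit a) c).symm⟩

theorem counit_comul (a : U) : Compl.map hIdeal (counitLeft counit.toLinearMap) (comul a) =
    Compl.of hIdeal U a := by
  let ψ := superLift _ _ superCommute_counit_left
  have h : ∀ z, ψ z = counitLeft counit.toLinearMap z :=
    linearMap_ext_stmul (f := ψ.toLinearMap) fun a c => by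
      rw [counitLeft_stmul]
      exact (Algebra.smul_def (counit a) c).symm
  rw [complMap_eq ψ _ h]
  have h1 : ∀ c, complMap ψ (ι₁ U c) = algebraMap K _ (counit c) := fun c => by
    refine (complMap_toCompl _ _).trans ((congrArg _ (superLift_inl _ _ _ c)).trans ?_)
    exact (toCompl U).commutes _
  have h2 : ∀ c, complMap ψ (ι₂ U c) = toCompl U c := fun c =>
    (complMap_toCompl _ _).trans (congrArg _ (superLift_inr _ _ _ c))
  exact (map_conv _ (complMap ψ) a).trans ((DFunLike.congr_fun (conv_of_left_counit _ h1) a).trans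
    (h2 a))

theorem comul_counit (a : U) : Compl.map hIdeal (counitRight counit.toLinearMap) (comul a) =
    Compl.of hIdeal U a := by
  let ψ := superLift _ _ superCommute_counit_left.symm
  have h : ∀ z, ψ z = counitRight counit.toLinearMap z :=
    linearMap_ext_stmul (f := ψ.toLinearMap) fun a c => by
      rw [counitRight_stmul]
      exact (Algebra.commutes (counit c) a).symm.trans (Algebra.smul_def (counit c) a).symm
  rw [complMap_eq ψ _ h]
  have h1 : ∀ c, complMap ψ (ι₁ U c) = toCompl U c := fun c =>
    (complMap_toCompl _ _).trans (congrArg _ (superLift_inl _ _ _ c))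
  have h2 : ∀ c, complMap ψ (ι₂ U c) = algebraMap K _ (counit c) := fun c => by
    refine (complMap_toCompl _ _).trans ((congrArg _ (superLift_inr _ _ _ c)).trans ?_)
    exact (toCompl U).commutes _
  exact (map_conv _ (complMap ψ) a).trans ((DFunLike.congr_fun (conv_of_right_counit _ h2) a).trans
    (h1 a))

end Osp

end Jordanian
namespace Jordanian

open Superalgebra

/-! ### The antipode in terms of the letters -/

namespace OspLetters

variable {A : Type*} [Ring A] [Algebra ℂ A] (L : OspLetters A)

/-- The antipode of `e`. -/
def antiE : A := -(L.e * (L.q * L.q))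

/-- The antipode of `b`. -/
def antiB : A := -(L.b * (L.p * (L.p * (L.p * L.p))))

/-- The antipode of `f`. -/
def antiF : A := -(L.f * (L.p * L.p)) - L.h * (L.b * (L.e * (L.p * L.p)))

/-- Applying a super-antihomomorphism S to f e = -e f - b reverses the products and adds a sign for
each pair of odd factors; the result is this identity. -/
theorem antiE_mul_antiF : L.antiE * L.antiF = -(L.antiF * L.antiE) + L.antiB := by
  simp only [antiE, antiB, antiF, L.rules, smul_expand A]
  module

theorem antiE_mul_antiB : L.antiE * L.antiB = L.antiB * L.antiE + L.antiE := by
  simp only [antiE, antiB, antiF, L.rules, smul_expand A]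
  module

theorem antiB_mul_antiF : L.antiB * L.antiF = L.antiF * L.antiB + L.antiF := by
  simp only [antiE, antiB, antiF, L.rules, smul_expand A]
  module

theorem antipode_F : (L.antiF + (1 / 2 : ℂ) • (L.h * (L.antiB * L.antiE)) - (1 / 8 : ℂ) • (L.h *
      (L.antiE * (L.p * (L.p * (L.p * L.p)) - 1)))) * L.q =
    -L.F - (1 / 2 : ℂ) • (L.h * ((L.T + L.T') * L.E)) := by
  simp only [antiE, antiB, antiF, F, T, T', E, L.rules, smul_expand A]
  module

/-- The summand -f² of T Y contributes +S(f)², since reversing two odd factors costs a sign. The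
fourth power of p is S(T²) = T⁻², and the last factor is S(T⁻¹). -/
theorem antipode_Y : (L.antiF * L.antiF + (1 / 2 : ℂ) • (L.h * (L.antiB * L.antiB)) +
      (1 / 8 : ℂ) • (L.h * (L.p * (L.p * (L.p * L.p)) - 1))) * (L.q * L.q) =
    -L.Y - L.h * L.H + L.h * (L.h * L.E ^ 2) := by
  simp only [antiE, antiB, antiF, Y, H, E, L.rules, smul_expand A]
  module

theorem antipode_H : L.antiB * (L.q * L.q) = -L.H + (2 : ℂ) • (L.h * L.E ^ 2) := by
  simp only [antiE, antiB, antiF, H, E, L.rules, smul_expand A]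
  module

end OspLetters

/-! ### Exponentials in the opposite algebra -/

section Op

variable {B : Type*} [Ring B] [Algebra K B] [IsAdicComplete hIdeal B]

instance : IsAdicComplete hIdeal Bᵐᵒᵖ := isAdicComplete_of_linearEquiv (MulOpposite.opLinearEquiv K)

theorem hexp_op (z : B) : hexp (MulOpposite.op z) = MulOpposite.op (hexp z) :=
  HMod.eq fun n => by
    refine (hMod_psEval (MulOpposite.op z) (PowerSeries.exp ℂ) n).symm.trans (HMod.trans
      (HMod.of_eq ?_) ((hMod_psEval z (PowerSeries.exp ℂ) n).map
        (MulOpposite.opLinearEquiv K).toLinearMap))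
    rw [map_sum]
    refine Finset.sum_congr rfl fun k _ => ?_
    rw [map_smul]
    exact congrArg _ (MulOpposite.op_pow z k).symm

end Op

namespace Osp

open OspGen

/-! ### The antipode -/

/-- A square root i of -1 removes the signs from the antipode: if S(a c) = (-1)^(|a||c|) S(c) S(a),
then the map equal to S on even and to i S on odd elements is an ordinary antihomomorphism.
Conversely S is recovered by first multiplying odd elements by -i. -/
theorem cst_I_mul_cst_I : cst Complex.I * cst Complex.I = -1 := by
  rw [← cst_mul, Complex.I_mul_I, cst_neg, cst_one]

theorem cst_I_smul (a : U) : cst Complex.I • cst Complex.I • a = -a := by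
  rw [smul_smul, cst_I_mul_cst_I, neg_one_smul]

/-- The map which is the identity on the even part and the multiplication by `-i` on the odd
part. -/
noncomputable def twist : U →ₗ[K] U :=
  cst (1 / 2) • (LinearMap.id + (parity (R := K)).toLinearMap) -
    (cst Complex.I * cst (1 / 2)) • (LinearMap.id - (parity (R := K)).toLinearMap)

theorem twist_apply (a : U) : twist a = cst (1 / 2) • (a + parity (R := K) a) -
    (cst Complex.I * cst (1 / 2)) • (a - parity (R := K) a) := rfl

theorem twist_even {a : U} (ha : parity (R := K) a = a) : twist a = a := by
  rw [twist_apply, ha, sub_self, smul_zero, sub_zero, cst_half_smul_add]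

theorem twist_odd {a : U} (ha : parity (R := K) a = -a) : twist a = -(cst Complex.I • a) := by
  rw [twist_apply, ha, add_neg_cancel, smul_zero, zero_sub, sub_neg_eq_add, mul_smul,
    cst_half_smul_add]

theorem twist_mul_even (a : U) {c : U} (hc : parity (R := K) c = c) :
    twist (a * c) = twist a * c := by
  rw [twist_apply, twist_apply, map_mul, hc, sub_mul, smul_mul_assoc, smul_mul_assoc, sub_mul,
    add_mul]

theorem twist_even_mul (a : U) {c : U} (hc : parity (R := K) c = c) :
    twist (c * a) = c * twist a := by
  rw [twist_apply, twist_apply, map_mul, hc, mul_sub, mul_smul_comm, mul_smul_comm, mul_sub,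
    mul_add]

theorem twist_mul_odd (a : U) {c : U} (hc : parity (R := K) c = -c) :
    twist (a * c) = twist (parity (R := K) a) * twist c := by
  obtain ⟨a₀, a₁, rfl, h₀, h₁⟩ := exists_even_add_odd a
  have h2 : parity (R := K) (a₁ * c) = a₁ * c := by rw [map_mul, h₁, hc, neg_mul_neg]
  rw [map_add, h₀, h₁, add_mul, map_add, map_add, twist_even_mul c h₀, twist_even h2,
    twist_even h₀, map_neg, twist_odd h₁, neg_neg, twist_odd hc, add_mul, mul_neg, mul_neg,
    mul_smul_comm, smul_mul_smul_comm, cst_I_mul_cst_I, neg_one_smul, neg_neg]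

theorem twist_odd_mul (a : U) {c : U} (hc : parity (R := K) c = -c) :
    twist (c * a) = twist c * twist (parity (R := K) a) := by
  obtain ⟨a₀, a₁, rfl, h₀, h₁⟩ := exists_even_add_odd a
  have h2 : parity (R := K) (c * a₁) = c * a₁ := by rw [map_mul, h₁, hc, neg_mul_neg]
  rw [map_add, h₀, h₁, mul_add, map_add, map_add, twist_mul_even c h₀, twist_even h2,
    twist_even h₀, map_neg, twist_odd h₁, neg_neg, twist_odd hc, mul_add, neg_mul, neg_mul,
    smul_mul_smul_comm, cst_I_mul_cst_I, neg_one_smul, neg_neg]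

theorem twist_parity (a : U) : twist (parity (R := K) a) = parity (R := K) (twist a) := by
  rw [twist_apply, twist_apply, map_sub, map_smul, map_smul, map_add, map_sub, parity_parity]

/-- The value of the antipode at `e`. -/
noncomputable def antiE : U := -(e * T 1)

/-- The value of the antipode at `b`. -/
noncomputable def antiB : U := -(b * T (-2))

/-- The value of the antipode at `f`. -/
noncomputable def antiF : U := -(f * T (-1)) - hbar • (b * (e * T (-1)))

theorem T_neg_two : T (-2) = letters.p * (letters.p * (letters.p * letters.p)) := by
  rw [letters_p, ← T_add, ← T_add, ← T_add]
  congr 1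
  norm_num

theorem antiE_eq : letI := complexAlgebra U
    letters.toLetters.antiE = antiE := by
  rw [antiE, T_one]
  rfl

theorem antiB_eq : letI := complexAlgebra U
    letters.toLetters.antiB = antiB := by
  rw [antiB, T_neg_two]
  rfl

theorem antiF_eq : letI := complexAlgebra U
    letters.toLetters.antiF = antiF := by
  rw [antiF, T_neg_one, Algebra.smul_def, ← letters.h_eq]
  rfl

theorem antiE_mul_antiF : antiE * antiF = -(antiF * antiE) + antiB := by
  letI := complexAlgebra U
  rw [← antiE_eq, ← antiF_eq, ← antiB_eq]
  exact letters.toLetters.antiE_mul_antiF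

theorem antiE_mul_antiB : antiE * antiB = antiB * antiE + antiE := by
  letI := complexAlgebra U
  rw [← antiE_eq, ← antiB_eq]
  exact letters.toLetters.antiE_mul_antiB

theorem antiB_mul_antiF : antiB * antiF = antiF * antiB + antiF := by
  letI := complexAlgebra U
  rw [← antiF_eq, ← antiB_eq]
  exact letters.toLetters.antiB_mul_antiF

/-- Each of e and f carries one factor i, so the product of the two gains the sign -1 that separates
the identities for S from the classical relations in the opposite algebra. -/
theorem exists_antiHom : ∃ φ : U →ₐ[K] Uᵐᵒᵖ, φ e = MulOpposite.op (cst Complex.I • antiE) ∧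
    φ f = MulOpposite.op (cst Complex.I • antiF) ∧ φ b = MulOpposite.op antiB := by
  refine exists_algHom ?_ ?_ ?_
  · rw [← MulOpposite.op_mul, ← MulOpposite.op_mul, ← MulOpposite.op_neg, ← MulOpposite.op_sub,
      smul_mul_smul_comm, smul_mul_smul_comm, cst_I_mul_cst_I, neg_one_smul, neg_one_smul,
      antiE_mul_antiF]
    congr 1
    abel
  · rw [← MulOpposite.op_mul, ← MulOpposite.op_mul, ← MulOpposite.op_add, smul_mul_assoc,
      mul_smul_comm, antiE_mul_antiB, smul_add]
  · rw [← MulOpposite.op_mul, ← MulOpposite.op_mul, ← MulOpposite.op_add, smul_mul_assoc,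
      mul_smul_comm, antiB_mul_antiF, smul_add]

/-- The antihomomorphism which maps `e`, `f`, `b` to `i S(e)`, `i S(f)`, `S(b)`. -/
noncomputable def antiHom : U →ₐ[K] Uᵐᵒᵖ := exists_antiHom.choose

theorem antiHom_e : antiHom e = MulOpposite.op (cst Complex.I • antiE) :=
  exists_antiHom.choose_spec.1

theorem antiHom_f : antiHom f = MulOpposite.op (cst Complex.I • antiF) :=
  exists_antiHom.choose_spec.2.1

theorem antiHom_b : antiHom b = MulOpposite.op antiB := exists_antiHom.choose_spec.2.2

/-- The antipode of `U_h(osp(1|2))`. -/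
noncomputable def antipode : U →ₗ[K] U :=
  (MulOpposite.opLinearEquiv K).symm.toLinearMap ∘ₗ antiHom.toLinearMap ∘ₗ twist

theorem antipode_apply (a : U) : antipode a = MulOpposite.unop (antiHom (twist a)) := rfl

theorem antipode_mul_even (a : U) {c : U} (hc : parity (R := K) c = c) :
    antipode (a * c) = antipode c * antipode a := by
  rw [antipode_apply, antipode_apply, antipode_apply, twist_mul_even a hc, twist_even hc, map_mul,
    MulOpposite.unop_mul]

theorem antipode_even_mul (a : U) {c : U} (hc : parity (R := K) c = c) :
    antipode (c * a) = antipode a * antipode c := by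
  rw [antipode_apply, antipode_apply, antipode_apply, twist_even_mul a hc, twist_even hc, map_mul,
    MulOpposite.unop_mul]

theorem antipode_mul_odd (a : U) {c : U} (hc : parity (R := K) c = -c) :
    antipode (a * c) = antipode c * antipode (parity (R := K) a) := by
  rw [antipode_apply, antipode_apply, antipode_apply, twist_mul_odd a hc, map_mul,
    MulOpposite.unop_mul]

theorem antipode_odd_mul (a : U) {c : U} (hc : parity (R := K) c = -c) :
    antipode (c * a) = antipode (parity (R := K) a) * antipode c := by
  rw [antipode_apply, antipode_apply, antipode_apply, twist_odd_mul a hc, map_mul,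
    MulOpposite.unop_mul]

theorem antipode_one : antipode 1 = 1 := by
  rw [antipode_apply, twist_even (map_one _), map_one, MulOpposite.unop_one]

theorem antipode_e : antipode e = antiE := by
  rw [antipode_apply, twist_odd parity_e, map_neg, map_smul, antiHom_e, MulOpposite.unop_neg,
    MulOpposite.unop_smul, MulOpposite.unop_op, cst_I_smul, neg_neg]

theorem antipode_f : antipode f = antiF := by
  rw [antipode_apply, twist_odd parity_f, map_neg, map_smul, antiHom_f, MulOpposite.unop_neg,
    MulOpposite.unop_smul, MulOpposite.unop_op, cst_I_smul, neg_neg]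

theorem antipode_b : antipode b = antiB := by
  rw [antipode_apply, twist_even parity_b, antiHom_b, MulOpposite.unop_op]

theorem antiHom_e_mul_e : antiHom (e * e) = MulOpposite.op (-(e * e * T 2)) := by
  have h : T 2 = T 1 * T 1 := by rw [← T_add]; norm_num
  rw [map_mul, antiHom_e, ← MulOpposite.op_mul, smul_mul_smul_comm, cst_I_mul_cst_I, neg_one_smul,
    antiE, neg_mul_neg, h, mul_assoc e (T 1), ← mul_assoc (T 1) e, ← (commute_e_T 1).eq]
  simp only [mul_assoc]

/-- The same device as for Δ(X): the image of T⁻² is computed to be T², and logarithms of commuting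
elements are compared. -/
theorem antiHom_X : antiHom (x X) = MulOpposite.op (-x X) := by
  have hc : Commute (antiHom (x X)) (MulOpposite.op (-x X)) := by
    rw [x_X, map_hlog, ← x_X]
    refine commute_hlog_left ?_
    rw [antiHom_e_mul_e]
    exact ((commute_e_mul_e_X.mul_left (commute_T_X 2)).neg_left.neg_right).op
  have htf : ∀ z : Uᵐᵒᵖ, hbar • z = 0 → z = 0 := fun z hz =>
    MulOpposite.unop_injective (torsionFree _ (congrArg MulOpposite.unop hz))
  have h3 : cst (-2) • antiHom (x X) = cst (-2) • MulOpposite.op (-x X) := by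
    refine eq_of_hexp_eq htf ((hc.smul_left _).smul_right _) ?_
    rw [← map_smul, ← map_hexp, ← T_eq, ← MulOpposite.op_smul, hexp_op, smul_neg, ← neg_smul,
      ← cst_neg, neg_neg, ← T_eq]
    have h1 : T (-2) = 1 - (cst 2 * hbar) • (e * e) := by rw [hbar_smul_e_mul_e, sub_sub_cancel]
    rw [h1, map_sub, map_one, map_smul, antiHom_e_mul_e, ← MulOpposite.op_one,
      ← MulOpposite.op_smul, ← MulOpposite.op_sub, smul_neg, ← smul_mul_assoc, hbar_smul_e_mul_e,
      sub_mul, one_mul, T_neg_mul_T]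
    congr 1
    abel
  have h2 : IsUnit (cst (-2)) :=
    (isUnit_iff_ne_zero.mpr (neg_ne_zero.mpr two_ne_zero)).map PowerSeries.C
  exact h2.smul_left_cancel.mp h3

theorem antipode_X : antipode (x X) = -x X := by
  rw [antipode_apply, twist_even parity_X, antiHom_X, MulOpposite.unop_op]

theorem antipode_T (s : ℂ) : antipode (T s) = T (-s) := by
  rw [antipode_apply, twist_even (parity_T s), T_eq, map_hexp, map_smul, antiHom_X,
    ← MulOpposite.op_smul, hexp_op, MulOpposite.unop_op, T_eq, cst_neg, neg_smul, smul_neg]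

theorem letters_T : letters.T = T 1 := T_one.symm

theorem letters_T' : letters.T' = T (-1) := T_neg_one.symm

theorem letters_E : letters.E = x E := by
  rw [x_E, ← letters_q]
  rfl

theorem letters_H : letters.H = x H := by
  rw [x_H, T_neg_one, mul_assoc]
  rfl

theorem letters_Y : letters.Y = x Y := by
  have h : T 1 * letters.Y = T 1 * x Y := by
    rw [T_mul_Y, ← letters_T, letters.T_mul_Y, letters_T, ← T_add, one_add_one_eq_two]
    rfl
  have h1 := congrArg (T (-1) * ·) h
  simpa only [← mul_assoc, T_neg_mul_T, one_mul] using h1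

theorem letters_F : letters.F = x F := by
  have h : T (1 / 2) * letters.F = T (1 / 2) * x F := by
    have h1 := letters.f_eq
    rw [letters_T, letters_q] at h1
    have h2 : letters.f = f := rfl
    have h3 : letters.e = e := rfl
    have h4 : letters.b = b := rfl
    rw [h2, h3, h4, f] at h1
    simpa using h1.symm
  have h1 := congrArg (T (-(1 / 2)) * ·) h
  simpa only [← mul_assoc, T_neg_mul_T, one_mul] using h1

theorem antipode_H : antipode (x H) = -x H + (cst 2 * hbar) • x E ^ 2 := by
  letI := complexAlgebra U
  have h := letters.toLetters.antipode_H
  rw [antiB_eq, letters.h_eq, ← Algebra.smul_def, complex_smul, smul_smul] at h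
  have h1 : letters.toLetters.E = x E := letters_E
  have h2 : letters.toLetters.H = x H := letters_H
  have h3 : letters.toLetters.q * letters.toLetters.q = T 1 := T_one.symm
  rw [h1, h2, h3] at h
  rw [← h]
  nth_rewrite 1 [x_H]
  rw [antipode_even_mul _ (parity_T _), antipode_T, antipode_b, neg_neg]

theorem antipode_E : antipode (x E) = -x E := by
  have h : T 1 * T (-(1 / 2)) = T (1 / 2) := by rw [← T_add]; norm_num
  rw [x_E, antipode_even_mul _ (parity_T _), antipode_T, antipode_e, antiE, neg_mul, mul_assoc, h,
    (commute_e_T _).eq]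

theorem antipode_F :
    antipode (x F) = -x F - (cst (1 / 2) * hbar) • ((T 1 + T (-1)) * x E) := by
  letI := complexAlgebra U
  have h := letters.toLetters.antipode_F
  have h1 : letters.toLetters.E = x E := letters_E
  have h2 : letters.toLetters.F = x F := letters_F
  have h3 : letters.toLetters.q = T (1 / 2) := letters_q
  have h4 : letters.toLetters.T = T 1 := letters_T
  have h5 : letters.toLetters.T' = T (-1) := letters_T'
  have h6 : letters.toLetters.p * (letters.toLetters.p * (letters.toLetters.p *
    letters.toLetters.p)) = T (-2) := T_neg_two.symm
  rw [antiB_eq, antiE_eq, antiF_eq, letters.h_eq, h1, h2, h3, h4, h5, h6] at h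
  simp only [← Algebra.smul_def, complex_smul, smul_smul] at h
  have h7 : parity (R := K) (T 1 * T 1 - 1) = T 1 * T 1 - 1 := by
    rw [map_sub, map_mul, parity_T, map_one]
  have h8 : T (-1) * T (-1) = T (-2) := by rw [← T_add]; norm_num
  rw [← h]
  nth_rewrite 1 [x_F_eq]
  rw [antipode_even_mul _ (parity_T _), antipode_T, map_sub, map_add, map_smul, map_smul,
    antipode_even_mul _ h7, antipode_mul_even _ parity_b, map_sub, antipode_even_mul _ (parity_T _),
    antipode_one, antipode_T, antipode_e, antipode_f, antipode_b, h8, neg_div, neg_neg]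

theorem antipode_Y : antipode (x Y) = -x Y - hbar • x H + hbar ^ 2 • x E ^ 2 := by
  letI := complexAlgebra U
  have h := letters.toLetters.antipode_Y
  have h1 : letters.toLetters.E = x E := letters_E
  have h2 : letters.toLetters.H = x H := letters_H
  have h3 : letters.toLetters.q * letters.toLetters.q = T 1 := T_one.symm
  have h4 : letters.toLetters.Y = x Y := letters_Y
  have h6 : letters.toLetters.p * (letters.toLetters.p * (letters.toLetters.p *
    letters.toLetters.p)) = T (-2) := T_neg_two.symm
  rw [antiB_eq, antiF_eq, letters.h_eq, h1, h2, h3, h4, h6] at h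
  simp only [← Algebra.smul_def, complex_smul, smul_smul] at h
  have h5 : x Y = T (-1) * (T 1 * x Y) := by rw [← mul_assoc, T_neg_mul_T, one_mul]
  rw [pow_two hbar, ← h]
  nth_rewrite 1 [h5]
  rw [antipode_even_mul _ (parity_T _), antipode_T, neg_neg, T_mul_Y, map_add, map_add, map_neg,
    map_smul, map_smul, map_sub, antipode_T, antipode_one, antipode_mul_even _ parity_b,
    antipode_mul_odd _ parity_f, parity_f, map_neg, antipode_f, antipode_b, mul_neg, neg_neg]

theorem antipode_parity (a : U) :
    antipode (parity (R := K) a) = parity (R := K) (antipode a) := by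
  have hT := parity_T
  have h : antiHom.comp (parity (R := K)) =
      (AlgHom.op (parity (R := K) (A := U))).comp antiHom := by
    refine algHom_ext ?_ ?_
    · rw [AlgHom.comp_apply, AlgHom.comp_apply, parity_e, map_neg, antiHom_e]
      refine (MulOpposite.op_neg _).symm.trans (congrArg MulOpposite.op ?_)
      change _ = parity (R := K) (cst Complex.I • antiE)
      rw [map_smul, antiE, map_neg, map_mul, parity_e, hT, neg_mul, smul_neg, smul_neg, smul_neg]
    · rw [AlgHom.comp_apply, AlgHom.comp_apply, parity_f, map_neg, antiHom_f]
      refine (MulOpposite.op_neg _).symm.trans (congrArg MulOpposite.op ?_)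
      change _ = parity (R := K) (cst Complex.I • antiF)
      simp only [antiF, map_smul, map_sub, map_neg, map_mul, parity_e, parity_f, parity_b, hT,
        neg_mul, mul_neg, smul_neg]
      rw [← smul_neg]
      congr 1
      abel
  rw [antipode_apply, twist_parity, antipode_apply]
  exact congrArg MulOpposite.unop (DFunLike.congr_fun h (twist a))

end Osp

end Jordanian
namespace Jordanian

open Superalgebra

/-! ### The antipode axioms -/

namespace Osp

open OspGen

/-- The map `a ⊗ c ↦ S(a) c`. -/
noncomputable def antipodeLeft : Tensor2 hIdeal U →ₗ[K] Compl hIdeal U :=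
  Compl.map hIdeal (mulMap U ∘ₗ tensorMap U antipode LinearMap.id)

/-- The map `a ⊗ c ↦ a S(c)`. -/
noncomputable def antipodeRight : Tensor2 hIdeal U →ₗ[K] Compl hIdeal U :=
  Compl.map hIdeal (mulMap U ∘ₗ tensorMap U LinearMap.id antipode)

theorem antipodeLeft_ι (a c : U) : antipodeLeft (ι₁ U a * ι₂ U c) = toCompl U (antipode a * c) := by
  rw [← of_stmul]
  exact Compl.map_of _ _

theorem antipodeRight_ι (a c : U) :
    antipodeRight (ι₁ U a * ι₂ U c) = toCompl U (a * antipode c) := by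
  rw [← of_stmul]
  exact Compl.map_of _ _

theorem tensor_linear_ext {M : Type*} [AddCommGroup M] [Module K M] [IsHausdorff hIdeal M]
    {φ ψ : Tensor2 hIdeal U →ₗ[K] M}
    (h : ∀ a c, φ (ι₁ U a * ι₂ U c) = ψ (ι₁ U a * ι₂ U c)) (w : Tensor2 hIdeal U) : φ w = ψ w :=
  linearMap_ext_compl (f := φ) (g := ψ) (fun x =>
    linearMap_ext_stmul (f := φ ∘ₗ Compl.of hIdeal _) (g := ψ ∘ₗ Compl.of hIdeal _)
      (fun a c => by
        change φ (Compl.of hIdeal _ (stmul a c)) = ψ (Compl.of hIdeal _ (stmul a c))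
        rw [of_stmul]
        exact h a c) x) w

theorem ι₂_even_mul_ι₁ (a : U) {c : U} (hc : parity (R := K) c = c) :
    ι₂ U c * ι₁ U a = ι₁ U a * ι₂ U c := superCommute_ι.right_even hc a

theorem ι₂_odd_mul_ι₁ (a : U) {c : U} (hc : parity (R := K) c = -c) :
    ι₂ U c * ι₁ U a = ι₁ U (parity (R := K) a) * ι₂ U c := (superCommute_ι a c).2 hc

theorem ι₂_mul_ι₁_even {a : U} (c : U) (ha : parity (R := K) a = a) :
    ι₂ U c * ι₁ U a = ι₁ U a * ι₂ U c := ((superCommute_ι.symm c a).1 ha).symm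

theorem ι₂_mul_ι₁_odd {a : U} (c : U) (ha : parity (R := K) a = -a) :
    ι₂ U c * ι₁ U a = ι₁ U a * ι₂ U (parity (R := K) c) := by
  rw [(superCommute_ι.symm (parity (R := K) c) a).2 ha, parity_parity]

theorem antiE_mul_T : antiE * T (-1) = -e := by
  rw [antiE, neg_mul, mul_assoc, T_mul_T_neg, mul_one]

theorem antiF_mul_T : antiF * T 1 = -f - hbar • (b * e) := by
  rw [antiF, sub_mul, neg_mul, mul_assoc, T_neg_mul_T, mul_one, smul_mul_assoc, mul_assoc b,
    mul_assoc e, T_neg_mul_T, mul_one]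

theorem antiB_mul_T : antiB * T 2 = -b := by
  rw [antiB, neg_mul, mul_assoc, T_neg_mul_T, mul_one]

theorem parity_T_mul_e (s : ℂ) : parity (R := K) (T s * e) = -(T s * e) := by
  rw [map_mul, parity_T, parity_e, mul_neg]

/-- On w = a ⊗ c the two terms of Δ(e) contribute S(a') S(e) T⁻¹ c and S(a') e c, where a' is the
parity image of a, and S(e) T⁻¹ = -e. -/
theorem antipodeLeft_comul_e_mul (w : Tensor2 hIdeal U) : antipodeLeft (comul e * w) = 0 := by
  refine tensor_linear_ext (φ := antipodeLeft ∘ₗ lmul (comul e)) (ψ := 0) (fun a c => ?_) w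
  change antipodeLeft (comul e * (ι₁ U a * ι₂ U c)) = 0
  have h : comul e * (ι₁ U a * ι₂ U c) =
      ι₁ U (e * a) * ι₂ U (T (-1) * c) + ι₁ U (parity (R := K) a) * ι₂ U (e * c) := by
    rw [comul_e, add_mul, ← mul_assoc (ι₂ U e), ι₂_odd_mul_ι₁ a parity_e, mul_assoc (ι₁ U e),
      ← mul_assoc (ι₂ U (T (-1))), ι₂_even_mul_ι₁ a (parity_T _)]
    simp only [map_mul, mul_assoc]
  rw [h, map_add, antipodeLeft_ι, antipodeLeft_ι, ← map_add, antipode_odd_mul _ parity_e,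
    antipode_e, mul_assoc, ← mul_assoc antiE, antiE_mul_T, neg_mul, mul_neg, neg_add_cancel,
    map_zero]

/-- The defect of S(f) T from -f is -h b e, and the third term of Δ(f) compensates it because S(b)
T² = -b. -/
theorem antipodeLeft_comul_f_mul (w : Tensor2 hIdeal U) : antipodeLeft (comul f * w) = 0 := by
  refine tensor_linear_ext (φ := antipodeLeft ∘ₗ lmul (comul f)) (ψ := 0) (fun a c => ?_) w
  change antipodeLeft (comul f * (ι₁ U a * ι₂ U c)) = 0
  have h : comul f * (ι₁ U a * ι₂ U c) =
      ι₁ U (f * a) * ι₂ U (T 1 * c) + ι₁ U (parity (R := K) a) * ι₂ U (f * c) -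
      hbar • (ι₁ U (b * parity (R := K) a) * ι₂ U (T 2 * e * c)) := by
    rw [comul_f, sub_mul, add_mul, ← mul_assoc (ι₂ U f), ι₂_odd_mul_ι₁ a parity_f,
      mul_assoc (ι₁ U f), ← mul_assoc (ι₂ U (T 1)), ι₂_even_mul_ι₁ a (parity_T _), smul_mul_assoc,
      mul_assoc (ι₁ U b), ← mul_assoc (ι₂ U (T 2 * e)), ι₂_odd_mul_ι₁ a (parity_T_mul_e 2)]
    simp only [map_mul, mul_assoc]
  rw [h, map_sub, map_add, map_smul, antipodeLeft_ι, antipodeLeft_ι, antipodeLeft_ι, ← map_add,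
    ← map_smul, ← map_sub, antipode_odd_mul _ parity_f, antipode_even_mul _ parity_b, antipode_f,
    antipode_b]
  simp only [mul_assoc]
  rw [← mul_assoc antiF, antiF_mul_T, ← mul_assoc antiB, antiB_mul_T]
  simp only [sub_mul, mul_sub, neg_mul, mul_neg, smul_mul_assoc, mul_smul_comm, mul_assoc, smul_neg]
  rw [← map_zero (toCompl U)]
  congr 1
  abel

theorem antipodeRight_mul_comul_e (w : Tensor2 hIdeal U) : antipodeRight (w * comul e) = 0 := by
  refine tensor_linear_ext (φ := antipodeRight ∘ₗ rmul (comul e)) (ψ := 0) (fun a c => ?_) w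
  change antipodeRight (ι₁ U a * ι₂ U c * comul e) = 0
  have h : ι₁ U a * ι₂ U c * comul e =
      ι₁ U (a * e) * ι₂ U (parity (R := K) c * T (-1)) + ι₁ U a * ι₂ U (c * e) := by
    rw [comul_e, mul_add, ← mul_assoc _ (ι₁ U e), mul_assoc _ (ι₂ U c) (ι₁ U e),
      ι₂_mul_ι₁_odd c parity_e]
    simp only [map_mul, mul_assoc]
  rw [h, map_add, antipodeRight_ι, antipodeRight_ι, ← map_add, antipode_mul_odd _ parity_e,
    antipode_mul_even _ (parity_T _), antipode_T, neg_neg, antipode_e, antiE, mul_assoc,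
    ← mul_assoc e, neg_mul, mul_neg, add_neg_cancel, map_zero]

theorem antipodeRight_mul_comul_f (w : Tensor2 hIdeal U) : antipodeRight (w * comul f) = 0 := by
  refine tensor_linear_ext (φ := antipodeRight ∘ₗ rmul (comul f)) (ψ := 0) (fun a c => ?_) w
  change antipodeRight (ι₁ U a * ι₂ U c * comul f) = 0
  have h : ι₁ U a * ι₂ U c * comul f =
      ι₁ U (a * f) * ι₂ U (parity (R := K) c * T 1) + ι₁ U a * ι₂ U (c * f) -
      hbar • (ι₁ U (a * b) * ι₂ U (c * (T 2 * e))) := by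
    rw [comul_f, mul_sub, mul_add, mul_smul_comm, ← mul_assoc _ (ι₁ U f),
      mul_assoc _ (ι₂ U c) (ι₁ U f), ι₂_mul_ι₁_odd c parity_f, ← mul_assoc _ (ι₁ U b),
      mul_assoc _ (ι₂ U c) (ι₁ U b), ι₂_mul_ι₁_even c parity_b]
    simp only [map_mul, mul_assoc]
  have h1 : antipode (T 2 * e) = -(e * T (-1)) := by
    have h2 : T 1 * T (-2) = T (-1) := by rw [← T_add]; norm_num
    rw [antipode_even_mul _ (parity_T _), antipode_T, antipode_e, antiE, neg_mul, mul_assoc, h2]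
  rw [h, map_sub, map_add, map_smul, antipodeRight_ι, antipodeRight_ι, antipodeRight_ι, ← map_add,
    ← map_smul, ← map_sub, antipode_mul_odd _ parity_f, antipode_mul_odd _ (parity_T_mul_e 2),
    antipode_mul_even _ (parity_T _), antipode_T, antipode_f, h1, antiF, ← map_zero (toCompl U)]
  congr 1
  simp only [sub_mul, mul_sub, neg_mul, mul_neg, smul_mul_assoc, mul_smul_comm, mul_assoc, smul_neg]
  abel

/-- The map m ∘ (S ⊗ id) ∘ Δ is not visibly multiplicative. With an arbitrary factor w the identity
does pass from x and y to x y, so it need only be known for e and f; the axiom is the case w = 1. -/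
theorem antipodeLeft_comul_mul (a : U) (w : Tensor2 hIdeal U) :
    antipodeLeft (comul a * w) = counit a • antipodeLeft w := by
  have h : ∀ a ∈ Algebra.adjoin K {e, f}, ∀ w : Tensor2 hIdeal U,
      antipodeLeft (comul a * w) = counit a • antipodeLeft w := fun a ha => by
    induction ha using Algebra.adjoin_induction with
    | mem x hx =>
      rcases hx with rfl | rfl <;> intro w
      · rw [antipodeLeft_comul_e_mul, counit_e, zero_smul]
      · rw [antipodeLeft_comul_f_mul, counit_f, zero_smul]
    | algebraMap c =>
      intro w
      rw [AlgHom.commutes, AlgHom.commutes, ← Algebra.smul_def, map_smul]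
      rfl
    | add x y _ _ hx hy => intro w; rw [map_add, map_add, add_mul, map_add, hx, hy, add_smul]
    | mul x y _ _ hx hy => intro w; rw [map_mul comul, map_mul counit, mul_assoc, hx, hy, mul_smul]
  exact hdense_adjoin.linearMap_ext
    (f := antipodeLeft ∘ₗ rmul w ∘ₗ comul.toLinearMap)
    (g := (LinearMap.toSpanSingleton K _ (antipodeLeft w)) ∘ₗ counit.toLinearMap)
    (fun a ha => h a ha w) a

theorem antipodeRight_mul_comul (a : U) (w : Tensor2 hIdeal U) :
    antipodeRight (w * comul a) = counit a • antipodeRight w := by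
  have h : ∀ a ∈ Algebra.adjoin K {e, f}, ∀ w : Tensor2 hIdeal U,
      antipodeRight (w * comul a) = counit a • antipodeRight w := fun a ha => by
    induction ha using Algebra.adjoin_induction with
    | mem x hx =>
      rcases hx with rfl | rfl <;> intro w
      · rw [antipodeRight_mul_comul_e, counit_e, zero_smul]
      · rw [antipodeRight_mul_comul_f, counit_f, zero_smul]
    | algebraMap c =>
      intro w
      rw [AlgHom.commutes, AlgHom.commutes, ← Algebra.commutes, ← Algebra.smul_def, map_smul]
      rfl
    | add x y _ _ hx hy => intro w; rw [map_add, map_add, mul_add, map_add, hx, hy, add_smul]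
    | mul x y _ _ hx hy =>
      intro w
      rw [map_mul comul, map_mul counit, ← mul_assoc, hy, hx, mul_comm, mul_smul]
  exact hdense_adjoin.linearMap_ext
    (f := antipodeRight ∘ₗ lmul w ∘ₗ comul.toLinearMap)
    (g := (LinearMap.toSpanSingleton K _ (antipodeRight w)) ∘ₗ counit.toLinearMap)
    (fun a ha => h a ha w) a

theorem antipodeLeft_comul (a : U) :
    antipodeLeft (comul a) = Compl.of hIdeal U (algebraMap K U (counit a)) := by
  have h := antipodeLeft_ι 1 1
  rw [map_one (ι₁ U), map_one (ι₂ U), mul_one, antipode_one, mul_one, map_one (toCompl U)] at h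
  have h1 := antipodeLeft_comul_mul a 1
  rw [mul_one, h] at h1
  rw [h1, ← Algebra.algebraMap_eq_smul_one]
  exact ((toCompl U).commutes _).symm

theorem antipodeRight_comul (a : U) :
    antipodeRight (comul a) = Compl.of hIdeal U (algebraMap K U (counit a)) := by
  have h := antipodeRight_ι 1 1
  rw [map_one (ι₁ U), map_one (ι₂ U), mul_one, antipode_one, mul_one, map_one (toCompl U)] at h
  have h1 := antipodeRight_mul_comul a 1
  rw [one_mul, h] at h1
  rw [h1, ← Algebra.algebraMap_eq_smul_one]
  exact ((toCompl U).commutes _).symm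

/-- The Hopf superalgebra `U_h(osp(1|2))`. -/
noncomputable def hopf : HopfSuperalgebra hIdeal U where
  complete := isAdicComplete
  comul := comul
  counit := counit
  antipode := antipode
  comul_parity a := (parity_comul a).symm.trans (parity_compl_apply _)
  counit_parity := counit_parity
  antipode_parity := antipode_parity
  coassoc := coassoc
  counit_comul := counit_comul
  comul_counit := comul_counit
  antipode_comul := antipodeLeft_comul
  comul_antipode := antipodeRight_comul

theorem comul_T' (s : ℂ) : comul (T s) = tens (T s) (T s) := by rw [comul_T, tens_eq]

theorem hasStructureMaps_hopf : HasStructureMaps hopf where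
  comul_X := comul_X
  comul_T := comul_T' 1
  comul_Tinv := comul_T' (-1)
  comul_H := comul_H
  comul_E := comul_E
  comul_F := comul_F
  comul_Y := comul_Y
  counit_X := counit_X
  counit_T := counit_T 1
  counit_Tinv := counit_T (-1)
  counit_H := counit_H
  counit_E := counit_E
  counit_F := counit_F
  counit_Y := counit_Y
  antipode_X := antipode_X
  antipode_T := antipode_T 1
  antipode_Tinv := (antipode_T (-1)).trans (by rw [neg_neg])
  antipode_H := antipode_H
  antipode_E := antipode_E
  antipode_F := antipode_F
  antipode_Y := antipode_Y

end Osp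

end Jordanian
namespace Jordanian

open Superalgebra

/-! ### Exponentials and intertwiners -/

section ExpH

variable {A : Type*} [Ring A] [Algebra K A]

theorem expH_eq (z : A) : expH z = hexp (toCompl A z) := HMod.eq fun n => by
  refine HMod.trans ?_ (hMod_psEval (toCompl A z) (PowerSeries.exp ℂ) n)
  have h : ∑ k ∈ Finset.range n, (cst (PowerSeries.coeff k (PowerSeries.exp ℂ)) * hbar ^ k) •
      toCompl A z ^ k = Compl.of hIdeal A (∑ k ∈ Finset.range n,
        (cst (1 / (k.factorial : ℂ)) * hbar ^ k) • z ^ k) := by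
    rw [← toCompl_apply, map_sum]
    refine Finset.sum_congr rfl fun k _ => ?_
    rw [map_smul, map_pow, PowerSeries.coeff_exp]
    simp
  rw [h]
  exact hMod_of_eval_eq rfl

end ExpH

namespace Osp

open OspGen

theorem intertwines_of_generators {B : Type*} [Ring B] [Algebra K B] [IsHausdorff hIdeal B]
    {φ ψ : U →ₐ[K] B} {r : B} (he : r * φ e = ψ e * r) (hf : r * φ f = ψ f * r) (a : U) :
    r * φ a = ψ a * r := by
  refine hdense_adjoin.linearMap_ext (f := lmul r ∘ₗ φ.toLinearMap) (g := rmul r ∘ₗ ψ.toLinearMap)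
    (fun a ha => ?_) a
  change r * φ a = ψ a * r
  induction ha using Algebra.adjoin_induction with
  | mem x hx =>
    rcases hx with rfl | rfl
    · exact he
    · exact hf
  | algebraMap c => rw [AlgHom.commutes, AlgHom.commutes, Algebra.commutes]
  | add x y _ _ hx hy => rw [map_add, map_add, mul_add, add_mul, hx, hy]
  | mul x y _ _ hx hy => rw [map_mul, map_mul, ← mul_assoc, hx, mul_assoc, hy, mul_assoc]

/-! ### The twist -/

theorem mul_eq_mul_of_mul_eq_mul {R : Type*} [Ring R] {a c g g' : R} (h : g * a = c * g)
    (h1 : g * g' = 1) (h2 : g' * g = 1) :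
    g' * c = a * g' := by
  calc g' * c = g' * (c * g) * g' := by rw [mul_assoc, mul_assoc, h1, mul_one]
    _ = a * g' := by rw [← h, ← mul_assoc, h2, one_mul]

/-- The group theory of the first hexagon, gᵢⱼ being the copies of G in the tensor cube. The last
hypothesis says that R₂₃ commutes with G₁₂ G₁₃ = exp(h b ⊗ Δ(X)), and g₁₂⁻¹ g₁₃ g₂₃ g₁₂ is (Δ ⊗ id)
G. -/
theorem group_hexagon_left {Γ : Type*} [Group Γ] {g₁₂ g₁₃ g₂₃ g₃₁ g₃₂ : Γ}
    (h1 : Commute g₃₁ g₃₂) (h2 : Commute g₁₂ g₃₂) (h3 : Commute g₁₂ g₁₃) (h4 : Commute g₁₃ g₂₃)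
    (h5 : g₃₂⁻¹ * g₂₃ * (g₁₂ * g₁₃) = g₁₂ * g₁₃ * (g₃₂⁻¹ * g₂₃)) :
    (g₃₁ * g₃₂)⁻¹ * (g₁₂⁻¹ * (g₁₃ * g₂₃) * g₁₂) = g₃₁⁻¹ * g₁₃ * (g₃₂⁻¹ * g₂₃) := by
  have h6 : g₃₂⁻¹ * g₁₂⁻¹ = g₁₂⁻¹ * g₃₂⁻¹ := (h2.inv_inv.eq).symm
  calc (g₃₁ * g₃₂)⁻¹ * (g₁₂⁻¹ * (g₁₃ * g₂₃) * g₁₂)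
      = g₃₁⁻¹ * (g₃₂⁻¹ * g₁₂⁻¹) * (g₁₃ * g₂₃) * g₁₂ := by
        rw [h1.eq, mul_inv_rev]
        simp only [mul_assoc]
    _ = g₃₁⁻¹ * g₁₂⁻¹ * (g₃₂⁻¹ * g₂₃ * (g₁₂ * g₁₃)) := by
        rw [h6, h4.eq, h3.eq]
        simp only [mul_assoc]
    _ = _ := by
        rw [h5]
        simp only [mul_assoc, inv_mul_cancel_left]

/-- The analogue for the second hexagon: the last hypothesis says that R₁₃ commutes with G₂₁ G₂₃,
and the conjugate of g₂₁ g₃₁ by g₂₃ comes from applying id ⊗ Δ to G₂₁. -/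
theorem group_hexagon_right {Γ : Type*} [Group Γ] {g₁₂ g₁₃ g₂₁ g₂₃ g₃₁ : Γ}
    (h1 : Commute g₂₁ g₃₁) (h2 : Commute g₂₁ g₂₃) (h3 : Commute g₁₂ g₁₃) (h4 : Commute g₁₃ g₂₃)
    (h5 : g₃₁⁻¹ * g₁₃ * (g₂₁ * g₂₃) = g₂₁ * g₂₃ * (g₃₁⁻¹ * g₁₃)) :
    (g₂₃⁻¹ * (g₂₁ * g₃₁) * g₂₃)⁻¹ * (g₁₂ * g₁₃) = g₃₁⁻¹ * g₁₃ * (g₂₁⁻¹ * g₁₂) := by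
  rw [inv_mul_eq_iff_eq_mul]
  have h6 : g₂₃ * (g₃₁⁻¹ * g₁₃) * g₂₁⁻¹ = g₂₁⁻¹ * (g₃₁⁻¹ * g₁₃) * g₂₃ := by
    rw [mul_inv_eq_iff_eq_mul, mul_assoc, mul_assoc, ← h2.eq, h5]
    simp only [mul_assoc, inv_mul_cancel_left]
  calc g₁₂ * g₁₃ = g₂₃⁻¹ * (g₁₃ * g₂₃) * g₁₂ := by
        rw [h4.eq, inv_mul_cancel_left, h3.eq]
    _ = g₂₃⁻¹ * (g₂₁ * g₃₁) * (g₂₁⁻¹ * (g₃₁⁻¹ * g₁₃) * g₂₃) * g₁₂ := by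
        rw [h1.eq]
        simp only [mul_assoc, mul_inv_cancel_left]
    _ = _ := by
        rw [← h6]
        simp only [mul_assoc]

section Twist

variable {B : Type*} [Ring B] [Algebra K B] [IsAdicComplete hIdeal B]

/-- The twist element `exp (h b ⊗ X)`, for two homomorphisms. -/
noncomputable def twistElement (i j : U →ₐ[K] B) : B := hexp (i b * j (x X))

/-- The inverse of the twist element. -/
noncomputable def twistInv (i j : U →ₐ[K] B) : B := hexp (-(i b * j (x X)))

theorem twistInv_mul (i j : U →ₐ[K] B) : twistInv i j * twistElement i j = 1 :=
  hexp_neg_mul_hexp _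

theorem mul_twistInv (i j : U →ₐ[K] B) : twistElement i j * twistInv i j = 1 :=
  hexp_mul_hexp_neg _

variable {i j k : U →ₐ[K] B}

/-- If [b, a] = s a, then moving a ⊗ 1 past b ⊗ X adds s (1 ⊗ X) to it, so moving it past G = exp(h
b ⊗ X) produces the factor Tˢ in the second place. -/
theorem twistElement_mul_left (h : SuperCommute i j) {a : U} {s : ℂ}
    (ha : b * a = a * b + cst s • a) :
    twistElement i j * i a = i a * j (T s) * twistElement i j := by
  have hX : Commute (i b) (j (x X)) := commute_of_even h _ parity_X
  have hc : Commute (i b * j (x X)) (cst s • j (x X)) :=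
    (hX.mul_left (Commute.refl _)).smul_right _
  have h1 : i b * j (x X) * i a = i a * (i b * j (x X) + cst s • j (x X)) := by
    rw [mul_assoc, h.right_even parity_X, ← mul_assoc, ← map_mul, ha, map_add, map_smul, map_mul,
      add_mul, mul_add, mul_assoc, smul_mul_assoc, mul_smul_comm]
  rw [twistElement, hexp_mul_eq_mul_hexp h1, add_comm, hexp_add hc.symm, hexp_smul_X, mul_assoc]

theorem commute_twistElement_left (h : SuperCommute i j) {a : U} (ha : Commute b a) :
    Commute (twistElement i j) (i a) :=
  commute_hexp_left (Commute.mul_left (ha.map i) (commute_of_even h a parity_X).symm)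

theorem commute_twistElement_right (h : SuperCommute i j) {a : U} (ha : Commute (x X) a) :
    Commute (twistElement i j) (j a) :=
  commute_hexp_left (Commute.mul_left ((h.symm.right_even parity_b a)) (ha.map j))

/-- As e has weight 1 under b, conjugation by G multiplies e ⊗ 1 by 1 ⊗ T, which cancels the T⁻¹ of
Δ(e); the term 1 ⊗ e commutes with G. -/
theorem twistElement_mul_conv_e (h : SuperCommute i j) :
    twistElement i j * conv h e = (i e + j e) * twistElement i j := by
  have h1 : b * e = e * b + cst 1 • e := by rw [cst_one, one_smul, be]
  have h2 : Commute (twistElement i j) (j e) := commute_twistElement_right h commute_e_X.symm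
  have h3 : Commute (twistElement i j) (j (T (-1))) :=
    commute_twistElement_right h (commute_T_X _).symm
  rw [conv_e, mul_add, ← mul_assoc, twistElement_mul_left h h1, h2.eq, mul_assoc, h3.eq,
    mul_assoc (i e), ← mul_assoc (j (T 1)), ← map_mul, T_mul_T_neg, map_one, one_mul, add_mul]

/-- Since f has weight -1, the factor T of f ⊗ T is cancelled. Because [f, X] = -T² e, conjugating 1
⊗ f by G creates h b ⊗ T² e, which is removed by the third term of Δ(f). -/
theorem twistElement_mul_conv_f (h : SuperCommute i j) :
    twistElement i j * conv h f = (i f + j f) * twistElement i j := by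
  have h1 : b * f = f * b + cst (-1) • f := by
    rw [cst_neg, cst_one, neg_one_smul, fb, add_neg_cancel_right]
  have h3 : Commute (twistElement i j) (j (T 1)) :=
    commute_twistElement_right h (commute_T_X _).symm
  have hX : Commute (x X) (T 2 * e) := (commute_T_X _).symm.mul_right commute_e_X.symm
  have h4 : Commute (i b * j (x X)) (-(i b * j (T 2 * e))) := by
    refine Commute.neg_right (Commute.mul_left (Commute.mul_right (Commute.refl _) ?_)
      (Commute.mul_right ?_ (hX.map j)))
    · exact h.symm.right_even parity_b _
    · exact h.right_even parity_X _
  have h5 : j f * (i b * j (x X)) = i b * j (x X) * j f + -(i b * j (T 2 * e)) := by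
    rw [← mul_assoc, ← h.symm.right_even parity_b, mul_assoc, ← map_mul, f_mul_X, map_sub, mul_sub,
      map_mul, ← sub_eq_add_neg, mul_assoc]
  have h6 := mul_hexp_of_commutator h5 h4
  rw [← twistElement] at h6
  have h7 : Commute (twistElement i j) (i b * j (T 2 * e)) :=
    (commute_twistElement_left h (Commute.refl _)).mul_right (commute_twistElement_right h hX)
  rw [conv_f, mul_sub, mul_add, ← mul_assoc, twistElement_mul_left h h1, mul_assoc _ _ (j (T 1)),
    h3.eq, mul_assoc (i f), ← mul_assoc (j (T (-1))), ← map_mul, T_neg_mul_T, map_one, one_mul,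
    mul_smul_comm, h7.eq, add_mul, h6, neg_mul, smul_neg]
  abel

/-- Follows from the cases of e and f because b = -(e f + f e) and the mixed terms anticommute. -/
theorem twistElement_mul_conv_b (h : SuperCommute i j) :
    twistElement i j * conv h b = (i b + j b) * twistElement i j := by
  have h1 : b = -(e * f) - f * e := by rw [fe]; abel
  have he := twistElement_mul_conv_e h
  have hf := twistElement_mul_conv_f h
  have h2 : i e * j f + j f * i e = 0 := by rw [h.odd parity_e parity_f]; abel
  have h3 : j e * i f + i f * j e = 0 := by rw [h.symm.odd parity_e parity_f]; abel
  have h4 : i b + j b = -((i e + j e) * (i f + j f)) - (i f + j f) * (i e + j e) := by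
    rw [h1]
    simp only [map_sub, map_neg, map_mul, add_mul, mul_add]
    rw [eq_neg_of_add_eq_zero_left h2, eq_neg_of_add_eq_zero_left h3]
    abel
  rw [h4]
  nth_rewrite 1 [h1]
  simp only [map_sub, map_neg, map_mul, mul_sub, mul_neg, sub_mul, neg_mul]
  rw [← mul_assoc, he, mul_assoc, hf, ← mul_assoc, ← mul_assoc _ (conv h f), hf,
    mul_assoc _ _ (conv h e), he]
  simp only [mul_assoc]

/-- The R-matrix, for two homomorphisms. -/
noncomputable def rElement (i j : U →ₐ[K] B) : B := twistInv j i * twistElement i j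

theorem rElement_mul_rElement (i j : U →ₐ[K] B) : rElement i j * rElement j i = 1 := by
  rw [rElement, rElement, mul_assoc, ← mul_assoc (twistElement i j), mul_twistInv, one_mul,
    twistInv_mul]

/-- On e and f, conjugation by G carries Δ to the undeformed coproduct, and conjugation by G₂₁
carries the opposite of Δ to the same one. -/
theorem rElement_mul_conv (h : SuperCommute i j) (a : U) :
    rElement i j * conv h a = conv h.symm a * rElement i j := by
  refine intertwines_of_generators ?_ ?_ a
  · rw [rElement, mul_assoc, twistElement_mul_conv_e h, ← mul_assoc, add_comm,
      mul_eq_mul_of_mul_eq_mul (twistElement_mul_conv_e h.symm) (mul_twistInv _ _)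
        (twistInv_mul _ _),
      mul_assoc]
  · rw [rElement, mul_assoc, twistElement_mul_conv_f h, ← mul_assoc, add_comm,
      mul_eq_mul_of_mul_eq_mul (twistElement_mul_conv_f h.symm) (mul_twistInv _ _)
        (twistInv_mul _ _),
      mul_assoc]

/-! ### The hexagon identities -/

/-- The twist element, as a unit. -/
noncomputable def twistUnit (i j : U →ₐ[K] B) : Bˣ :=
  ⟨twistElement i j, twistInv i j, mul_twistInv i j, twistInv_mul i j⟩

theorem hexp_neg_eq_inv {z : B} {u : Bˣ} (h : hexp z = u) : hexp (-z) = (u⁻¹ : Bˣ) := by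
  rw [← Units.mul_left_inj u, Units.inv_mul, ← h, hexp_neg_mul_hexp]

theorem commute_b_mul_X (hij : SuperCommute i j) (hik : SuperCommute i k) (hjk : SuperCommute j k) :
    Commute (i b * j (x X)) (i b * k (x X)) :=
  Commute.mul_left (Commute.mul_right (Commute.refl _) (commute_of_even hik _ parity_X))
    (Commute.mul_right (commute_of_even hij _ parity_X).symm (commute_of_even hjk _ parity_X))

theorem commute_b_mul_X' (hij : SuperCommute i j) (hik : SuperCommute i k)
    (hjk : SuperCommute j k) : Commute (i b * k (x X)) (j b * k (x X)) :=
  Commute.mul_left (Commute.mul_right (commute_of_even hij _ parity_b)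
      (commute_of_even hik _ parity_X))
    (Commute.mul_right (commute_of_even hjk _ parity_X).symm (Commute.refl _))

theorem commute_twistElement (hij : SuperCommute i j) (hik : SuperCommute i k)
    (hjk : SuperCommute j k) : Commute (twistElement i j) (twistElement i k) :=
  commute_hexp_hexp (commute_b_mul_X hij hik hjk)

theorem commute_twistElement' (hij : SuperCommute i j) (hik : SuperCommute i k)
    (hjk : SuperCommute j k) : Commute (twistElement i k) (twistElement j k) :=
  commute_hexp_hexp (commute_b_mul_X' hij hik hjk)

theorem hexp_b_mul_X_add (hij : SuperCommute i j) (hik : SuperCommute i k)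
    (hjk : SuperCommute j k) :
    hexp (i b * (j (x X) + k (x X))) = twistElement i j * twistElement i k := by
  rw [mul_add, hexp_add (commute_b_mul_X hij hik hjk)]
  rfl

/-- Conjugation by G₁₂ turns Δ(b) into b ⊗ 1 + 1 ⊗ b and does not affect X in the third place, so (Δ
⊗ id) G is conjugate to G₁₃ G₂₃. -/
theorem hexp_conv_b_mul_X (hij : SuperCommute i j) (hik : SuperCommute i k)
    (hjk : SuperCommute j k) : hexp (conv hij b * k (x X)) =
      twistInv i j * (twistElement i k * twistElement j k) * twistElement i j := by
  have hc : Commute (twistElement i j) (k (x X)) :=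
    commute_hexp_left (Commute.mul_left (commute_of_even hik _ parity_X)
      (commute_of_even hjk _ parity_X))
  have h1 : (i b + j b) * k (x X) * twistElement i j =
      twistElement i j * (conv hij b * k (x X)) := by
    rw [← mul_assoc, twistElement_mul_conv_b, mul_assoc, ← hc.eq, mul_assoc]
  have h2 := hexp_mul_eq_mul_hexp h1
  rw [add_mul, hexp_add (commute_b_mul_X' hij hik hjk)] at h2
  change twistElement i k * twistElement j k * twistElement i j = _ at h2
  rw [mul_assoc (twistInv i j), h2, ← mul_assoc, twistInv_mul, one_mul]

/-- The conjugates by `R` of an exponential of `b ⊗ Δ(X)`. -/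
theorem rElement_mul_twist (hij : SuperCommute i j) (hik : SuperCommute i k)
    (hjk : SuperCommute j k) (hX : conv hjk (x X) = j (x X) + k (x X))
    (hX' : conv hjk.symm (x X) = k (x X) + j (x X)) :
    rElement j k * (twistElement i j * twistElement i k) =
      twistElement i j * twistElement i k * rElement j k := by
  rw [← hexp_b_mul_X_add hij hik hjk]
  -- The product of the two twists is the exponential of h b ⊗ Δ(X). The factor b is even and sits
  -- in another place than R; and R Δ(X) is the opposite of Δ(X) times R, which is Δ(X) R as X is
  -- primitive.
  refine (commute_hexp_left (Commute.mul_left ?_ ?_)).symm.eq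
  · refine Commute.mul_right ?_ ?_
    · refine (commute_hexp_left ?_).symm
      exact (Commute.mul_left (commute_of_even hik _ parity_b).symm
        (commute_of_even hij _ parity_X).symm).neg_left
    · refine (commute_hexp_left ?_).symm
      exact Commute.mul_left (commute_of_even hij _ parity_b).symm
        (commute_of_even hik _ parity_X).symm
  · have h := rElement_mul_conv hjk (x X)
    rw [hX, hX', add_comm (k (x X))] at h
    exact h.symm

/-- For the three embeddings into the tensor cube the left side is Δ ⊗ id applied to R = G₂₁⁻¹ G,
with Δ(X) already expanded in the first exponential. -/
theorem hexagon_left (hij : SuperCommute i j) (hik : SuperCommute i k) (hjk : SuperCommute j k)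
    (hX : conv hjk (x X) = j (x X) + k (x X)) (hX' : conv hjk.symm (x X) = k (x X) + j (x X)) :
    hexp (-(k b * (i (x X) + j (x X)))) * hexp (conv hij b * k (x X)) =
      rElement i k * rElement j k := by
  have h1 : hexp (-(k b * (i (x X) + j (x X)))) =
      ((twistUnit k i * twistUnit k j)⁻¹ : Bˣ) := by
    refine hexp_neg_eq_inv ?_
    exact hexp_b_mul_X_add hik.symm hjk.symm hij
  rw [h1, hexp_conv_b_mul_X hij hik hjk]
  exact congrArg Units.val (group_hexagon_left (g₁₂ := twistUnit i j) (g₁₃ := twistUnit i k)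
    (g₂₃ := twistUnit j k) (g₃₁ := twistUnit k i) (g₃₂ := twistUnit k j)
    (Units.ext (commute_twistElement hik.symm hjk.symm hij))
    (Units.ext (commute_twistElement' hik hij hjk.symm))
    (Units.ext (commute_twistElement hij hik hjk))
    (Units.ext (commute_twistElement' hij hik hjk))
    (Units.ext (rElement_mul_twist hij hik hjk hX hX')))

/-- Here the left side is id ⊗ Δ applied to R, with Δ(X) expanded in the second exponential. -/
theorem hexagon_right (hij : SuperCommute i j) (hik : SuperCommute i k) (hjk : SuperCommute j k)
    (hX : conv hik (x X) = i (x X) + k (x X)) (hX' : conv hik.symm (x X) = k (x X) + i (x X)) :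
    hexp (-(conv hjk b * i (x X))) * hexp (i b * (j (x X) + k (x X))) =
      rElement i k * rElement i j := by
  have h1 : hexp (-(conv hjk b * i (x X))) =
      (((twistUnit j k)⁻¹ * (twistUnit j i * twistUnit k i) * twistUnit j k)⁻¹ : Bˣ) :=
    hexp_neg_eq_inv (hexp_conv_b_mul_X hjk hij.symm hik.symm)
  rw [h1, hexp_b_mul_X_add hij hik hjk]
  exact congrArg Units.val (group_hexagon_right (g₁₂ := twistUnit i j) (g₁₃ := twistUnit i k)
    (g₂₁ := twistUnit j i) (g₂₃ := twistUnit j k) (g₃₁ := twistUnit k i)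
    (Units.ext (commute_twistElement' hjk hij.symm hik.symm))
    (Units.ext (commute_twistElement hij.symm hjk hik))
    (Units.ext (commute_twistElement hij hik hjk))
    (Units.ext (commute_twistElement' hij hik hjk))
    (Units.ext (rElement_mul_twist hij.symm hjk hik hX hX')))

end Twist

end Osp

end Jordanian
namespace Jordanian

open Superalgebra

namespace Osp

open OspGen

/-! ### The universal R-matrix -/

/-- Primitivity of X is transported from the tensor square along a homomorphism, so nothing has to
be known about torsion in the target. -/
theorem conv_X_of_hom {B : Type*} [Ring B] [Algebra K B] [IsAdicComplete hIdeal B]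
    {i j : U →ₐ[K] B} (h : SuperCommute i j) (φ : Tensor2 hIdeal U →ₐ[K] B)
    (hi : ∀ a, φ (ι₁ U a) = i a) (hj : ∀ a, φ (ι₂ U a) = j a) :
    conv h (x X) = i (x X) + j (x X) := by
  rw [← conv_congr (superCommute_ι.comp φ) h hi hj, ← map_conv superCommute_ι φ, comul_X',
    map_add, hi,
    hj]

theorem conv_X_symm_of_hom {B : Type*} [Ring B] [Algebra K B] [IsAdicComplete hIdeal B]
    {i j : U →ₐ[K] B} (h : SuperCommute i j) (φ : Tensor2 hIdeal U →ₐ[K] B)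
    (hi : ∀ a, φ (ι₁ U a) = i a) (hj : ∀ a, φ (ι₂ U a) = j a) :
    conv h.symm (x X) = j (x X) + i (x X) :=
  conv_X_of_hom h.symm (φ.comp (flipHom U))
    (fun a => (congrArg φ (flipHom_ι₁ a)).trans (hj a))
    (fun a => (congrArg φ (flipHom_ι₂ a)).trans (hi a))

theorem map_twistElement {B C : Type*} [Ring B] [Algebra K B] [IsAdicComplete hIdeal B] [Ring C]
    [Algebra K C] [IsAdicComplete hIdeal C] {i j : U →ₐ[K] B} {i' j' : U →ₐ[K] C} (φ : B →ₐ[K] C)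
    (hi : ∀ a, φ (i a) = i' a) (hj : ∀ a, φ (j a) = j' a) :
    φ (twistElement i j) = twistElement i' j' := by
  rw [twistElement, map_hexp, map_mul, hi, hj]
  rfl

theorem map_rElement_apply {B C : Type*} [Ring B] [Algebra K B] [IsAdicComplete hIdeal B] [Ring C]
    [Algebra K C] [IsAdicComplete hIdeal C] {i j : U →ₐ[K] B} (φ : B →ₐ[K] C) {x₁ b₁ x₂ b₂ : C}
    (h1 : φ (i b) = b₁) (h2 : φ (i (x X)) = x₁) (h3 : φ (j b) = b₂) (h4 : φ (j (x X)) = x₂) :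
    φ (rElement i j) = hexp (-(b₂ * x₁)) * hexp (b₁ * x₂) := by
  rw [rElement, twistElement, twistInv, map_mul, map_hexp, map_hexp, map_neg, map_mul,
    map_mul, h1, h2, h3, h4]

theorem map_rElement {B C : Type*} [Ring B] [Algebra K B] [IsAdicComplete hIdeal B] [Ring C]
    [Algebra K C] [IsAdicComplete hIdeal C] {i j : U →ₐ[K] B} {i' j' : U →ₐ[K] C} (φ : B →ₐ[K] C)
    (hi : ∀ a, φ (i a) = i' a) (hj : ∀ a, φ (j a) = j' a) :
    φ (rElement i j) = rElement i' j' :=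
  map_rElement_apply φ (hi _) (hi _) (hj _) (hj _)

theorem G_eq : G = twistElement (ι₁ U) (ι₂ U) :=
  (expH_eq _).trans (congrArg hexp (of_stmul b (x X)))

theorem flip21_G : flip21 hIdeal U G = twistElement (ι₂ U) (ι₁ U) := by
  rw [flip21_eq, G_eq]
  exact map_twistElement (flipHom U) flipHom_ι₁ flipHom_ι₂

theorem isUnit_flip21_G : IsUnit (flip21 hIdeal U G) := by
  rw [flip21_G]
  exact isUnit_hexp _

theorem inverse_hexp {B : Type*} [Ring B] [Algebra K B] [IsAdicComplete hIdeal B] (z : B) :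
    Ring.inverse (hexp z) = hexp (-z) :=
  Ring.inverse_unit ⟨hexp z, hexp (-z), hexp_mul_hexp_neg z, hexp_neg_mul_hexp z⟩

theorem R_eq : R = rElement (ι₁ U) (ι₂ U) := by
  rw [R, flip21_G, G_eq]
  exact congrArg (· * _) (inverse_hexp _)

theorem isUnit_R : IsUnit R := by
  rw [R_eq]
  exact (isUnit_hexp _).mul (isUnit_hexp _)

theorem parity_R : Compl.map hIdeal (parity (R := K) (A := STensor K U U)).toLinearMap R = R := by
  refine (parity_compl_apply R).symm.trans ?_
  have hφ : ∀ φ : U →ₐ[K] Tensor2 hIdeal U,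
      (∀ a, parity (R := K) (φ a) = φ (parity (R := K) a)) →
      parity (R := K) (φ b) = φ b ∧ parity (R := K) (φ (x X)) = φ (x X) := fun φ h =>
    ⟨(h b).trans (congrArg φ parity_b), (h _).trans (congrArg φ parity_X)⟩
  rw [R_eq]
  exact map_rElement_apply (parity (R := K) (A := Tensor2 hIdeal U)) (hφ _ parity_ι₁).1
    (hφ _ parity_ι₁).2 (hφ _ parity_ι₂).1 (hφ _ parity_ι₂).2

theorem flip21_comul (a : U) : flip21 hIdeal U (comul a) = conv superCommute_ι.symm a := by
  rw [flip21_eq]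
  exact (map_conv _ _ a).trans (DFunLike.congr_fun (conv_congr _ _ flipHom_ι₁ flipHom_ι₂) a)

theorem R_mul_comul (a : U) : R * comul a = flip21 hIdeal U (comul a) * R := by
  rw [R_eq, flip21_comul]
  exact rElement_mul_conv superCommute_ι a

theorem flip21_R_mul_R : flip21 hIdeal U R * R = 1 := by
  rw [flip21_eq, R_eq]
  refine (congrArg (· * _) (map_rElement (flipHom U) flipHom_ι₁ flipHom_ι₂)).trans ?_
  exact rElement_mul_rElement _ _

theorem leg12_R : leg12 hIdeal U R = rElement (j₁ U) (j₂ U) := by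
  rw [leg12_eq, R_eq]
  exact map_rElement (leg12Hom U) leg12Hom_ι₁ leg12Hom_ι₂

theorem leg13_R : leg13 hIdeal U R = rElement (j₁ U) (j₃ U) := by
  rw [leg13_eq, R_eq]
  exact map_rElement (leg13Hom U) leg13Hom_ι₁ leg13Hom_ι₂

theorem leg23_R : leg23 hIdeal U R = rElement (j₂ U) (j₃ U) := by
  rw [leg23_eq, R_eq]
  exact map_rElement (leg23Hom U) leg23Hom_ι₁ leg23Hom_ι₂

theorem map_rElement_left {B C : Type*} [Ring B] [Algebra K B] [IsAdicComplete hIdeal B] [Ring C]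
    [Algebra K C] [IsAdicComplete hIdeal C] {i' j' : U →ₐ[K] C} {i j k : U →ₐ[K] B}
    {hij : SuperCommute i j} (φ : C →ₐ[K] B) (h1 : ∀ a, φ (i' a) = conv hij a)
    (h2 : ∀ a, φ (j' a) = k a) (hik : SuperCommute i k) (hjk : SuperCommute j k)
    (hX₁ : conv hij (x X) = i (x X) + j (x X)) (hX : conv hjk (x X) = j (x X) + k (x X))
    (hX' : conv hjk.symm (x X) = k (x X) + j (x X)) :
    φ (rElement i' j') = rElement i k * rElement j k := by
  rw [← hexagon_left hij hik hjk hX hX']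
  exact map_rElement_apply φ (h1 b) ((h1 (x X)).trans hX₁) (h2 b) (h2 (x X))

theorem map_rElement_right {B C : Type*} [Ring B] [Algebra K B] [IsAdicComplete hIdeal B] [Ring C]
    [Algebra K C] [IsAdicComplete hIdeal C] {i' j' : U →ₐ[K] C} {i j k : U →ₐ[K] B}
    {hjk : SuperCommute j k} (φ : C →ₐ[K] B) (h1 : ∀ a, φ (i' a) = i a)
    (h2 : ∀ a, φ (j' a) = conv hjk a) (hij : SuperCommute i j) (hik : SuperCommute i k)
    (hX₁ : conv hjk (x X) = j (x X) + k (x X)) (hX : conv hik (x X) = i (x X) + k (x X))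
    (hX' : conv hik.symm (x X) = k (x X) + i (x X)) :
    φ (rElement i' j') = rElement i k * rElement i j := by
  rw [← hexagon_right hij hik hjk hX hX']
  exact map_rElement_apply φ (h1 b) (h1 (x X)) (h2 b) ((h2 (x X)).trans hX₁)

theorem comulTensorId_R :
    comulTensorId comul.toLinearMap R = leg13 hIdeal U R * leg23 hIdeal U R := by
  rw [comulTensorId_eq comul parity_comul, leg13_R, leg23_R, R_eq]
  exact map_rElement_left (comulTensorIdHom comul parity_comul)
    (fun a => (comulTensorIdHom_ι₁ comul parity_comul a).trans (leg12Hom_comul a))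
    (comulTensorIdHom_ι₂ comul parity_comul) superCommute_j₁_j₃ superCommute_j₂_j₃
    (conv_X_of_hom superCommute_j₁_j₂ (leg12Hom U) leg12Hom_ι₁ leg12Hom_ι₂)
    (conv_X_of_hom superCommute_j₂_j₃ (leg23Hom U) leg23Hom_ι₁ leg23Hom_ι₂)
    (conv_X_symm_of_hom superCommute_j₂_j₃ (leg23Hom U) leg23Hom_ι₁ leg23Hom_ι₂)

theorem idTensorComul_R :
    idTensorComul comul.toLinearMap R = leg13 hIdeal U R * leg12 hIdeal U R := by
  rw [idTensorComul_eq comul parity_comul, leg13_R, leg12_R, R_eq]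
  exact map_rElement_right (idTensorComulHom comul parity_comul)
    (idTensorComulHom_ι₁ comul parity_comul)
    (fun a => (idTensorComulHom_ι₂ comul parity_comul a).trans (leg23Hom_comul a))
    superCommute_j₁_j₂ superCommute_j₁_j₃
    (conv_X_of_hom superCommute_j₂_j₃ (leg23Hom U) leg23Hom_ι₁ leg23Hom_ι₂)
    (conv_X_of_hom superCommute_j₁_j₃ (leg13Hom U) leg13Hom_ι₁ leg13Hom_ι₂)
    (conv_X_symm_of_hom superCommute_j₁_j₃ (leg13Hom U) leg13Hom_ι₁ leg13Hom_ι₂)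

theorem isTriangularRMatrix_R : IsTriangularRMatrix hopf R where
  isUnit := isUnit_R
  even := parity_R
  intertwines := R_mul_comul
  comul_left := comulTensorId_R
  comul_right := idTensorComul_R
  triangular := flip21_R_mul_R

/-! ### The classical limit -/

theorem hMod_T (s : ℂ) : HMod 1 (T s) 1 := by
  rw [T_eq]
  exact hMod_one_hexp _

theorem hMod_b : HMod 1 b (x H) := by
  have h := (hMod_T 1).mul_right (x H)
  rwa [one_mul] at h

theorem hMod_rElement {B : Type*} [Ring B] [Algebra K B] [IsAdicComplete hIdeal B]
    {i j : U →ₐ[K] B} (h : SuperCommute i j) : HMod 2 (rElement i j)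
      (1 + hbar • (i (x H) * j (x X) - i (x X) * j (x H))) := by
  have hi := hMod_b.map i.toLinearMap
  have hj := hMod_b.map j.toLinearMap
  have h1 : HMod 2 (twistElement i j) (1 + hbar • (i (x H) * j (x X))) :=
    (hMod_two_hexp _).trans ((HMod.refl 2 1).add (hi.mul_right (j (x X))).hbar_smul)
  have h2 : HMod 2 (twistInv j i) (1 + hbar • (-(i (x X) * j (x H)))) := by
    refine (hMod_two_hexp _).trans ((HMod.refl 2 1).add (HMod.hbar_smul ?_))
    rw [h.left_even parity_X]
    exact (hj.mul_right (i (x X))).neg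
  refine (h2.mul h1).trans ?_
  refine ⟨-(i (x X) * j (x H)) * (i (x H) * j (x X)), ?_⟩
  rw [add_mul, one_mul, mul_add, mul_one, smul_mul_smul_comm, ← pow_two, smul_sub, smul_neg]
  abel

theorem exists_R_eq : ∃ c, R = 1 + hbar • rMatrix + hbar ^ 2 • c := by
  obtain ⟨c, hc⟩ := hMod_rElement (superCommute_ι (A := U))
  refine ⟨c, ?_⟩
  rw [R_eq, rMatrix, tens_eq, tens_eq, ← hc]
  abel

/-- Comparing R d = d' R up to h² gives d - d' ≡ h(d' r - r d). As d' ≡ d modulo h, d' may be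
replaced by d in the bracket. -/
theorem cobracket_of_intertwines {B : Type*} [Ring B] [Algebra K B] {R r d d' : B}
    (hR : HMod 2 R (1 + hbar • r)) (h : R * d = d' * R) :
    ∃ c, d - d' = hbar • (d * r - r * d) + hbar ^ 2 • c := by
  have h1 : HMod 1 R 1 := (hR.mono one_le_two).trans ⟨r, by rw [pow_one, add_sub_cancel_left]⟩
  have h2 : HMod 1 d d' := by
    have h3 := (h1.mul_right d).symm.trans ((HMod.of_eq h).trans (h1.mul_left d'))
    rwa [one_mul, mul_one] at h3
  have h3 : HMod 2 ((1 + hbar • r) * d) (d' * (1 + hbar • r)) :=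
    (hR.mul_right d).symm.trans ((HMod.of_eq h).trans (hR.mul_left d'))
  obtain ⟨c, hc⟩ := h3
  obtain ⟨c', hc'⟩ := (h2.mul_right r).hbar_smul
  refine ⟨c - c', ?_⟩
  rw [smul_sub (hbar ^ 2), ← hc, ← hc', add_mul, mul_add, one_mul, mul_one,
    smul_mul_assoc, mul_smul_comm,
    smul_sub]
  abel

theorem exists_cobracket (a : U) : ∃ c, comul a - flip21 hIdeal U (comul a) =
    hbar • (comul a * rMatrix - rMatrix * comul a) + hbar ^ 2 • c := by
  obtain ⟨c, hc⟩ := exists_R_eq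
  refine cobracket_of_intertwines ⟨c, ?_⟩ (R_mul_comul a)
  rw [hc, add_sub_cancel_left]

theorem exists_comul_x (i : OspGen) :
    ∃ c, comul (x i) = tens (x i) 1 + tens 1 (x i) + hbar • c := by
  have h1 : ∀ (a : U) (s : ℂ), HMod 1 (tens a (T s)) (tens a 1) := fun a s => by
    rw [tens_eq, tens_eq]
    exact ((hMod_T s).map (ι₂ U).toLinearMap).mul_left _
  have h2 : ∀ (a : U) (s : ℂ), HMod 1 (tens (T s) a) (tens 1 a) := fun a s => by
    rw [tens_eq, tens_eq]
    exact ((hMod_T s).map (ι₁ U).toLinearMap).mul_right _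
  have h3 : HMod 1 (comul (x i)) (tens (x i) 1 + tens 1 (x i)) := by
    cases i with
    | H => rw [comul_H]; exact (h1 _ _).add (h2 _ _)
    | X => rw [comul_X]
    | Y => rw [comul_Y]; exact (h1 _ _).add (h2 _ _)
    | E => rw [comul_E]; exact (h1 _ _).add (h2 _ _)
    | F =>
      rw [comul_F]
      have h4 : ∀ w : Tensor2 hIdeal U, HMod 1 ((cst (1 / 4) * hbar) • w) 0 := fun w =>
        ⟨cst (1 / 4) • w, by rw [sub_zero, pow_one, smul_smul, mul_comm]⟩
      have h5 := (((h1 (x F) (1 / 2)).add (h2 (x F) (-1 / 2))).add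
        (h4 (tens (T (-1) * x E) (T (-1 / 2) * x H + x H * T (-1 / 2))))).sub
        (h4 (tens (T (1 / 2) * x H + x H * T (1 / 2)) (T 1 * x E)))
      rwa [add_zero, sub_zero] at h5
  obtain ⟨c, hc⟩ := h3
  refine ⟨c, ?_⟩
  rw [pow_one] at hc
  rw [← hc, add_sub_cancel]

end Osp

end Jordanian
namespace Jordanian

/-! ### Induced representations -/

section Induced

open Matrix

variable {S : Type*} [Ring S]

/-- The matrix of `e` in the representation induced from a representation of `sl(2)`. -/
def matrixE (p : S) : Matrix (Fin 4) (Fin 4) S :=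
  !![0, p, 0, 0; 1, 0, 0, 1; 0, 0, 0, p; 0, 0, 1, 0]

/-- The matrix of `f` in the representation induced from a representation of `sl(2)`. -/
def matrixF (b m : S) : Matrix (Fin 4) (Fin 4) S :=
  !![0, -b, -m, 0; 0, 0, 0, m; 1, 0, 0, 1 - b; 0, -1, 0, 0]

/-- The matrix of the Cartan element in the representation induced from a representation of
`sl(2)`. -/
def matrixB (b : S) : Matrix (Fin 4) (Fin 4) S :=
  !![b, 0, 0, 0; 0, b + 1, 0, 0; 0, 0, b - 1, 0; 0, 0, 0, b]

variable {b p m : S}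

/-- Over U(sl(2)) the algebra U(osp(1|2)) has the basis 1, e, f, e f, with coefficients on the
right. The columns of the matrices are left multiplications of these basis elements: for instance e
· e f = f b₊ + e and f · e f = e b₋ + f (1 - b). -/
theorem matrixF_mul_matrixE (hpm : p * m = m * p + b) :
    matrixF b m * matrixE p = -(matrixE p * matrixF b m) - matrixB b := by
  ext i k
  fin_cases i <;> fin_cases k <;>
    simp [matrixE, matrixF, matrixB, Matrix.mul_apply, Fin.sum_univ_four, hpm] <;> abel

theorem matrixB_mul_matrixE (hbp : b * p = p * b + 2 * p) :
    matrixB b * matrixE p = matrixE p * matrixB b + matrixE p := by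
  ext i k
  fin_cases i <;> fin_cases k <;>
    simp [matrixE, matrixB, Matrix.mul_apply, Fin.sum_univ_four, hbp, mul_add, add_mul, mul_sub,
      sub_mul, two_mul] <;> abel

theorem matrixF_mul_matrixB (hmb : m * b = b * m + 2 * m) :
    matrixF b m * matrixB b = matrixB b * matrixF b m + matrixF b m := by
  ext i k
  fin_cases i <;> fin_cases k <;>
    simp [matrixF, matrixB, Matrix.mul_apply, Fin.sum_univ_four, hmb, mul_add, add_mul, mul_sub,
      sub_mul, two_mul] <;> abel

theorem matrixE_mul_matrixE_col (p : S) (i : Fin 4) :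
    (matrixE p * matrixE p) i 0 = Pi.single (M := fun _ => S) 0 p i := by
  fin_cases i <;> simp [matrixE, Matrix.mul_apply, Fin.sum_univ_four]

theorem matrixF_mul_matrixF_col (b m : S) (i : Fin 4) :
    (-(matrixF b m * matrixF b m)) i 0 = Pi.single (M := fun _ => S) 0 m i := by
  fin_cases i <;> simp [matrixF, Matrix.mul_apply, Fin.sum_univ_four]

theorem matrixB_col (b : S) (i : Fin 4) :
    matrixB b i 0 = Pi.single (M := fun _ => S) 0 b i := by
  fin_cases i <;> simp [matrixB]

variable [Algebra K S] [IsAdicComplete hIdeal S]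

instance isAdicComplete_matrix : IsAdicComplete hIdeal (Matrix (Fin 4) (Fin 4) S) :=
  have h : IsAdicComplete hIdeal (Fin 4 → S) := isAdicComplete_pi
  have h' : IsAdicComplete hIdeal (Fin 4 → Fin 4 → S) := isAdicComplete_pi
  h'

/-- A homomorphism `j` to `U_h(osp(1|2))` with the even elements `e²`, `b`, `-f²` in its image is
split modulo the kernel of any homomorphism `τ`. -/
theorem exists_linearMap_of_sl2 {A : Type*} [Ring A] [Algebra K A] {b' p' m' : A}
    (hA : HDense (Subalgebra.toSubmodule (Algebra.adjoin K {p', b', m'}))) (j : A →ₐ[K] Osp.U)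
    (hp : j p' = Osp.e * Osp.e) (hb : j b' = Osp.b) (hm : j m' = -(Osp.f * Osp.f)) (τ : A →ₐ[K] S)
    (hbp : τ b' * τ p' = τ p' * τ b' + 2 * τ p') (hmb : τ m' * τ b' = τ b' * τ m' + 2 * τ m')
    (hpm : τ p' * τ m' = τ m' * τ p' + τ b') : ∃ ρ : Osp.U →ₗ[K] S, ∀ a, ρ (j a) = τ a := by
  obtain ⟨π, he, hf, hb'⟩ := Osp.exists_algHom (matrixF_mul_matrixE hpm) (matrixB_mul_matrixE hbp)
    (matrixF_mul_matrixB hmb)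
  -- The basis vector 1 generates a copy of the inducing module: elements of the image of j act on
  -- it through τ alone. So the first column of their matrices vanishes off the diagonal, which
  -- makes the corner entry multiplicative on them.
  have key : ∀ a ∈ Algebra.adjoin K {p', b', m'}, ∀ i,
      π (j a) i 0 = Pi.single (M := fun _ => S) 0 (τ a) i := fun a ha => by
    induction ha using Algebra.adjoin_induction with
    | mem x hx =>
      intro i
      rcases hx with rfl | rfl | rfl
      · rw [hp, map_mul, he, matrixE_mul_matrixE_col]
      · rw [hb, hb', matrixB_col]
      · rw [hm, map_neg, map_mul, hf, matrixF_mul_matrixF_col]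
    | algebraMap c =>
      intro i
      rw [AlgHom.commutes, AlgHom.commutes, AlgHom.commutes, Matrix.algebraMap_matrix_apply]
      fin_cases i <;> simp
    | add x y _ _ hx hy =>
      intro i
      rw [map_add, map_add, map_add, Matrix.add_apply, hx, hy, Pi.single_add, Pi.add_apply]
    | mul x y _ _ hx hy =>
      intro i
      rw [map_mul, map_mul, map_mul, Matrix.mul_apply, Fin.sum_univ_four, hy, hy, hy, hy, hx]
      fin_cases i <;> simp
  let ρ : Osp.U →ₗ[K] S := {
    toFun := fun a => π a 0 0
    map_add' := fun a c => by rw [map_add, Matrix.add_apply]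
    map_smul' := fun c a => by rw [map_smul, Matrix.smul_apply, RingHom.id_apply] }
  refine ⟨ρ, fun a => ?_⟩
  refine hA.linearMap_ext (f := ρ ∘ₗ j.toLinearMap) (g := τ.toLinearMap) (fun a ha => ?_) a
  exact (key a ha 0).trans (Pi.single_eq_same _ _)

end Induced

end Jordanian
namespace Jordanian

open Superalgebra

namespace Osp

open OspGen

/-! ### The relations of Ohn's algebra in `U_h(osp(1|2))` -/

theorem proj_sinhSeries : proj (sinhSeries X) = x E ^ 2 := by
  have h := proj_rel Rel.EE
  rw [map_sub, map_pow, proj_gen, sub_eq_zero] at h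
  exact h.symm

theorem x_E_sq : x E ^ 2 = T 1 * (e * e) := by
  have h : T 1 = T (1 / 2) * T (1 / 2) := by rw [← T_add]; norm_num
  rw [x_E, pow_two, mul_assoc, ← mul_assoc e, (commute_e_T _).eq, h]
  simp only [mul_assoc]

theorem e_mul_e : e * e = T (-1) * x E ^ 2 := by
  rw [x_E_sq, ← mul_assoc, T_neg_mul_T, one_mul]

theorem H_mul_X : x H * x X = x X * x H + cst 2 • x E ^ 2 := by
  have h : T (-1) * T 2 = T 1 := by rw [← T_add]; norm_num
  rw [x_H, mul_assoc, b_mul_X, mul_add, ← mul_assoc, (commute_T_X _).eq, mul_assoc, mul_smul_comm,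
    x_E_sq, ((commute_e_T 2).mul_left (commute_e_T 2)).eq, ← mul_assoc (T (-1)) (T 2), h]

/-- The presentation contains [T, Y] only, so [X, Y] = H has to be derived, here multiplied by T. In
T Y = -f² + (h/2) b² + (h/8)(T² - 1) the bracket of X with -f² is T² b + T⁴ - T², its bracket with
(h/2) b² is b - T² b - T⁴ + T², and X commutes with T². -/
theorem X_mul_T_mul_Y : x X * (T 1 * x Y) = T 1 * x Y * x X + b := by
  have hf : x X * f = f * x X + T 2 * e := by rw [f_mul_X, sub_add_cancel]
  have hb : x X * b = b * x X - cst 2 • (e * e * T 2) := by rw [b_mul_X, add_sub_cancel_right]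
  have hT : T 2 * T 2 = T 4 := by rw [← T_add]; norm_num
  have hcT : x X * T 2 = T 2 * x X := (commute_T_X 2).eq.symm
  have hff : x X * (f * f) = f * f * x X - T 2 * b - (cst 2 * hbar) • (T 4 * (e * e)) := by
    have h1 : x X * (f * f) = f * f * x X + (f * T 2 * e + T 2 * e * f) := by
      rw [← mul_assoc, hf, add_mul, mul_assoc f, hf, mul_add]
      simp only [mul_assoc, add_assoc]
    have h4 : (2 : ℂ) + 2 = 4 := by norm_num
    rw [h1, f_mul_T, sub_mul, mul_assoc (T 2) f, fe, smul_mul_assoc, h4, mul_sub, mul_neg]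
    simp only [mul_assoc]
    abel
  have h2 : (cst (1 / 2) * hbar) • (cst 2 • (e * e * T 2)) = cst (1 / 2) • (T 2 - 1) := by
    have h3 : T (-2) * T 2 = 1 := T_neg_mul_T 2
    rw [smul_smul, mul_assoc, mul_comm hbar, ← smul_smul, ← smul_mul_assoc, hbar_smul_e_mul_e,
      sub_mul, one_mul, h3]
  have h5 : (cst 2 * hbar) • (T 4 * (e * e)) = T 4 - T 2 := by
    have h3 : T 4 * T (-2) = T 2 := by rw [← T_add]; norm_num
    rw [← mul_smul_comm, hbar_smul_e_mul_e, mul_sub, mul_one, h3]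
  have hbb : (cst (1 / 2) * hbar) • (x X * (b * b)) = (cst (1 / 2) * hbar) • (b * b * x X) -
      (T 2 * b - b + (T 4 - T 2)) := by
    have h1 : x X * (b * b) = b * b * x X - (b * cst 2 • (e * e * T 2) +
        cst 2 • (e * e * T 2) * b) := by
      rw [← mul_assoc, hb, sub_mul, mul_assoc b, hb, mul_sub]
      simp only [mul_assoc]
      abel
    have h4 : (2 : ℂ) + 2 = 4 := by norm_num
    rw [h1, smul_sub, smul_add, ← mul_smul_comm (cst (1 / 2) * hbar) b,
      ← smul_mul_assoc (cst (1 / 2) * hbar) (cst 2 • (e * e * T 2)) b, h2, mul_smul_comm,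
      smul_mul_assoc, mul_sub, sub_mul, b_mul_T, h4, mul_one, one_mul]
    have h6 : cst 2 • (T 4 - T 2) = (T 4 - T 2) + (T 4 - T 2) := by
      rw [cst_two, two_smul]
    rw [h6]
    have h7 : cst (1 / 2) • (T 2 * b + (T 4 - T 2 + (T 4 - T 2)) - b) +
        cst (1 / 2) • (T 2 * b - b) = T 2 * b - b + (T 4 - T 2) := by
      rw [← smul_add, ← cst_half_smul_add (T 2 * b - b + (T 4 - T 2))]
      congr 1
      abel
    rw [h7]
  rw [T_mul_Y]
  simp only [mul_add, mul_neg, mul_smul_comm, mul_sub, mul_one, add_mul, neg_mul, smul_mul_assoc,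
    sub_mul, one_mul]
  rw [hff, hbb, h5, hcT]
  abel

theorem X_mul_Y : x X * x Y - x Y * x X - x H = 0 := by
  have h := X_mul_T_mul_Y
  have h1 : T (-1) * (T 1 * x Y) = x Y := by rw [← mul_assoc, T_neg_mul_T, one_mul]
  have h2 := congrArg (T (-1) * ·) h
  simp only [mul_add, ← x_H] at h2
  rw [← mul_assoc, (commute_T_X _).eq, mul_assoc, h1, ← mul_assoc, h1] at h2
  rw [h2]
  abel

end Osp

namespace Sl

open SlGen

instance : IsAdicComplete hIdeal U := presentation.isAdicComplete_alg

/-- The projection of the topologically free algebra onto Ohn's algebra. -/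
noncomputable def proj : FreeSeries SlGen →ₐ[K] U := presentation.proj

theorem proj_rel {r : FreeSeries SlGen} (hr : Rel r) : proj r = 0 := presentation.proj_rel hr

theorem proj_gen (i : SlGen) : proj (gen i) = x i := rfl

theorem proj_expSeries (s : ℂ) : proj (expSeries X s) = T s := rfl

theorem T_eq (s : ℂ) : T s = hexp (cst s • x X) := presentation.proj_expSeries X s

theorem algHom_ext {B : Type*} [Ring B] [Algebra K B] [IsHausdorff hIdeal B] {f g : U →ₐ[K] B}
    (h : ∀ i, f (x i) = g (x i)) : f = g := presentation.algHom_ext h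

theorem parity_eq (a : U) : parity (R := K) a = a := by
  have h : parity (R := K) (A := U) = AlgHom.id K U := algHom_ext fun i =>
    presentation.parity_var i
  exact DFunLike.congr_fun h a

theorem hMod_T (s : ℂ) : HMod 1 (T s) 1 := by
  rw [T_eq]
  exact hMod_one_hexp _

/-- The element `sinh (h X) / h`. -/
noncomputable def sinhX : U := proj (sinhSeries X)

theorem hMod_sinhX : HMod 1 sinhX (x X) := by
  obtain ⟨t, ht⟩ := powerSeries_eq_C_add_X_mul (sinhSeries X)
  have h0 : PowerSeries.constantCoeff (sinhSeries X) = FreeAlgebra.ι ℂ X := by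
    rw [← PowerSeries.coeff_zero_eq_constantCoeff_apply, sinhSeries, PowerSeries.coeff_mk]
    simp
  refine ⟨proj t, ?_⟩
  rw [sinhX, ht, h0, map_add, ← map_smul, hbar_pow_smul_series algebraMap_hbar_freeSeries, pow_one]
  exact add_sub_cancel_left _ _

theorem proj_toOsp_sinhSeries :
    seriesLift (fun i => Osp.x (toOsp i)) (sinhSeries X) = Osp.x OspGen.E ^ 2 := by
  have h1 := congrArg (seriesLift fun i => Osp.x (toOsp i)) (hbar_smul_sinhSeries X)
  have h2 := congrArg Osp.proj (hbar_smul_sinhSeries OspGen.X)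
  rw [map_smul, map_sub, seriesLift_expSeries, seriesLift_expSeries] at h1
  rw [map_smul, map_sub, Osp.proj_sinhSeries, Osp.proj_expSeries, Osp.proj_expSeries, Osp.T_eq,
    Osp.T_eq] at h2
  have h3 : IsUnit (cst 2) := (isUnit_iff_ne_zero.mpr two_ne_zero).map PowerSeries.C
  rw [← sub_eq_zero]
  refine Osp.torsionFree _ (h3.smul_left_cancel.mp ?_)
  rw [smul_zero, smul_smul, smul_sub, h2, sub_eq_zero]
  exact h1

theorem seriesLift_toOsp_rel {r : FreeSeries SlGen} (hr : Rel r) :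
    seriesLift (fun i : SlGen => Osp.x (toOsp i)) r = 0 := by
  have hT : ∀ s, seriesLift (fun i : SlGen => Osp.x (toOsp i)) (expSeries X s) = Osp.T s :=
    fun s => by
      rw [seriesLift_expSeries, Osp.T_eq]
      rfl
  rcases hr with _ | _
  · simp only [map_sub, map_mul, map_smul, seriesLift_gen, proj_toOsp_sinhSeries]
    change Osp.x OspGen.H * Osp.x OspGen.X - Osp.x OspGen.X * Osp.x OspGen.H - _ = 0
    rw [Osp.H_mul_X]
    abel
  · simp only [map_sub, map_add, map_mul, map_smul, seriesLift_gen, hT]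
    have h := Osp.proj_rel Osp.Rel.HY
    simp only [map_sub, map_add, map_mul, map_smul, Osp.proj_gen, Osp.proj_expSeries] at h
    rw [← h]
    simp only [toOsp, smul_mul_assoc, mul_smul_comm]
    abel
  · simp only [map_sub, map_mul, seriesLift_gen]
    exact Osp.X_mul_Y

theorem exists_toOsp : ∃ j : U →ₐ[K] Osp.U, ∀ i, j (x i) = Osp.x (toOsp i) :=
  ⟨presentation.lift (fun i : SlGen => Osp.x (toOsp i)) fun _ hr => seriesLift_toOsp_rel hr,
    presentation.lift_var _ _⟩

/-- The embedding of Ohn's algebra. -/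
noncomputable def embed : U →ₐ[K] Osp.U := exists_toOsp.choose

theorem embed_x (i : SlGen) : embed (x i) = Osp.x (toOsp i) := exists_toOsp.choose_spec i

theorem embed_T (s : ℂ) : embed (T s) = Osp.T s := by
  rw [T_eq, map_hexp, map_smul, embed_x, Osp.T_eq]
  rfl

theorem embed_sinhX : embed sinhX = Osp.x OspGen.E ^ 2 := by
  have h : embed.comp proj = seriesLift fun i => Osp.x (toOsp i) := by
    refine AlgHom.ext fun s => series_hdense.linearMap_ext (f := (embed.comp proj).toLinearMap)
      (g := (seriesLift fun i => Osp.x (toOsp i)).toLinearMap) (fun s hs => ?_) s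
    have h1 : Algebra.adjoin K (Set.range (gen (G := SlGen))) ≤
        AlgHom.equalizer (embed.comp proj) (seriesLift fun i => Osp.x (toOsp i)) := by
      rw [Algebra.adjoin_le_iff]
      rintro _ ⟨i, rfl⟩
      exact (embed_x i).trans
        (seriesLift_gen (G := SlGen) (fun i => Osp.x (toOsp i)) i).symm
    exact h1 hs
  exact (DFunLike.congr_fun h (sinhSeries X)).trans proj_toOsp_sinhSeries

/-- The classical Cartan element. -/
noncomputable def b : U := T 1 * x H

/-- The classical raising element. -/
noncomputable def bPlus : U := T (-1) * sinhX

/-- The classical lowering element. -/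
noncomputable def bMinus : U := T 1 * x Y - (cst (1 / 2) * hbar) • (b * b) -
  (cst (1 / 8) * hbar) • (T 2 - 1)

theorem embed_b : embed b = Osp.b := by
  rw [b, map_mul, embed_T, embed_x]
  rfl

theorem embed_bPlus : embed bPlus = Osp.e * Osp.e := by
  rw [bPlus, map_mul, embed_T, embed_sinhX, Osp.e_mul_e]

theorem embed_bMinus : embed bMinus = -(Osp.f * Osp.f) := by
  rw [bMinus, map_sub, map_sub, map_mul, map_smul, map_smul, map_mul, map_sub, map_one, embed_T,
    embed_T, embed_x, embed_b]
  change Osp.T 1 * Osp.x OspGen.Y - _ - _ = _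
  rw [Osp.T_mul_Y]
  abel

theorem hMod_b : HMod 1 b (x H) := by
  have h := (hMod_T 1).mul_right (x H)
  rwa [one_mul] at h

theorem hMod_bPlus : HMod 1 bPlus (x X) := by
  have h := (hMod_T (-1)).mul hMod_sinhX
  rwa [one_mul] at h

theorem hMod_hbar_smul (c : K) (a : U) : HMod 1 ((c * hbar) • a) 0 :=
  ⟨c • a, by rw [sub_zero, pow_one, smul_smul, mul_comm]⟩

theorem hMod_bMinus : HMod 1 bMinus (x Y) := by
  have h := ((hMod_T 1).mul_right (x Y)).sub (hMod_hbar_smul (cst (1 / 2)) (b * b)) |>.sub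
    (hMod_hbar_smul (cst (1 / 8)) (T 2 - 1))
  rwa [one_mul, sub_zero, sub_zero] at h

/-- Modulo h the elements b, b₊, b₋ coincide with the generators H, X, Y of Ohn's algebra. -/
theorem hdense_adjoin :
    HDense (Subalgebra.toSubmodule (Algebra.adjoin K {bPlus, b, bMinus})) := fun a => by
  obtain ⟨s, hs, has⟩ := presentation.hdense_adjoin a
  suffices h : ∃ t ∈ Algebra.adjoin K {bPlus, b, bMinus}, HMod 1 s t by
    obtain ⟨t, ht, hst⟩ := h
    exact ⟨t, ht, has.trans hst⟩
  clear has a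
  replace hs : s ∈ Algebra.adjoin K (Set.range presentation.var) := hs
  induction hs using Algebra.adjoin_induction with
  | mem y hy =>
    obtain ⟨i, rfl⟩ := hy
    cases i with
    | H => exact ⟨b, Algebra.subset_adjoin (by simp), hMod_b.symm⟩
    | X => exact ⟨bPlus, Algebra.subset_adjoin (by simp), hMod_bPlus.symm⟩
    | Y => exact ⟨bMinus, Algebra.subset_adjoin (by simp), hMod_bMinus.symm⟩
  | algebraMap c => exact ⟨_, Subalgebra.algebraMap_mem _ c, HMod.refl _ _⟩
  | add y z _ _ hy hz =>
    obtain ⟨t, ht, hyt⟩ := hy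
    obtain ⟨t', ht', hzt⟩ := hz
    exact ⟨t + t', add_mem ht ht', hyt.add hzt⟩
  | mul y z _ _ hy hz =>
    obtain ⟨t, ht, hyt⟩ := hy
    obtain ⟨t', ht', hzt⟩ := hz
    exact ⟨t * t', mul_mem ht ht', hyt.mul hzt⟩

/-! ### Injectivity of the embedding -/

theorem isAdicComplete_of_hbar_smul {Q : Type*} [AddCommGroup Q] [Module K Q]
    (h : ∀ a : Q, hbar • a = 0) : IsAdicComplete hIdeal Q where
  toIsHausdorff := isHausdorff_of_hMod fun a ha => by
    obtain ⟨z, hz⟩ := ha 1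
    rwa [sub_zero, pow_one, h] at hz
  toIsPrecomplete := isPrecomplete_of_hMod fun u hu => by
    -- When h acts as zero, congruence modulo a positive power of h is equality, so the sequence is
    -- constant from index 1 on; the term of index 0 is unconstrained.
    refine ⟨u 1, fun n => ?_⟩
    have h1 : ∀ n, u (n + 1) = u 1 := fun n => by
      induction n with
      | zero => rfl
      | succ n ih =>
        obtain ⟨z, hz⟩ := hu (n + 1)
        rw [pow_succ', mul_smul, h, sub_eq_zero] at hz
        exact hz.trans ih
    cases n with
    | zero => exact HMod.zero _ _
    | succ n => exact HMod.of_eq (h1 n)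

theorem eq_of_hMod_one {A B : Type*} [Ring A] [Algebra K A] [Ring B] [Algebra K B]
    (hh : ∀ y : B, hbar • y = 0) (τ : A →ₐ[K] B) {c d : A} (h : HMod 1 c d) : τ c = τ d := by
  obtain ⟨z, hz⟩ := h
  rw [← sub_eq_zero, ← map_sub, hz, pow_one, map_smul, hh]

theorem map_b_mul_bPlus {Q : Type*} [Ring Q] [Algebra K Q] (hh : ∀ y : Q, hbar • y = 0)
    (τ : U →ₐ[K] Q) : τ b * τ bPlus = τ bPlus * τ b + 2 * τ bPlus := by
  rw [eq_of_hMod_one hh τ hMod_b, eq_of_hMod_one hh τ hMod_bPlus]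
  have h := congrArg τ (proj_rel Rel.HX)
  have hS : τ (proj (sinhSeries X)) = τ (x X) := eq_of_hMod_one hh τ hMod_sinhX
  simp only [map_sub, map_mul, map_smul, proj_gen, hS, map_zero, cst_two] at h
  rw [two_smul] at h
  rw [← sub_eq_zero, ← h, two_mul]
  abel

theorem map_T {Q : Type*} [Ring Q] [Algebra K Q] (hh : ∀ y : Q, hbar • y = 0)
    (τ : U →ₐ[K] Q) (s : ℂ) : τ (T s) = 1 :=
  (eq_of_hMod_one hh τ (hMod_T s)).trans (map_one τ)

theorem map_bMinus_mul_b {Q : Type*} [Ring Q] [Algebra K Q] (hh : ∀ y : Q, hbar • y = 0)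
    (τ : U →ₐ[K] Q) : τ bMinus * τ b = τ b * τ bMinus + 2 * τ bMinus := by
  rw [eq_of_hMod_one hh τ hMod_b, eq_of_hMod_one hh τ hMod_bMinus]
  have h := congrArg τ (proj_rel Rel.HY)
  have h1 : cst (1 / 2) • (1 + 1 : Q) = 1 := by
    rw [← two_smul K (1 : Q), smul_smul, ← cst_two, cst, cst, ← map_mul]
    norm_num
  simp only [map_sub, map_add, map_mul, map_smul, proj_gen, proj_expSeries, map_T hh, h1, mul_one,
    one_mul, map_zero] at h
  rw [← sub_eq_zero, ← neg_eq_zero, ← h, two_mul]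
  abel

theorem map_bMinus_mul_bPlus {Q : Type*} [Ring Q] [Algebra K Q] (hh : ∀ y : Q, hbar • y = 0)
    (τ : U →ₐ[K] Q) : τ bPlus * τ bMinus = τ bMinus * τ bPlus + τ b := by
  rw [eq_of_hMod_one hh τ hMod_b, eq_of_hMod_one hh τ hMod_bMinus,
    eq_of_hMod_one hh τ hMod_bPlus]
  have h := congrArg τ (proj_rel Rel.XY)
  simp only [map_sub, map_mul, proj_gen, map_zero] at h
  rw [← sub_eq_zero, ← h]
  abel

/-- The projection τ of Ohn's algebra onto its quotient modulo h factors through the embedding by a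
linear map ρ. If `embed a` is divisible by h, then τ(a) is a value of ρ at a multiple of h, hence
zero. -/
theorem embed_saturated (a : U) {w : Osp.U} (ha : embed a = hbar • w) : ∃ a', a = hbar • a' := by
  let τ : U →ₐ[K] U ⧸ (hTwoSided U 1).asIdeal := Ideal.Quotient.mkₐ K _
  have hh : ∀ y : U ⧸ (hTwoSided U 1).asIdeal, hbar • y = 0 := fun y => by
    obtain ⟨c, rfl⟩ := Ideal.Quotient.mk_surjective y
    exact Ideal.Quotient.eq_zero_iff_mem.mpr (TwoSidedIdeal.mem_asIdeal.mpr
      (mem_hTwoSided.mpr ⟨c, by rw [sub_zero, pow_one]⟩))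
  have := isAdicComplete_of_hbar_smul hh
  obtain ⟨ρ, hρ⟩ := exists_linearMap_of_sl2 hdense_adjoin embed embed_bPlus embed_b embed_bMinus τ
    (map_b_mul_bPlus hh τ) (map_bMinus_mul_b hh τ) (map_bMinus_mul_bPlus hh τ)
  have h3 := hρ a
  rw [ha, map_smul, hh] at h3
  obtain ⟨z, hz⟩ := mem_hTwoSided.mp (TwoSidedIdeal.mem_asIdeal.mp
    (Ideal.Quotient.eq_zero_iff_mem.mp h3.symm))
  exact ⟨z, by rw [← pow_one hbar, ← hz, sub_zero]⟩

/-- By saturation an element of the kernel is divisible by h, and the quotient is again in the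
kernel because U_h is torsion-free; Ohn's algebra is separated. -/
theorem embed_injective : Function.Injective embed := by
  rw [injective_iff_map_eq_zero]
  intro a ha
  refine HMod.eq fun n => ?_
  suffices h : ∃ z, a = hbar ^ n • z ∧ embed z = 0 by
    obtain ⟨z, hz, _⟩ := h
    exact ⟨z, by rw [sub_zero, hz]⟩
  induction n with
  | zero => exact ⟨a, by rw [pow_zero, one_smul], ha⟩
  | succ n ih =>
    obtain ⟨z, hz, hz0⟩ := ih
    obtain ⟨z', hz'⟩ := embed_saturated z (w := 0) (by rw [hz0, smul_zero])
    refine ⟨z', by rw [hz, hz', smul_smul, pow_succ], Osp.torsionFree _ ?_⟩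
    rw [← map_smul, ← hz', hz0]

/-- The embedding of Ohn's algebra is split. -/
theorem exists_retraction : ∃ ρ : Osp.U →ₗ[K] U, ∀ a, ρ (embed a) = a := by
  -- Injectivity, obtained modulo h, allows the exact sl(2) relations between b, b₊ and b₋ to be
  -- checked after the embedding; so a representation may now be induced from Ohn's algebra itself,
  -- with τ the identity.
  refine exists_linearMap_of_sl2 hdense_adjoin embed embed_bPlus embed_b embed_bMinus
    (AlgHom.id K U) ?_ ?_ ?_ <;> apply embed_injective <;>
    simp only [AlgHom.id_apply, map_add, map_mul, embed_b, embed_bPlus, embed_bMinus, map_ofNat]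
  · rw [← mul_assoc, Osp.be, add_mul, mul_assoc, Osp.be, mul_add, two_mul, mul_assoc]
    abel
  · rw [neg_mul, mul_assoc, Osp.fb, mul_add, ← mul_assoc, Osp.fb, add_mul, two_mul, mul_neg]
    simp only [mul_assoc]
    abel
  · have he : ∀ w, Osp.b * (Osp.e * w) = Osp.e * (Osp.b * w) + Osp.e * w := fun w => by
      rw [← mul_assoc, Osp.be, add_mul, mul_assoc]
    have hef : ∀ w, Osp.f * (Osp.e * w) = -(Osp.e * (Osp.f * w)) - Osp.b * w := fun w => by
      rw [← mul_assoc, Osp.fe, sub_mul, neg_mul, mul_assoc]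
    simp only [mul_assoc, Osp.fe, Osp.be, Osp.fb, he, hef, mul_add, mul_sub, mul_neg, neg_mul]
    abel

end Sl

end Jordanian
namespace Jordanian

open Superalgebra

/-! ### Restriction of a Hopf superalgebra to a split subalgebra -/

theorem Compl.map_comp {R : Type*} [CommRing R] {I : Ideal R} {L M N : Type*} [AddCommGroup L]
    [Module R L] [AddCommGroup M] [Module R M] [AddCommGroup N] [Module R N] (g : M →ₗ[R] N)
    (f : L →ₗ[R] M) (y : Compl I L) : map I g (map I f y) = map I (g ∘ₗ f) y := by
  refine ext fun n => ?_
  obtain ⟨x, hx⟩ := exists_rep n y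
  rw [eval_map g (eval_map f hx), eval_map _ hx, LinearMap.comp_apply]

theorem Compl.map_id {R : Type*} [CommRing R] {I : Ideal R} {M : Type*} [AddCommGroup M]
    [Module R M] {f : M →ₗ[R] M} (hf : ∀ x, f x = x) (y : Compl I M) : map I f y = y := by
  refine ext fun n => ?_
  obtain ⟨x, hx⟩ := exists_rep n y
  rw [eval_map _ hx, hx, hf]

/-- Completion need not preserve injectivity, but it preserves left inverses. This is why a
splitting of the embedding is needed and not just its injectivity. -/
theorem Compl.map_injective {R : Type*} [CommRing R] {I : Ideal R} {M N : Type*} [AddCommGroup M]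
    [Module R M] [AddCommGroup N] [Module R N] {f : M →ₗ[R] N} {g : N →ₗ[R] M}
    (h : ∀ x, g (f x) = x) : Function.Injective (map I f) :=
  Function.LeftInverse.injective (g := map I g) fun y => by rw [map_comp, map_id h]

section Restrict

variable {A B : Type*} [Ring A] [Algebra K A] [Superalgebra K A] [Ring B] [Algebra K B]
  [Superalgebra K B] {C D : Type*} [Ring C] [Algebra K C] [Superalgebra K C] [Ring D]
  [Algebra K D] [Superalgebra K D]

theorem tensorMap_leftInverse {f : A →ₗ[K] B} {g : C →ₗ[K] D} {f' : B →ₗ[K] A} {g' : D →ₗ[K] C}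
    (hf : ∀ a, f' (f a) = a) (hg : ∀ c, g' (g c) = c) (x : STensor K A C) :
    tensorMap B f' g' (tensorMap A f g x) = x :=
  linearMap_ext_stmul (f := tensorMap B f' g' ∘ₗ tensorMap A f g) (g := LinearMap.id)
    (fun a c => by
      change stmul (f' (f a)) (g' (g c)) = stmul a c
      rw [hf, hg]) x

/-- The map `a ⊗ c ↦ j(a) ⊗ j(c)` of completed tensor squares. -/
noncomputable def map₂ (j : A →ₗ[K] B) : Tensor2 hIdeal A →ₗ[K] Tensor2 hIdeal B :=
  Compl.map hIdeal (tensorMap A j j)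

/-- The map `a ⊗ c ⊗ d ↦ j(a) ⊗ j(c) ⊗ j(d)` of completed tensor cubes. -/
noncomputable def map₃ (j : A →ₗ[K] B) : Tensor3 hIdeal A →ₗ[K] Tensor3 hIdeal B :=
  Compl.map hIdeal (tensorMap (STensor K A A) (tensorMap A j j) j)

section

variable {j : A →ₗ[K] B} {ρ : B →ₗ[K] A}

theorem map₂_injective (hρ : ∀ a, ρ (j a) = a) : Function.Injective (map₂ j) :=
  Compl.map_injective (tensorMap_leftInverse hρ hρ)

theorem map₃_injective (hρ : ∀ a, ρ (j a) = a) : Function.Injective (map₃ j) :=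
  Compl.map_injective (tensorMap_leftInverse (tensorMap_leftInverse hρ hρ) hρ)

/-- Linear maps out of the tensor squares which are compatible with `j` are compatible after
completion. -/
theorem map_map₂ {M N : Type*} [AddCommGroup M] [Module K M] [AddCommGroup N] [Module K N]
    {f : STensor K A A →ₗ[K] M} {g : STensor K B B →ₗ[K] N} {k : M →ₗ[K] N}
    (h : ∀ a c, k (f (stmul a c)) = g (stmul (j a) (j c))) (z : Tensor2 hIdeal A) :
    Compl.map hIdeal k (Compl.map hIdeal f z) = Compl.map hIdeal g (map₂ j z) := by
  have h1 : k ∘ₗ f = g ∘ₗ tensorMap A j j := LinearMap.ext fun x =>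
    linearMap_ext_stmul (f := k ∘ₗ f) (g := g ∘ₗ tensorMap A j j) h x
  rw [map₂, Compl.map_comp, Compl.map_comp, h1]

variable {Δ : A →ₗ[K] Tensor2 hIdeal A} {Δ' : B →ₗ[K] Tensor2 hIdeal B}

theorem map₃_comulTensorId (h : ∀ a, map₂ j (Δ a) = Δ' (j a)) (z : Tensor2 hIdeal A) :
    map₃ j (comulTensorId Δ z) = comulTensorId Δ' (map₂ j z) := by
  refine linearMap_ext_compl (f := map₃ j ∘ₗ comulTensorId Δ) (g := comulTensorId Δ' ∘ₗ map₂ j)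
    (fun x => linearMap_ext_stmul (f := map₃ j ∘ₗ comulTensorId Δ ∘ₗ Compl.of hIdeal _)
      (g := comulTensorId Δ' ∘ₗ map₂ j ∘ₗ Compl.of hIdeal _) (fun a c => ?_) x) z
  change map₃ j (comulTensorId Δ (Compl.of hIdeal _ (stmul a c))) =
    comulTensorId Δ' (map₂ j (Compl.of hIdeal _ (stmul a c)))
  rw [comulTensorId_of, map₂, Compl.map_of, tensorMap_stmul, comulTensorId_of, ← h]
  exact map_map₂ (fun _ _ => rfl) _

theorem map₃_idTensorComul (h : ∀ a, map₂ j (Δ a) = Δ' (j a)) (z : Tensor2 hIdeal A) :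
    map₃ j (idTensorComul Δ z) = idTensorComul Δ' (map₂ j z) := by
  refine linearMap_ext_compl (f := map₃ j ∘ₗ idTensorComul Δ) (g := idTensorComul Δ' ∘ₗ map₂ j)
    (fun x => linearMap_ext_stmul (f := map₃ j ∘ₗ idTensorComul Δ ∘ₗ Compl.of hIdeal _)
      (g := idTensorComul Δ' ∘ₗ map₂ j ∘ₗ Compl.of hIdeal _) (fun a c => ?_) x) z
  change map₃ j (idTensorComul Δ (Compl.of hIdeal _ (stmul a c))) =
    idTensorComul Δ' (map₂ j (Compl.of hIdeal _ (stmul a c)))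
  rw [idTensorComul_of, map₂, Compl.map_of, tensorMap_stmul, idTensorComul_of, ← h]
  exact map_map₂ (fun _ _ => rfl) _

end

/-- The Hopf superalgebra structure on a split subalgebra which is stable under the structure
maps. -/
noncomputable def HopfSuperalgebra.restrict (𝓗 : HopfSuperalgebra hIdeal B)
    (hA : IsAdicComplete hIdeal A) (j : A →ₐ[K] B)
    (hj : ∀ a, parity (R := K) (j a) = j (parity (R := K) a)) (ρ : B →ₗ[K] A)
    (hρ : ∀ a, ρ (j a) = a) (Δ : A →ₐ[K] Tensor2 hIdeal A)
    (hΔ : ∀ a, map₂ j.toLinearMap (Δ a) = 𝓗.comul (j a)) (S : A →ₗ[K] A)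
    (hS : ∀ a, j (S a) = 𝓗.antipode (j a)) : HopfSuperalgebra hIdeal A where
  complete := hA
  comul := Δ
  counit := 𝓗.counit.comp j
  antipode := S
  -- This and the axioms below, apart from that for the parity of the counit, are verified after an
  -- injective map induced by j, where they become the corresponding axiom of the larger Hopf
  -- superalgebra.
  comul_parity a := map₂_injective (j := j.toLinearMap) hρ (by
    rw [hΔ, ← hj, 𝓗.comul_parity, ← hΔ]
    refine (map_map₂ (j := j.toLinearMap) (k := tensorMap A j.toLinearMap j.toLinearMap)
      (fun a c => ?_) _).symm
    change tensorMap A j.toLinearMap j.toLinearMap (tensorParity K A A (stmul a c)) =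
      tensorParity K B B (stmul (j a) (j c))
    rw [tensorParity_stmul, tensorParity_stmul, tensorMap_stmul, hj, hj]
    rfl)
  counit_parity a := by
    rw [AlgHom.comp_apply, ← hj, 𝓗.counit_parity]
    rfl
  antipode_parity a := Function.LeftInverse.injective hρ (by
    rw [hS, ← hj, ← hj, 𝓗.antipode_parity, hS])
  coassoc a := map₃_injective (j := j.toLinearMap) hρ (by
    have h : ∀ a, map₂ j.toLinearMap (Δ.toLinearMap a) =
      𝓗.comul.toLinearMap (j.toLinearMap a) := hΔ
    rw [map₃_comulTensorId h, map₃_idTensorComul h, hΔ, 𝓗.coassoc])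
  counit_comul a := Compl.map_injective (f := j.toLinearMap) hρ (by
    refine (map_map₂ (j := j.toLinearMap) (g := counitLeft 𝓗.counit.toLinearMap)
      (fun a c => ?_) _).trans ?_
    · rw [counitLeft_stmul, counitLeft_stmul, map_smul]
      rfl
    · rw [hΔ, 𝓗.counit_comul, Compl.map_of]
      rfl)
  comul_counit a := Compl.map_injective (f := j.toLinearMap) hρ (by
    refine (map_map₂ (j := j.toLinearMap) (g := counitRight 𝓗.counit.toLinearMap)
      (fun a c => ?_) _).trans ?_
    · rw [counitRight_stmul, counitRight_stmul, map_smul]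
      rfl
    · rw [hΔ, 𝓗.comul_counit, Compl.map_of]
      rfl)
  antipode_comul a := Compl.map_injective (f := j.toLinearMap) hρ (by
    refine (map_map₂ (j := j.toLinearMap) (g := mulMap B ∘ₗ tensorMap B 𝓗.antipode LinearMap.id)
      (fun a c => ?_) _).trans ?_
    · change j (mulMap A (stmul (S a) c)) = mulMap B (stmul (𝓗.antipode (j a)) (j c))
      rw [mulMap_stmul, mulMap_stmul, map_mul, hS]
    · rw [hΔ, 𝓗.antipode_comul, Compl.map_of]
      exact congrArg _ (j.commutes _).symm)
  comul_antipode a := Compl.map_injective (f := j.toLinearMap) hρ (by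
    refine (map_map₂ (j := j.toLinearMap) (g := mulMap B ∘ₗ tensorMap B LinearMap.id 𝓗.antipode)
      (fun a c => ?_) _).trans ?_
    · change j (mulMap A (stmul a (S c))) = mulMap B (stmul (j a) (𝓗.antipode (j c)))
      rw [mulMap_stmul, mulMap_stmul, map_mul, hS]
    · rw [hΔ, 𝓗.comul_antipode, Compl.map_of]
      exact congrArg _ (j.commutes _).symm)

/-- The map `map₂` as a homomorphism of algebras. -/
noncomputable def map₂Hom (j : A →ₐ[K] B)
    (hj : ∀ a, parity (R := K) (j a) = j (parity (R := K) a)) :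
    Tensor2 hIdeal A →ₐ[K] Tensor2 hIdeal B :=
  complMap (superLift (inl.comp j) (inr.comp j)
    ((superCommute_inl_inr.comp_left hj).symm.comp_left hj).symm)

theorem map₂_eq (j : A →ₐ[K] B) (hj : ∀ a, parity (R := K) (j a) = j (parity (R := K) a))
    (z : Tensor2 hIdeal A) : map₂ j.toLinearMap z = map₂Hom j hj z :=
  complMap_eq _ _ (fun x => linearMap_ext_stmul
    (f := (superLift (inl.comp j) (inr.comp j)
      ((superCommute_inl_inr.comp_left hj).symm.comp_left hj).symm).toLinearMap)
    (g := tensorMap A j.toLinearMap j.toLinearMap) (fun a c => inl_mul_inr (j a) (j c)) x) z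

end Restrict

end Jordanian
namespace Jordanian

open Superalgebra

namespace Sl

open SlGen

/-! ### Ohn's algebra as a Hopf subalgebra -/

theorem parity_x_toOsp (i : SlGen) :
    parity (R := K) (Osp.x (toOsp i)) = Osp.x (toOsp i) := by
  cases i <;> exact Osp.parity_x_even rfl

theorem parity_embed (a : U) : parity (R := K) (embed a) = embed (parity (R := K) a) := by
  rw [parity_eq]
  have h : (parity (R := K) (A := Osp.U)).comp embed = embed := algHom_ext fun i => by
    rw [AlgHom.comp_apply, embed_x, parity_x_toOsp]
  exact DFunLike.congr_fun h a

/-- A linear retraction of the embedding. -/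
noncomputable def retraction : Osp.U →ₗ[K] U := exists_retraction.choose

theorem retraction_embed (a : U) : retraction (embed a) = a := exists_retraction.choose_spec a

theorem map₂_tens (a c : U) : map₂ embed.toLinearMap (tens a c) = Osp.tens (embed a) (embed c) :=
  Compl.map_of _ _

/-- The map j ⊗ j on completed tensor squares is injective because j splits, and the coproducts of
the embedded generators lie in its image; hence Δ ∘ j factors through it. -/
theorem exists_comul : ∃ Δ : U →ₐ[K] Tensor2 hIdeal U,
    (∀ a, map₂ embed.toLinearMap (Δ a) = Osp.comul (embed a)) ∧
    Δ (x X) = tens (x X) 1 + tens 1 (x X) ∧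
    Δ (x H) = tens (x H) (T 1) + tens (T (-1)) (x H) ∧
    Δ (x Y) = tens (x Y) (T 1) + tens (T (-1)) (x Y) := by
  let b : SlGen → Tensor2 hIdeal U := fun
    | H => tens (x H) (T 1) + tens (T (-1)) (x H)
    | X => tens (x X) 1 + tens 1 (x X)
    | Y => tens (x Y) (T 1) + tens (T (-1)) (x Y)
  have hb : ∀ i, map₂Hom embed parity_embed (b i) = Osp.comul (embed (x i)) := fun i => by
    rw [← map₂_eq, embed_x]
    cases i with
    | H =>
      rw [toOsp, Osp.comul_H, map_add, map₂_tens, map₂_tens, embed_T, embed_T, embed_x]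
      rfl
    | X =>
      rw [toOsp, Osp.comul_X, map_add, map₂_tens, map₂_tens, map_one, embed_x]
      rfl
    | Y =>
      rw [toOsp, Osp.comul_Y, map_add, map₂_tens, map₂_tens, embed_T, embed_T, embed_x]
      rfl
  have hinj : Function.Injective (map₂Hom embed parity_embed) := fun y z h =>
    map₂_injective (j := embed.toLinearMap) retraction_embed
      (by rw [map₂_eq _ parity_embed, map₂_eq _ parity_embed, h])
  obtain ⟨Δ, h, hΔ⟩ := presentation.exists_lift_of_injective hinj (Osp.comul.comp embed) b hb
  exact ⟨Δ, fun a => (map₂_eq _ parity_embed _).trans (DFunLike.congr_fun h a), hΔ X, hΔ H, hΔ Y⟩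

/-- The coproduct of Ohn's algebra. -/
noncomputable def comul : U →ₐ[K] Tensor2 hIdeal U := exists_comul.choose

theorem map₂_comul (a : U) : map₂ embed.toLinearMap (comul a) = Osp.comul (embed a) :=
  exists_comul.choose_spec.1 a

/-- The antipode of Ohn's algebra. -/
noncomputable def antipode : U →ₗ[K] U := retraction ∘ₗ Osp.antipode ∘ₗ embed.toLinearMap

theorem exists_antipode_var (i : SlGen) : ∃ a', Osp.antipode (embed (x i)) = embed a' := by
  rw [embed_x]
  cases i with
  | H => exact ⟨-x H + (cst 2 * hbar) • sinhX, by
      rw [toOsp, Osp.antipode_H, map_add, map_neg, map_smul, embed_sinhX, embed_x]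
      rfl⟩
  | X => exact ⟨-x X, by
      rw [toOsp, Osp.antipode_X, map_neg, embed_x]
      rfl⟩
  | Y => exact ⟨-x Y - hbar • x H + hbar ^ 2 • sinhX, by
      rw [toOsp, Osp.antipode_Y, map_add, map_sub, map_neg, map_smul, map_smul, embed_sinhX,
        embed_x, embed_x]
      rfl⟩

/-- The retraction inverts the embedding only on its image, so the image must be shown to be stable
under the antipode. This holds on generators and passes to products, the image being even; density
does the rest. -/
theorem embed_antipode (a : U) : embed (antipode a) = Osp.antipode (embed a) := by
  have h : ∀ s ∈ Algebra.adjoin K (Set.range presentation.var),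
      ∃ s', Osp.antipode (embed s) = embed s' := fun s hs => by
    induction hs using Algebra.adjoin_induction with
    | mem y hy =>
      obtain ⟨i, rfl⟩ := hy
      exact exists_antipode_var i
    | algebraMap c => exact ⟨algebraMap K _ c, by
        rw [AlgHom.commutes, Algebra.algebraMap_eq_smul_one, map_smul, Osp.antipode_one]⟩
    | add y z _ _ hy hz =>
      obtain ⟨y', hy'⟩ := hy
      obtain ⟨z', hz'⟩ := hz
      exact ⟨y' + z', by rw [map_add, map_add, map_add, hy', hz']⟩
    | mul y z _ _ hy hz =>
      obtain ⟨y', hy'⟩ := hy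
      obtain ⟨z', hz'⟩ := hz
      have hp : parity (R := K) (embed y) = embed y := by rw [parity_embed, parity_eq]
      exact ⟨z' * y', by
        rw [map_mul embed y, map_mul embed z', Osp.antipode_even_mul _ hp, hy', hz']⟩
  refine presentation.hdense_adjoin.linearMap_ext (f := embed.toLinearMap ∘ₗ antipode)
    (g := Osp.antipode ∘ₗ embed.toLinearMap) (fun s hs => ?_) a
  obtain ⟨s', hs'⟩ := h s hs
  change embed (retraction (Osp.antipode (embed s))) = Osp.antipode (embed s)
  rw [hs', retraction_embed]

/-- Ohn's Hopf algebra. -/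
noncomputable def hopf : HopfSuperalgebra hIdeal U :=
  Osp.hopf.restrict presentation.isAdicComplete_alg embed parity_embed retraction retraction_embed
    comul map₂_comul antipode embed_antipode

theorem smul_x_E_sq (c : K) : (c * (cst 2 * hbar)) • Osp.x OspGen.E ^ 2 =
    c • (Osp.T 1 - Osp.T (-1)) := by
  have h : Osp.T 1 * Osp.T (-2) = Osp.T (-1) := by rw [← Osp.T_add]; norm_num
  rw [Osp.x_E_sq, mul_smul, ← mul_smul_comm, Osp.hbar_smul_e_mul_e, mul_sub, mul_one, h]

/-- Reconciles the two forms of the antipode of H: as 2h E² = T - T⁻¹, -T H T⁻¹ equals -H + 2h E².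
-/
theorem T_mul_H_mul_T : Osp.T 1 * Osp.x OspGen.H * Osp.T (-1) =
    Osp.x OspGen.H - (Osp.T 1 - Osp.T (-1)) := by
  have h : (-1 : ℂ) + 2 = 1 := by norm_num
  have h1 : cst (-1) = -1 := by rw [cst, map_neg, map_one]
  change Osp.b * Osp.T (-1) = _
  rw [Osp.b_mul_T, h, h1, neg_smul, one_smul, ← sub_eq_add_neg, Osp.x_H]

/-- Moving T past Y costs (h/2)(T H + H T); after multiplication by T⁻¹ the conjugate of H
contributes the term in E², since (h/2)(T - T⁻¹) = h² E². -/
theorem T_mul_Y_mul_T : Osp.T 1 * Osp.x OspGen.Y * Osp.T (-1) =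
    Osp.x OspGen.Y + hbar • Osp.x OspGen.H - hbar ^ 2 • Osp.x OspGen.E ^ 2 := by
  have h := Osp.proj_rel Osp.Rel.TY
  simp only [map_sub, map_add, map_mul, map_smul, Osp.proj_gen, Osp.proj_expSeries] at h
  rw [sub_sub, sub_eq_zero] at h
  have hT : Osp.T 1 * Osp.T (-1) = 1 := Osp.T_mul_T_neg 1
  have h2 : hbar = cst (1 / 2) * (cst 2 * hbar) := by
    rw [← mul_assoc, cst, cst, ← map_mul]
    norm_num
  have h3 : hbar ^ 2 • Osp.x OspGen.E ^ 2 =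
      (cst (1 / 2) * hbar) • (Osp.T 1 - Osp.T (-1)) := by
    rw [← smul_x_E_sq]
    congr 1
    nth_rewrite 1 [pow_two, h2]
    ring
  have h4 : hbar • Osp.x OspGen.H = (cst (1 / 2) * hbar) • (Osp.x OspGen.H + Osp.x OspGen.H) := by
    nth_rewrite 1 [h2]
    rw [← two_smul K, smul_smul, ← cst_two]
    congr 1
    ring
  rw [h, add_mul, mul_assoc, hT, mul_one, smul_mul_assoc, add_mul, T_mul_H_mul_T, mul_assoc, hT,
    mul_one, h3, h4, add_sub_assoc, ← smul_sub]
  congr 2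
  abel

theorem antipode_eq {a c : U} (h : Osp.antipode (embed a) = embed c) : antipode a = c :=
  embed_injective (by rw [embed_antipode, h])

theorem hasStructureMaps_hopf : HasStructureMaps hopf where
  comul_X := exists_comul.choose_spec.2.1
  comul_H := exists_comul.choose_spec.2.2.1
  comul_Y := exists_comul.choose_spec.2.2.2
  counit_X := (congrArg Osp.counit (embed_x X)).trans Osp.counit_X
  counit_H := (congrArg Osp.counit (embed_x H)).trans Osp.counit_H
  counit_Y := (congrArg Osp.counit (embed_x Y)).trans Osp.counit_Y
  antipode_X := antipode_eq (by
    rw [map_neg, embed_x]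
    exact Osp.antipode_X)
  antipode_H := antipode_eq (by
    rw [map_neg, map_mul, map_mul, embed_T, embed_T, embed_x]
    refine Osp.antipode_H.trans ?_
    change _ = -(Osp.T 1 * Osp.x OspGen.H * Osp.T (-1))
    have h := smul_x_E_sq 1
    rw [one_mul, one_smul] at h
    rw [T_mul_H_mul_T, h]
    abel)
  antipode_Y := antipode_eq (by
    rw [map_neg, map_mul, map_mul, embed_T, embed_T, embed_x]
    refine Osp.antipode_Y.trans ?_
    change _ = -(Osp.T 1 * Osp.x OspGen.Y * Osp.T (-1))
    rw [T_mul_Y_mul_T]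
    abel)

theorem isHopfEmbedding_embed : IsHopfEmbedding hopf Osp.hopf embed where
  generators := embed_x
  parity := parity_embed
  injective := embed_injective
  saturated := fun a _ h => embed_saturated a h
  comul a := (map₂_comul a).symm
  counit _ := rfl
  antipode a := (embed_antipode a).symm

theorem map₂_R : map₂ embed.toLinearMap R = Osp.R := by
  have h1 : toCompl _ (stmul (R := K) (T 1 * x H) (x X)) = tens b (x X) := rfl
  have h2 : toCompl _ (-stmul (R := K) (x X) (T 1 * x H)) = -tens (x X) b := map_neg _ _
  have h3 : Osp.tens (Osp.x OspGen.X) Osp.b = ι₂ Osp.U Osp.b * ι₁ Osp.U (Osp.x OspGen.X) := by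
    rw [Osp.tens_eq]
    exact superCommute_ι.left_even Osp.parity_X _
  have h4 : embed (x X) = Osp.x OspGen.X := embed_x X
  rw [R, expH_eq, expH_eq, h1, h2, Osp.R_eq, map₂_eq _ parity_embed, map_mul, map_hexp, map_hexp,
    map_neg, ← map₂_eq, ← map₂_eq, map₂_tens, map₂_tens, embed_b, h4, h3, Osp.tens_eq]
  rfl

end Sl

end Jordanian

/-! ### The main theorem -/

theorem mainTheorem6 :
    -- `U_h(osp(1|2))` is a torsion-free deformation of `U(osp(1|2))`
    (∀ a : Osp.U, hbar • a = 0 → a = 0) ∧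
    (∃ φ : Osp.U →+* Classical.U, Function.Surjective φ ∧
      (∀ a, φ a = 0 ↔ ∃ b, a = hbar • b) ∧
      (∀ (c : K) (a : Osp.U), φ (c • a) = PowerSeries.constantCoeff c • φ a) ∧
      ∀ i, φ (Osp.x i) = Classical.x i) ∧
    -- it is an `h`-adic Hopf superalgebra with the given coproduct, counit and antipode
    ∃ 𝓗 : HopfSuperalgebra hIdeal Osp.U, Osp.HasStructureMaps 𝓗 ∧
      -- its classical limit is `U(osp(1|2))`, with the cobracket given by `h ∧ b₊`
      (∀ i, ∃ c, 𝓗.comul (Osp.x i) =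
        Osp.tens (Osp.x i) 1 + Osp.tens 1 (Osp.x i) + hbar • c) ∧
      (∀ a, ∃ c, 𝓗.comul a - flip21 hIdeal Osp.U (𝓗.comul a) =
        hbar • (𝓗.comul a * Osp.rMatrix - Osp.rMatrix * 𝓗.comul a) + hbar ^ 2 • c) ∧
      -- it contains Ohn's algebra as a Hopf subalgebra, whose R-matrix is that of the whole algebra
      (∃ 𝓞 : HopfSuperalgebra hIdeal Sl.U, Sl.HasStructureMaps 𝓞 ∧
        ∃ j : Sl.U →ₐ[K] Osp.U, IsHopfEmbedding 𝓞 𝓗 j ∧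
          Compl.map hIdeal (tensorMap Sl.U j.toLinearMap j.toLinearMap) Sl.R = Osp.R) ∧
      -- the universal R-matrix is `G₂₁⁻¹ G`, and it is a quantization of `h ∧ b₊`
      IsUnit (flip21 hIdeal Osp.U Osp.G) ∧
      IsTriangularRMatrix 𝓗 Osp.R ∧
      ∃ c, Osp.R = 1 + hbar • Osp.rMatrix + hbar ^ 2 • c := by
  refine ⟨Osp.torsionFree, ⟨Osp.reduction, Osp.reduction_surjective,
    fun a => Osp.reduction_eq_zero_iff, Osp.reduction_smul, Osp.reduction_x⟩, Osp.hopf,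
    Osp.hasStructureMaps_hopf, Osp.exists_comul_x, Osp.exists_cobracket,
    ⟨Sl.hopf, Sl.hasStructureMaps_hopf, Sl.embed, Sl.isHopfEmbedding_embed, Sl.map₂_R⟩,
    Osp.isUnit_flip21_G, Osp.isTriangularRMatrix_R, Osp.exists_R_eq⟩
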